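/- **Conventions.** Let $\mathbb K$ be a field of characteristic $0$. Collections, operads and algebras live in $\mathbb Z$-graded (possibly unbounded) cochain complexes over $\mathbb K$; a collection has spaces $P(n)$, $n\ge 0$, with a left $S_n$-action. For collections $P,Q$ the plethysm is $$(P\odot Q)(n)=\bigoplus_{r\ge0}P(r)\otimes_{S_r}\Big(\bigoplus_{k_1+\dots+k_r=n}\mathrm{Ind}_{S_{k_1}\times\dots\times S_{k_r}}^{S_n}Q(k_1)\otimes\dots\otimes Q(k_r)\Big).$$ $\Lambda\mathsf{Lie}$ is the operad (with zero differential) generated by one symmetric binary operation $\{a_1,a_2\}$ of degree $-1$ with the Jacobi identity $\{\{a_1,a_2\},a_3\}+\{\{a_2,a_3\},a_1\}+\{\{a_3,a_1\},a_2\}=0$. $\Lambda\mathsf{Lie}_\infty=\mathrm{Cobar}(\Lambda^2\mathsf{coCom})$ is the dg operad freely generated by $S_n$-invariant elements $s_n$ of arity $n$ and degree $3-2n$, $n\ge2$, with $$\partial s_n=-\sum_{p=2}^{n-1}\ \sum_{\sigma\in \mathrm{Sh}_{p,n-p}}\sigma(s_{n-p+1}\circ_1 s_p),$$ and $U:\Lambda\mathsf{Lie}_\infty\to\Lambda\mathsf{Lie}$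 is the morphism with $U(s_2)=\{a_1,a_2\}$ and $U(s_n)=0$ for $n\ge3$. *Twisting.* Let $\hat\varphi:\Lambda\mathsf{Lie}_\infty\to\mathcal O$ be a morphism of dg operads, $\varphi_n=\hat\varphi(s_n)$ for $n\ge2$ and $\varphi_n=0$ for $n<2$. Put $$\mathrm{Tw}\,\mathcal O(n)=\prod_{r\ge0}\mathbf s^{2r}\big(\mathcal O(r+n)\big)^{S_r},$$ where $S_r$ permutes the first $r$ inputs and $S_n$ the last $n$. For $f\in \mathrm{Tw}\,\mathcal O(n)$ write $f(1_r)\in\mathcal O(r+n)$, of degree $|f|-2r$, for its components. The unit of $\mathrm{Tw}\,\mathcal O$ has component the unit of $\mathcal O$ for $r=0$ and $0$ for $r\ge1$. The component $(f\circ_i g)(1_r)$ is the sum over $0\le p\le r$ and $\sigma\in\mathrm{Sh}_{p,r-p}$ of the composites of $f(1_p)$ with $g(1_{r-p})$ inserted in its input $p+i$, where the first $p$ inputs of $f(1_p)$ are labelled $\sigma(1),\dots,\sigma(p)$, the first $r-p$ inputs of $g(1_{r-p})$ are labelled $\sigma(p+1),\dots,\sigma(r)$, and the remaining inputs are labelled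 $r+1,r+2,\dots$ in the order of the insertion $\circ_i$. Let $\kappa\in\mathrm{Tw}\,\mathcal O(1)$ be the element of degree $1$ with $\kappa(1_r)=\varphi_{r+1}$. The differential of $\mathrm{Tw}\,\mathcal O$ is $$\partial^{\mathrm{Tw}}f=\partial^{\mathcal O}f+\varphi\cdot f+\kappa\circ_1 f-(-1)^{|f|}\sum_{i=1}^n f\circ_i\kappa,\qquad (\varphi\cdot f)(1_r)=-(-1)^{|f|}\sum_{p=1}^{r}\ \sum_{\sigma\in\mathrm{Sh}_{p,r-p}}\sigma\big(f(1_{r-p+1})\circ_1\varphi_p\big).$$ Let $\beta:\Lambda\mathsf{Lie}_\infty\to\mathrm{Tw}\,\mathcal O$ be given by $\beta(s_n)(1_r)=\varphi_{r+n}$. Let $\eta:\mathrm{Tw}\,\mathcal O\to\mathcal O$, $\eta(f)=f(1_0)$, and $\mathfrak D:\mathrm{Tw}\,\mathcal O\to\mathrm{Tw}\,\mathrm{Tw}\,\mathcal O$, $\mathfrak D(f)(1_r\otimes1_s)=f(1_{s+r})$. A *$\mathrm{Tw}$-coalgebra* structure on $\hat\varphi$ is a morphism of dg operads $c:\mathcal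 O\to\mathrm{Tw}\,\mathcal O$ with $c\circ\hat\varphi=\beta$, $\eta\circ c=\mathrm{id}_{\mathcal O}$ and $\mathfrak D\circ c=\mathrm{Tw}(c)\circ c$. The arrow $\hat\varphi$ is a *homotopy fixed point* for $\mathrm{Tw}$ if $\eta:\mathrm{Tw}\,\mathcal O\to\mathcal O$ is a quasi-isomorphism. **Theorem.** Let $P$ be a dg operad, and let $\mathcal O$ be a dg operad obtained from the plethysm $P\odot\Lambda\mathsf{Lie}$ by imposing the distributive law. That is, there are given morphisms of dg operads $\mathfrak j:P\to\mathcal O$ and $\mathfrak i:\Lambda\mathsf{Lie}\to\mathcal O$ such that the map $P\odot\Lambda\mathsf{Lie}\to\mathcal O$, $(v;X_1,\dots,X_r)\mapsto\mathfrak j(v)(\mathfrak i(X_1),\dots,\mathfrak i(X_r))$, is an isomorphism, and such that in $\mathcal O$ $$\{a_1,a_2\}\circ_2\gamma=(-1)^{|\gamma|}\sum_{i=1}^n\varsigma_{1,i}\big(\gamma\circ_i\{a_1,a_2\}\big)\qquad\text{for all }n\ge0,\ \gamma\in P(n),$$ where $\varsigma_{1,i}$ is the cycle $(1,2,\dots,i)\in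 S_{n+1}$. Let $\hat\varphi=\mathfrak i\circ U:\Lambda\mathsf{Lie}_\infty\to\mathcal O$. Then: 1. The canonical embedding $\mathrm{emb}:\mathcal O\to\mathrm{Tw}\,\mathcal O$, $\mathrm{emb}(v)(1_0)=v$, $\mathrm{emb}(v)(1_r)=0$ for $r\ge1$, is a morphism of dg operads and is a $\mathrm{Tw}$-coalgebra structure on $(\mathcal O,\hat\varphi)$. 2. If, in addition, there is an integer $N$ such that $|v|\ge N$ for all $n\ge0$ and all nonzero homogeneous $v\in P(n)$, then $(\mathcal O,\hat\varphi)$ is a homotopy fixed point for $\mathrm{Tw}$. -/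

import Mathlib

universe u v w z

noncomputable section

namespace TwOperad

/-- The sign `(-1)^p`, as a scalar. -/
def sgn (K : Type u) [Field K] (p : ℤ) : K := ((p.negOnePow : ℤˣ) : ℤ)

/-! ### Collections -/

/-- A collection of graded vector spaces: `obj n d` is the space of elements of arity `n` and
degree `d`. The symmetric group actions are encoded as an action of the groupoid of the sets
`Fin n` and their bijections; as `Fin m ≃ Fin n` is empty for `m ≠ n`, this is the same as a left
action of `S_n` on `obj n d` for all `n`. The element `act σ a` is `a` with its `x`-th input
relabelled by `σ x`, that is `a(σ 1, …, σ n)`. -/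
structure Collection (K : Type u) [Field K] where
  obj : ℕ → ℤ → Type v
  [grp : ∀ n d, AddCommGroup (obj n d)]
  [mod : ∀ n d, Module K (obj n d)]
  act : ∀ {m n : ℕ} {d : ℤ}, (Fin m ≃ Fin n) → obj m d →ₗ[K] obj n d
  act_refl : ∀ {n : ℕ} {d : ℤ} (a : obj n d), act (Equiv.refl (Fin n)) a = a
  act_trans : ∀ {l m n : ℕ} {d : ℤ} (σ : Fin l ≃ Fin m) (τ : Fin m ≃ Fin n) (a : obj l d),
    act (σ.trans τ) a = act τ (act σ a)

attribute [instance] Collection.grp Collection.mod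

namespace Collection

variable {K : Type u} [Field K]

/-- Transport along equalities of arities and degrees. -/
def cast (A : Collection.{u, v} K) {m n : ℕ} {d e : ℤ} (hm : m = n) (hd : d = e) :
    A.obj m d →ₗ[K] A.obj n e := by
  subst hm; subst hd; exact LinearMap.id

theorem act_cast (A : Collection.{u, v} K) {m n : ℕ} {d e : ℤ} (hm : m = n) (hd : d = e)
    (τ : Fin n ≃ Fin n) (a : A.obj m d) :
    A.act τ (A.cast hm hd a) =
      A.cast hm hd (A.act (((finCongr hm).trans τ).trans (finCongr hm.symm)) a) := by
  subst hm; subst hd; rfl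

/-- Maps of collections: equivariant linear maps of degree `0`. -/
structure Hom (A : Collection.{u, v} K) (B : Collection.{u, w} K) where
  app : ∀ n d, A.obj n d →ₗ[K] B.obj n d
  app_act : ∀ {m n : ℕ} {d : ℤ} (σ : Fin m ≃ Fin n) (a : A.obj m d),
    app n d (A.act σ a) = B.act σ (app m d a)

end Collection

/-! ### Differential graded operads -/

section positions

variable {n k m : ℕ}

/-- When an operation with `k` inputs is inserted in the `i`-th input of an operation with `n`
inputs, the input `x ≠ i` of the latter becomes this input of the result. -/
def outerPos (hm : n + k = m + 1) (i x : Fin n) (hx : x ≠ i) : Fin m :=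
  ⟨if x < i then x else x + k - 1, by
    have h1 := x.2
    have h2 := i.2
    have h3 : (x : ℕ) ≠ i := fun h => hx (Fin.ext h)
    split_ifs with h
    · have h4 : (x : ℕ) < i := h
      omega
    · have h4 : ¬ (x : ℕ) < i := h
      omega⟩

/-- When an operation with `k` inputs is inserted in the `i`-th input of an operation with `n`
inputs, the input `y` of the former becomes this input of the result. -/
def innerPos (hm : n + k = m + 1) (i : Fin n) (y : Fin k) : Fin m :=
  ⟨i + y, by have h1 := i.2; have h2 := y.2; omega⟩

end positions

/-- The operations of a dg operad, without the axioms: unit, elementary insertions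
`comp i a b = a ∘_i b` (inputs are counted from `0`) and differential. -/
structure OperadData (K : Type u) [Field K] extends Collection.{u, v} K where
  one : obj 1 0
  comp : ∀ {n k m : ℕ} {p q d : ℤ} (_ : Fin n) (_ : n + k = m + 1) (_ : p + q = d),
    obj n p →ₗ[K] obj k q →ₗ[K] obj m d
  diff : ∀ {n : ℕ} {p q : ℤ} (_ : p + 1 = q), obj n p →ₗ[K] obj n q

/-- dg operads over `K`. -/
structure DGOperad (K : Type u) [Field K] extends OperadData.{u, v} K where
  comp_act : ∀ {n k m n' k' m' : ℕ} {p q d : ℤ} (i : Fin n) (hm : n + k = m + 1)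
    (hm' : n' + k' = m' + 1) (hd : p + q = d) (σ : Fin n ≃ Fin n') (τ : Fin k ≃ Fin k')
    (ρ : Fin m ≃ Fin m') (a : obj n p) (b : obj k q),
    (∀ (x : Fin n) (hx : x ≠ i),
      ρ (outerPos hm i x hx) = outerPos hm' (σ i) (σ x) (σ.injective.ne hx)) →
    (∀ y : Fin k, ρ (innerPos hm i y) = innerPos hm' (σ i) (τ y)) →
    comp (σ i) hm' hd (act σ a) (act τ b) = act ρ (comp i hm hd a b)
  one_comp : ∀ {n : ℕ} {p : ℤ} (a : obj n p),
    comp (0 : Fin 1) (Nat.add_comm 1 n) (zero_add p) one a = a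
  comp_one : ∀ {n : ℕ} {p : ℤ} (i : Fin n) (a : obj n p),
    comp i rfl (add_zero p) a one = a
  /-- `a ∘_i (b ∘_j c) = (a ∘_i b) ∘_{i-1+j} c`. -/
  comp_assoc : ∀ {n k l m₁ m₂ m : ℕ} {p q s d₁ d₂ d : ℤ} (i : Fin n) (j : Fin k) (t : Fin m₁)
    (h₁ : n + k = m₁ + 1) (h₂ : m₁ + l = m + 1) (h₃ : k + l = m₂ + 1) (h₄ : n + m₂ = m + 1)
    (e₁ : p + q = d₁) (e₂ : d₁ + s = d) (e₃ : q + s = d₂) (e₄ : p + d₂ = d)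
    (a : obj n p) (b : obj k q) (c : obj l s), (t : ℕ) = i + j →
    comp i h₄ e₄ a (comp j h₃ e₃ b c) = comp t h₂ e₂ (comp i h₁ e₁ a b) c
  /-- `(a ∘_i b) ∘_{j+k-1} c = (-1)^{|b||c|} (a ∘_j c) ∘_i b` for `i < j`. -/
  comp_comm : ∀ {n k l m₁ m₂ m : ℕ} {p q s d₁ d₂ d : ℤ} (i j : Fin n) (t : Fin m₁) (t' : Fin m₂)
    (h₁ : n + k = m₁ + 1) (h₂ : m₁ + l = m + 1) (h₃ : n + l = m₂ + 1) (h₄ : m₂ + k = m + 1)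
    (e₁ : p + q = d₁) (e₂ : d₁ + s = d) (e₃ : p + s = d₂) (e₄ : d₂ + q = d)
    (a : obj n p) (b : obj k q) (c : obj l s), i < j → (t : ℕ) + 1 = j + k → (t' : ℕ) = i →
    comp t h₂ e₂ (comp i h₁ e₁ a b) c = sgn K (q * s) • comp t' h₄ e₄ (comp j h₃ e₃ a c) b
  diff_diff : ∀ {n : ℕ} {p q s : ℤ} (h : p + 1 = q) (h' : q + 1 = s) (a : obj n p),
    diff h' (diff h a) = 0
  diff_act : ∀ {m n : ℕ} {p q : ℤ} (h : p + 1 = q) (σ : Fin m ≃ Fin n) (a : obj m p),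
    diff h (act σ a) = act σ (diff h a)
  diff_comp : ∀ {n k m : ℕ} {p q d p' q' d' : ℤ} (i : Fin n) (hm : n + k = m + 1)
    (hd : p + q = d) (hp : p + 1 = p') (hq : q + 1 = q') (h : d + 1 = d')
    (e : p' + q = d') (e' : p + q' = d') (a : obj n p) (b : obj k q),
    diff h (comp i hm hd a b) =
      comp i hm e (diff hp a) b + sgn K p • comp i hm e' a (diff hq b)

/-- Morphisms of dg operads. -/
structure OperadHom {K : Type u} [Field K] (A : OperadData.{u, v} K) (B : OperadData.{u, w} K)
    extends Collection.Hom A.toCollection B.toCollection where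
  app_one : app 1 0 A.one = B.one
  app_comp : ∀ {n k m : ℕ} {p q d : ℤ} (i : Fin n) (hm : n + k = m + 1) (hd : p + q = d)
    (a : A.obj n p) (b : A.obj k q),
    app m d (A.comp i hm hd a b) = B.comp i hm hd (app n p a) (app k q b)
  app_diff : ∀ {n : ℕ} {p q : ℤ} (h : p + 1 = q) (a : A.obj n p),
    app n q (A.diff h a) = B.diff h (app n p a)

/-- Composition of morphisms of dg operads. -/
def OperadHom.trans {K : Type u} [Field K] {A : OperadData.{u, v} K} {B : OperadData.{u, w} K}
    {C : OperadData.{u, z} K} (f : OperadHom A B) (g : OperadHom B C) : OperadHom A C where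
  app n d := (g.app n d).comp (f.app n d)
  app_act σ a := by simp [f.app_act, g.app_act]
  app_one := by simp [f.app_one, g.app_one]
  app_comp i hm hd a b := by simp [f.app_comp, g.app_comp]
  app_diff h a := by simp [f.app_diff, g.app_diff]

/-! ### dg operads presented by generators and relations -/

section presentation

variable (K : Type u) [Field K] (G : ℕ → ℤ → Type)

/-- Formal expressions in generators `G n d` of arity `n` and degree `d`. -/
inductive Expr : ℕ → ℤ → Type u
  | gen {n : ℕ} {d : ℤ} (g : G n d) : Expr n d
  | one : Expr 1 0
  | zero {n : ℕ} {d : ℤ} : Expr n d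
  | add {n : ℕ} {d : ℤ} (a b : Expr n d) : Expr n d
  | smul {n : ℕ} {d : ℤ} (c : K) (a : Expr n d) : Expr n d
  | act {m n : ℕ} {d : ℤ} (σ : Fin m ≃ Fin n) (a : Expr m d) : Expr n d
  | comp {n k m : ℕ} {p q d : ℤ} (i : Fin n) (hm : n + k = m + 1) (hd : p + q = d)
      (a : Expr n p) (b : Expr k q) : Expr m d
  | diff {n : ℕ} {p q : ℤ} (h : p + 1 = q) (a : Expr n p) : Expr n q

/-- Finite sums of formal expressions. -/
def Expr.sum {ι : Type} (s : Finset ι) {n : ℕ} {d : ℤ} (f : ι → Expr K G n d) : Expr K G n d :=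
  (s.toList.map f).foldr Expr.add Expr.zero

variable {K G} (R : ∀ n d, Expr K G n d → Expr K G n d → Prop)

/-- The smallest congruence on formal expressions that contains the relations `R`, the axioms of
graded vector spaces and the axioms of dg operads. -/
inductive ExprRel : ∀ {n : ℕ} {d : ℤ}, Expr K G n d → Expr K G n d → Prop
  | of {n d} {a b : Expr K G n d} : R n d a b → ExprRel a b
  | refl {n d} (a : Expr K G n d) : ExprRel a a
  | symm {n d} {a b : Expr K G n d} : ExprRel a b → ExprRel b a
  | trans {n d} {a b c : Expr K G n d} : ExprRel a b → ExprRel b c → ExprRel a c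
  | add_congr {n d} {a a' b b' : Expr K G n d} :
      ExprRel a a' → ExprRel b b' → ExprRel (.add a b) (.add a' b')
  | smul_congr {n d} (c : K) {a a' : Expr K G n d} :
      ExprRel a a' → ExprRel (.smul c a) (.smul c a')
  | act_congr {m n d} (σ : Fin m ≃ Fin n) {a a' : Expr K G m d} :
      ExprRel a a' → ExprRel (.act σ a) (.act σ a')
  | comp_congr {n k m p q d} (i : Fin n) (hm : n + k = m + 1) (hd : p + q = d)
      {a a' : Expr K G n p} {b b' : Expr K G k q} :
      ExprRel a a' → ExprRel b b' → ExprRel (.comp i hm hd a b) (.comp i hm hd a' b')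
  | diff_congr {n p q} (h : p + 1 = q) {a a' : Expr K G n p} :
      ExprRel a a' → ExprRel (.diff h a) (.diff h a')
  | add_comm {n d} (a b : Expr K G n d) : ExprRel (.add a b) (.add b a)
  | add_assoc {n d} (a b c : Expr K G n d) :
      ExprRel (.add (.add a b) c) (.add a (.add b c))
  | zero_add {n d} (a : Expr K G n d) : ExprRel (.add .zero a) a
  | neg_add {n d} (a : Expr K G n d) : ExprRel (.add (.smul (-1) a) a) .zero
  | smul_add {n d} (c : K) (a b : Expr K G n d) :
      ExprRel (.smul c (.add a b)) (.add (.smul c a) (.smul c b))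
  | add_smul {n d} (c c' : K) (a : Expr K G n d) :
      ExprRel (.smul (c + c') a) (.add (.smul c a) (.smul c' a))
  | mul_smul {n d} (c c' : K) (a : Expr K G n d) :
      ExprRel (.smul (c * c') a) (.smul c (.smul c' a))
  | one_smul {n d} (a : Expr K G n d) : ExprRel (.smul 1 a) a
  | act_add {m n d} (σ : Fin m ≃ Fin n) (a b : Expr K G m d) :
      ExprRel (.act σ (.add a b)) (.add (.act σ a) (.act σ b))
  | act_smul {m n d} (σ : Fin m ≃ Fin n) (c : K) (a : Expr K G m d) :
      ExprRel (.act σ (.smul c a)) (.smul c (.act σ a))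
  | add_comp {n k m p q d} (i : Fin n) (hm : n + k = m + 1) (hd : p + q = d)
      (a a' : Expr K G n p) (b : Expr K G k q) :
      ExprRel (.comp i hm hd (.add a a') b) (.add (.comp i hm hd a b) (.comp i hm hd a' b))
  | smul_comp {n k m p q d} (i : Fin n) (hm : n + k = m + 1) (hd : p + q = d)
      (c : K) (a : Expr K G n p) (b : Expr K G k q) :
      ExprRel (.comp i hm hd (.smul c a) b) (.smul c (.comp i hm hd a b))
  | comp_add {n k m p q d} (i : Fin n) (hm : n + k = m + 1) (hd : p + q = d)
      (a : Expr K G n p) (b b' : Expr K G k q) :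
      ExprRel (.comp i hm hd a (.add b b')) (.add (.comp i hm hd a b) (.comp i hm hd a b'))
  | comp_smul {n k m p q d} (i : Fin n) (hm : n + k = m + 1) (hd : p + q = d)
      (c : K) (a : Expr K G n p) (b : Expr K G k q) :
      ExprRel (.comp i hm hd a (.smul c b)) (.smul c (.comp i hm hd a b))
  | diff_add {n p q} (h : p + 1 = q) (a b : Expr K G n p) :
      ExprRel (.diff h (.add a b)) (.add (.diff h a) (.diff h b))
  | diff_smul {n p q} (h : p + 1 = q) (c : K) (a : Expr K G n p) :
      ExprRel (.diff h (.smul c a)) (.smul c (.diff h a))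
  | act_refl {n d} (a : Expr K G n d) : ExprRel (.act (Equiv.refl (Fin n)) a) a
  | act_trans {l m n d} (σ : Fin l ≃ Fin m) (τ : Fin m ≃ Fin n) (a : Expr K G l d) :
      ExprRel (.act (σ.trans τ) a) (.act τ (.act σ a))
  | comp_act {n k m n' k' m' : ℕ} {p q d : ℤ} (i : Fin n) (hm : n + k = m + 1)
      (hm' : n' + k' = m' + 1) (hd : p + q = d) (σ : Fin n ≃ Fin n') (τ : Fin k ≃ Fin k')
      (ρ : Fin m ≃ Fin m') (a : Expr K G n p) (b : Expr K G k q)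
      (hσ : ∀ (x : Fin n) (hx : x ≠ i),
        ρ (outerPos hm i x hx) = outerPos hm' (σ i) (σ x) (σ.injective.ne hx))
      (hτ : ∀ y : Fin k, ρ (innerPos hm i y) = innerPos hm' (σ i) (τ y)) :
      ExprRel (.comp (σ i) hm' hd (.act σ a) (.act τ b)) (.act ρ (.comp i hm hd a b))
  | one_comp {n : ℕ} {p : ℤ} (a : Expr K G n p) :
      ExprRel (.comp (0 : Fin 1) (Nat.add_comm 1 n) (_root_.zero_add p) .one a) a
  | comp_one {n : ℕ} {p : ℤ} (i : Fin n) (a : Expr K G n p) :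
      ExprRel (.comp i rfl (add_zero p) a .one) a
  | comp_assoc {n k l m₁ m₂ m : ℕ} {p q s d₁ d₂ d : ℤ} (i : Fin n) (j : Fin k) (t : Fin m₁)
      (h₁ : n + k = m₁ + 1) (h₂ : m₁ + l = m + 1) (h₃ : k + l = m₂ + 1) (h₄ : n + m₂ = m + 1)
      (e₁ : p + q = d₁) (e₂ : d₁ + s = d) (e₃ : q + s = d₂) (e₄ : p + d₂ = d)
      (a : Expr K G n p) (b : Expr K G k q) (c : Expr K G l s) (ht : (t : ℕ) = i + j) :
      ExprRel (.comp i h₄ e₄ a (.comp j h₃ e₃ b c)) (.comp t h₂ e₂ (.comp i h₁ e₁ a b) c)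
  | comp_comm {n k l m₁ m₂ m : ℕ} {p q s d₁ d₂ d : ℤ} (i j : Fin n) (t : Fin m₁) (t' : Fin m₂)
      (h₁ : n + k = m₁ + 1) (h₂ : m₁ + l = m + 1) (h₃ : n + l = m₂ + 1) (h₄ : m₂ + k = m + 1)
      (e₁ : p + q = d₁) (e₂ : d₁ + s = d) (e₃ : p + s = d₂) (e₄ : d₂ + q = d)
      (a : Expr K G n p) (b : Expr K G k q) (c : Expr K G l s)
      (hij : i < j) (ht : (t : ℕ) + 1 = j + k) (ht' : (t' : ℕ) = i) :
      ExprRel (.comp t h₂ e₂ (.comp i h₁ e₁ a b) c)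
        (.smul (sgn K (q * s)) (.comp t' h₄ e₄ (.comp j h₃ e₃ a c) b))
  | diff_diff {n : ℕ} {p q s : ℤ} (h : p + 1 = q) (h' : q + 1 = s) (a : Expr K G n p) :
      ExprRel (.diff h' (.diff h a)) .zero
  | diff_act {m n : ℕ} {p q : ℤ} (h : p + 1 = q) (σ : Fin m ≃ Fin n) (a : Expr K G m p) :
      ExprRel (.diff h (.act σ a)) (.act σ (.diff h a))
  | diff_comp {n k m : ℕ} {p q d p' q' d' : ℤ} (i : Fin n) (hm : n + k = m + 1)
      (hd : p + q = d) (hp : p + 1 = p') (hq : q + 1 = q') (h : d + 1 = d')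
      (e : p' + q = d') (e' : p + q' = d') (a : Expr K G n p) (b : Expr K G k q) :
      ExprRel (.diff h (.comp i hm hd a b))
        (.add (.comp i hm e (.diff hp a) b)
          (.smul (sgn K p) (.comp i hm e' a (.diff hq b))))

/-- Congruence of formal expressions, as an equivalence relation. -/
def exprSetoid (n : ℕ) (d : ℤ) : Setoid (Expr K G n d) where
  r := ExprRel R
  iseqv := ⟨ExprRel.refl, ExprRel.symm, ExprRel.trans⟩

/-- Formal expressions modulo congruence. -/
def PresObj (n : ℕ) (d : ℤ) : Type u := Quotient (exprSetoid R n d)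

instance (n : ℕ) (d : ℤ) : Add (PresObj R n d) :=
  ⟨Quotient.map₂ Expr.add fun _ _ h _ _ h' => ExprRel.add_congr h h'⟩

instance (n : ℕ) (d : ℤ) : Zero (PresObj R n d) := ⟨Quotient.mk _ Expr.zero⟩

instance (n : ℕ) (d : ℤ) : SMul K (PresObj R n d) :=
  ⟨fun c => Quotient.map (Expr.smul c) fun _ _ h => ExprRel.smul_congr c h⟩

instance (n : ℕ) (d : ℤ) : Neg (PresObj R n d) := ⟨fun a => (-1 : K) • a⟩

instance (n : ℕ) (d : ℤ) : AddCommGroup (PresObj R n d) where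
  nsmul := nsmulRec
  zsmul := zsmulRec
  add_assoc := by rintro ⟨a⟩ ⟨b⟩ ⟨c⟩; exact Quotient.sound (ExprRel.add_assoc a b c)
  zero_add := by rintro ⟨a⟩; exact Quotient.sound (ExprRel.zero_add a)
  add_zero := by
    rintro ⟨a⟩; exact Quotient.sound ((ExprRel.add_comm a _).trans (ExprRel.zero_add a))
  add_comm := by rintro ⟨a⟩ ⟨b⟩; exact Quotient.sound (ExprRel.add_comm a b)
  neg_add_cancel := by rintro ⟨a⟩; exact Quotient.sound (ExprRel.neg_add a)

instance (n : ℕ) (d : ℤ) : Module K (PresObj R n d) :=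
  Module.ofMinimalAxioms
    (by rintro c ⟨a⟩ ⟨b⟩; exact Quotient.sound (ExprRel.smul_add c a b))
    (by rintro c c' ⟨a⟩; exact Quotient.sound (ExprRel.add_smul c c' a))
    (by rintro c c' ⟨a⟩; exact Quotient.sound (ExprRel.mul_smul c c' a))
    (by rintro ⟨a⟩; exact Quotient.sound (ExprRel.one_smul a))

/-- The dg operad presented by the generators `G` and the relations `R`. The relations may involve
the differential; a relation that expresses the differential of each generator through the
generators describes a differential on a free operad. -/
def presented : DGOperad.{u, u} K where
  obj := PresObj R
  act {m n d} σ :=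
    { toFun := Quotient.map (Expr.act σ) fun _ _ h => ExprRel.act_congr σ h
      map_add' := by rintro ⟨a⟩ ⟨b⟩; exact Quotient.sound (ExprRel.act_add σ a b)
      map_smul' := by rintro c ⟨a⟩; exact Quotient.sound (ExprRel.act_smul σ c a) }
  act_refl := by rintro n d ⟨a⟩; exact Quotient.sound (ExprRel.act_refl a)
  act_trans := by rintro l m n d σ τ ⟨a⟩; exact Quotient.sound (ExprRel.act_trans σ τ a)
  one := Quotient.mk _ Expr.one
  comp {n k m p q d} i hm hd :=
    LinearMap.mk₂ K
      (Quotient.map₂ (Expr.comp i hm hd) fun _ _ h _ _ h' => ExprRel.comp_congr i hm hd h h')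
      (by rintro ⟨a⟩ ⟨a'⟩ ⟨b⟩; exact Quotient.sound (ExprRel.add_comp i hm hd a a' b))
      (by rintro c ⟨a⟩ ⟨b⟩; exact Quotient.sound (ExprRel.smul_comp i hm hd c a b))
      (by rintro ⟨a⟩ ⟨b⟩ ⟨b'⟩; exact Quotient.sound (ExprRel.comp_add i hm hd a b b'))
      (by rintro c ⟨a⟩ ⟨b⟩; exact Quotient.sound (ExprRel.comp_smul i hm hd c a b))
  diff {n p q} h :=
    { toFun := Quotient.map (Expr.diff h) fun _ _ h' => ExprRel.diff_congr h h'
      map_add' := by rintro ⟨a⟩ ⟨b⟩; exact Quotient.sound (ExprRel.diff_add h a b)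
      map_smul' := by rintro c ⟨a⟩; exact Quotient.sound (ExprRel.diff_smul h c a) }
  comp_act := by
    rintro n k m n' k' m' p q d i hm hm' hd σ τ ρ ⟨a⟩ ⟨b⟩ hσ hτ
    exact Quotient.sound (ExprRel.comp_act i hm hm' hd σ τ ρ a b hσ hτ)
  one_comp := by rintro n p ⟨a⟩; exact Quotient.sound (ExprRel.one_comp a)
  comp_one := by rintro n p i ⟨a⟩; exact Quotient.sound (ExprRel.comp_one i a)
  comp_assoc := by
    rintro n k l m₁ m₂ m p q s d₁ d₂ d i j t h₁ h₂ h₃ h₄ e₁ e₂ e₃ e₄ ⟨a⟩ ⟨b⟩ ⟨c⟩ ht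
    exact Quotient.sound (ExprRel.comp_assoc i j t h₁ h₂ h₃ h₄ e₁ e₂ e₃ e₄ a b c ht)
  comp_comm := by
    rintro n k l m₁ m₂ m p q s d₁ d₂ d i j t t' h₁ h₂ h₃ h₄ e₁ e₂ e₃ e₄ ⟨a⟩ ⟨b⟩ ⟨c⟩ hij ht ht'
    exact Quotient.sound (ExprRel.comp_comm i j t t' h₁ h₂ h₃ h₄ e₁ e₂ e₃ e₄ a b c hij ht ht')
  diff_diff := by rintro n p q s h h' ⟨a⟩; exact Quotient.sound (ExprRel.diff_diff h h' a)
  diff_act := by rintro m n p q h σ ⟨a⟩; exact Quotient.sound (ExprRel.diff_act h σ a)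
  diff_comp := by
    rintro n k m p q d p' q' d' i hm hd hp hq h e e' ⟨a⟩ ⟨b⟩
    exact Quotient.sound (ExprRel.diff_comp i hm hd hp hq h e e' a b)

/-- The class of a formal expression in the presented dg operad. -/
def presMk {n : ℕ} {d : ℤ} (a : Expr K G n d) : (presented R).obj n d := Quotient.mk _ a

/-- The value of a formal expression in a dg operad `O`, given the values of the generators. -/
def Expr.eval (O : OperadData.{u, v} K) (g : ∀ n d, G n d → O.obj n d) :
    ∀ {n : ℕ} {d : ℤ}, Expr K G n d → O.obj n d
  | _, _, .gen x => g _ _ x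
  | _, _, .one => O.one
  | _, _, .zero => 0
  | _, _, .add a b => a.eval O g + b.eval O g
  | _, _, .smul c a => c • a.eval O g
  | _, _, .act σ a => O.act σ (a.eval O g)
  | _, _, .comp i hm hd a b => O.comp i hm hd (a.eval O g) (b.eval O g)
  | _, _, .diff h a => O.diff h (a.eval O g)

variable {R}

theorem ExprRel.eval_eq (O : DGOperad.{u, v} K) (g : ∀ n d, G n d → O.obj n d)
    (hR : ∀ n d (a b : Expr K G n d), R n d a b →
      a.eval O.toOperadData g = b.eval O.toOperadData g)
    {n : ℕ} {d : ℤ} {a b : Expr K G n d} (h : ExprRel R a b) :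
    a.eval O.toOperadData g = b.eval O.toOperadData g := by
  induction h with
  | of h => exact hR _ _ _ _ h
  | refl => rfl
  | symm _ ih => exact ih.symm
  | trans _ _ ih ih' => exact ih.trans ih'
  | add_congr _ _ ih ih' => simp only [Expr.eval, ih, ih']
  | smul_congr _ _ ih => simp only [Expr.eval, ih]
  | act_congr _ _ ih => simp only [Expr.eval, ih]
  | comp_congr _ _ _ _ _ ih ih' => simp only [Expr.eval, ih, ih']
  | diff_congr _ _ ih => simp only [Expr.eval, ih]
  | add_comm => simp only [Expr.eval]; exact _root_.add_comm _ _
  | add_assoc => simp only [Expr.eval]; exact _root_.add_assoc _ _ _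
  | zero_add => simp only [Expr.eval]; exact _root_.zero_add _
  | neg_add => simp [Expr.eval]
  | smul_add => simp only [Expr.eval]; exact _root_.smul_add _ _ _
  | add_smul => simp only [Expr.eval]; exact _root_.add_smul _ _ _
  | mul_smul => simp only [Expr.eval]; exact SemigroupAction.mul_smul _ _ _
  | one_smul => simp only [Expr.eval]; exact _root_.one_smul _ _
  | act_add => simp [Expr.eval]
  | act_smul => simp [Expr.eval]
  | add_comp => simp [Expr.eval]
  | smul_comp => simp [Expr.eval]
  | comp_add => simp [Expr.eval]
  | comp_smul => simp [Expr.eval]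
  | diff_add => simp [Expr.eval]
  | diff_smul => simp [Expr.eval]
  | act_refl => exact O.act_refl _
  | act_trans => exact O.act_trans _ _ _
  | comp_act i hm hm' hd σ τ ρ a b hσ hτ => exact O.comp_act i hm hm' hd σ τ ρ _ _ hσ hτ
  | one_comp => exact O.one_comp _
  | comp_one => exact O.comp_one _ _
  | comp_assoc i j t h₁ h₂ h₃ h₄ e₁ e₂ e₃ e₄ a b c ht =>
    exact O.comp_assoc i j t h₁ h₂ h₃ h₄ e₁ e₂ e₃ e₄ _ _ _ ht
  | comp_comm i j t t' h₁ h₂ h₃ h₄ e₁ e₂ e₃ e₄ a b c hij ht ht' =>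
    exact O.comp_comm i j t t' h₁ h₂ h₃ h₄ e₁ e₂ e₃ e₄ _ _ _ hij ht ht'
  | diff_diff => exact O.diff_diff _ _ _
  | diff_act => exact O.diff_act _ _ _
  | diff_comp i hm hd hp hq h e e' a b => exact O.diff_comp i hm hd hp hq h e e' _ _

/-- The morphism from a presented dg operad given by values of the generators that satisfy the
relations. -/
def presLift (O : DGOperad.{u, v} K) (g : ∀ n d, G n d → O.obj n d)
    (hR : ∀ n d (a b : Expr K G n d), R n d a b →
      a.eval O.toOperadData g = b.eval O.toOperadData g) :
    OperadHom (presented R).toOperadData O.toOperadData where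
  app n d :=
    { toFun := Quotient.lift (Expr.eval O.toOperadData g) fun _ _ h => ExprRel.eval_eq O g hR h
      map_add' := by rintro ⟨a⟩ ⟨b⟩; rfl
      map_smul' := by rintro c ⟨a⟩; rfl }
  app_act := by rintro m n d σ ⟨a⟩; rfl
  app_one := rfl
  app_comp := by rintro n k m p q d i hm hd ⟨a⟩ ⟨b⟩; rfl
  app_diff := by rintro n p q h ⟨a⟩; rfl

theorem Expr.eval_sum (O : OperadData.{u, v} K) (g : ∀ n d, G n d → O.obj n d) {ι : Type}
    (s : Finset ι) {n : ℕ} {d : ℤ} (f : ι → Expr K G n d) :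
    (Expr.sum K G s f).eval O g = ∑ x ∈ s, (f x).eval O g := by
  rw [← Finset.sum_map_toList]
  unfold Expr.sum
  induction s.toList with
  | nil => rfl
  | cons x l ih => simp [Expr.eval, ih]

end presentation

/-! ### The operads `ΛLie` and `ΛLie_∞` -/

section lie

variable (K : Type u) [Field K]

/-- The generator of `ΛLie`: a binary bracket of degree `-1`. -/
inductive LieGen : ℕ → ℤ → Type
  | bracket : LieGen 2 (-1)

/-- The expression `{{a₁, a₂}, a₃}`. -/
def bracketTwice : Expr K LieGen 3 (-2) :=
  .comp (0 : Fin 2) (by norm_num) (by norm_num) (.gen .bracket) (.gen .bracket)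

/-- The relations of `ΛLie`: the bracket is symmetric (it has odd degree), satisfies the Jacobi
identity `{{a₁, a₂}, a₃} + {{a₂, a₃}, a₁} + {{a₃, a₁}, a₂} = 0`, and is closed. -/
inductive LieRel : ∀ n d, Expr K LieGen n d → Expr K LieGen n d → Prop
  | symm : LieRel 2 (-1) (.act (Equiv.swap 0 1) (.gen .bracket)) (.gen .bracket)
  | jacobi : LieRel 3 (-2)
      (.add (bracketTwice K) (.add (.act (finRotate 3) (bracketTwice K))
        (.act ((finRotate 3).trans (finRotate 3)) (bracketTwice K)))) .zero
  | diff : LieRel 2 0 (.diff (by norm_num) (.gen .bracket)) .zero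

/-- The operad `ΛLie`, with zero differential. -/
def LLie : DGOperad.{u, u} K := presented (LieRel K)

/-- The element `{a₁, a₂}` of `ΛLie(2)`. -/
def bracket : (LLie K).obj 2 (-1) := presMk (LieRel K) (.gen .bracket)

/-- The `(p, n - p)`-shuffles. -/
def shuffles (p n : ℕ) : Finset (Fin n ≃ Fin n) :=
  Finset.univ.filter fun σ =>
    (∀ x y : Fin n, x < y → (y : ℕ) < p → σ x < σ y) ∧
    (∀ x y : Fin n, x < y → p ≤ (x : ℕ) → σ x < σ y)

/-- The generators of `ΛLie_∞`: one generator of each arity `n ≥ 2`, of degree `3 - 2n`. -/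
inductive LieInfGen : ℕ → ℤ → Type
  | br {n : ℕ} {d : ℤ} (hn : 2 ≤ n) (hd : d = 3 - 2 * n) : LieInfGen n d

/-- The relations of `ΛLie_∞`: the generator `s_n` of arity `n` is `S_n`-invariant, and its
differential is `- ∑_{p=2}^{n-1} ∑_{σ ∈ Sh(p, n-p)} σ (s_{n-p+1} ∘_1 s_p)`. -/
inductive LieInfRel : ∀ n d, Expr K LieInfGen n d → Expr K LieInfGen n d → Prop
  | symm {n : ℕ} {d : ℤ} (hn : 2 ≤ n) (hd : d = 3 - 2 * n) (σ : Fin n ≃ Fin n) :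
      LieInfRel n d (.act σ (.gen (.br hn hd))) (.gen (.br hn hd))
  | diff {n : ℕ} {d e : ℤ} (hn : 2 ≤ n) (hd : d = 3 - 2 * n) (h : d + 1 = e) :
      LieInfRel n e (.diff h (.gen (.br hn hd)))
        (.smul (-1) (Expr.sum K LieInfGen (Finset.univ : Finset {p // p ∈ Finset.Ico 2 n})
          fun p => Expr.sum K LieInfGen (shuffles p n) fun σ =>
            have hp := Finset.mem_Ico.1 p.2
            .act σ (.comp (n := n - p + 1) (k := p) (p := 3 - 2 * ((n - p + 1 : ℕ) : ℤ))
              (q := 3 - 2 * ((p : ℕ) : ℤ)) 0 (by omega) (by omega)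
              (.gen (.br (by omega) rfl)) (.gen (.br hp.1 rfl)))))

/-- The dg operad `ΛLie_∞ = Cobar(Λ²coCom)`. -/
def LLieInf : DGOperad.{u, u} K := presented (LieInfRel K)

/-- The generator of arity `n ≥ 2` of `ΛLie_∞`. -/
def infBracket {n : ℕ} {d : ℤ} (hn : 2 ≤ n) (hd : d = 3 - 2 * n) : (LLieInf K).obj n d :=
  presMk (LieInfRel K) (.gen (.br hn hd))

theorem act_bracket (σ : Fin 2 ≃ Fin 2) : (LLie K).act σ (bracket K) = bracket K := by
  have h : σ = Equiv.refl _ ∨ σ = Equiv.swap 0 1 := by revert σ; decide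
  rcases h with rfl | rfl
  · exact (LLie K).act_refl _
  · exact Quotient.sound (ExprRel.of LieRel.symm)

theorem diff_bracket {e : ℤ} (h : -1 + 1 = e) : (LLie K).diff h (bracket K) = 0 := by
  obtain rfl : e = 0 := by omega
  exact Quotient.sound (ExprRel.of LieRel.diff)

theorem sum_shuffles_bracket :
    ∑ σ ∈ shuffles 2 3, (LLie K).act σ ((LLie K).comp (m := 3) (d := -2) (0 : Fin 2)
      (by norm_num) (by norm_num) (bracket K) (bracket K)) = 0 := by
  set x := (LLie K).comp (m := 3) (d := -2) (0 : Fin 2) (by norm_num) (by norm_num)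
    (bracket K) (bracket K) with hx
  have hJ : x + ((LLie K).act (finRotate 3) x +
      (LLie K).act ((finRotate 3).trans (finRotate 3)) x) = 0 :=
    Quotient.sound (ExprRel.of LieRel.jacobi)
  have hsym : (LLie K).act (Equiv.swap (0 : Fin 3) 1) x = x := by
    have h := (LLie K).comp_act (m := 3) (m' := 3) (d := -2) (0 : Fin 2) (by norm_num)
      (by norm_num) (by norm_num) (Equiv.refl _) (Equiv.swap 0 1) (Equiv.swap (0 : Fin 3) 1)
      (bracket K) (bracket K) (by decide) (by decide)
    rw [act_bracket, act_bracket] at h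
    exact h.symm
  have hs : shuffles 2 3 = {Equiv.refl _, finRotate 3, Equiv.swap 1 2} := by decide
  have h2 : (LLie K).act (Equiv.swap (1 : Fin 3) 2) x =
      (LLie K).act ((finRotate 3).trans (finRotate 3)) x := by
    have h3 : (finRotate 3).trans (finRotate 3) =
        (Equiv.swap (0 : Fin 3) 1).trans (Equiv.swap 1 2) := by decide
    rw [h3, (LLie K).act_trans, hsym]
  rw [hs, Finset.sum_insert (by decide), Finset.sum_insert (by decide), Finset.sum_singleton,
    (LLie K).act_refl, h2]
  exact hJ

/-- The values of the generators of `ΛLie_∞` under the canonical morphism to `ΛLie`. -/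
def toLieVal (n : ℕ) (d : ℤ) : LieInfGen n d → (LLie K).obj n d
  | .br _ hd => if h : n = 2 then (LLie K).cast h.symm (by subst h; omega) (bracket K) else 0

theorem toLieVal_of_ne {n : ℕ} {d : ℤ} (hn : 2 ≤ n) (hd : d = 3 - 2 * n) (h : n ≠ 2) :
    toLieVal K n d (.br hn hd) = 0 := dif_neg h

theorem toLieVal_two {d : ℤ} (hn : 2 ≤ 2) (hd : d = 3 - 2 * (2 : ℕ)) :
    toLieVal K 2 d (.br hn hd) = (LLie K).cast rfl (by omega) (bracket K) := by
  simp [toLieVal]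

theorem toLieVal_rel (n : ℕ) (d : ℤ) (a b : Expr K LieInfGen n d) (h : LieInfRel K n d a b) :
    a.eval (LLie K).toOperadData (toLieVal K) = b.eval (LLie K).toOperadData (toLieVal K) := by
  cases h with
  | symm hn hd σ =>
    simp only [Expr.eval]
    rcases eq_or_ne n 2 with rfl | h
    · obtain rfl : d = -1 := by omega
      rw [toLieVal_two]
      exact act_bracket K σ
    · rw [toLieVal_of_ne K hn hd h, map_zero]
  | diff hn hd h =>
    rename_i e
    have h0 : (LLie K).diff h (toLieVal K n e (.br hn hd)) = 0 := by
      rcases eq_or_ne n 2 with rfl | h'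
      · obtain rfl : e = -1 := by omega
        rw [toLieVal_two]
        exact diff_bracket K h
      · rw [toLieVal_of_ne K hn hd h', map_zero]
    simp only [Expr.eval, Expr.eval_sum]
    rw [h0]
    rcases eq_or_ne n 3 with rfl | h3
    · obtain rfl : e = -3 := by omega
      obtain rfl : d = -2 := by omega
      rw [Finset.sum_eq_single (⟨2, by simp⟩ : {p // p ∈ Finset.Ico 2 3})]
      · have h := sum_shuffles_bracket K
        simp only [toLieVal, Nat.reduceSub, Nat.reduceAdd, dite_true]
        erw [h, smul_zero]
      · rintro ⟨p, hp⟩ - h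
        rw [Finset.mem_Ico] at hp
        exact absurd (Subtype.ext (by omega : p = 2)) h
      · simp
    · rw [Finset.sum_eq_zero, smul_zero]
      intro p _
      refine Finset.sum_eq_zero fun σ _ => ?_
      have hp := Finset.mem_Ico.1 p.2
      rcases eq_or_ne (p : ℕ) 2 with h2 | h2
      · rw [toLieVal_of_ne K _ _ (by omega : n - p + 1 ≠ 2)]
        simp
      · rw [toLieVal_of_ne K hp.1 _ h2]
        simp

/-- The canonical morphism `U : ΛLie_∞ → ΛLie`. -/
def toLie : OperadHom (LLieInf K).toOperadData (LLie K).toOperadData :=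
  presLift (LLie K) (toLieVal K) (toLieVal_rel K)

end lie

/-! ### Twisting: the underlying collections -/

section twisting

variable {K : Type u} [Field K]

/-- The bijection of `Fin (r + m)` with `Fin (r + n)` that is the identity on the first `r` elements
and `σ` on the remaining ones. -/
def extend (r : ℕ) {m n : ℕ} (σ : Fin m ≃ Fin n) : Fin (r + m) ≃ Fin (r + n) :=
  (finSumFinEquiv.symm.trans (Equiv.sumCongr (Equiv.refl (Fin r)) σ)).trans finSumFinEquiv

@[simp] theorem extend_natAdd (r : ℕ) {m n : ℕ} (σ : Fin m ≃ Fin n) (x : Fin m) :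
    extend r σ (Fin.natAdd r x) = Fin.natAdd r (σ x) := by
  simp [extend]

@[simp] theorem extend_castAdd (r : ℕ) {m n : ℕ} (σ : Fin m ≃ Fin n) (x : Fin r) :
    extend r σ (Fin.castAdd m x) = Fin.castAdd n x := by
  simp [extend]

theorem extend_refl (r n : ℕ) : extend r (Equiv.refl (Fin n)) = Equiv.refl _ := by
  ext x
  refine Fin.addCases (fun y => ?_) (fun y => ?_) x <;> simp

theorem extend_trans (r : ℕ) {l m n : ℕ} (σ : Fin l ≃ Fin m) (τ : Fin m ≃ Fin n) :
    extend r (σ.trans τ) = (extend r σ).trans (extend r τ) := by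
  ext x
  refine Fin.addCases (fun y => ?_) (fun y => ?_) x <;> simp

/-- The permutation `τ` fixes all elements but the first `r`. -/
def FixesFrom (r : ℕ) {N : ℕ} (τ : Fin N ≃ Fin N) : Prop := ∀ x : Fin N, r ≤ (x : ℕ) → τ x = x

instance (r : ℕ) {N : ℕ} : DecidablePred (FixesFrom r (N := N)) := fun τ => by
  unfold FixesFrom; infer_instance

theorem fixesFrom_conj (r : ℕ) {m n : ℕ} (σ : Fin m ≃ Fin n) {τ : Fin (r + n) ≃ Fin (r + n)}
    (hτ : FixesFrom r τ) :
    FixesFrom r (((extend r σ).trans τ).trans (extend r σ).symm) := by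
  intro x hx
  obtain ⟨y, rfl⟩ : ∃ y : Fin m, x = Fin.natAdd r y :=
    ⟨⟨x - r, by omega⟩, Fin.ext (by simp; omega)⟩
  simp only [Equiv.trans_apply, extend_natAdd]
  rw [hτ _ (by simp), Equiv.symm_apply_eq, extend_natAdd]

/-- The elements of `Tw A (n)` of degree `d`: families `f` of elements `f r = f(1_r)` of
`A(r + n)`, of degree `d - 2r`, that are invariant under the permutations of the first `r` inputs.
This is the degree `d` part of `∏_r s^{2r} A(r + n)^{S_r}`. -/
def twSubmodule (A : Collection.{u, v} K) (n : ℕ) (d : ℤ) :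
    Submodule K (∀ r : ℕ, A.obj (r + n) (d - 2 * r)) where
  carrier := {f | ∀ (r : ℕ) (τ : Fin (r + n) ≃ Fin (r + n)), FixesFrom r τ → A.act τ (f r) = f r}
  add_mem' hf hg r τ hτ := by simp [hf r τ hτ, hg r τ hτ]
  zero_mem' r τ _ := by simp
  smul_mem' c f hf r τ hτ := by simp [hf r τ hτ]

/-- The collection `Tw A`. The group `S_n` permutes the last `n` inputs. -/
def Tw (A : Collection.{u, v} K) : Collection.{u, v} K where
  obj n d := twSubmodule A n d
  act {m n d} σ :=
    { toFun f := ⟨fun r => A.act (extend r σ) (f.1 r), fun r τ hτ => by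
        have h := f.2 r _ (fixesFrom_conj r σ hτ)
        change A.act τ (A.act (extend r σ) (f.1 r)) = A.act (extend r σ) (f.1 r)
        conv_rhs => rw [← h]
        rw [← A.act_trans, ← A.act_trans]
        congr 2
        ext x
        simp⟩
      map_add' f g := Subtype.ext (funext fun r => map_add _ _ _)
      map_smul' c f := Subtype.ext (funext fun r => map_smul _ _ _) }
  act_refl f := Subtype.ext (funext fun r => by
    change A.act (extend r (Equiv.refl _)) (f.1 r) = f.1 r
    rw [extend_refl, A.act_refl])
  act_trans σ τ f := Subtype.ext (funext fun r => by
    change A.act (extend r (σ.trans τ)) (f.1 r) = A.act (extend r τ) (A.act (extend r σ) (f.1 r))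
    rw [extend_trans, A.act_trans])

section components

variable {A : Collection.{u, v} K} {n : ℕ} {d : ℤ}

/-- The component `f(1_r)` of an element of `Tw A (n)`. -/
def twAt (r : ℕ) : (Tw A).obj n d →ₗ[K] A.obj (r + n) (d - 2 * r) :=
  (LinearMap.proj r).comp (twSubmodule A n d).subtype

/-- The element of `Tw A (n)` with given components. -/
def twMk (f : ∀ r : ℕ, A.obj (r + n) (d - 2 * r))
    (hf : ∀ (r : ℕ) (τ : Fin (r + n) ≃ Fin (r + n)), FixesFrom r τ → A.act τ (f r) = f r) :
    (Tw A).obj n d := ⟨f, hf⟩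

@[simp] theorem twAt_twMk (f : ∀ r : ℕ, A.obj (r + n) (d - 2 * r))
    (hf : ∀ (r : ℕ) (τ : Fin (r + n) ≃ Fin (r + n)), FixesFrom r τ → A.act τ (f r) = f r)
    (r : ℕ) : twAt r (twMk f hf) = f r := rfl

theorem tw_ext {f g : (Tw A).obj n d} (h : ∀ r, twAt r f = twAt r g) : f = g :=
  Subtype.ext (funext h)

theorem act_twAt (f : (Tw A).obj n d) (r : ℕ) (τ : Fin (r + n) ≃ Fin (r + n))
    (hτ : FixesFrom r τ) : A.act τ (twAt r f) = twAt r f := f.2 r τ hτ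

theorem twAt_act {m : ℕ} (σ : Fin m ≃ Fin n) (f : (Tw A).obj m d) (r : ℕ) :
    twAt r ((Tw A).act σ f) = A.act (extend r σ) (twAt r f) := rfl

end components

/-- The action of `Tw` on maps of collections. -/
def twMap {A : Collection.{u, v} K} {B : Collection.{u, w} K} (c : Collection.Hom A B) :
    Collection.Hom (Tw A) (Tw B) where
  app n d :=
    { toFun f := twMk (fun r => c.app _ _ (twAt r f)) fun r τ hτ => by
        rw [← c.app_act, act_twAt f r τ hτ]
      map_add' f g := tw_ext fun r => by simp
      map_smul' a f := tw_ext fun r => by simp }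
  app_act σ f := tw_ext fun r => c.app_act _ _

/-- The natural projection `η : Tw A → A`, `f ↦ f(1_0)`. -/
def twCounit (A : Collection.{u, v} K) (n : ℕ) (d : ℤ) : (Tw A).obj n d →ₗ[K] A.obj n d :=
  (A.cast (Nat.zero_add n) (by simp)).comp (twAt 0)

/-- The comultiplication `𝔇 : Tw A → Tw (Tw A)`, `𝔇(f)(1_r ⊗ 1_s) = f(1_{s+r})`. -/
def twComult (A : Collection.{u, v} K) (n : ℕ) (d : ℤ) :
    (Tw A).obj n d →ₗ[K] (Tw (Tw A)).obj n d where
  toFun f :=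
    twMk
      (fun r => twMk
        (fun s => A.cast (Nat.add_assoc s r n) (by push_cast; ring) (twAt (s + r) f))
        fun s τ hτ => by
          rw [A.act_cast, act_twAt]
          intro x hx
          have h := hτ (finCongr (Nat.add_assoc s r n) x) (by simp; omega)
          rw [Equiv.trans_apply, Equiv.trans_apply, h]
          rfl)
      fun r τ hτ => tw_ext fun s => by
        rw [twAt_act, twAt_twMk, A.act_cast, act_twAt]
        intro x hx
        obtain ⟨y, hy⟩ : ∃ y : Fin (r + n), finCongr (Nat.add_assoc s r n) x = Fin.natAdd s y :=
          ⟨⟨x - s, by omega⟩, Fin.ext (by simp; omega)⟩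
        have hy' : s + (y : ℕ) = x := by
          have := congrArg Fin.val hy
          simpa using this.symm
        have h := hτ y (by omega)
        simp only [Equiv.trans_apply, hy, extend_natAdd, h]
        exact Fin.ext (by simpa using hy')
  map_add' f g := tw_ext fun r => tw_ext fun s => by simp
  map_smul' a f := tw_ext fun r => tw_ext fun s => by simp

/-! ### Twisting: the operations -/

variable (O : DGOperad.{u, v} K)

/-- The relabellings by which the elementary insertion `f ∘_i g (1_r)` in `Tw O` is assembled from
`f(1_a) ∘_{a+i} g(1_b)`, `a + b = r`: the last `n` inputs of `f(1_a)` and the last `k` inputs of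
`g(1_b)` become the last `m` inputs, numbered as in an insertion `∘_i`, and the remaining inputs
become the first `r` inputs in an arbitrary way. -/
def twRelabel {n k m : ℕ} (hm : n + k = m + 1) (i : Fin n) (a b r : ℕ)
    (h : (a + n) + (b + k) = (r + m) + 1) : Finset (Fin (r + m) ≃ Fin (r + m)) :=
  Finset.univ.filter fun σ =>
    (∀ (x : Fin n) (hx : x ≠ i),
      σ (outerPos h (Fin.natAdd a i) (Fin.natAdd a x) (by simpa using hx)) =
        Fin.natAdd r (outerPos hm i x hx)) ∧
    (∀ y : Fin k, σ (innerPos h (Fin.natAdd a i) (Fin.natAdd b y)) =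
      Fin.natAdd r (innerPos hm i y))

/-- The `a`-th summand of `(f ∘_i g)(1_r)` in `Tw O`, where `a + b = r`: the sum over all
`(a, b)`-shuffles of the relabellings of `f(1_a) ∘_{a+i} g(1_b)`. As `f(1_a)` and `g(1_b)` are
invariant under `S_a` and `S_b`, this is the sum over all relabellings in `twRelabel`, divided by
`a! b!`. -/
def twCompTerm {n k m : ℕ} {p q d : ℤ} (i : Fin n) (hm : n + k = m + 1) (hd : p + q = d)
    (a b r : ℕ) (h : a + b = r) :
    O.obj (a + n) (p - 2 * a) →ₗ[K] O.obj (b + k) (q - 2 * b) →ₗ[K]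
      O.obj (r + m) (d - 2 * r) :=
  ((a.factorial * b.factorial : ℕ) : K)⁻¹ •
    ∑ σ ∈ twRelabel hm i a b r (by omega),
      (O.comp (Fin.natAdd a i) (by omega) (by omega)).compr₂ (O.act σ)

theorem act_twCompTerm {n k m : ℕ} {p q d : ℤ} (i : Fin n) (hm : n + k = m + 1) (hd : p + q = d)
    (a b r : ℕ) (h : a + b = r) (x : O.obj (a + n) (p - 2 * a)) (y : O.obj (b + k) (q - 2 * b))
    (τ : Fin (r + m) ≃ Fin (r + m)) (hτ : FixesFrom r τ) :
    O.act τ (twCompTerm O i hm hd a b r h x y) = twCompTerm O i hm hd a b r h x y := by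
  have key : ∀ τ : Fin (r + m) ≃ Fin (r + m), FixesFrom r τ →
      ∀ σ ∈ twRelabel hm i a b r (by omega), σ.trans τ ∈ twRelabel hm i a b r (by omega) := by
    intro τ hτ σ hσ
    simp only [twRelabel, Finset.mem_filter, Finset.mem_univ, true_and, Equiv.trans_apply] at hσ ⊢
    refine ⟨fun x hx => ?_, fun y => ?_⟩
    · rw [hσ.1 x hx, hτ _ (by simp)]
    · rw [hσ.2 y, hτ _ (by simp)]
  have hτ' : FixesFrom r τ.symm := fun x hx => by rw [Equiv.symm_apply_eq, hτ x hx]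
  simp only [twCompTerm, LinearMap.smul_apply, LinearMap.sum_apply, LinearMap.compr₂_apply,
    map_smul, map_sum, ← O.act_trans]
  congr 1
  refine Finset.sum_bij' (fun σ _ => σ.trans τ) (fun σ _ => σ.trans τ.symm)
    (fun σ hσ => key τ hτ σ hσ) (fun σ hσ => key τ.symm hτ' σ hσ) ?_ ?_ ?_
  · intro σ _; ext; simp
  · intro σ _; ext; simp
  · intro σ _; rfl

/-- The elementary insertions of `Tw O`. -/
def twComp {n k m : ℕ} {p q d : ℤ} (i : Fin n) (hm : n + k = m + 1) (hd : p + q = d) :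
    (Tw O.toCollection).obj n p →ₗ[K] (Tw O.toCollection).obj k q →ₗ[K]
      (Tw O.toCollection).obj m d :=
  LinearMap.mk₂ K
    (fun f g => twMk
      (fun r => ∑ a : Fin (r + 1),
        twCompTerm O i hm hd a (r - a) r (by omega) (twAt a f) (twAt (r - a) g))
      fun r τ hτ => by
        rw [map_sum]
        exact Finset.sum_congr rfl fun a _ => act_twCompTerm O i hm hd _ _ _ _ _ _ τ hτ)
    (fun f f' g => tw_ext fun r => by simp [Finset.sum_add_distrib])
    (fun c f g => tw_ext fun r => by simp [Finset.smul_sum])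
    (fun f g g' => tw_ext fun r => by simp [Finset.sum_add_distrib])
    (fun c f g => tw_ext fun r => by simp [Finset.smul_sum])

/-- The unit of `Tw O`. -/
def twOne : (Tw O.toCollection).obj 1 0 :=
  twMk (fun r => if h : r = 0 then O.cast (by omega) (by subst h; simp) O.one else 0)
    fun r τ hτ => by
      by_cases h : r = 0
      · have h1 : τ = Equiv.refl _ := Equiv.ext fun x => hτ x (by omega)
        rw [h1, O.act_refl]
      · simp [h]

variable {O} (φ : OperadHom (LLieInf K).toOperadData O.toOperadData)

/-- The elements `φ_n = φ(1ᶜ_n)` of `O(n)` of degree `3 - 2n`, the values of the generators of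
`ΛLie_∞` under a morphism to `O`; they are `0` for `n < 2`. -/
def mc (n : ℕ) (d : ℤ) (hd : d = 3 - 2 * n) : O.obj n d :=
  if hn : 2 ≤ n then φ.app n d (infBracket K hn hd) else 0

theorem act_mc {n : ℕ} {d : ℤ} (hd : d = 3 - 2 * n) (τ : Fin n ≃ Fin n) :
    O.act τ (mc φ n d hd) = mc φ n d hd := by
  unfold mc
  split_ifs with hn
  · rw [← φ.app_act]
    congr 1
    exact Quotient.sound (ExprRel.of (LieInfRel.symm hn hd τ))
  · exact map_zero _

/-- The element of `Tw O (n)` with components `φ_{r+n}`. For `n ≥ 2` it is the image of the generator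
of arity `n` under the canonical morphism `β : ΛLie_∞ → Tw O`; for `n = 1` it is `κ(φ)`. -/
def twMC (n : ℕ) (d : ℤ) (hd : d = 3 - 2 * n) : (Tw O.toCollection).obj n d :=
  twMk (fun r => mc φ (r + n) (d - 2 * r) (by push_cast; omega)) fun _ τ _ => act_mc φ _ τ

/-- The `p`-th summand of `φ · f (1_r)`, up to the sign: the sum over all `(p, r - p)`-shuffles
`σ` of `σ (f(1_{r-p+1}) ∘_1 φ_p)`. As `f(1_{r-p+1})` and `φ_p` are invariant under permutations of
the inputs in question, this is the sum over all permutations of the first `r` inputs, divided by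
`p! (r - p)!`. -/
def twActionTerm {n : ℕ} {d e : ℤ} (h : d + 1 = e) (r p : ℕ) (hpr : p ≤ r) :
    O.obj ((r - p + 1) + n) (d - 2 * ((r - p + 1 : ℕ) : ℤ)) →ₗ[K] O.obj (r + n) (e - 2 * r) :=
  ((p.factorial * (r - p).factorial : ℕ) : K)⁻¹ •
    ∑ σ ∈ Finset.univ.filter (FixesFrom r (N := r + n)),
      (O.act σ).comp
        ((O.comp (m := r + n) (⟨0, by omega⟩ : Fin ((r - p + 1) + n)) (by omega) (by omega)).flip
          (mc φ p (3 - 2 * p) rfl))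

theorem act_twActionTerm {n : ℕ} {d e : ℤ} (h : d + 1 = e) (r p : ℕ) (hpr : p ≤ r)
    (x : O.obj ((r - p + 1) + n) (d - 2 * ((r - p + 1 : ℕ) : ℤ)))
    (τ : Fin (r + n) ≃ Fin (r + n)) (hτ : FixesFrom r τ) :
    O.act τ (twActionTerm φ h r p hpr x) = twActionTerm φ h r p hpr x := by
  have hτ' : FixesFrom r τ.symm := fun x hx => by rw [Equiv.symm_apply_eq, hτ x hx]
  have key : ∀ τ : Fin (r + n) ≃ Fin (r + n), FixesFrom r τ →
      ∀ σ ∈ Finset.univ.filter (FixesFrom r (N := r + n)),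
        σ.trans τ ∈ Finset.univ.filter (FixesFrom r (N := r + n)) := by
    intro τ hτ σ hσ
    simp only [Finset.mem_filter, Finset.mem_univ, true_and] at hσ ⊢
    intro x hx
    rw [Equiv.trans_apply, hσ x hx, hτ x hx]
  simp only [twActionTerm, LinearMap.smul_apply, LinearMap.sum_apply, LinearMap.comp_apply,
    map_smul, map_sum, ← O.act_trans]
  congr 1
  refine Finset.sum_bij' (fun σ _ => σ.trans τ) (fun σ _ => σ.trans τ.symm)
    (fun σ hσ => key τ hτ σ hσ) (fun σ hσ => key τ.symm hτ' σ hσ) ?_ ?_ ?_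
  · intro σ _; ext; simp
  · intro σ _; ext; simp
  · intro σ _; rfl

/-- The sum of the differential of `O` and the auxiliary action of `φ`: the component of index `r`
of `f` is mapped to `∂ (f(1_r)) - (-1)^{|f|} ∑_{p=1}^r ∑_σ σ (f(1_{r-p+1}) ∘_1 φ_p)`. -/
def twDiffAux {n : ℕ} {d e : ℤ} (h : d + 1 = e) :
    (Tw O.toCollection).obj n d →ₗ[K] (Tw O.toCollection).obj n e where
  toFun f := twMk
    (fun r => O.diff (by omega) (twAt r f) -
      sgn K d • ∑ p ∈ (Finset.Icc 1 r).attach,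
        twActionTerm φ h r p (Finset.mem_Icc.1 p.2).2 (twAt (r - p + 1) f))
    fun r τ hτ => by
      rw [map_sub, map_smul, map_sum, ← O.diff_act, act_twAt f r τ hτ]
      congr 2
      exact Finset.sum_congr rfl fun p _ => act_twActionTerm φ h r p _ _ τ hτ
  map_add' f g := tw_ext fun r => by
    simp only [twAt_twMk, map_add, Finset.sum_add_distrib, smul_add]
    abel
  map_smul' c f := tw_ext fun r => by
    simp only [twAt_twMk, map_smul, ← Finset.smul_sum, smul_sub, RingHom.id_apply]
    rw [smul_comm]

/-- The differential of `Tw O`: `∂ f + φ · f + κ(φ) ∘_1 f - (-1)^{|f|} ∑_i f ∘_i κ(φ)`. -/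
def twDiff {n : ℕ} {d e : ℤ} (h : d + 1 = e) :
    (Tw O.toCollection).obj n d →ₗ[K] (Tw O.toCollection).obj n e :=
  twDiffAux φ h + twComp O (0 : Fin 1) (Nat.add_comm 1 n) (by omega) (twMC φ 1 1 (by norm_num)) -
    sgn K d • ∑ i : Fin n, (twComp O i rfl h).flip (twMC φ 1 1 (by norm_num))

/-- The twisted operad `Tw O` of an arrow `φ : ΛLie_∞ → O`. -/
def TwOp : OperadData.{u, v} K where
  toCollection := Tw O.toCollection
  one := twOne O
  comp := twComp O
  diff := twDiff φ

/-- `c : O → Tw O` is a coalgebra structure over the comonad `Tw` on the arrow `φ : ΛLie_∞ → O`. -/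
structure IsTwCoalgebra (c : OperadHom O.toOperadData (TwOp φ)) : Prop where
  /-- `c` is a morphism under `ΛLie_∞`: `c ∘ φ` agrees with `β : ΛLie_∞ → Tw O` on the generators
  of `ΛLie_∞`. -/
  under : ∀ (n : ℕ) (d : ℤ) (hn : 2 ≤ n) (hd : d = 3 - 2 * n),
    c.app n d (φ.app n d (infBracket K hn hd)) = twMC φ n d hd
  counit : ∀ (n : ℕ) (d : ℤ) (a : O.obj n d), twCounit O.toCollection n d (c.app n d a) = a
  coassoc : ∀ (n : ℕ) (d : ℤ) (a : O.obj n d),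
    twComult O.toCollection n d (c.app n d a) = (twMap c.toHom).app n d (c.app n d a)

/-- `c : O → Tw O` is the canonical embedding: `c(a)(1_0) = a`, and `c(a)(1_r) = 0` for
`r ≥ 1`. -/
def IsCanonicalEmbedding (c : OperadHom O.toOperadData (TwOp φ)) : Prop :=
  ∀ (n : ℕ) (d : ℤ) (a : O.obj n d),
    twAt 0 (c.app n d a) = O.cast (Nat.zero_add n).symm (by simp) a ∧
      ∀ r : ℕ, 1 ≤ r → twAt r (c.app n d a) = 0

/-- A family of linear maps of degree `0` that commutes with the differentials and induces
isomorphisms on cohomology. -/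
structure IsQuasiIso {A : OperadData.{u, v} K} {B : OperadData.{u, w} K}
    (f : ∀ n d, A.obj n d →ₗ[K] B.obj n d) : Prop where
  comm : ∀ {n : ℕ} {p q : ℤ} (h : p + 1 = q) (a : A.obj n p),
    f n q (A.diff h a) = B.diff h (f n p a)
  injective : ∀ {n : ℕ} {p q s : ℤ} (h : p + 1 = q) (h' : q + 1 = s) (a : A.obj n q),
    A.diff h' a = 0 → (∃ b : B.obj n p, B.diff h b = f n q a) → ∃ a' : A.obj n p, A.diff h a' = a
  surjective : ∀ {n : ℕ} {p q s : ℤ} (h : p + 1 = q) (h' : q + 1 = s) (b : B.obj n q),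
    B.diff h' b = 0 →
      ∃ (a : A.obj n q) (b' : B.obj n p), A.diff h' a = 0 ∧ f n q a = b + B.diff h b'

/-- The arrow `φ : ΛLie_∞ → O` is a homotopy fixed point for `Tw`: the counit `η : Tw O → O` is a
quasi-isomorphism. -/
def IsHomotopyFixedPoint : Prop :=
  IsQuasiIso (A := TwOp φ) (B := O.toOperadData) (twCounit O.toCollection)

end twisting

/-! ### Plethysm and distributive laws -/

section distributive

variable {K : Type u} [Field K]

/-- Symbols `(v; X_1, …, X_r)` with `v` in `A(r)` and `X_i` in `B(k_i)`, together with a labelling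
of all inputs of `X_1, …, X_r` by the elements of `Fin n`. They generate the arity `n` and
degree `d` part of `A ⊙ B`. -/
structure PlSym (A : Collection.{u, v} K) (B : Collection.{u, w} K) (n : ℕ) (d : ℤ) where
  r : ℕ
  p : ℤ
  v : A.obj r p
  k : Fin r → ℕ
  q : Fin r → ℤ
  X : ∀ i, B.obj (k i) (q i)
  f : (Σ i, Fin (k i)) ≃ Fin n
  hd : p + ∑ i, q i = d

/-- The Koszul sign of the permutation that takes `X_1 ⊗ … ⊗ X_r` to `X_{τ 1} ⊗ … ⊗ X_{τ r}`, for
`X_i` of degree `q i`. -/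
def koszulSign (K : Type u) [Field K] {r : ℕ} (τ : Fin r ≃ Fin r) (q : Fin r → ℤ) : K :=
  ∏ x : Fin r, ∏ y : Fin r, if x < y ∧ τ y < τ x then sgn K (q (τ x) * q (τ y)) else 1

/-- The relations between the symbols: they are multilinear; the symmetric groups acting on the
`B(k_i)` act through the labelling (which describes the induced representation); and the action of
`S_r` on `v` is exchanged for the permutation of the `X_i` (which describes the coinvariants). -/
inductive PlRel (A : Collection.{u, v} K) (B : Collection.{u, w} K) (n : ℕ) (d : ℤ) :
    (PlSym A B n d →₀ K) → Prop
  | left_add {r : ℕ} {p : ℤ} (a a' : A.obj r p) (k : Fin r → ℕ) (q : Fin r → ℤ)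
      (X : ∀ i, B.obj (k i) (q i)) (f : (Σ i, Fin (k i)) ≃ Fin n) (hd : p + ∑ i, q i = d) :
      PlRel A B n d (Finsupp.single ⟨r, p, a + a', k, q, X, f, hd⟩ 1 -
        Finsupp.single ⟨r, p, a, k, q, X, f, hd⟩ 1 - Finsupp.single ⟨r, p, a', k, q, X, f, hd⟩ 1)
  | left_smul {r : ℕ} {p : ℤ} (c : K) (a : A.obj r p) (k : Fin r → ℕ) (q : Fin r → ℤ)
      (X : ∀ i, B.obj (k i) (q i)) (f : (Σ i, Fin (k i)) ≃ Fin n) (hd : p + ∑ i, q i = d) :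
      PlRel A B n d (Finsupp.single ⟨r, p, c • a, k, q, X, f, hd⟩ 1 -
        Finsupp.single ⟨r, p, a, k, q, X, f, hd⟩ c)
  | right_add {r : ℕ} {p : ℤ} (a : A.obj r p) (k : Fin r → ℕ) (q : Fin r → ℤ)
      (X : ∀ i, B.obj (k i) (q i)) (i : Fin r) (b b' : B.obj (k i) (q i))
      (f : (Σ i, Fin (k i)) ≃ Fin n) (hd : p + ∑ i, q i = d) :
      PlRel A B n d (Finsupp.single ⟨r, p, a, k, q, Function.update X i (b + b'), f, hd⟩ 1 -
        Finsupp.single ⟨r, p, a, k, q, Function.update X i b, f, hd⟩ 1 -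
        Finsupp.single ⟨r, p, a, k, q, Function.update X i b', f, hd⟩ 1)
  | right_smul {r : ℕ} {p : ℤ} (a : A.obj r p) (k : Fin r → ℕ) (q : Fin r → ℤ)
      (X : ∀ i, B.obj (k i) (q i)) (i : Fin r) (c : K) (b : B.obj (k i) (q i))
      (f : (Σ i, Fin (k i)) ≃ Fin n) (hd : p + ∑ i, q i = d) :
      PlRel A B n d (Finsupp.single ⟨r, p, a, k, q, Function.update X i (c • b), f, hd⟩ 1 -
        Finsupp.single ⟨r, p, a, k, q, Function.update X i b, f, hd⟩ c)
  | act_right {r : ℕ} {p : ℤ} (a : A.obj r p) (k : Fin r → ℕ) (q : Fin r → ℤ)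
      (X : ∀ i, B.obj (k i) (q i)) (τ : ∀ i, Fin (k i) ≃ Fin (k i))
      (f : (Σ i, Fin (k i)) ≃ Fin n) (hd : p + ∑ i, q i = d) :
      PlRel A B n d (Finsupp.single ⟨r, p, a, k, q, fun i => B.act (τ i) (X i), f, hd⟩ 1 -
        Finsupp.single ⟨r, p, a, k, q, X, (Equiv.sigmaCongrRight τ).trans f, hd⟩ 1)
  | act_left {r : ℕ} {p : ℤ} (τ : Fin r ≃ Fin r) (a : A.obj r p) (k : Fin r → ℕ) (q : Fin r → ℤ)
      (X : ∀ i, B.obj (k i) (q i)) (f : (Σ i, Fin (k i)) ≃ Fin n) (hd : p + ∑ i, q i = d)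
      (hd' : p + ∑ i, q (τ i) = d) :
      PlRel A B n d (Finsupp.single ⟨r, p, A.act τ a, k, q, X, f, hd⟩ 1 -
        Finsupp.single ⟨r, p, a, fun i => k (τ i), fun i => q (τ i), fun i => X (τ i),
          (Equiv.sigmaCongrLeft (β := fun i => Fin (k i)) τ).trans f, hd'⟩ (koszulSign K τ q))

/-- The plethysm `A ⊙ B`: its part of arity `n` and degree `d` is
`⨁_r A(r) ⊗_{S_r} (⨁_{k_1 + … + k_r = n} Ind B(k_1) ⊗ … ⊗ B(k_r))`. -/
abbrev Plethysm (A : Collection.{u, v} K) (B : Collection.{u, w} K) (n : ℕ) (d : ℤ) :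
    Type (max u v w) :=
  (PlSym A B n d →₀ K) ⧸ Submodule.span K {x | PlRel A B n d x}

/-- The class of a symbol in the plethysm. -/
def plMk {A : Collection.{u, v} K} {B : Collection.{u, w} K} {n : ℕ} {d : ℤ} (s : PlSym A B n d) :
    Plethysm A B n d :=
  Submodule.Quotient.mk (Finsupp.single s 1)

/-- The sum of the first `j` values of `g`. -/
def psum {M : Type} [AddCommMonoid M] {r : ℕ} (g : Fin r → M) (j : ℕ) : M :=
  ∑ i : Fin r, if (i : ℕ) < j then g i else 0

theorem psum_zero {M : Type} [AddCommMonoid M] {r : ℕ} (g : Fin r → M) : psum g 0 = 0 := by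
  simp [psum]

theorem psum_succ {M : Type} [AddCommMonoid M] {r : ℕ} (g : Fin r → M) (j : ℕ) (hj : j < r) :
    psum g (j + 1) = psum g j + g ⟨j, hj⟩ := by
  have h : g ⟨j, hj⟩ = ∑ i : Fin r, if i = ⟨j, hj⟩ then g i else 0 := by simp
  unfold psum
  rw [h, ← Finset.sum_add_distrib]
  refine Finset.sum_congr rfl fun i _ => ?_
  by_cases h1 : (i : ℕ) < j
  · simp [h1, Nat.lt_succ_of_lt h1, Fin.ext_iff, h1.ne]
  · by_cases h2 : (i : ℕ) = j
    · simp [h2, Fin.ext_iff]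
    · simp [h1, h2, Fin.ext_iff, show ¬ (i : ℕ) < j + 1 by omega]

theorem psum_self {M : Type} [AddCommMonoid M] {r : ℕ} (g : Fin r → M) : psum g r = ∑ i, g i := by
  simp [psum]

/-- The result of inserting the first `j` of the operations `X_1, …, X_r` in the first `j` inputs
of `v`. -/
def insertFirst (O : OperadData.{u, v} K) {r : ℕ} {p : ℤ} (a : O.obj r p) {k : Fin r → ℕ}
    {q : Fin r → ℤ} (X : ∀ i, O.obj (k i) (q i)) :
    ∀ j : ℕ, j ≤ r → O.obj (psum k j + (r - j)) (p + psum q j)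
  | 0, _ => O.cast (by simp [psum_zero]) (by simp [psum_zero]) a
  | j + 1, h =>
      O.comp (n := psum k j + (r - j)) ⟨psum k j, by omega⟩
        (by rw [psum_succ k j h]; omega) (by rw [psum_succ q j h]; omega)
        (insertFirst O a X j (by omega)) (X ⟨j, h⟩)

/-- The composite `(…((v ∘ X_1) ∘ X_2) …) ∘ X_r = v(X_1, …, X_r)`, whose inputs are numbered from
left to right. -/
def fullComp (O : OperadData.{u, v} K) {r : ℕ} {p : ℤ} (a : O.obj r p) {k : Fin r → ℕ}
    {q : Fin r → ℤ} (X : ∀ i, O.obj (k i) (q i)) : O.obj (∑ i, k i) (p + ∑ i, q i) :=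
  O.cast (by simp [psum_self]) (by rw [psum_self]) (insertFirst O a X r le_rfl)

/-- The value of a symbol `(v; X_1, …, X_r)` in an operad `O`, for maps `g : A → O` and
`h : B → O`: the composite `g(v)(h(X_1), …, h(X_r))`, with its inputs relabelled as the symbol
prescribes. -/
def PlSym.value {A : Collection.{u, v} K} {B : Collection.{u, w} K} {O : OperadData.{u, z} K}
    (g : Collection.Hom A O.toCollection) (h : Collection.Hom B O.toCollection) {n : ℕ} {d : ℤ}
    (s : PlSym A B n d) : O.obj n d :=
  O.act (finSigmaFinEquiv.symm.trans s.f)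
    (O.cast rfl s.hd (fullComp O (g.app _ _ s.v) fun i => h.app _ _ (s.X i)))

/-- The dg operad `O` is obtained from `P` and `ΛLie` using the distributive law
`{a₁, a₂} ∘₂ γ = (-1)^{|γ|} ∑_{i=1}^n ς_{1,i} (γ ∘_i {a₁, a₂})`, where `ς_{1,i}` is the
cycle `(1, 2, …, i)`: the collection `O` is identified with the plethysm `P ⊙ ΛLie`, the
operad structure of `O` extends those of `P` and `ΛLie` (by the morphisms `j` and `i`), with the
symbol `(v; X_1, …, X_r)` standing for `v(X_1, …, X_r)`, and the distributive law holds. -/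
structure IsDistributive {P : DGOperad.{u, v} K} {O : DGOperad.{u, w} K}
    (j : OperadHom P.toOperadData O.toOperadData)
    (i : OperadHom (LLie K).toOperadData O.toOperadData) : Prop where
  plethysm : ∀ (n : ℕ) (d : ℤ),
    ∃ Φ : Plethysm P.toCollection (LLie K).toCollection n d ≃ₗ[K] O.obj n d,
      ∀ s : PlSym P.toCollection (LLie K).toCollection n d,
        Φ (plMk s) = s.value (O := O.toOperadData) j.toHom i.toHom
  law : ∀ (n : ℕ) (p : ℤ) (γ : P.obj n p),
    O.comp (m := n + 1) (d := p - 1) (1 : Fin 2) (by omega) (by omega)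
        (i.app 2 (-1) (bracket K)) (j.app n p γ) =
      sgn K p • ∑ s : Fin n, O.act (Fin.cycleRange s.castSucc)
        (O.comp (m := n + 1) (d := p - 1) s (by omega) (by omega)
          (j.app n p γ) (i.app 2 (-1) (bracket K)))

/-- The degrees of `P` are bounded below, uniformly in all arities. -/
def BoundedBelow (P : Collection.{u, v} K) : Prop :=
  ∃ N : ℤ, ∀ (n : ℕ) (d : ℤ), d < N → ∀ a : P.obj n d, a = 0

end distributive

end TwOperad
end

/-!
The first part rests on the fact that `{a₀, -}` is a derivation on all of `O`: the bracket of a new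
input with an operation is the signed sum of the brackets with the single inputs of the operation
(`IsDistributive.isDerivationOn`). For operations of `P` this is the distributive law, for
operations of `ΛLie` it follows from the Jacobi identity, and the property is inherited by
composites (`IsDerivationOn.comp`). As only the binary generator of `ΛLie_∞` has a nonzero image in
`O`, the terms of `∂^Tw f` with `φ` are brackets. In the commutator with `κ` the brackets with the
last `n` inputs cancel, so `∂^Tw` is the differential of `O` plus a nonzero multiple of
`f(1_{r+1}) ↦ symm (f(1_{r+1}) ∘₁ {a₁, a₂})`, the sum over the permutations of the first `r + 2`
inputs (`twAt_twDiff`); it appears only in the components of index at least two. On the image of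
the embedding it vanishes, and `emb` is a chain map (`embApp_diff`).

For the second part, `η ∘ emb = id` gives surjectivity on cohomology, and it remains to show that a
cocycle of `Tw O` whose component of index `0` vanishes is a coboundary. As `P` is bounded below
and the bracket has degree `-1`, an operation of `O` of arity `N` and degree `d` vanishes if `d + N`
is small (`eq_zero_of_bound`). Hence an element of `Tw O` has only finitely many components, and
those of a cocycle can be removed one by one, beginning with that of largest index
(`exists_twDiff_eq`), if the rows formed by the maps `f ↦ symm (f ∘₁ {a₁, a₂})` are exact
(`eq_zero_of_symm_comp_bracket`, `exists_symm_comp_bracket`).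

To prove the exactness, operations are described by coefficients. The operad `ΛLie` maps to the
suspended associative operad by commutators (`toAss`), and an operation of `O`, as a combination of
composites `v(X₁, …, X_m)`, has a coefficient in `P(m)` at each `m`-tuple of words (`coeff`). Give
the symmetrized inputs the letter `0` and the other inputs distinct positive letters. As
`{a₁, a₂}` becomes `a₁a₂ + a₂a₁`, substituting the bracket for an input with letter `0` doubles
letters `0` in the words; on coefficients this is the alternating sum over the ways to drop one of
two neighbouring letters `0` (`sum_coeff_comp_bracket`, `tupleDiff`). The insertion of a letter `0`
before a letter that does not follow a letter `0` is a homotopy that contracts `tupleDiff` up to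
the number of runs of letters `0` (`tupleDiff_tupleHtpy`), and in characteristic zero this number
can be inverted once a letter `0` occurs.

It remains to pass back from coefficients to operations. `ΛLie` is spanned by right-normed brackets
whose innermost input is prescribed (`LLie.mem_rightNormed`), here an input with the largest letter
of the bracket. The expansion of such a bracket contains exactly one word whose last letter is the
largest, and brackets of at least three inputs with letter `0` are killed by the symmetrization. So
the coefficients at the words of this form and at the word `00` (`IsGood`) determine a symmetrized
operation, and they can be prescribed (`reconstruct_coeff`, `coeff_reconstruct`). Dropping a letter
`0` preserves this class of words, so the homotopy can be applied to the coefficients.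
-/

noncomputable section

namespace TwOperad

/-! ### Signs, transport and positions -/

section signs

variable (K : Type u) [Field K]

theorem sgn_zero : sgn K 0 = 1 := by simp [sgn]

theorem sgn_add (p q : ℤ) : sgn K (p + q) = sgn K p * sgn K q := by
  simp [sgn, Int.negOnePow_add]

theorem sgn_neg (p : ℤ) : sgn K (-p) = sgn K p := by simp [sgn, Int.negOnePow_neg]

theorem sgn_one : sgn K 1 = -1 := by simp [sgn]

theorem sgn_mul_self (p : ℤ) : sgn K p * sgn K p = 1 := by
  rcases Int.even_or_odd p with h | h
  · simp [sgn, Int.negOnePow_even p h]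
  · simp [sgn, Int.negOnePow_odd p h]

theorem sgn_of_even {p : ℤ} (h : Even p) : sgn K p = 1 := by simp [sgn, Int.negOnePow_even p h]

theorem sgn_eq_of_even_sub {p q : ℤ} (h : Even (p - q)) : sgn K p = sgn K q := by
  rw [← sub_add_cancel p q, sgn_add, sgn_of_even K h, one_mul]

theorem sgn_ne_zero (p : ℤ) : sgn K p ≠ 0 := fun h => by
  have := sgn_mul_self K p
  simp [h] at this

end signs

section casts

variable {K : Type u} [Field K]

namespace Collection

@[simp] theorem cast_rfl (A : Collection.{u, v} K) {n : ℕ} {d : ℤ} (a : A.obj n d) :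
    A.cast rfl rfl a = a := rfl

@[simp] theorem cast_cast (A : Collection.{u, v} K) {l m n : ℕ} {d e c : ℤ} (h : l = m)
    (h' : m = n) (k : d = e) (k' : e = c) (a : A.obj l d) :
    A.cast h' k' (A.cast h k a) = A.cast (h.trans h') (k.trans k') a := by
  subst h; subst h'; subst k; subst k'; rfl

theorem act_finCongr (A : Collection.{u, v} K) {m n : ℕ} {d : ℤ} (h : m = n) (a : A.obj m d) :
    A.act (finCongr h) a = A.cast h rfl a := by
  subst h; exact A.act_refl a

theorem act_cast_deg (A : Collection.{u, v} K) {m n : ℕ} {d e : ℤ} (h : d = e)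
    (σ : Fin m ≃ Fin n) (a : A.obj m d) :
    A.act σ (A.cast rfl h a) = A.cast rfl h (A.act σ a) := by
  subst h; rfl

theorem act_cast_arity (A : Collection.{u, v} K) {l m n : ℕ} {d e : ℤ} (h : l = m) (k : d = e)
    (σ : Fin m ≃ Fin n) (a : A.obj l d) :
    A.act σ (A.cast h k a) = A.cast rfl k (A.act ((finCongr h).trans σ) a) := by
  subst h; subst k; rfl

theorem Hom.app_cast {A : Collection.{u, v} K} {B : Collection.{u, w} K} (f : Hom A B)
    {m n : ℕ} {d e : ℤ} (h : m = n) (k : d = e) (a : A.obj m d) :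
    f.app n e (A.cast h k a) = B.cast h k (f.app m d a) := by
  subst h; subst k; rfl

theorem act_act_symm (A : Collection.{u, v} K) {m n : ℕ} {d : ℤ} (σ : Fin m ≃ Fin n)
    (a : A.obj n d) : A.act σ (A.act σ.symm a) = a := by
  rw [← A.act_trans, Equiv.symm_trans_self, A.act_refl]

end Collection

theorem OperadData.comp_cast_left (O : OperadData.{u, v} K) {n n' k m : ℕ} {p p' q d : ℤ}
    (hn : n = n') (hp : p = p') (i : Fin n') (hm : n' + k = m + 1) (hd : p' + q = d)
    (a : O.obj n p) (b : O.obj k q) :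
    O.comp i hm hd (O.cast hn hp a) b =
      O.comp (Fin.cast hn.symm i) (by omega) (by omega) a b := by
  subst hn; subst hp; rfl

theorem OperadData.comp_cast_right (O : OperadData.{u, v} K) {n k k' m : ℕ} {p q q' d : ℤ}
    (hk : k = k') (hq : q = q') (i : Fin n) (hm : n + k' = m + 1) (hd : p + q' = d)
    (a : O.obj n p) (b : O.obj k q) :
    O.comp i hm hd a (O.cast hk hq b) = O.comp i (by omega) (by omega) a b := by
  subst hk; subst hq; rfl

theorem OperadData.cast_comp (O : OperadData.{u, v} K) {n k m m' : ℕ} {p q d d' : ℤ}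
    (h : m = m') (h' : d = d') (i : Fin n) (hm : n + k = m + 1) (hd : p + q = d)
    (a : O.obj n p) (b : O.obj k q) :
    O.cast h h' (O.comp i hm hd a b) = O.comp i (by omega) (by omega) a b := by
  subst h; subst h'; rfl

theorem OperadData.diff_cast (O : OperadData.{u, v} K) {m n : ℕ} {d e d' e' : ℤ}
    (h : m = n) (hd : d = e) (k' : e + 1 = e') (k : d + 1 = d') (a : O.obj m d) :
    O.diff k' (O.cast h hd a) = O.cast h (by omega) (O.diff k a) := by
  subst h; subst hd; subst k'; subst k; rfl

end casts

section positions

theorem val_cycleRange {n : ℕ} (i j : Fin n) :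
    (Fin.cycleRange i j : ℕ) =
      if (j : ℕ) < i then (j : ℕ) + 1 else if (j : ℕ) = i then 0 else j := by
  have : NeZero n := ⟨by have := i.2; omega⟩
  rcases lt_trichotomy j i with h | h | h
  · rw [Fin.coe_cycleRange_of_lt h, if_pos (Fin.lt_def.1 h)]
  · subst h; simp
  · rw [Fin.cycleRange_of_gt h, if_neg (by rw [Fin.lt_def] at h; omega),
      if_neg (by rw [Fin.lt_def] at h; omega)]

theorem val_outerPos {n k m : ℕ} (hm : n + k = m + 1) (i x : Fin n) (hx : x ≠ i) :
    (outerPos hm i x hx : ℕ) = if (x : ℕ) < i then (x : ℕ) else x + k - 1 := rfl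

theorem val_innerPos {n k m : ℕ} (hm : n + k = m + 1) (i : Fin n) (y : Fin k) :
    (innerPos hm i y : ℕ) = i + y := rfl

theorem outerPos_or_innerPos {n k m : ℕ} (hm : n + k = m + 1) (i : Fin n) (t : Fin m) :
    (∃ x, ∃ hx : x ≠ i, t = outerPos hm i x hx) ∨ ∃ y, t = innerPos hm i y := by
  have ht := t.2
  have hi := i.2
  by_cases h1 : (t : ℕ) < i
  · refine Or.inl ⟨⟨t, by omega⟩, fun h => by have := congrArg Fin.val h; simp at this; omega, ?_⟩
    ext; simp [val_outerPos, h1]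
  · by_cases h2 : (t : ℕ) < i + k
    · refine Or.inr ⟨⟨t - i, by omega⟩, ?_⟩
      ext; simp [val_innerPos]; omega
    · refine Or.inl ⟨⟨t + 1 - k, by omega⟩,
        fun h => by have := congrArg Fin.val h; simp at this; omega, ?_⟩
      ext; rw [val_outerPos, if_neg (by simp; omega)]; simp; omega

theorem outerPos_injective {n k m : ℕ} (hm : n + k = m + 1) (i x x' : Fin n) (hx : x ≠ i)
    (hx' : x' ≠ i) (h : outerPos hm i x hx = outerPos hm i x' hx') : x = x' := by
  have h1 := congrArg Fin.val h
  have h2 : (x : ℕ) ≠ i := fun h => hx (Fin.ext h)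
  have h3 : (x' : ℕ) ≠ i := fun h => hx' (Fin.ext h)
  rw [val_outerPos, val_outerPos] at h1
  ext; split_ifs at h1 <;> omega

theorem outerPos_ne_innerPos {n k m : ℕ} (hm : n + k = m + 1) (i x : Fin n) (hx : x ≠ i)
    (y : Fin k) : outerPos hm i x hx ≠ innerPos hm i y := fun h => by
  have h1 := congrArg Fin.val h
  have h2 : (x : ℕ) ≠ i := fun h => hx (Fin.ext h)
  rw [val_outerPos, val_innerPos] at h1
  split_ifs at h1 <;> omega

/-- The inputs of `a ∘_i b` are the inputs of `a` other than `i` and the inputs of `b`. -/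
def insertionEquiv {n k m : ℕ} (hm : n + k = m + 1) (i : Fin n) :
    {x : Fin n // x ≠ i} ⊕ Fin k ≃ Fin m :=
  Equiv.ofBijective (Sum.elim (fun x => outerPos hm i x.1 x.2) (innerPos hm i)) <| by
    constructor
    · rintro (⟨x, hx⟩ | y) (⟨x', hx'⟩ | y') h
      · simp only [Sum.elim_inl] at h
        simp [outerPos_injective hm i x x' hx hx' h]
      · exact absurd h (outerPos_ne_innerPos hm i x hx y')
      · exact absurd h.symm (outerPos_ne_innerPos hm i x' hx' y)
      · have := congrArg Fin.val h
        simp only [Sum.elim_inr, val_innerPos] at this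
        simp only [Sum.inr.injEq]; ext; omega
    · intro t
      rcases outerPos_or_innerPos hm i t with ⟨x, hx, rfl⟩ | ⟨y, rfl⟩
      · exact ⟨Sum.inl ⟨x, hx⟩, rfl⟩
      · exact ⟨Sum.inr y, rfl⟩

theorem sum_insertion {n k m : ℕ} (hm : n + k = m + 1) (i : Fin n) {M : Type*} [AddCommMonoid M]
    (F : Fin m → M) :
    ∑ t, F t = ∑ x : {x : Fin n // x ≠ i}, F (outerPos hm i x.1 x.2) +
      ∑ y, F (innerPos hm i y) := by
  rw [← (insertionEquiv hm i).sum_comp, Fintype.sum_sum_type]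
  rfl

/-- Relabellings of the inputs of two operations induce a relabelling of the inputs of an
insertion. -/
def insertionCongr {n k m n' k' m' : ℕ} (hm : n + k = m + 1) (hm' : n' + k' = m' + 1) (i : Fin n)
    (σ : Fin n ≃ Fin n') (τ : Fin k ≃ Fin k') : Fin m ≃ Fin m' :=
  ((insertionEquiv hm i).symm.trans
    (Equiv.sumCongr (σ.subtypeEquiv fun x => by simp) τ)).trans (insertionEquiv hm' (σ i))

theorem insertionCongr_outerPos {n k m n' k' m' : ℕ} (hm : n + k = m + 1)
    (hm' : n' + k' = m' + 1) (i : Fin n) (σ : Fin n ≃ Fin n') (τ : Fin k ≃ Fin k') (x : Fin n)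
    (hx : x ≠ i) :
    insertionCongr hm hm' i σ τ (outerPos hm i x hx) =
      outerPos hm' (σ i) (σ x) (σ.injective.ne hx) := by
  have : outerPos hm i x hx = insertionEquiv hm i (Sum.inl ⟨x, hx⟩) := rfl
  rw [this]
  simp only [insertionCongr, Equiv.trans_apply, Equiv.symm_apply_apply]
  rfl

theorem insertionCongr_innerPos {n k m n' k' m' : ℕ} (hm : n + k = m + 1)
    (hm' : n' + k' = m' + 1) (i : Fin n) (σ : Fin n ≃ Fin n') (τ : Fin k ≃ Fin k') (y : Fin k) :
    insertionCongr hm hm' i σ τ (innerPos hm i y) = innerPos hm' (σ i) (τ y) := by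
  have : innerPos hm i y = insertionEquiv hm i (Sum.inr y) := rfl
  rw [this]
  simp only [insertionCongr, Equiv.trans_apply, Equiv.symm_apply_apply]
  rfl

variable {K : Type u} [Field K]

theorem DGOperad.comp_act_act (O : DGOperad.{u, v} K) {n k m n' k' m' : ℕ} {p q d : ℤ}
    (i : Fin n) (hm : n + k = m + 1) (hm' : n' + k' = m' + 1) (hd : p + q = d)
    (σ : Fin n ≃ Fin n') (τ : Fin k ≃ Fin k') (a : O.obj n p) (b : O.obj k q) :
    O.comp (σ i) hm' hd (O.act σ a) (O.act τ b) =
      O.act (insertionCongr hm hm' i σ τ) (O.comp i hm hd a b) :=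
  O.comp_act i hm hm' hd σ τ _ a b (fun x hx => insertionCongr_outerPos hm hm' i σ τ x hx)
    (fun y => insertionCongr_innerPos hm hm' i σ τ y)

theorem DGOperad.comp_act_left (O : DGOperad.{u, v} K) {n k m n' m' : ℕ} {p q d : ℤ}
    (i : Fin n) (i' : Fin n') (hm : n + k = m + 1) (hm' : n' + k = m' + 1) (hd : p + q = d)
    (σ : Fin n ≃ Fin n') (hi : σ i = i') (ρ : Fin m ≃ Fin m') (a : O.obj n p) (b : O.obj k q)
    (h1 : ∀ (x : Fin n) (hx : x ≠ i),
      ρ (outerPos hm i x hx) = outerPos hm' i' (σ x) (hi ▸ σ.injective.ne hx))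
    (h2 : ∀ y : Fin k, ρ (innerPos hm i y) = innerPos hm' i' y) :
    O.comp i' hm' hd (O.act σ a) b = O.act ρ (O.comp i hm hd a b) := by
  subst hi
  have h := O.comp_act i hm hm' hd σ (Equiv.refl _) ρ a b h1 h2
  rwa [O.act_refl] at h

theorem DGOperad.comp_act_right (O : DGOperad.{u, v} K) {n k m k' m' : ℕ} {p q d : ℤ}
    (i : Fin n) (hm : n + k = m + 1) (hm' : n + k' = m' + 1) (hd : p + q = d)
    (τ : Fin k ≃ Fin k') (ρ : Fin m ≃ Fin m') (a : O.obj n p) (b : O.obj k q)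
    (h1 : ∀ (x : Fin n) (hx : x ≠ i), ρ (outerPos hm i x hx) = outerPos hm' i x hx)
    (h2 : ∀ y : Fin k, ρ (innerPos hm i y) = innerPos hm' i (τ y)) :
    O.comp i hm' hd a (O.act τ b) = O.act ρ (O.comp i hm hd a b) := by
  have h := O.comp_act i hm hm' hd (Equiv.refl _) τ ρ a b h1 h2
  rwa [O.act_refl] at h

end positions

/-! ### Operations for which the bracket is a derivation -/

section commutator

variable {K : Type u} [Field K] (O : DGOperad.{u, v} K) (b : O.obj 2 (-1))

/-- The result of substituting `{a₀, a_x}` for the input `a_x` of `f`, where `a₀` is a new input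
that precedes those of `f`. -/
def bracketAt {n : ℕ} {p : ℤ} (x : Fin n) (f : O.obj n p) : O.obj (n + 1) (p - 1) :=
  O.act (Fin.cycleRange x.castSucc) (O.comp x (by omega) (by omega) f b)

/-- The bracket with `f` is the sum of the brackets with the single inputs of `f`. -/
def IsDerivationOn {n : ℕ} {p : ℤ} (f : O.obj n p) : Prop :=
  O.comp (m := n + 1) (d := p - 1) (1 : Fin 2) (by omega) (by omega) b f =
    sgn K p • ∑ x, bracketAt O b x f

theorem cycleRange_outerPos {n : ℕ} (x z : Fin n) (hz : z ≠ x) (hm : n + 2 = n + 1 + 1) :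
    Fin.cycleRange x.castSucc (outerPos hm x z hz) = z.succ := by
  have h : (z : ℕ) ≠ x := fun h => hz (Fin.ext h)
  ext
  rw [val_cycleRange, val_outerPos]
  simp only [Fin.val_castSucc, Fin.val_succ]
  grind

theorem cycleRange_innerPos_zero {n : ℕ} (x : Fin n) (hm : n + 2 = n + 1 + 1) :
    Fin.cycleRange x.castSucc (innerPos hm x 0) = 0 := by
  ext
  rw [val_cycleRange, val_innerPos]
  simp

theorem cycleRange_innerPos_one {n : ℕ} (x : Fin n) (hm : n + 2 = n + 1 + 1) :
    Fin.cycleRange x.castSucc (innerPos hm x 1) = x.succ := by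
  ext
  rw [val_cycleRange, val_innerPos]
  simp

/-- Extension of a bijection by a fixed first element. -/
def succEquiv {m n : ℕ} (σ : Fin m ≃ Fin n) : Fin (m + 1) ≃ Fin (n + 1) :=
  ((finSuccEquiv m).trans σ.optionCongr).trans (finSuccEquiv n).symm

@[simp] theorem succEquiv_zero {m n : ℕ} (σ : Fin m ≃ Fin n) : succEquiv σ 0 = 0 := by
  simp [succEquiv]

@[simp] theorem succEquiv_succ {m n : ℕ} (σ : Fin m ≃ Fin n) (x : Fin m) :
    succEquiv σ x.succ = (σ x).succ := by
  simp [succEquiv]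

variable {O b}

theorem bracketAt_act {m n : ℕ} {p : ℤ} (σ : Fin m ≃ Fin n) (x : Fin m) (f : O.obj m p) :
    bracketAt O b (σ x) (O.act σ f) = O.act (succEquiv σ) (bracketAt O b x f) := by
  unfold bracketAt
  rw [O.comp_act_left x (σ x) (by omega) (by omega) (by omega) σ rfl
    (((Fin.cycleRange x.castSucc).trans (succEquiv σ)).trans (Fin.cycleRange (σ x).castSucc).symm),
    ← O.act_trans, ← O.act_trans]
  · congr 1
    rw [Equiv.trans_assoc, Equiv.symm_trans_self, Equiv.trans_refl]
  · intro z hz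
    rw [Equiv.trans_apply, Equiv.trans_apply, Equiv.symm_apply_eq, cycleRange_outerPos,
      cycleRange_outerPos, succEquiv_succ]
  · intro y
    rw [Equiv.trans_apply, Equiv.trans_apply, Equiv.symm_apply_eq]
    fin_cases y
    · simp [cycleRange_innerPos_zero]
    · simp [cycleRange_innerPos_one]

theorem IsDerivationOn.act {m n : ℕ} {p : ℤ} {f : O.obj m p} (h : IsDerivationOn O b f)
    (σ : Fin m ≃ Fin n) : IsDerivationOn O b (O.act σ f) := by
  unfold IsDerivationOn at h ⊢
  rw [O.comp_act_right (m := m + 1) (1 : Fin 2) (by omega) (by omega) (by omega) σ (succEquiv σ),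
    h, map_smul, map_sum, ← σ.sum_comp]
  · simp_rw [bracketAt_act]
  · intro x hx
    obtain rfl : x = 0 := by omega
    have h1 : outerPos (show 2 + m = m + 1 + 1 by omega) 1 0 hx = 0 := by
      ext; simp [val_outerPos]
    rw [h1, succEquiv_zero]
    ext; simp [val_outerPos]
  · intro y
    have h1 : innerPos (show 2 + m = m + 1 + 1 by omega) 1 y = y.succ := by
      ext; simp [val_innerPos]; omega
    rw [h1, succEquiv_succ]
    ext; simp [val_innerPos]; omega

theorem IsDerivationOn.zero {n : ℕ} {p : ℤ} : IsDerivationOn O b (0 : O.obj n p) := by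
  simp [IsDerivationOn, bracketAt]

theorem IsDerivationOn.add {n : ℕ} {p : ℤ} {f g : O.obj n p} (hf : IsDerivationOn O b f)
    (hg : IsDerivationOn O b g) : IsDerivationOn O b (f + g) := by
  unfold IsDerivationOn bracketAt at *
  simp [hf, hg, Finset.sum_add_distrib]

theorem IsDerivationOn.smul {n : ℕ} {p : ℤ} {f : O.obj n p} (hf : IsDerivationOn O b f) (c : K) :
    IsDerivationOn O b (c • f) := by
  unfold IsDerivationOn bracketAt at *
  simp only [map_smul, LinearMap.smul_apply, hf, ← Finset.smul_sum]
  rw [smul_comm]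

theorem IsDerivationOn.cast {m n : ℕ} {p q : ℤ} {f : O.obj m p} (hf : IsDerivationOn O b f)
    (h : m = n) (h' : p = q) : IsDerivationOn O b (O.cast h h' f) := by
  subst h; subst h'; exact hf

/-- The bracket with an input of `f` commutes with the insertion of `g` in another input, up to the
sign for interchanging the bracket with `g`. -/
theorem bracketAt_outerPos {n k m : ℕ} {p q d : ℤ} (i x : Fin n) (hx : x ≠ i)
    (hm : n + k = m + 1) (hd : p + q = d) (f : O.obj n p) (g : O.obj k q) :
    bracketAt O b (outerPos hm i x hx) (O.comp i hm hd f g) =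
      sgn K q • O.comp i.succ (by omega) (by omega) (bracketAt O b x f) g := by
  have hx' : (x : ℕ) ≠ i := fun h => hx (Fin.ext h)
  unfold bracketAt
  rw [O.comp_act_left (m := m + 1)
      (outerPos (show n + 2 = n + 1 + 1 by omega) x i hx.symm) i.succ (by omega) (by omega)
    (by omega) _ (cycleRange_outerPos x i hx.symm (by omega))
    (Fin.cycleRange (outerPos hm i x hx).castSucc), ← map_smul]
  · congr 1
    rcases lt_or_gt_of_ne hx with h | h
    · have := O.comp_comm x i (outerPos (show n + 2 = n + 1 + 1 by omega) x i hx.symm)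
          (outerPos hm i x hx)
        (by omega) (by omega : n + 1 + k = m + 1 + 1) hm (by omega : m + 2 = m + 1 + 1)
        (rfl : p + (-1) = p + -1) (by omega : p + -1 + q = d - 1) hd (by omega) f b g h
        (by rw [val_outerPos, if_neg (by rw [Fin.lt_def] at h; omega)]; omega)
        (by rw [val_outerPos, if_pos (by rw [Fin.lt_def] at h; omega)])
      have e : O.comp (outerPos (show n + 2 = n + 1 + 1 by omega) x i hx.symm)
          (by omega : n + 1 + k = m + 1 + 1)
        (by omega : p - 1 + q = d - 1) (O.comp x (by omega) (by omega) f b) g = _ := this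
      rw [e, smul_smul, ← sgn_add]
      rw [sgn_of_even K (by ring_nf; simp), one_smul]
    · have := O.comp_comm i x (outerPos hm i x hx)
          (outerPos (show n + 2 = n + 1 + 1 by omega) x i hx.symm)
        hm (by omega : m + 2 = m + 1 + 1) (by omega) (by omega : n + 1 + k = m + 1 + 1)
        hd (by omega : d + -1 = d - 1) (rfl : p + (-1) = p + -1) (by omega : p + -1 + q = d - 1)
        f g b h
        (by rw [val_outerPos, if_neg (by rw [Fin.lt_def] at h; omega)]; omega)
        (by rw [val_outerPos, if_pos (by rw [Fin.lt_def] at h; omega)])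
      rw [this, show q * -1 = -q by ring, sgn_neg]
  · intro z hz
    rcases outerPos_or_innerPos (by omega : n + 2 = n + 1 + 1) x z with ⟨y, hy, rfl⟩ | ⟨y, rfl⟩
    · have hyi : (y : ℕ) ≠ i := fun h => hz (by congr 1; exact Fin.ext h)
      have hyx : (y : ℕ) ≠ x := fun h => hy (Fin.ext h)
      simp only [cycleRange_outerPos]
      ext
      simp only [val_cycleRange, val_outerPos, Fin.val_castSucc, Fin.val_succ]
      grind
    · have hy := y.2
      ext
      simp only [val_cycleRange, val_outerPos, val_innerPos, Fin.val_castSucc, Fin.val_succ]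
      grind
  · intro y
    have hy := y.2
    ext
    simp only [val_cycleRange, val_outerPos, val_innerPos, Fin.val_castSucc, Fin.val_succ]
    grind

/-- The bracket with an input of `g` in `f ∘_i g` is the insertion of a bracket with an input of
`g`; the cycle moves the new input to the front. -/
theorem bracketAt_innerPos {n k m : ℕ} {p q d : ℤ} (i : Fin n) (y : Fin k)
    (hm : n + k = m + 1) (hd : p + q = d) (f : O.obj n p) (g : O.obj k q) :
    bracketAt O b (innerPos hm i y) (O.comp i hm hd f g) =
      O.act (Fin.cycleRange ⟨i, by have := i.2; omega⟩)
        (O.comp i (by omega : n + (k + 1) = m + 1 + 1) (by omega : p + (q - 1) = d - 1) f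
          (bracketAt O b y g)) := by
  have hi := i.2
  have hy := y.2
  unfold bracketAt
  have h1 := O.comp_assoc i y (innerPos hm i y) hm (by omega : m + 2 = m + 1 + 1)
    (by omega : k + 2 = k + 1 + 1) (by omega : n + (k + 1) = m + 1 + 1) hd
    (by omega : d + -1 = d - 1) (by omega : q + -1 = q - 1) (by omega : p + (q - 1) = d - 1)
    f g b rfl
  rw [← h1, O.comp_act_right (m := m + 1) i (by omega) (by omega) (by omega)
    (Fin.cycleRange y.castSucc)
    ((Fin.cycleRange (innerPos hm i y).castSucc).trans
      (Fin.cycleRange ⟨i, by omega⟩).symm), ← O.act_trans]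
  · congr 1
    rw [Equiv.trans_assoc, Equiv.symm_trans_self, Equiv.trans_refl]
  · intro x hx
    have hx' : (x : ℕ) ≠ i := fun h => hx (Fin.ext h)
    rw [Equiv.trans_apply, Equiv.symm_apply_eq]
    ext
    simp only [val_cycleRange, val_outerPos, val_innerPos, Fin.val_castSucc]
    grind
  · intro t
    rw [Equiv.trans_apply, Equiv.symm_apply_eq]
    ext
    simp only [val_cycleRange, val_innerPos, Fin.val_castSucc]
    grind

/-- The property is inherited by composites: the bracket with `f ∘_i g` is the sum of the brackets
with the inputs of `f` other than `i`, inserted by `g`, and of `f ∘_i {a₀, g}`. -/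
theorem IsDerivationOn.comp {n k m : ℕ} {p q d : ℤ} (i : Fin n)
    (hm : n + k = m + 1) (hd : p + q = d) {f : O.obj n p} {g : O.obj k q}
    (hf : IsDerivationOn O b f) (hg : IsDerivationOn O b g) :
    IsDerivationOn O b (O.comp i hm hd f g) := by
  have hi := i.2
  have hg' := hg
  unfold IsDerivationOn at hf hg ⊢
  have h1 := O.comp_assoc (m := m + 1) (1 : Fin 2) i i.succ (by omega : 2 + n = n + 1 + 1)
    (by omega : n + 1 + k = m + 1 + 1) hm (by omega : 2 + m = m + 1 + 1)
    (by omega : -1 + p = p - 1) (by omega : p - 1 + q = d - 1) hd (by omega : -1 + d = d - 1)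
    b f g (by simp; omega)
  -- The summand of index `i` is `f ∘_i {a₀, g}`, to which the hypothesis on `g` applies.
  have h2 : O.comp (m := m + 1) (d := d - 1) i.succ (by omega) (by omega) (bracketAt O b i f) g =
      sgn K q • ∑ y, bracketAt O b (innerPos hm i y) (O.comp i hm hd f g) := by
    have h3 := O.comp_assoc (m := m + 1) i (1 : Fin 2) ⟨i + 1, by omega⟩
      (by omega : n + 2 = n + 1 + 1) (by omega : n + 1 + k = m + 1 + 1)
      (by omega : 2 + k = k + 1 + 1) (by omega : n + (k + 1) = m + 1 + 1)
      (by omega : p + -1 = p - 1) (by omega : p - 1 + q = d - 1) (by omega : -1 + q = q - 1)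
      (by omega : p + (q - 1) = d - 1) f b g (by simp)
    rw [hg, map_smul, map_sum] at h3
    simp_rw [bracketAt_innerPos]
    rw [← map_sum, ← map_smul, h3]
    conv_lhs => unfold bracketAt
    rw [O.comp_act_left (m := m + 1) ⟨i + 1, by omega⟩ i.succ (by omega) (by omega) (by omega) _
      (by ext; simp [val_cycleRange]) (Fin.cycleRange ⟨i, by omega⟩)]
    · intro z hz
      have hz' : (z : ℕ) ≠ i + 1 := fun h => hz (Fin.ext h)
      ext
      simp only [val_cycleRange, val_outerPos, Fin.val_castSucc, Fin.val_succ]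
      grind
    · intro y
      ext
      simp only [val_cycleRange, val_innerPos, Fin.val_succ]
      grind
  rw [h1, hf, map_smul, LinearMap.smul_apply, map_sum, LinearMap.sum_apply, sum_insertion hm i,
    show sgn K d = sgn K p * sgn K q by rw [← hd, sgn_add], mul_smul]
  congr 1
  have h4 : ∀ x : {x : Fin n // x ≠ i}, bracketAt O b (outerPos hm i x.1 x.2)
      (O.comp i hm hd f g) = sgn K q • O.comp i.succ (by omega) (by omega)
        (bracketAt O b x.1 f) g := fun x => bracketAt_outerPos i x.1 x.2 hm hd f g
  simp_rw [h4, smul_add]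
  rw [← h2, ← Finset.smul_sum, smul_smul, sgn_mul_self, one_smul,
    ← Fintype.sum_subtype_add_sum_subtype (fun x => x ≠ i)]
  congr 1
  have : Unique {x : Fin n // ¬ x ≠ i} :=
    ⟨⟨⟨i, by simp⟩⟩, fun x => Subtype.ext (by simpa using x.2)⟩
  rw [Fintype.sum_unique]
  have h5 : ((default : {x : Fin n // ¬ x ≠ i}) : Fin n) = i := by
    simpa using (default : {x : Fin n // ¬ x ≠ i}).2
  rw [h5]

end commutator

/-! ### The bracket is a derivation on the whole operad -/

section lieOperad

variable {K : Type u} [Field K]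

theorem presMk_surjective {G : ℕ → ℤ → Type} (R : ∀ n d, Expr K G n d → Expr K G n d → Prop)
    {n : ℕ} {d : ℤ} (X : (presented R).obj n d) : ∃ a, presMk R a = X :=
  Quotient.exists_rep X

/-- Induction over the elements of the operad `ΛLie`. -/
theorem LLie.induction {C : ∀ {n : ℕ} {d : ℤ}, (LLie K).obj n d → Prop}
    (bracket : C (bracket K)) (one : C (LLie K).one)
    (zero : ∀ {n : ℕ} {d : ℤ}, C (0 : (LLie K).obj n d))
    (add : ∀ {n : ℕ} {d : ℤ} (X Y : (LLie K).obj n d), C X → C Y → C (X + Y))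
    (smul : ∀ {n : ℕ} {d : ℤ} (c : K) (X : (LLie K).obj n d), C X → C (c • X))
    (act : ∀ {m n : ℕ} {d : ℤ} (σ : Fin m ≃ Fin n) (X : (LLie K).obj m d), C X →
      C ((LLie K).act σ X))
    (comp : ∀ {n k m : ℕ} {p q d : ℤ} (i : Fin n) (hm : n + k = m + 1) (hd : p + q = d)
      (X : (LLie K).obj n p) (Y : (LLie K).obj k q), C X → C Y → C ((LLie K).comp i hm hd X Y))
    (diff : ∀ {n : ℕ} {p q : ℤ} (h : p + 1 = q) (X : (LLie K).obj n p), C X →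
      C ((LLie K).diff h X))
    {n : ℕ} {d : ℤ} (X : (LLie K).obj n d) : C X := by
  obtain ⟨a, rfl⟩ := presMk_surjective _ X
  induction a with
  | gen g => cases g; exact bracket
  | one => exact one
  | zero => exact zero
  | add a b iha ihb => exact add _ _ iha ihb
  | smul c a ih => exact smul c _ ih
  | act σ a ih => exact act σ _ ih
  | comp i hm hd a b iha ihb => exact comp i hm hd _ _ iha ihb
  | diff h a ih => exact diff h _ ih

theorem diff_one_eq_zero (A : DGOperad.{u, v} K) {q : ℤ} (h : 0 + 1 = q) :
    A.diff h A.one = 0 := by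
  obtain rfl : q = 1 := by omega
  have h1 := A.diff_comp (m := 1) (0 : Fin 1) rfl (by norm_num) h h h (by norm_num) (by norm_num)
    A.one A.one
  have h2 : A.comp (m := 1) (0 : Fin 1) rfl (zero_add 0) A.one A.one = A.one := A.comp_one 0 A.one
  have h3 : A.comp (m := 1) (0 : Fin 1) rfl (by norm_num) (A.diff h A.one) A.one =
    A.diff h A.one := A.comp_one 0 (A.diff h A.one)
  have h4 : A.comp (m := 1) (0 : Fin 1) rfl (by norm_num) A.one (A.diff h A.one) =
    A.diff h A.one := A.one_comp (A.diff h A.one)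
  rw [h2, h3, h4, sgn_zero, one_smul] at h1
  simpa using h1

/-- The differential of `ΛLie` vanishes. -/
theorem LLie.diff_eq_zero {n : ℕ} {p q : ℤ} (h : p + 1 = q) (X : (LLie K).obj n p) :
    (LLie K).diff h X = 0 := by
  suffices H : ∀ q' (h' : p + 1 = q'), (LLie K).diff h' X = 0 from H q h
  refine LLie.induction (C := fun {n p} X => ∀ q' (h' : p + 1 = q'), (LLie K).diff h' X = 0)
    ?_ ?_ ?_ ?_ ?_ ?_ ?_ ?_ X
  · exact fun q' h' => diff_bracket K h'
  · exact fun q' h' => diff_one_eq_zero _ h'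
  · exact fun q' h' => map_zero _
  · intro n d X Y hX hY q' h'
    rw [map_add, hX, hY, add_zero]
  · intro n d c X hX q' h'
    rw [map_smul, hX, smul_zero]
  · intro m n d σ X hX q' h'
    rw [DGOperad.diff_act, hX, map_zero]
  · intro n k m p q d i hm hd X Y hX hY q' h'
    rw [(LLie K).diff_comp i hm hd rfl rfl h' (by omega) (by omega), hX, hY]
    simp
  · intro n p q h X hX q' h'
    exact (LLie K).diff_diff h h' X

end lieOperad

section derivation

variable {K : Type u} [Field K] {O : DGOperad.{u, w} K}
  (i : OperadHom (LLie K).toOperadData O.toOperadData)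

/-- The bracket of an operad under `ΛLie`. -/
def br : O.obj 2 (-1) := i.app 2 (-1) (bracket K)

theorem act_br (σ : Fin 2 ≃ Fin 2) : O.act σ (br i) = br i := by
  rw [br, ← i.app_act, act_bracket]

theorem diff_br {e : ℤ} (h : -1 + 1 = e) : O.diff h (br i) = 0 := by
  rw [br, ← i.app_diff, diff_bracket, map_zero]

theorem bracket_comp_one (A : DGOperad.{u, w} K) (b : A.obj 2 (-1))
    (hb : ∀ σ : Fin 2 ≃ Fin 2, A.act σ b = b) :
    A.comp (m := 3) (d := -2) (1 : Fin 2) (by norm_num) (by norm_num) b b =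
      A.act (finRotate 3) (A.comp (m := 3) (d := -2) (0 : Fin 2) (by norm_num) (by norm_num) b b)
    := by
  have h := A.comp_act (m := 3) (m' := 3) (d := -2) (0 : Fin 2) (by norm_num)
    (by norm_num) (by norm_num) (Equiv.swap 0 1) (Equiv.refl _) (finRotate 3)
    b b (by decide) (by decide)
  rw [hb, hb] at h
  exact h

/-- The Jacobi identity, with the three cyclic relabellings of `{{a₁, a₂}, a₃}`. -/
theorem LLie.jacobi :
    (LLie K).comp (m := 3) (d := -2) (0 : Fin 2) (by norm_num) (by norm_num)
      (bracket K) (bracket K) + ((LLie K).act (finRotate 3) ((LLie K).comp (m := 3) (d := -2)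
        (0 : Fin 2) (by norm_num) (by norm_num) (bracket K) (bracket K)) +
      (LLie K).act ((finRotate 3).trans (finRotate 3)) ((LLie K).comp (m := 3) (d := -2)
        (0 : Fin 2) (by norm_num) (by norm_num) (bracket K) (bracket K))) = 0 :=
  Quotient.sound (ExprRel.of LieRel.jacobi)

theorem isDerivationOn_br : IsDerivationOn O (br i) (br i) := by
  have h0 := congrArg (i.app 3 (-2)) (LLie.jacobi (K := K))
  simp only [map_add, i.app_act, i.app_comp, map_zero] at h0
  change (O.comp (m := 3) (d := -2) (0 : Fin 2) (by norm_num) (by norm_num) (br i) (br i)) +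
    (O.act (finRotate 3) (O.comp (m := 3) (d := -2) (0 : Fin 2) (by norm_num) (by norm_num)
      (br i) (br i)) + O.act ((finRotate 3).trans (finRotate 3)) (O.comp (m := 3) (d := -2)
        (0 : Fin 2) (by norm_num) (by norm_num) (br i) (br i))) = 0 at h0
  unfold IsDerivationOn bracketAt
  rw [Fin.sum_univ_two]
  have h1 := bracket_comp_one O (br i) (act_br i)
  -- The derivation property of the bracket is the Jacobi identity. By the symmetry of the bracket,
  -- the relabellings of `{{a₁, a₂}, a₃}` that occur can be replaced by cyclic ones.
  have e1 : Fin.cycleRange (Fin.castSucc (0 : Fin 2)) = Equiv.refl _ := by decide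
  have e2 : (finRotate 3).trans (Fin.cycleRange (Fin.castSucc (1 : Fin 2))) =
    ((Equiv.swap 0 1 : Fin 3 ≃ Fin 3).trans ((finRotate 3).trans (finRotate 3))) := by decide
  have e3 : O.act (Equiv.swap 0 1 : Fin 3 ≃ Fin 3) (O.comp (m := 3) (d := -2) (0 : Fin 2)
      (by norm_num) (by norm_num) (br i) (br i)) = O.comp (m := 3) (d := -2) (0 : Fin 2)
      (by norm_num) (by norm_num) (br i) (br i) := by
    have h := O.comp_act (m := 3) (m' := 3) (d := -2) (0 : Fin 2) (by norm_num)
      (by norm_num) (by norm_num) (Equiv.refl _) (Equiv.swap 0 1) (Equiv.swap (0 : Fin 3) 1)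
      (br i) (br i) (by decide) (by decide)
    rw [act_br, act_br] at h
    exact h.symm
  change O.comp (m := 3) (d := -2) (1 : Fin 2) (by norm_num) (by norm_num) (br i) (br i) =
    sgn K (-1) • (O.act (Fin.cycleRange (Fin.castSucc (0 : Fin 2)))
      (O.comp (m := 3) (d := -2) (0 : Fin 2) (by norm_num) (by norm_num) (br i) (br i)) +
      O.act (Fin.cycleRange (Fin.castSucc (1 : Fin 2)))
        (O.comp (m := 3) (d := -2) (1 : Fin 2) (by norm_num) (by norm_num) (br i) (br i)))
  rw [h1, ← O.act_trans, e1, e2, O.act_trans, e3, O.act_refl, sgn_neg, sgn_one]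
  rw [neg_smul, one_smul, eq_neg_iff_add_eq_zero]
  rw [← h0]; abel

theorem isDerivationOn_one : IsDerivationOn O (br i) O.one := by
  unfold IsDerivationOn bracketAt
  have e1 : Fin.cycleRange (Fin.castSucc (0 : Fin 1)) = Equiv.refl _ := by decide
  have h1 : O.comp (m := 2) (d := -1) (1 : Fin 2) rfl rfl (br i) O.one = br i :=
    O.comp_one 1 (br i)
  have h2 : O.comp (m := 2) (d := -1) (0 : Fin 1) rfl rfl O.one (br i) = br i := O.one_comp (br i)
  rw [Fin.sum_univ_one, e1, sgn_zero, one_smul, O.act_refl]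
  exact h1.trans h2.symm

theorem isDerivationOn_app {n : ℕ} {d : ℤ} (X : (LLie K).obj n d) :
    IsDerivationOn O (br i) (i.app n d X) := by
  refine LLie.induction (C := fun {n d} X => IsDerivationOn O (br i) (i.app n d X))
    ?_ ?_ ?_ ?_ ?_ ?_ ?_ ?_ X
  · exact isDerivationOn_br i
  · rw [i.app_one]; exact isDerivationOn_one i
  · intro n d; rw [map_zero]; exact .zero
  · intro n d X Y hX hY; rw [map_add]; exact hX.add hY
  · intro n d c X hX; rw [map_smul]; exact hX.smul c
  · intro m n d σ X hX; rw [i.app_act]; exact hX.act σ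
  · intro n k m p q d s hm hd X Y hX hY; rw [i.app_comp]; exact hX.comp s hm hd hY
  · intro n p q h X hX; rw [LLie.diff_eq_zero, map_zero]; exact .zero

theorem isDerivationOn_fullComp {b : O.obj 2 (-1)} {r : ℕ} {p : ℤ} {a : O.obj r p} {k : Fin r → ℕ}
    {q : Fin r → ℤ} {X : ∀ l, O.obj (k l) (q l)} (ha : IsDerivationOn O b a)
    (hX : ∀ l, IsDerivationOn O b (X l)) : IsDerivationOn O b (fullComp O.toOperadData a X) := by
  have h : ∀ s (hs : s ≤ r), IsDerivationOn O b (insertFirst O.toOperadData a X s hs) := by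
    intro s
    induction s with
    | zero => exact fun hs => ha.cast _ _
    | succ s ih => exact fun hs => (ih (by omega)).comp _ _ _ (hX _)
  exact (h r le_rfl).cast _ _

variable {i} {P : DGOperad.{u, v} K} {j : OperadHom P.toOperadData O.toOperadData}

/-- An additive predicate that holds for the composites `v(X_1, …, X_r)` holds for all
operations. -/
theorem IsDistributive.induction (h : IsDistributive j i) {n : ℕ} {d : ℤ} {C : O.obj n d → Prop}
    (value : ∀ s : PlSym P.toCollection (LLie K).toCollection n d,
      C (s.value (O := O.toOperadData) j.toHom i.toHom))
    (zero : C 0) (add : ∀ f g, C f → C g → C (f + g)) (smul : ∀ (c : K) f, C f → C (c • f))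
    (f : O.obj n d) : C f := by
  obtain ⟨Φ, hΦ⟩ := h.plethysm n d
  obtain ⟨x, rfl⟩ := Φ.surjective f
  obtain ⟨y, rfl⟩ := Submodule.Quotient.mk_surjective _ x
  induction y using Finsupp.induction_linear with
  | zero => rw [Submodule.Quotient.mk_zero, map_zero]; exact zero
  | add y y' hy hy' => rw [Submodule.Quotient.mk_add, map_add]; exact add _ _ hy hy'
  | single s c =>
    rw [← mul_one c, ← smul_eq_mul, ← Finsupp.smul_single, Submodule.Quotient.mk_smul, map_smul]
    refine smul c _ ?_
    have := hΦ s
    rw [plMk] at this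
    rw [this]
    exact value s

theorem IsDistributive.isDerivationOn (h : IsDistributive j i) {n : ℕ} {d : ℤ} (f : O.obj n d) :
    IsDerivationOn O (br i) f := by
  refine h.induction (C := IsDerivationOn O (br i)) ?_ .zero (fun f g => .add)
      (fun c f hf => hf.smul c) f
  intro s
  refine IsDerivationOn.act (IsDerivationOn.cast ?_ _ _) _
  exact isDerivationOn_fullComp (h.law _ _ _) fun l => isDerivationOn_app i _

end derivation

/-! ### The differential of the twisted operad -/

section symmetrization

variable {K : Type u} [Field K]

/-- The permutations of `Fin N` that fix all elements but the first `r`. -/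
def fixing (r N : ℕ) : Finset (Fin N ≃ Fin N) := Finset.univ.filter (FixesFrom r)

@[simp] theorem mem_fixing {r N : ℕ} {σ : Fin N ≃ Fin N} : σ ∈ fixing r N ↔ FixesFrom r σ := by
  simp [fixing]

theorem FixesFrom.trans {r N : ℕ} {σ τ : Fin N ≃ Fin N} (hσ : FixesFrom r σ)
    (hτ : FixesFrom r τ) : FixesFrom r (σ.trans τ) := fun x hx => by
  rw [Equiv.trans_apply, hσ x hx, hτ x hx]

theorem FixesFrom.symm {r N : ℕ} {σ : Fin N ≃ Fin N} (hσ : FixesFrom r σ) :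
    FixesFrom r σ.symm := fun x hx => by rw [Equiv.symm_apply_eq, hσ x hx]

theorem sum_fixing_trans {r N : ℕ} {M : Type*} [AddCommMonoid M] (F : (Fin N ≃ Fin N) → M)
    {τ : Fin N ≃ Fin N} (hτ : FixesFrom r τ) :
    ∑ σ ∈ fixing r N, F (τ.trans σ) = ∑ σ ∈ fixing r N, F σ := by
  refine Finset.sum_bij' (fun σ _ => τ.trans σ) (fun σ _ => τ.symm.trans σ) ?_ ?_ ?_ ?_ ?_
  · intro σ hσ; exact mem_fixing.2 (hτ.trans (mem_fixing.1 hσ))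
  · intro σ hσ; exact mem_fixing.2 (hτ.symm.trans (mem_fixing.1 hσ))
  · intro σ _; ext; simp
  · intro σ _; ext; simp
  · intro σ _; rfl

theorem sum_fixing_trans' {r N : ℕ} {M : Type*} [AddCommMonoid M] (F : (Fin N ≃ Fin N) → M)
    {τ : Fin N ≃ Fin N} (hτ : FixesFrom r τ) :
    ∑ σ ∈ fixing r N, F (σ.trans τ) = ∑ σ ∈ fixing r N, F σ := by
  refine Finset.sum_bij' (fun σ _ => σ.trans τ) (fun σ _ => σ.trans τ.symm) ?_ ?_ ?_ ?_ ?_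
  · intro σ hσ; exact mem_fixing.2 ((mem_fixing.1 hσ).trans hτ)
  · intro σ hσ; exact mem_fixing.2 ((mem_fixing.1 hσ).trans hτ.symm)
  · intro σ _; ext; simp
  · intro σ _; ext; simp
  · intro σ _; rfl

/-- The sum of the relabellings of an operation by the permutations of its first `r` inputs. -/
def symm (A : Collection.{u, v} K) (r : ℕ) {N : ℕ} {d : ℤ} : A.obj N d →ₗ[K] A.obj N d :=
  ∑ σ ∈ fixing r N, A.act σ

theorem symm_apply (A : Collection.{u, v} K) (r : ℕ) {N : ℕ} {d : ℤ} (f : A.obj N d) :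
    symm A r f = ∑ σ ∈ fixing r N, A.act σ f := by
  simp [symm]

theorem symm_act (A : Collection.{u, v} K) {r N : ℕ} {d : ℤ} (f : A.obj N d)
    {τ : Fin N ≃ Fin N} (hτ : FixesFrom r τ) : symm A r (A.act τ f) = symm A r f := by
  simp_rw [symm_apply, ← A.act_trans]
  exact sum_fixing_trans (fun σ => A.act σ f) hτ

theorem act_symm (A : Collection.{u, v} K) {r N : ℕ} {d : ℤ} (f : A.obj N d)
    {τ : Fin N ≃ Fin N} (hτ : FixesFrom r τ) : A.act τ (symm A r f) = symm A r f := by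
  simp_rw [symm_apply, map_sum, ← A.act_trans]
  exact sum_fixing_trans' (fun σ => A.act σ f) hτ

/-- The operations that are invariant under the permutations of their first `r` inputs. -/
def IsInv (A : Collection.{u, v} K) (r : ℕ) {N : ℕ} {d : ℤ} (f : A.obj N d) : Prop :=
  ∀ τ : Fin N ≃ Fin N, FixesFrom r τ → A.act τ f = f

theorem isInv_symm (A : Collection.{u, v} K) (r : ℕ) {N : ℕ} {d : ℤ} (f : A.obj N d) :
    IsInv A r (symm A r f) := fun _ hτ => act_symm A f hτ

theorem IsInv.symm_eq {A : Collection.{u, v} K} {r N : ℕ} {d : ℤ} {f : A.obj N d}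
    (hf : IsInv A r f) : symm A r f = ((fixing r N).card : K) • f := by
  rw [symm_apply, Finset.sum_congr rfl fun σ hσ => hf σ (mem_fixing.1 hσ), Finset.sum_const,
    Nat.cast_smul_eq_nsmul]

theorem fixing_nonempty (r N : ℕ) : (fixing r N).Nonempty :=
  ⟨Equiv.refl _, mem_fixing.2 fun _ _ => rfl⟩

end symmetrization

section differential

variable {K : Type u} [Field K] {O : DGOperad.{u, w} K}

/-- All ways to substitute a bracket for one of the first inputs of `f` agree up to a permutation
of the first inputs. -/
theorem symm_comp_eq {N M t : ℕ} {d e : ℤ} {f : O.obj N d} (hf : IsInv O.toCollection t f)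
    (b : O.obj 2 (-1)) (hM : N + 2 = M + 1) (he : d + -1 = e) (x y : Fin N) (hx : (x : ℕ) < t)
    (hy : (y : ℕ) < t) :
    symm O.toCollection (t + 1) (O.comp x hM he f b) =
      symm O.toCollection (t + 1) (O.comp y hM he f b) := by
  have hτ : FixesFrom t (Equiv.swap y x) := fun z hz =>
    Equiv.swap_apply_of_ne_of_ne (fun h => by subst h; omega) (fun h => by subst h; omega)
  have h1 := O.comp_act_act y hM hM he (Equiv.swap y x) (Equiv.refl (Fin 2)) f b
  rw [O.act_refl, hf _ hτ, Equiv.swap_apply_left] at h1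
  rw [h1, symm_act]
  intro z hz
  have hz' : z = outerPos hM y ⟨z - 1, by have := z.2; omega⟩
      (fun h => by have := congrArg Fin.val h; simp at this; omega) := by
    ext; rw [val_outerPos, if_neg (by simp; omega)]; simp; omega
  rw [hz', insertionCongr_outerPos]
  ext
  rw [val_outerPos, val_outerPos, hτ _ (by simp; omega), Equiv.swap_apply_left]
  simp only [if_neg (show ¬ (z : ℕ) - 1 < y by omega), if_neg (show ¬ (z : ℕ) - 1 < x by omega)]

theorem twAt_twComp {n k m : ℕ} {p q d : ℤ} (i : Fin n) (hm : n + k = m + 1) (hd : p + q = d)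
    (f : (Tw O.toCollection).obj n p) (g : (Tw O.toCollection).obj k q) (r : ℕ) :
    twAt r (twComp O i hm hd f g) = ∑ a : Fin (r + 1),
      twCompTerm O i hm hd a (r - a) r (by omega) (twAt a f) (twAt (r - a) g) := rfl

variable {b : O.obj 2 (-1)}

theorem IsDerivationOn.comp_eq {n m : ℕ} {p d : ℤ} {f : O.obj n p} (h : IsDerivationOn O b f)
    (hm : n + 1 = m) (hd : p - 1 = d) :
    O.comp (m := m) (d := d) (1 : Fin 2) (by omega) (by omega) b f =
      sgn K p • ∑ x : Fin n, O.act (Fin.cycleRange ⟨x, by have := x.2; omega⟩)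
        (O.comp x (by omega) (by omega) f b) := by
  subst hm; subst hd; exact h

variable (i : OperadHom (LLie K).toOperadData O.toOperadData)

theorem mc_of_ne {n : ℕ} {d : ℤ} (hd : d = 3 - 2 * n) (h : n ≠ 2) :
    mc ((toLie K).trans i) n d hd = 0 := by
  unfold mc
  split_ifs with hn
  · have : (toLie K).app n d (infBracket K hn hd) = 0 := toLieVal_of_ne K hn hd h
    change i.app n d ((toLie K).app n d (infBracket K hn hd)) = 0
    rw [this, map_zero]
  · rfl

theorem mc_two {d : ℤ} (hd : d = 3 - 2 * (2 : ℕ)) :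
    mc ((toLie K).trans i) 2 d hd = O.cast rfl (by omega) (br i) := by
  obtain rfl : d = -1 := by omega
  unfold mc
  rw [dif_pos le_rfl]
  change i.app 2 (-1) ((toLie K).app 2 (-1) (infBracket K le_rfl hd)) = br i
  rw [show (toLie K).app 2 (-1) (infBracket K le_rfl hd) = bracket K from toLieVal_two K le_rfl hd]
  rfl

theorem mc_of_eq {n : ℕ} {d : ℤ} (hd : d = 3 - 2 * n) (h : 2 = n) :
    mc ((toLie K).trans i) n d hd = O.cast h (by omega) (br i) := by
  subst h; exact mc_two i hd

variable {n : ℕ} {d e : ℤ}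

/-- Only the component of index `1` of `κ` is nonzero. -/
theorem twCompTerm_mc_left_of_ne (h : d + 1 = e) (f : (Tw O.toCollection).obj n d) (a c r : ℕ)
    (hr : a + c = r) (ha : a ≠ 1) :
    twCompTerm O (0 : Fin 1) (Nat.add_comm 1 n) (by omega : 1 + d = e) a c r hr
      (twAt a (twMC ((toLie K).trans i) 1 1 (by norm_num))) (twAt c f) = 0 := by
  have : twAt a (twMC ((toLie K).trans i) 1 1 (by norm_num)) = 0 := mc_of_ne i _ (by omega)
  rw [this, map_zero, LinearMap.zero_apply]

/-- The composite `κ ∘₁ f` is the bracket with `f`. The sum over shuffles is the sum over all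
permutations of the first inputs, divided by the number of permutations of the first `t` inputs of
`f`. -/
theorem twCompTerm_mc_left (h : d + 1 = e) (f : (Tw O.toCollection).obj n d) (t r : ℕ)
    (hr : 1 + t = r) :
    twCompTerm O (0 : Fin 1) (Nat.add_comm 1 n) (by omega : 1 + d = e) 1 t r hr
      (twAt 1 (twMC ((toLie K).trans i) 1 1 (by norm_num))) (twAt t f) =
    (t.factorial : K)⁻¹ • symm O.toCollection r
      (O.comp (m := r + n) (1 : Fin 2) (by omega) (by omega) (br i) (twAt t f)) := by
  have h1 : twAt 1 (twMC ((toLie K).trans i) 1 1 (by norm_num)) =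
    O.cast rfl (by norm_num) (br i) := mc_of_eq i _ rfl
  rw [h1, symm_apply]
  simp only [twCompTerm, LinearMap.smul_apply, LinearMap.sum_apply, LinearMap.compr₂_apply,
    Nat.factorial_one, one_mul]
  congr 1
  have h2 : twRelabel (Nat.add_comm 1 n) (0 : Fin 1) 1 t r (by omega) = fixing r (r + n) := by
    ext σ
    simp only [twRelabel, Finset.mem_filter, Finset.mem_univ, true_and, mem_fixing]
    constructor
    · rintro ⟨-, h3⟩ x hx
      have := h3 ⟨x - r, by omega⟩
      have e1 : innerPos (by omega : (1 + 1) + (t + n) = r + n + 1) (Fin.natAdd 1 (0 : Fin 1))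
          (Fin.natAdd t ⟨x - r, by omega⟩) =
        x := by ext; simp [val_innerPos]; omega
      rw [e1] at this
      rw [this]; ext; simp only [Fin.val_natAdd, val_innerPos, Fin.val_zero]; omega
    · refine fun h3 => ⟨fun x hx => absurd (Subsingleton.elim _ _) hx, fun y => ?_⟩
      rw [h3 _ (by simp [val_innerPos]; omega)]
      ext; simp [val_innerPos]; omega
  rw [h2]
  refine Finset.sum_congr rfl fun σ _ => ?_
  rw [O.comp_cast_left]
  rfl

theorem twCompTerm_mc_right_of_ne (h : d + 1 = e) (f : (Tw O.toCollection).obj n d) (y : Fin n)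
    (a c r : ℕ) (hr : a + c = r) (hc : c ≠ 1) :
    twCompTerm O y rfl h a c r hr (twAt a f)
      (twAt c (twMC ((toLie K).trans i) 1 1 (by norm_num))) = 0 := by
  have : twAt c (twMC ((toLie K).trans i) 1 1 (by norm_num)) = 0 := mc_of_ne i _ (by omega)
  rw [this, map_zero]

/-- The composite `f ∘_y κ` is the bracket with the input `y` among the last inputs of `f`. The
cycle moves the additional input of the bracket to the front. -/
theorem twCompTerm_mc_right (h : d + 1 = e) (f : (Tw O.toCollection).obj n d) (y : Fin n)
    (t r : ℕ) (hr : t + 1 = r) :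
    twCompTerm O y rfl h t 1 r hr (twAt t f)
      (twAt 1 (twMC ((toLie K).trans i) 1 1 (by norm_num))) =
    (t.factorial : K)⁻¹ • symm O.toCollection r (O.act (Fin.cycleRange ⟨t + y, by omega⟩)
      (O.comp (m := r + n) (Fin.natAdd t y) (by omega) (by omega) (twAt t f) (br i))) := by
  have h1 : twAt 1 (twMC ((toLie K).trans i) 1 1 (by norm_num)) =
    O.cast rfl (by norm_num) (br i) := mc_of_eq i _ rfl
  have hy := y.2
  rw [h1, symm_apply]
  simp only [twCompTerm, LinearMap.smul_apply, LinearMap.sum_apply, LinearMap.compr₂_apply,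
    Nat.factorial_one, mul_one, ← O.act_trans]
  congr 1
  have e1 : ∀ (x : Fin n) (hx : Fin.natAdd t x ≠ Fin.natAdd t y),
      Fin.cycleRange (⟨t + y, by omega⟩ : Fin (r + n))
      (outerPos (by omega : t + n + (1 + 1) = r + n + 1) (Fin.natAdd t y) (Fin.natAdd t x) hx) =
      Fin.natAdd r x := by
    intro x hx
    have : (x : ℕ) ≠ y := fun h => hx (by rw [Fin.ext h])
    ext
    simp only [val_cycleRange, val_outerPos, Fin.val_natAdd]
    grind
  have e2 : ∀ z : Fin 1, Fin.cycleRange (⟨t + y, by omega⟩ : Fin (r + n))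
      (innerPos (by omega : t + n + (1 + 1) = r + n + 1) (Fin.natAdd t y) (Fin.natAdd 1 z)) =
      Fin.natAdd r y := by
    intro z
    ext
    simp only [val_cycleRange, val_innerPos, Fin.val_natAdd]
    grind
  have e3 : ∀ (x : Fin n) (hx : x ≠ y), outerPos (rfl : n + 1 = n + 1) y x hx = x := by
    intro x hx; ext; simp [val_outerPos]
  have e4 : ∀ z : Fin 1, innerPos (rfl : n + 1 = n + 1) y z = y := by
    intro x; ext; simp [val_innerPos]
  -- Precomposition with the cycle identifies the permutations of the first `r` inputs with the
  -- relabellings in the composite.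
  refine Finset.sum_bij' (fun σ _ => (Fin.cycleRange ⟨t + y, by omega⟩).symm.trans σ)
    (fun σ _ => (Fin.cycleRange ⟨t + y, by omega⟩).trans σ) ?_ ?_ ?_ ?_ ?_
  · intro σ hσ
    simp only [twRelabel, Finset.mem_filter, Finset.mem_univ, true_and, mem_fixing] at hσ ⊢
    intro x hx
    obtain ⟨x', rfl⟩ : ∃ x' : Fin n, x = Fin.natAdd r x' :=
      ⟨⟨x - r, by omega⟩, Fin.ext (by simp; omega)⟩
    rw [Equiv.trans_apply]
    by_cases hxy : x' = y
    · subst hxy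
      rw [← e2 0, Equiv.symm_apply_apply, hσ.2, e2 0, e4]
    · rw [← e1 x' (by simpa using hxy), Equiv.symm_apply_apply, hσ.1 _ hxy, e1, e3]
  · intro σ hσ
    simp only [twRelabel, Finset.mem_filter, Finset.mem_univ, true_and, mem_fixing,
      Equiv.trans_apply] at hσ ⊢
    refine ⟨fun x hx => ?_, fun z => ?_⟩
    · rw [e1, e3, hσ _ (by simp)]
    · rw [e2, e4, hσ _ (by simp)]
  · intro σ _; ext; simp
  · intro σ _; ext; simp
  · intro σ _
    rw [O.comp_cast_right, ← Equiv.trans_assoc, Equiv.self_trans_symm, Equiv.refl_trans]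

variable (hder : ∀ {n : ℕ} {p : ℤ} (f : O.obj n p), IsDerivationOn O (br i) f)

include hder

/-- The part `κ ∘₁ f - (-1)^{|f|} ∑ f ∘_y κ` of the differential: only the brackets with the first
inputs of `f` survive. -/
theorem twAt_commutator (h : d + 1 = e) (f : (Tw O.toCollection).obj n d) (t : ℕ) :
    twAt (t + 1) (twComp O (0 : Fin 1) (Nat.add_comm 1 n) (by omega : 1 + d = e)
        (twMC ((toLie K).trans i) 1 1 (by norm_num)) f -
      sgn K d • ∑ y : Fin n, twComp O y rfl h f (twMC ((toLie K).trans i) 1 1 (by norm_num))) =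
    (sgn K d * (t.factorial : K)⁻¹) • ∑ x : Fin t, symm O.toCollection (t + 1)
      (O.comp (m := t + 1 + n) (Fin.castAdd n x) (by omega) (by omega) (twAt t f) (br i)) := by
  have h1 : twAt (t + 1) (twComp O (0 : Fin 1) (Nat.add_comm 1 n) (by omega : 1 + d = e)
      (twMC ((toLie K).trans i) 1 1 (by norm_num)) f) = (t.factorial : K)⁻¹ •
      symm O.toCollection (t + 1) (O.comp (m := t + 1 + n) (1 : Fin 2) (by omega) (by omega)
        (br i) (twAt t f)) := by
    rw [twAt_twComp, Finset.sum_eq_single_of_mem (⟨1, by omega⟩ : Fin (t + 1 + 1))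
      (Finset.mem_univ _)]
    rotate_left
    · intro a _ ha
      exact twCompTerm_mc_left_of_ne i h f a _ _ _ (fun h => ha (Fin.ext h))
    · have : ∀ s (hs : 1 + s = t + 1), s = t → twCompTerm O (0 : Fin 1) (Nat.add_comm 1 n)
          (by omega : 1 + d = e) 1 s (t + 1) hs
          (twAt 1 (twMC ((toLie K).trans i) 1 1 (by norm_num))) (twAt s f) =
          (t.factorial : K)⁻¹ •
          symm O.toCollection (t + 1) (O.comp (m := t + 1 + n) (1 : Fin 2) (by omega) (by omega)
            (br i) (twAt t f)) := by
        rintro s hs rfl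
        exact twCompTerm_mc_left i h f s _ hs
      exact this _ _ (by simp)
  have h2 : ∀ y : Fin n, twAt (t + 1) (twComp O y rfl h f
      (twMC ((toLie K).trans i) 1 1 (by norm_num))) = (t.factorial : K)⁻¹ •
      symm O.toCollection (t + 1) (O.act (Fin.cycleRange ⟨t + y, by omega⟩)
      (O.comp (m := t + 1 + n) (Fin.natAdd t y) (by omega) (by omega) (twAt t f) (br i))) := by
    intro y
    rw [twAt_twComp, Finset.sum_eq_single_of_mem (⟨t, by omega⟩ : Fin (t + 1 + 1))
      (Finset.mem_univ _)]
    rotate_left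
    · intro a _ ha
      refine twCompTerm_mc_right_of_ne i h f y a _ _ _ (fun h => ha (Fin.ext ?_))
      simp; omega
    · have : ∀ s (hs : t + s = t + 1), s = 1 → twCompTerm O y rfl h t s (t + 1) hs (twAt t f)
          (twAt s (twMC ((toLie K).trans i) 1 1 (by norm_num))) = (t.factorial : K)⁻¹ •
          symm O.toCollection (t + 1) (O.act (Fin.cycleRange ⟨t + y, by omega⟩)
          (O.comp (m := t + 1 + n) (Fin.natAdd t y) (by omega) (by omega) (twAt t f) (br i))) := by
        rintro s hs rfl
        exact twCompTerm_mc_right i h f y t _ hs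
      exact this _ _ (by simp)
  rw [map_sub, map_smul, map_sum, h1]
  simp_rw [h2]
  -- By the derivation property, the bracket with `f` is a sum over the inputs of `f`. The summands
  -- of the last `n` inputs cancel with the composites `f ∘_y κ`.
  rw [(hder (twAt t f)).comp_eq (by omega) (by push_cast; omega), map_smul, map_sum,
    Fin.sum_univ_add,
    sgn_eq_of_even_sub K (show Even (d - 2 * (t : ℤ) - d) by
      rw [sub_sub_cancel_left]; simp), ← Finset.smul_sum, smul_add, smul_add]
  rw [smul_comm (t.factorial : K)⁻¹ (sgn K d), smul_comm (t.factorial : K)⁻¹ (sgn K d)]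
  simp only [Fin.val_natAdd, add_sub_cancel_right, Fin.val_castAdd, mul_smul]
  congr 2
  refine Finset.sum_congr rfl fun x _ => ?_
  -- The cycle only moves inputs among the first `t + 1` ones, which are symmetrized.
  rw [symm_act]
  intro z hz
  have hx := x.2
  ext
  rw [val_cycleRange]
  grind

omit hder in
theorem twAt_zero_commutator (h : d + 1 = e) (f : (Tw O.toCollection).obj n d) :
    twAt 0 (twComp O (0 : Fin 1) (Nat.add_comm 1 n) (by omega : 1 + d = e)
        (twMC ((toLie K).trans i) 1 1 (by norm_num)) f -
      sgn K d • ∑ y : Fin n, twComp O y rfl h f (twMC ((toLie K).trans i) 1 1 (by norm_num))) =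
    0 := by
  have h1 : twAt 0 (twComp O (0 : Fin 1) (Nat.add_comm 1 n) (by omega : 1 + d = e)
      (twMC ((toLie K).trans i) 1 1 (by norm_num)) f) = 0 := by
    rw [twAt_twComp]
    exact Finset.sum_eq_zero fun a _ => twCompTerm_mc_left_of_ne i h f a _ _ _ (by omega)
  have h2 : ∀ y : Fin n, twAt 0 (twComp O y rfl h f
      (twMC ((toLie K).trans i) 1 1 (by norm_num))) = 0 := by
    intro y
    rw [twAt_twComp]
    exact Finset.sum_eq_zero fun a _ => twCompTerm_mc_right_of_ne i h f y a _ _ _ (by omega)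
  rw [map_sub, map_smul, map_sum, h1]
  simp [h2]

omit hder in
theorem twActionTerm_of_ne (h : d + 1 = e) (r p : ℕ) (hpr : p ≤ r) (hp : p ≠ 2)
    (x : O.obj ((r - p + 1) + n) (d - 2 * ((r - p + 1 : ℕ) : ℤ))) :
    twActionTerm ((toLie K).trans i) h r p hpr x = 0 := by
  simp only [twActionTerm, LinearMap.smul_apply, LinearMap.sum_apply, LinearMap.comp_apply,
    LinearMap.flip_apply]
  rw [mc_of_ne i _ hp]
  simp

omit hder in
theorem twActionTerm_two (h : d + 1 = e) (s : ℕ) (f : (Tw O.toCollection).obj n d) :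
    twActionTerm ((toLie K).trans i) h (s + 2) 2 (by omega) (twAt (s + 1) f) =
      ((2 * s.factorial : ℕ) : K)⁻¹ • symm O.toCollection (s + 2)
        (O.comp (m := s + 2 + n) (⟨0, by omega⟩ : Fin (s + 1 + n)) (by omega)
          (by push_cast; omega) (twAt (s + 1) f) (br i)) := by
  rw [symm_apply]
  simp only [twActionTerm, LinearMap.smul_apply, LinearMap.sum_apply, LinearMap.comp_apply,
    LinearMap.flip_apply]
  rw [mc_two]
  congr 1

omit hder in
theorem twAt_twDiff_zero (h : d + 1 = e) (f : (Tw O.toCollection).obj n d) :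
    twAt 0 (twDiff ((toLie K).trans i) h f) = O.diff (by omega) (twAt 0 f) := by
  have h1 := twAt_zero_commutator i h f
  simp only [twDiff, LinearMap.sub_apply, LinearMap.add_apply, LinearMap.smul_apply,
    LinearMap.sum_apply, LinearMap.flip_apply]
  rw [add_sub_assoc, map_add, h1, add_zero]
  change O.diff _ (twAt 0 f) - _ = _
  rw [Finset.sum_eq_zero, smul_zero, sub_zero]
  exact fun p _ => absurd (Finset.mem_Icc.1 p.2) (by omega)

theorem twAt_twDiff_one (h : d + 1 = e) (f : (Tw O.toCollection).obj n d) :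
    twAt 1 (twDiff ((toLie K).trans i) h f) = O.diff (by omega) (twAt 1 f) := by
  have h1 := twAt_commutator i hder h f 0
  simp only [twDiff, LinearMap.sub_apply, LinearMap.add_apply, LinearMap.smul_apply,
    LinearMap.sum_apply, LinearMap.flip_apply]
  rw [add_sub_assoc, map_add]
  refine (congrArg (_ + ·) h1).trans ?_
  change O.diff _ (twAt 1 f) - _ + _ = _
  rw [Finset.sum_eq_zero]
  · simp
  · intro p _
    have := Finset.mem_Icc.1 p.2
    exact twActionTerm_of_ne i h _ _ _ (by omega) _

/-- The differential of `Tw O` is induced by the differential of `O` and the substitution of a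
bracket for one of the first inputs. -/
theorem twAt_twDiff [CharZero K] (h : d + 1 = e) (f : (Tw O.toCollection).obj n d) (s : ℕ) :
    twAt (s + 2) (twDiff ((toLie K).trans i) h f) = O.diff (by omega) (twAt (s + 2) f) +
      (sgn K d * ((2 * s.factorial : ℕ) : K)⁻¹) • symm O.toCollection (s + 2)
        (O.comp (m := s + 2 + n) (⟨0, by omega⟩ : Fin (s + 1 + n)) (by omega)
          (by push_cast; omega) (twAt (s + 1) f) (br i)) := by
  have h1 := twAt_commutator i hder h f (s + 1)
  simp only [twDiff, LinearMap.sub_apply, LinearMap.add_apply, LinearMap.smul_apply,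
    LinearMap.sum_apply, LinearMap.flip_apply]
  rw [add_sub_assoc, map_add]
  refine (congrArg (_ + ·) h1).trans ?_
  change O.diff _ (twAt (s + 2) f) - sgn K d • ∑ p ∈ (Finset.Icc 1 (s + 2)).attach, _ + _ = _
  rw [Finset.sum_eq_single (⟨2, by simp⟩ : {p // p ∈ Finset.Icc 1 (s + 2)})]
  · have h2 := twActionTerm_two i h s f
    change _ - sgn K d • twActionTerm ((toLie K).trans i) h (s + 2) 2 _ (twAt (s + 1) f) + _ = _
    rw [h2]
    have h3 : ∀ x : Fin (s + 1), symm O.toCollection (s + 1 + 1)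
        (O.comp (m := s + 1 + 1 + n) (d := e - 2 * ((s + 2 : ℕ) : ℤ)) (Fin.castAdd n x)
          (by omega) (by push_cast; omega) (twAt (s + 1) f) (br i)) = symm O.toCollection (s + 2)
        (O.comp (m := s + 2 + n) (⟨0, by omega⟩ : Fin (s + 1 + n)) (by omega)
          (by push_cast; omega) (twAt (s + 1) f) (br i)) := fun x =>
      by
      exact symm_comp_eq (act_twAt f (s + 1)) (br i) _ _ _ _ x.2 (Nat.succ_pos s)
    rw [Finset.sum_congr rfl fun x _ => h3 x, Finset.sum_const, Finset.card_univ, Fintype.card_fin,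
      ← Nat.cast_smul_eq_nsmul K, smul_smul, smul_smul, sub_add, ← sub_smul,
      sub_eq_add_neg (O.diff _ _), ← neg_smul]
    congr 2
    have h4 : (s.factorial : K) ≠ 0 := by exact_mod_cast s.factorial_ne_zero
    have h5 : (s : K) + 1 ≠ 0 := by exact_mod_cast s.succ_ne_zero
    -- The coefficient is `(s + 1) / (s + 1)! - 1 / (2 s!) = 1 / (2 s!)`, with the contribution of
    -- the commutator first and that of the action of `φ` second.
    rw [Nat.factorial_succ]
    push_cast
    field_simp
    ring
  · rintro p _ hp
    exact twActionTerm_of_ne i h _ _ _ (fun h => hp (Subtype.ext h)) _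
  · simp

end differential

/-! ### The canonical embedding -/

section embedding

variable {K : Type u} [Field K]

/-- The elements of `Tw A` with a single nonzero component, of index `0`. -/
def embApp (A : Collection.{u, v} K) (n : ℕ) (d : ℤ) : A.obj n d →ₗ[K] (Tw A).obj n d where
  toFun a := twMk
    (fun r => if h : r = 0 then A.cast (by omega) (by subst h; simp) a else 0)
    fun r τ hτ => by
      by_cases h : r = 0
      · rw [show τ = Equiv.refl _ from Equiv.ext fun x => hτ x (by omega), A.act_refl]
      · simp [h]
  map_add' a b := tw_ext fun r => by
    by_cases h : r = 0 <;> simp [h]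
  map_smul' c a := tw_ext fun r => by
    by_cases h : r = 0 <;> simp [h]

variable {A : Collection.{u, v} K} {n : ℕ} {d : ℤ}

theorem twAt_embApp_zero (a : A.obj n d) :
    twAt 0 (embApp A n d a) = A.cast (Nat.zero_add n).symm (by simp) a := rfl

theorem twAt_embApp_of_ne (a : A.obj n d) {r : ℕ} (hr : r ≠ 0) :
    twAt r (embApp A n d a) = 0 := dif_neg hr

theorem twAt_embApp_eq (a : A.obj n d) {r : ℕ} (hr : r = 0) :
    twAt r (embApp A n d a) = A.cast (by omega) (by subst hr; simp) a := dif_pos hr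

theorem embApp_act {m : ℕ} (σ : Fin m ≃ Fin n) (a : A.obj m d) :
    embApp A n d (A.act σ a) = (Tw A).act σ (embApp A m d a) := by
  refine tw_ext fun r => ?_
  rw [twAt_act]
  by_cases h : r = 0
  · subst h
    rw [twAt_embApp_zero, twAt_embApp_zero, A.act_cast_arity, ← A.cast_cast
        (Nat.zero_add n).symm rfl rfl
      (by simp), ← A.act_finCongr, ← A.act_trans]
    refine congrArg (fun τ => A.cast rfl _ (A.act τ a)) (Equiv.ext fun x => ?_)
    obtain ⟨y, hy⟩ : ∃ y : Fin m, finCongr (Nat.zero_add m).symm x = Fin.natAdd 0 y :=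
      ⟨x, Fin.ext (by simp)⟩
    have : y = x := Fin.ext (by have := congrArg Fin.val hy; simp at this; omega)
    rw [Equiv.trans_apply, Equiv.trans_apply, hy, extend_natAdd, this]
    ext; simp
  · rw [twAt_embApp_of_ne _ h, twAt_embApp_of_ne _ h, map_zero]

variable {O : DGOperad.{u, w} K}

theorem embApp_comp {n k m : ℕ} {p q d : ℤ} (i : Fin n) (hm : n + k = m + 1) (hd : p + q = d)
    (a : O.obj n p) (b : O.obj k q) :
    embApp O.toCollection m d (O.comp i hm hd a b) =
      twComp O i hm hd (embApp O.toCollection n p a) (embApp O.toCollection k q b) := by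
  refine tw_ext fun r => ?_
  rw [twAt_twComp]
  by_cases h : r = 0
  · subst h
    rw [Fin.sum_univ_one, twAt_embApp_zero]
    change _ = twCompTerm O i hm hd 0 0 0 _ (twAt 0 (embApp O.toCollection n p a))
      (twAt 0 (embApp O.toCollection k q b))
    simp only [twCompTerm, LinearMap.sum_apply, LinearMap.compr₂_apply,
      Nat.factorial_zero, mul_one, Nat.cast_one, inv_one, one_smul]
    -- In the component of index `0` there are no inputs to shuffle, and only the identity is left.
    rw [Finset.sum_eq_single (Equiv.refl _)]
    · rw [O.act_refl, twAt_embApp_zero, twAt_embApp_zero, O.comp_cast_left, O.comp_cast_right,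
        O.cast_comp]
      congr 3
      ext; simp
    · intro σ hσ hne
      refine absurd (Equiv.ext fun t => ?_) hne
      simp only [twRelabel, Finset.mem_filter, Finset.mem_univ, true_and] at hσ
      rcases outerPos_or_innerPos hm i (Fin.cast (Nat.zero_add m) t) with ⟨x, hx, ht⟩ | ⟨y, ht⟩
      · have h1 : t = outerPos (by omega : (0 + n) + (0 + k) = (0 + m) + 1) (Fin.natAdd 0 i)
            (Fin.natAdd 0 x) (by simpa using hx) := by
          ext
          have := congrArg Fin.val ht
          simpa [val_outerPos] using this
        conv_lhs => rw [h1]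
        rw [hσ.1 x hx, ← ht]
        ext; simp
      · have h1 : t = innerPos (by omega : (0 + n) + (0 + k) = (0 + m) + 1) (Fin.natAdd 0 i)
            (Fin.natAdd 0 y) := by
          ext
          have := congrArg Fin.val ht
          simpa [val_innerPos] using this
        conv_lhs => rw [h1]
        rw [hσ.2 y, ← ht]
        ext; simp
    · intro h
      refine absurd ?_ h
      simp only [twRelabel, Finset.mem_filter, Finset.mem_univ, true_and]
      refine ⟨fun x hx => ?_, fun y => ?_⟩
      · ext; simp [val_outerPos]
      · ext; simp [val_innerPos]
  · rw [twAt_embApp_of_ne _ h, Finset.sum_eq_zero]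
    intro s _
    by_cases hs : (s : ℕ) = 0
    · rw [twAt_embApp_of_ne b (r := r - s) (by omega), map_zero]
    · rw [twAt_embApp_of_ne a hs, map_zero, LinearMap.zero_apply]

theorem twCounit_embApp (A : Collection.{u, v} K) {n : ℕ} {d : ℤ} (a : A.obj n d) :
    twCounit A n d (embApp A n d a) = a := by
  change A.cast _ _ (twAt 0 (embApp A n d a)) = a
  rw [twAt_embApp_zero, A.cast_cast]
  rfl

variable [CharZero K] (i : OperadHom (LLie K).toOperadData O.toOperadData)

/-- The part of the differential that involves the bracket vanishes on elements with a single
component of index `0`, as it takes components of positive index. -/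
theorem embApp_diff (hder : ∀ {n : ℕ} {p : ℤ} (f : O.obj n p), IsDerivationOn O (br i) f)
    {n : ℕ} {p q : ℤ} (h : p + 1 = q) (a : O.obj n p) :
    embApp O.toCollection n q (O.diff h a) =
      twDiff ((toLie K).trans i) h (embApp O.toCollection n p a) := by
  refine tw_ext fun r => ?_
  match r with
  | 0 =>
    rw [twAt_twDiff_zero, twAt_embApp_zero, twAt_embApp_zero]
    exact (O.diff_cast _ _ _ h a).symm
  | 1 => rw [twAt_twDiff_one i hder, twAt_embApp_of_ne _ one_ne_zero,
      twAt_embApp_of_ne _ one_ne_zero, map_zero]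
  | s + 2 => rw [twAt_twDiff i hder, twAt_embApp_of_ne _ (by omega), twAt_embApp_of_ne _ (by omega),
      twAt_embApp_of_ne _ (by omega), map_zero, map_zero, LinearMap.zero_apply, map_zero,
      smul_zero, add_zero]

/-- The canonical embedding `O → Tw O` is a morphism of dg operads if the bracket is a derivation
on `O`. -/
def emb (hder : ∀ {n : ℕ} {p : ℤ} (f : O.obj n p), IsDerivationOn O (br i) f) :
    OperadHom O.toOperadData (TwOp ((toLie K).trans i)) where
  app := embApp O.toCollection
  app_act := embApp_act
  app_one := rfl
  app_comp s hm hd a b := embApp_comp s hm hd a b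
  app_diff h a := embApp_diff i hder h a

variable {i}

theorem isCanonicalEmbedding_emb
    (hder : ∀ {n : ℕ} {p : ℤ} (f : O.obj n p), IsDerivationOn O (br i) f) :
    IsCanonicalEmbedding ((toLie K).trans i) (emb i hder) := fun _ _ a =>
  ⟨twAt_embApp_zero a, fun _ hr => twAt_embApp_of_ne a (by omega)⟩

theorem isTwCoalgebra_emb
    (hder : ∀ {n : ℕ} {p : ℤ} (f : O.obj n p), IsDerivationOn O (br i) f) :
    IsTwCoalgebra ((toLie K).trans i) (emb i hder) where
  under n d hn hd := by
    refine tw_ext fun r => ?_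
    change twAt r (embApp O.toCollection n d (i.app n d ((toLie K).app n d (infBracket K hn hd)))) =
      mc ((toLie K).trans i) (r + n) (d - 2 * r) _
    -- For `n ≥ 2` and `r ≥ 1` the arity `r + n` is at least three, so that both sides vanish.
    by_cases hr : r = 0
    · subst hr
      have h : ∀ m e (hm : n = m) (he : d = e) (h' : e = 3 - 2 * m),
          mc ((toLie K).trans i) m e h' = O.cast hm he (mc ((toLie K).trans i) n d hd) := by
        rintro m e rfl rfl h'; rfl
      rw [twAt_embApp_zero, h (0 + n) (d - 2 * (0 : ℕ)) (by omega) (by simp)]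
      congr 1
      unfold mc
      rw [dif_pos hn]
      rfl
    · rw [twAt_embApp_of_ne _ hr, mc_of_ne _ _ (by omega)]
  counit n d a := twCounit_embApp _ a
  coassoc n d a := by
    refine tw_ext fun r => tw_ext fun s => ?_
    change O.cast _ _ (twAt (s + r) (embApp O.toCollection n d a)) =
      twAt s (embApp O.toCollection (r + n) (d - 2 * r) (twAt r (embApp O.toCollection n d a)))
    by_cases hr : r = 0
    · subst hr
      by_cases hs : s = 0
      · subst hs
        rw [twAt_embApp_zero (twAt 0 (embApp O.toCollection n d a)),
          twAt_embApp_eq a (show 0 + 0 = 0 from rfl), O.cast_cast]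
      · rw [twAt_embApp_of_ne _ hs, twAt_embApp_of_ne _ (by omega), map_zero]
    · rw [twAt_embApp_of_ne a hr, map_zero, map_zero, twAt_embApp_of_ne _ (by omega), map_zero]

end embedding

/-! ### The suspended associative operad -/

section words

/-- The word that replaces the letter `x` when the word `u` is substituted for the letter `i`. -/
def substLetter {n k m : ℕ} (hm : n + k = m + 1) (i : Fin n) (u : List (Fin k)) (x : Fin n) :
    List (Fin m) :=
  if h : x = i then u.map (innerPos hm i) else [outerPos hm i x h]

/-- The substitution of the word `u` for the letter `i` of the word `w`. -/
def substWord {n k m : ℕ} (hm : n + k = m + 1) (i : Fin n) (w : List (Fin n)) (u : List (Fin k)) :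
    List (Fin m) :=
  w.flatMap (substLetter hm i u)

variable {n k m : ℕ} {hm : n + k = m + 1} {i : Fin n} {u : List (Fin k)}

theorem substLetter_self : substLetter hm i u i = u.map (innerPos hm i) := dif_pos rfl

theorem substLetter_of_ne {x : Fin n} (h : x ≠ i) : substLetter hm i u x = [outerPos hm i x h] :=
  dif_neg h

theorem mem_substLetter_outerPos {x y : Fin n} (hx : x ≠ i) :
    outerPos hm i x hx ∈ substLetter hm i u y ↔ x = y := by
  by_cases hy : y = i
  · subst hy
    rw [substLetter_self, List.mem_map]
    constructor
    · rintro ⟨z, -, hz⟩; exact absurd hz.symm (outerPos_ne_innerPos _ _ _ _ _)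
    · intro h; exact absurd h hx
  · rw [substLetter_of_ne hy, List.mem_singleton]
    constructor
    · exact outerPos_injective hm i x y hx hy
    · rintro rfl; rfl

theorem innerPos_injective (hm : n + k = m + 1) (i : Fin n) :
    Function.Injective (innerPos hm i) := fun y z h => by
  have := congrArg Fin.val h
  rw [val_innerPos, val_innerPos] at this
  ext; omega

theorem mem_substLetter_innerPos {x : Fin n} {y : Fin k} :
    innerPos hm i y ∈ substLetter hm i u x ↔ x = i ∧ y ∈ u := by
  by_cases hx : x = i
  · subst hx
    rw [substLetter_self, List.mem_map_of_injective (innerPos_injective hm x)]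
    simp
  · rw [substLetter_of_ne hx, List.mem_singleton]
    simp only [hx, false_and, iff_false]
    exact fun h => outerPos_ne_innerPos _ _ _ _ _ h.symm

theorem length_flatMap_substLetter {w : List (Fin n)} (h : i ∉ w) :
    (w.flatMap (substLetter hm i u)).length = w.length := by
  induction w with
  | nil => rfl
  | cons x w ih =>
    rw [List.mem_cons, not_or] at h
    rw [List.flatMap_cons, List.length_append, ih h.2, substLetter_of_ne (Ne.symm h.1)]
    simp [add_comm]

theorem length_substWord {w : List (Fin n)} (hw : w.Nodup) (h : i ∈ w) :
    (substWord hm i w u).length + 1 = w.length + u.length := by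
  obtain ⟨w₁, w₂, rfl, h1⟩ := List.eq_append_cons_of_mem h
  have h2 : i ∉ w₂ := by
    rw [List.nodup_append, List.nodup_cons] at hw
    exact hw.2.1.1
  rw [substWord, List.flatMap_append, List.flatMap_cons, List.length_append, List.length_append,
    length_flatMap_substLetter h1, length_flatMap_substLetter h2, substLetter_self,
    List.length_map]
  simp; omega

theorem idxOf_map_of_injective {α β : Type*} [DecidableEq α] [DecidableEq β] {f : α → β}
    (hf : Function.Injective f) (l : List α) (a : α) : (l.map f).idxOf (f a) = l.idxOf a := by
  induction l with
  | nil => rfl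
  | cons x l ih => simp only [List.map_cons, List.idxOf_cons, ih, hf.beq_eq]

theorem idxOf_substWord_innerPos {w : List (Fin n)} (h : i ∈ w) {y : Fin k} (hy : y ∈ u) :
    (substWord hm i w u).idxOf (innerPos hm i y) = w.idxOf i + u.idxOf y := by
  obtain ⟨w₁, w₂, rfl, h1⟩ := List.eq_append_cons_of_mem h
  rw [substWord, List.flatMap_append, List.flatMap_cons, List.idxOf_append_of_notMem,
    length_flatMap_substLetter h1, List.idxOf_append_of_notMem h1, List.idxOf_cons_self,
    substLetter_self, List.idxOf_append_of_mem]
  · rw [Nat.add_zero]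
    rw [idxOf_map_of_injective (innerPos_injective hm i)]
  · exact List.mem_map_of_mem hy
  · simp only [List.mem_flatMap, not_exists, not_and]
    intro x hx hx'
    rw [mem_substLetter_innerPos] at hx'
    exact h1 (hx'.1 ▸ hx)

/-- A letter `x ≠ i` is shifted if it follows `i` in `w`. -/
theorem idxOf_substWord_outerPos {w : List (Fin n)} (hw : w.Nodup) (hi : i ∈ w) {x : Fin n}
    (hx : x ≠ i) (h : x ∈ w) :
    ((substWord hm i w u).idxOf (outerPos hm i x hx) : ℤ) =
      w.idxOf x + if w.idxOf i < w.idxOf x then (u.length : ℤ) - 1 else 0 := by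
  obtain ⟨w₁, w₂, rfl, h1⟩ := List.eq_append_cons_of_mem h
  have hlen : (substLetter hm i u x).idxOf (outerPos hm i x hx) = 0 := by
    rw [substLetter_of_ne hx]; simp
  rw [substWord, List.flatMap_append, List.flatMap_cons, List.idxOf_append_of_notMem,
    List.idxOf_append_of_notMem h1, List.idxOf_cons_self,
    List.idxOf_append_of_mem, hlen]
  · by_cases h2 : i ∈ w₁
    · have h3 : w₁.idxOf i < w₁.length := List.idxOf_lt_length_of_mem h2
      rw [List.idxOf_append_of_mem h2, if_pos (by omega)]
      have h4 := length_substWord (hm := hm) (u := u) (List.nodup_append.1 hw).1 h2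
      rw [substWord] at h4
      omega
    · rw [List.idxOf_append_of_notMem h2, if_neg (by omega), length_flatMap_substLetter h2]
      simp
  · rw [mem_substLetter_outerPos]
  · simp only [List.mem_flatMap, not_exists, not_and]
    intro y hy hy'
    rw [mem_substLetter_outerPos] at hy'
    exact h1 (hy' ▸ hy)

theorem nodup_substWord {w : List (Fin n)} (hw : w.Nodup) (hu : u.Nodup) :
    (substWord hm i w u).Nodup := by
  rw [substWord, List.nodup_flatMap]
  constructor
  · intro x _
    by_cases hx : x = i
    · subst hx
      rw [substLetter_self]
      exact hu.map (innerPos_injective hm x)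
    · rw [substLetter_of_ne hx]; simp
  · refine hw.imp fun {x y} hxy => ?_
    intro t ht ht'
    rcases outerPos_or_innerPos hm i t with ⟨z, hz, rfl⟩ | ⟨z, rfl⟩
    · rw [mem_substLetter_outerPos] at ht ht'
      exact hxy (ht.symm.trans ht')
    · rw [mem_substLetter_innerPos] at ht ht'
      exact hxy (ht.1.trans ht'.1.symm)

theorem mem_of_nodup_of_length {w : List (Fin n)} (hw : w.Nodup) (h : w.length = n) (x : Fin n) :
    x ∈ w := by
  have h1 : w.toFinset = Finset.univ := by
    rw [← Finset.card_eq_iff_eq_univ, List.toFinset_card_of_nodup hw, h, Fintype.card_fin]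
  rw [← List.mem_toFinset, h1]
  exact Finset.mem_univ x

end words

section associative

/-- The words in which each letter of `Fin n` occurs once; they span the part of arity `n` of the
suspended associative operad, which is concentrated in degree `1 - n`. -/
abbrev Word (n : ℕ) (d : ℤ) : Type := {l : List (Fin n) // l.Nodup ∧ l.length = n ∧ d = 1 - n}

namespace Word

variable {n k m : ℕ} {p q d : ℤ}

theorem mem (w : Word n d) (x : Fin n) : x ∈ w.1 := mem_of_nodup_of_length w.2.1 w.2.2.1 x

/-- Relabelling of the letters of a word. -/
def map {m n : ℕ} {d : ℤ} (σ : Fin m ≃ Fin n) (w : Word m d) : Word n d :=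
  ⟨w.1.map σ, w.2.1.map σ.injective, by
    have := Fintype.card_congr σ
    simp only [Fintype.card_fin] at this
    rw [List.length_map, w.2.2.1, this], by
    have := Fintype.card_congr σ
    simp only [Fintype.card_fin] at this
    rw [← this]; exact w.2.2.2⟩

/-- Substitution of a word for a letter. -/
def subst (i : Fin n) (hm : n + k = m + 1) (hd : p + q = d) (w : Word n p) (u : Word k q) :
    Word m d :=
  ⟨substWord hm i w.1 u.1, nodup_substWord w.2.1 u.2.1, by
    have := length_substWord (hm := hm) (u := u.1) w.2.1 (w.mem i)
    rw [w.2.2.1, u.2.2.1] at this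
    omega, by
    have h1 := w.2.2.2
    have h2 := u.2.2.2
    omega⟩

end Word

variable (K : Type u) [Field K]

/-- The insertions of the suspended associative operad. The sign is that of the permutation of
the inserted word with the letters that precede it. -/
def assComp {n k m : ℕ} {p q d : ℤ} (i : Fin n) (hm : n + k = m + 1) (hd : p + q = d) :
    (Word n p →₀ K) →ₗ[K] (Word k q →₀ K) →ₗ[K] (Word m d →₀ K) :=
  Finsupp.linearCombination K fun w =>
    sgn K (q * w.1.idxOf i) • Finsupp.lmapDomain K K (Word.subst i hm hd w)

variable {K}

theorem assComp_single {n k m : ℕ} {p q d : ℤ} (i : Fin n) (hm : n + k = m + 1) (hd : p + q = d)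
    (w : Word n p) (u : Word k q) :
    assComp K i hm hd (Finsupp.single w 1) (Finsupp.single u 1) =
      sgn K (q * w.1.idxOf i) • Finsupp.single (Word.subst i hm hd w u) 1 := by
  simp [assComp]

theorem finsupp_induction {α : Type*} {C : (α →₀ K) → Prop} (zero : C 0)
    (add : ∀ a b, C a → C b → C (a + b)) (smul : ∀ (c : K) a, C a → C (c • a))
    (single : ∀ x, C (Finsupp.single x 1)) (a : α →₀ K) : C a := by
  induction a using Finsupp.induction_linear with
  | zero => exact zero
  | add a b ha hb => exact add _ _ ha hb
  | single x c =>
    have := smul c _ (single x)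
    rwa [Finsupp.smul_single, smul_eq_mul, mul_one] at this

theorem assComp_act {n k m n' k' m' : ℕ} {p q d : ℤ} (i : Fin n) (hm : n + k = m + 1)
    (hm' : n' + k' = m' + 1) (hd : p + q = d) (σ : Fin n ≃ Fin n') (τ : Fin k ≃ Fin k')
    (ρ : Fin m ≃ Fin m') (a : Word n p →₀ K) (b : Word k q →₀ K)
    (h1 : ∀ (x : Fin n) (hx : x ≠ i),
      ρ (outerPos hm i x hx) = outerPos hm' (σ i) (σ x) (σ.injective.ne hx))
    (h2 : ∀ y : Fin k, ρ (innerPos hm i y) = innerPos hm' (σ i) (τ y)) :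
    assComp K (σ i) hm' hd (Finsupp.lmapDomain K K (Word.map σ) a)
      (Finsupp.lmapDomain K K (Word.map τ) b) =
      Finsupp.lmapDomain K K (Word.map ρ) (assComp K i hm hd a b) := by
  induction a using finsupp_induction with
  | zero => simp
  | add a a' ha ha' => simp only [map_add, LinearMap.add_apply, ha, ha']
  | smul c a ha => simp only [map_smul, LinearMap.smul_apply, ha]
  | single w =>
  induction b using finsupp_induction with
  | zero => simp
  | add a a' ha ha' => simp only [map_add, ha, ha']
  | smul c a ha => simp only [map_smul, ha]
  | single u =>
  rw [assComp_single, Finsupp.lmapDomain_apply, Finsupp.lmapDomain_apply, Finsupp.mapDomain_single,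
    Finsupp.mapDomain_single, assComp_single, map_smul, Finsupp.lmapDomain_apply,
    Finsupp.mapDomain_single]
  have h3 : (Word.map σ w).1.idxOf (σ i) = w.1.idxOf i :=
    idxOf_map_of_injective σ.injective _ _
  rw [h3]
  congr 2
  refine Subtype.ext ?_
  change substWord hm' (σ i) (w.1.map σ) (u.1.map τ) = (substWord hm i w.1 u.1).map ρ
  rw [substWord, substWord, List.flatMap_map, List.map_flatMap]
  refine List.flatMap_congr fun x _ => ?_
  by_cases hx : x = i
  · subst hx
    rw [substLetter_self, substLetter_self, List.map_map, List.map_map]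
    exact List.map_congr_left fun y _ => (h2 y).symm
  · rw [substLetter_of_ne hx, substLetter_of_ne (σ.injective.ne hx), List.map_singleton, h1]

theorem assComp_assoc {n k l m₁ m₂ m : ℕ} {p q s d₁ d₂ d : ℤ} (i : Fin n) (j : Fin k) (t : Fin m₁)
    (h₁ : n + k = m₁ + 1) (h₂ : m₁ + l = m + 1) (h₃ : k + l = m₂ + 1) (h₄ : n + m₂ = m + 1)
    (e₁ : p + q = d₁) (e₂ : d₁ + s = d) (e₃ : q + s = d₂) (e₄ : p + d₂ = d)
    (a : Word n p →₀ K) (b : Word k q →₀ K) (c : Word l s →₀ K) (ht : (t : ℕ) = i + j) :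
    assComp K i h₄ e₄ a (assComp K j h₃ e₃ b c) =
      assComp K t h₂ e₂ (assComp K i h₁ e₁ a b) c := by
  induction a using finsupp_induction with
  | zero => simp
  | add a a' ha ha' => simp only [map_add, LinearMap.add_apply, ha, ha']
  | smul c a ha => simp only [map_smul, LinearMap.smul_apply, ha]
  | single w =>
  induction b using finsupp_induction with
  | zero => simp
  | add a a' ha ha' => simp only [map_add, LinearMap.add_apply, ha, ha']
  | smul c a ha => simp only [map_smul, LinearMap.smul_apply, ha]
  | single u =>
  induction c using finsupp_induction with
  | zero => simp
  | add a a' ha ha' => simp only [map_add, ha, ha']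
  | smul c a ha => simp only [map_smul, ha]
  | single z =>
  obtain rfl : t = innerPos h₁ i j := Fin.ext ht
  rw [assComp_single, assComp_single, map_smul, map_smul, LinearMap.smul_apply, assComp_single,
    assComp_single, smul_smul, smul_smul, ← sgn_add, ← sgn_add]
  -- The positions of the letters for which words are substituted add up, and so do the exponents
  -- of the signs.
  have h5 : (Word.subst i h₁ e₁ w u).1.idxOf (innerPos h₁ i j) = w.1.idxOf i + u.1.idxOf j :=
    idxOf_substWord_innerPos (w.mem i) (u.mem j)
  congr 1
  · rw [h5, ← e₃]
    push_cast
    ring_nf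
  congr 1
  refine Subtype.ext ?_
  change substWord h₄ i w.1 (substWord h₃ j u.1 z.1) =
    substWord h₂ (innerPos h₁ i j) (substWord h₁ i w.1 u.1) z.1
  simp only [substWord]
  rw [List.flatMap_assoc]
  refine List.flatMap_congr fun x _ => ?_
  by_cases hx : x = i
  · subst hx
    rw [substLetter_self, substLetter_self, List.flatMap_map, List.map_flatMap]
    refine List.flatMap_congr fun y _ => ?_
    by_cases hy : y = j
    · subst hy
      rw [substLetter_self, substLetter_self, List.map_map]
      refine List.map_congr_left fun y' _ => Fin.ext ?_
      simp only [Function.comp_apply, val_innerPos, add_assoc]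
    · have hy' : (y : ℕ) ≠ j := fun h => hy (Fin.ext h)
      rw [substLetter_of_ne hy, substLetter_of_ne ((innerPos_injective h₁ x).ne hy),
        List.map_singleton]
      congr 1
      ext
      simp only [val_innerPos, val_outerPos]
      grind
  · have hx' : (x : ℕ) ≠ i := fun h => hx (Fin.ext h)
    have hj := j.2
    rw [substLetter_of_ne hx, substLetter_of_ne hx, List.flatMap_singleton,
      substLetter_of_ne (outerPos_ne_innerPos _ _ _ _ _)]
    congr 1
    ext
    simp only [val_innerPos, val_outerPos]
    grind

theorem substWord_comm {n k l m₁ m₂ m : ℕ} (i j : Fin n) (hij : (i : ℕ) < j)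
    (h₁ : n + k = m₁ + 1) (h₂ : m₁ + l = m + 1) (h₃ : n + l = m₂ + 1) (h₄ : m₂ + k = m + 1)
    (hji : j ≠ i) (w : List (Fin n)) (u : List (Fin k)) (z : List (Fin l)) :
    substWord h₂ (outerPos h₁ i j hji) (substWord h₁ i w u) z =
      substWord h₄ (outerPos h₃ j i hji.symm) (substWord h₃ j w z) u := by
  simp only [substWord]
  rw [List.flatMap_assoc, List.flatMap_assoc]
  refine List.flatMap_congr fun x _ => ?_
  by_cases hx : x = i
  · subst hx
    rw [substLetter_self, substLetter_of_ne hji.symm, List.flatMap_singleton, List.flatMap_map,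
      substLetter_self, List.map_eq_flatMap]
    refine List.flatMap_congr fun y _ => ?_
    rw [substLetter_of_ne (outerPos_ne_innerPos _ _ _ _ _).symm]
    congr 1
    ext
    simp only [val_innerPos, val_outerPos]
    grind
  by_cases hx' : x = j
  · subst hx'
    rw [substLetter_self, substLetter_of_ne hji, List.flatMap_singleton, List.flatMap_map,
      substLetter_self, List.map_eq_flatMap]
    refine List.flatMap_congr fun y _ => ?_
    rw [substLetter_of_ne (outerPos_ne_innerPos _ _ _ _ _).symm]
    congr 1
    ext
    simp only [val_innerPos, val_outerPos]
    grind
  · have h5 : (x : ℕ) ≠ i := fun h => hx (Fin.ext h)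
    have h6 : (x : ℕ) ≠ j := fun h => hx' (Fin.ext h)
    rw [substLetter_of_ne hx, substLetter_of_ne hx', List.flatMap_singleton,
      List.flatMap_singleton,
      substLetter_of_ne (fun h => hx' (outerPos_injective _ _ _ _ _ _ h)),
      substLetter_of_ne (fun h => hx (outerPos_injective _ _ _ _ _ _ h))]
    congr 1
    ext
    simp only [val_outerPos]
    grind

theorem assComp_comm {n k l m₁ m₂ m : ℕ} {p q s d₁ d₂ d : ℤ} (i j : Fin n) (t : Fin m₁)
    (t' : Fin m₂)
    (h₁ : n + k = m₁ + 1) (h₂ : m₁ + l = m + 1) (h₃ : n + l = m₂ + 1) (h₄ : m₂ + k = m + 1)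
    (e₁ : p + q = d₁) (e₂ : d₁ + s = d) (e₃ : p + s = d₂) (e₄ : d₂ + q = d)
    (a : Word n p →₀ K) (b : Word k q →₀ K) (c : Word l s →₀ K) (hij : i < j)
    (ht : (t : ℕ) + 1 = j + k) (ht' : (t' : ℕ) = i) :
    assComp K t h₂ e₂ (assComp K i h₁ e₁ a b) c =
      sgn K (q * s) • assComp K t' h₄ e₄ (assComp K j h₃ e₃ a c) b := by
  induction a using finsupp_induction with
  | zero => simp
  | add a a' ha ha' => simp only [map_add, LinearMap.add_apply, ha, ha', smul_add]
  | smul c a ha => simp only [map_smul, LinearMap.smul_apply, ha]; rw [smul_comm]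
  | single w =>
  induction b using finsupp_induction with
  | zero => simp
  | add a a' ha ha' => simp only [map_add, LinearMap.add_apply, ha, ha', smul_add]
  | smul c a ha => simp only [map_smul, LinearMap.smul_apply, ha]; rw [smul_comm]
  | single u =>
  induction c using finsupp_induction with
  | zero => simp
  | add a a' ha ha' => simp only [map_add, LinearMap.add_apply, ha, ha', smul_add]
  | smul c a ha => simp only [map_smul, LinearMap.smul_apply, ha]; rw [smul_comm]
  | single z =>
  have hij' : (i : ℕ) < j := hij
  have hji : j ≠ i := hij.ne'
  obtain rfl : t = outerPos h₁ i j hji := Fin.ext (by rw [val_outerPos, if_neg (by omega)]; omega)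
  obtain rfl : t' = outerPos h₃ j i hij.ne := Fin.ext
      (by rw [val_outerPos, if_pos (by omega)]; omega)
  rw [assComp_single, assComp_single, map_smul, map_smul, LinearMap.smul_apply,
    LinearMap.smul_apply, assComp_single, assComp_single, smul_smul, smul_smul, smul_smul,
    ← sgn_add, ← sgn_add, ← sgn_add]
  -- The letter that comes later in `w` is shifted by the first substitution, which accounts for
  -- the sign `(-1)^{qs}` of the interchange.
  have h5 : ((Word.subst i h₁ e₁ w u).1.idxOf (outerPos h₁ i j hji) : ℤ) = w.1.idxOf j +
      if w.1.idxOf i < w.1.idxOf j then (u.1.length : ℤ) - 1 else 0 :=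
    idxOf_substWord_outerPos w.2.1 (w.mem i) hji (w.mem j)
  have h6 : ((Word.subst j h₃ e₃ w z).1.idxOf (outerPos h₃ j i hij.ne) : ℤ) = w.1.idxOf i +
      if w.1.idxOf j < w.1.idxOf i then (z.1.length : ℤ) - 1 else 0 :=
    idxOf_substWord_outerPos w.2.1 (w.mem j) hij.ne (w.mem i)
  have h7 : w.1.idxOf i ≠ w.1.idxOf j := fun h => by
    rw [List.idxOf_inj (w.mem i)] at h
    exact hij.ne h
  have hu := u.2.2.2
  have hz := z.2.2.2
  congr 1
  · rw [h5, h6, u.2.2.1, z.2.2.1, show (k : ℤ) - 1 = -q by omega,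
      show (l : ℤ) - 1 = -s by omega]
    refine sgn_eq_of_even_sub K ?_
    rcases lt_or_gt_of_ne h7 with h | h
    · rw [if_pos h, if_neg (by omega)]
      exact ⟨-(q * s), by ring⟩
    · rw [if_neg (by omega), if_pos h]
      exact ⟨0, by ring⟩
  congr 1
  exact Subtype.ext (substWord_comm i j hij' h₁ h₂ h₃ h₄ hji w.1 u.1 z.1)

/-- The word of length one. -/
def Word.one : Word 1 0 := ⟨[0], by simp, by simp, by simp⟩

variable (K) in
/-- The unit of the suspended associative operad. -/
def assOne : Word 1 0 →₀ K := Finsupp.single Word.one 1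

theorem assOne_comp {n : ℕ} {p : ℤ} (a : Word n p →₀ K) :
    assComp K (0 : Fin 1) (Nat.add_comm 1 n) (zero_add p) (assOne K) a = a := by
  induction a using finsupp_induction with
  | zero => simp
  | add a a' ha ha' => simp only [map_add, ha, ha']
  | smul c a ha => simp only [map_smul, ha]
  | single w =>
  rw [assOne, assComp_single]
  have h0 : Word.one.1.idxOf 0 = 0 := rfl
  simp only [h0, Nat.cast_zero, mul_zero, sgn_zero, one_smul]
  congr 1
  refine Subtype.ext ?_
  change substWord (Nat.add_comm 1 n) 0 [0] w.1 = w.1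
  rw [substWord, List.flatMap_singleton, substLetter_self]
  refine (List.map_congr_left fun y _ => ?_).trans (List.map_id w.1)
  ext; simp [val_innerPos]

theorem assComp_one {n : ℕ} {p : ℤ} (i : Fin n) (a : Word n p →₀ K) :
    assComp K i rfl (add_zero p) a (assOne K) = a := by
  induction a using finsupp_induction with
  | zero => simp
  | add a a' ha ha' => simp only [map_add, LinearMap.add_apply, ha, ha']
  | smul c a ha => simp only [map_smul, LinearMap.smul_apply, ha]
  | single w =>
  rw [assOne, assComp_single]
  simp only [zero_mul, sgn_zero, one_smul]
  congr 1
  refine Subtype.ext ?_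
  change substWord rfl i w.1 [0] = w.1
  rw [substWord]
  refine (List.flatMap_congr fun x _ => ?_).trans (List.flatMap_singleton' w.1)
  by_cases hx : x = i
  · subst hx
    rw [substLetter_self, List.map_singleton]
    congr 1
  · rw [substLetter_of_ne hx]
    congr 1
    ext; simp [val_outerPos]

variable (K) in
/-- The suspended associative operad. -/
def LAss : DGOperad.{u, u} K where
  obj n d := Word n d →₀ K
  act σ := Finsupp.lmapDomain K K (Word.map σ)
  act_refl a := by
    have : ∀ {n : ℕ} {d : ℤ}, (Word.map (Equiv.refl (Fin n)) : Word n d → Word n d) = id := by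
      intro n d; funext w; exact Subtype.ext (List.map_id _)
    simp [this]
  act_trans σ τ a := by
    rw [Finsupp.lmapDomain_apply, Finsupp.lmapDomain_apply, Finsupp.lmapDomain_apply,
      ← Finsupp.mapDomain_comp]
    congr 1
    funext w
    exact Subtype.ext (by simp [Word.map])
  one := assOne K
  comp := assComp K
  diff _ := 0
  comp_act i hm hm' hd σ τ ρ a b h1 h2 := assComp_act i hm hm' hd σ τ ρ a b h1 h2
  one_comp := assOne_comp
  comp_one := assComp_one
  comp_assoc := assComp_assoc
  comp_comm := assComp_comm
  diff_diff _ _ _ := rfl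
  diff_act _ _ _ := by simp
  diff_comp _ _ _ _ _ _ _ _ _ _ := by simp

end associative

/-! ### The words of an element of `ΛLie` -/

section commutator

variable (K : Type u) [Field K]

/-- The words `01` and `10`. -/
def Word.pair (b : Bool) : Word 2 (-1) :=
  ⟨if b then [0, 1] else [1, 0], by cases b <;> simp, by cases b <;> simp, by norm_num⟩

/-- The (graded) commutator of the two inputs. -/
def assBracket : Word 2 (-1) →₀ K :=
  Finsupp.single (Word.pair true) 1 + Finsupp.single (Word.pair false) 1

/-- The words on three letters, for the verification of the Jacobi identity. -/
def Word.triple (l : List (Fin 3)) (h : l.Nodup ∧ l.length = 3) : Word 3 (-2) :=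
  ⟨l, h.1, h.2, by norm_num⟩

theorem map_assBracket : Finsupp.lmapDomain K K (Word.map (Equiv.swap 0 1)) (assBracket K) =
    assBracket K := by
  have h : ∀ b, Word.map (Equiv.swap 0 1) (Word.pair b) = Word.pair !b := by
    intro b
    refine Subtype.ext ?_
    revert b
    change ∀ b : Bool, List.map (Equiv.swap (0 : Fin 2) 1) (if b then [0, 1] else [1, 0]) =
      if !b then [0, 1] else [1, 0]
    decide
  simp only [assBracket, map_add, Finsupp.lmapDomain_apply, Finsupp.mapDomain_single, h]
  exact add_comm _ _

theorem assComp_assBracket : assComp K (m := 3) (d := -2) (0 : Fin 2) (by norm_num) (by norm_num)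
    (assBracket K) (assBracket K) =
      Finsupp.single (Word.triple [0, 1, 2] (by decide)) 1 +
      Finsupp.single (Word.triple [1, 0, 2] (by decide)) 1 -
      Finsupp.single (Word.triple [2, 0, 1] (by decide)) 1 -
      Finsupp.single (Word.triple [2, 1, 0] (by decide)) 1 := by
  have h1 : (Word.pair true).1.idxOf 0 = 0 := rfl
  have h2 : (Word.pair false).1.idxOf 0 = 1 := rfl
  have e : ∀ b b' l h, substWord (m := 3) (by norm_num) (0 : Fin 2) (Word.pair b).1
      (Word.pair b').1 = l → Word.subst (0 : Fin 2) (by norm_num) (by norm_num) (Word.pair b)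
        (Word.pair b') = Word.triple l h := fun b b' l h hl => Subtype.ext hl
  simp only [assBracket, map_add, LinearMap.add_apply, assComp_single, h1, h2]
  rw [e true true [0, 1, 2] (by decide) (by decide), e true false [1, 0, 2] (by decide) (by decide),
    e false true [2, 0, 1] (by decide) (by decide), e false false [2, 1, 0] (by decide) (by decide)]
  simp only [Nat.cast_zero, mul_zero, sgn_zero, one_smul, Nat.cast_one, mul_one, sgn_neg, sgn_one,
    neg_smul]
  abel

theorem assBracket_jacobi :
    let x := assComp K (m := 3) (d := -2) (0 : Fin 2) (by norm_num) (by norm_num)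
      (assBracket K) (assBracket K)
    x + (Finsupp.lmapDomain K K (Word.map (finRotate 3)) x +
      Finsupp.lmapDomain K K (Word.map ((finRotate 3).trans (finRotate 3))) x) = 0 := by
  intro x
  have e : ∀ (σ : Fin 3 ≃ Fin 3) l h l' h', l.map σ = l' →
    Word.map σ (Word.triple l h) = Word.triple l' h' := fun σ l h l' h' hl => Subtype.ext hl
  simp only [x, assComp_assBracket, map_sub, map_add, Finsupp.lmapDomain_apply,
    Finsupp.mapDomain_single]
  rw [e (finRotate 3) [0, 1, 2] _ [1, 2, 0] (by decide) (by decide),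
    e (finRotate 3) [1, 0, 2] _ [2, 1, 0] (by decide) (by decide),
    e (finRotate 3) [2, 0, 1] _ [0, 1, 2] (by decide) (by decide),
    e (finRotate 3) [2, 1, 0] _ [0, 2, 1] (by decide) (by decide),
    e ((finRotate 3).trans (finRotate 3)) [0, 1, 2] _ [2, 0, 1] (by decide) (by decide),
    e ((finRotate 3).trans (finRotate 3)) [1, 0, 2] _ [0, 2, 1] (by decide) (by decide),
    e ((finRotate 3).trans (finRotate 3)) [2, 0, 1] _ [1, 2, 0] (by decide) (by decide),
    e ((finRotate 3).trans (finRotate 3)) [2, 1, 0] _ [1, 0, 2] (by decide) (by decide)]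
  abel

/-- The value of the generator of `ΛLie` in the suspended associative operad. -/
def toAssVal (n : ℕ) (d : ℤ) : LieGen n d → (LAss K).obj n d
  | .bracket => assBracket K

/-- The morphism from `ΛLie` to the suspended associative operad that maps the bracket to the
commutator. -/
def toAss : OperadHom (LLie K).toOperadData (LAss K).toOperadData :=
  presLift (LAss K) (toAssVal K) fun n d a b h => by
    cases h with
    | symm => exact map_assBracket K
    | jacobi => exact assBracket_jacobi K
    | diff => rfl

end commutator

section labels

variable {K : Type u} [Field K]

/-- The image of a combination of words under the substitution of letters `l x` for `x`. -/
def relabel {k : ℕ} {q : ℤ} (l : Fin k → ℕ) : (Word k q →₀ K) →ₗ[K] (List ℕ →₀ K) :=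
  Finsupp.lmapDomain K K fun u => u.1.map l

theorem relabel_single {k : ℕ} {q : ℤ} (l : Fin k → ℕ) (u : Word k q) (c : K) :
    relabel l (Finsupp.single u c) = Finsupp.single (u.1.map l) c := by
  simp [relabel]

/-- The expansion of an element of `ΛLie` in commutators. -/
def expand {k : ℕ} {q : ℤ} : (LLie K).obj k q →ₗ[K] (Word k q →₀ K) := (toAss K).app k q

theorem expand_act {k k' : ℕ} {q : ℤ} (σ : Fin k ≃ Fin k') (X : (LLie K).obj k q) :
    expand ((LLie K).act σ X) = Finsupp.mapDomain (Word.map σ) (expand X) :=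
  (toAss K).app_act σ X

theorem expand_comp {n k m : ℕ} {p q d : ℤ} (i : Fin n) (hm : n + k = m + 1) (hd : p + q = d)
    (X : (LLie K).obj n p) (Y : (LLie K).obj k q) :
    expand ((LLie K).comp i hm hd X Y) = assComp K i hm hd (expand X) (expand Y) :=
  (toAss K).app_comp i hm hd X Y

theorem expand_bracket : expand (bracket K) = assBracket K := rfl

/-- The words, with letters `l x` substituted for the inputs `x`, in the expansion of an element
of `ΛLie` in commutators. -/
def words {k : ℕ} {q : ℤ} (X : (LLie K).obj k q) (l : Fin k → ℕ) : List ℕ →₀ K :=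
  relabel l (expand X)

theorem words_eq {k : ℕ} {q : ℤ} (X : (LLie K).obj k q) (l : Fin k → ℕ) :
    words X l = Finsupp.mapDomain (fun u : Word k q => u.1.map l)
      (expand X) := rfl

theorem words_add {k : ℕ} {q : ℤ} (X Y : (LLie K).obj k q) (l : Fin k → ℕ) :
    words (X + Y) l = words X l + words Y l := by
  rw [words, map_add]; exact map_add (relabel l) _ _

theorem words_smul {k : ℕ} {q : ℤ} (c : K) (X : (LLie K).obj k q) (l : Fin k → ℕ) :
    words (c • X) l = c • words X l := by
  rw [words, map_smul]; exact map_smul (relabel l) _ _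

theorem words_act {k k' : ℕ} {q : ℤ} (σ : Fin k ≃ Fin k') (X : (LLie K).obj k q)
    (l : Fin k' → ℕ) : words ((LLie K).act σ X) l = words X (l ∘ σ) := by
  rw [words_eq, expand_act, ← Finsupp.mapDomain_comp, words_eq]
  congr 1
  funext u
  simp [Word.map]

theorem words_of_ne {k : ℕ} {q : ℤ} {X : (LLie K).obj k q} {l : Fin k → ℕ} {w : List ℕ}
    (h : words X l w ≠ 0) : ∃ u : Word k q, u.1.map l = w := by
  by_contra h'
  apply h
  rw [words_eq]
  exact Finsupp.mapDomain_of_notMem_range _ _ fun ⟨u, hu⟩ => h' ⟨u, hu⟩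

theorem Word.perm_ofFn {k : ℕ} {q : ℤ} (u : Word k q) (l : Fin k → ℕ) :
    (u.1.map l).Perm (List.ofFn l) := by
  have h : u.1.Perm (List.finRange k) :=
    (List.perm_ext_iff_of_nodup u.2.1 (List.nodup_finRange k)).2 fun x => by simp [u.mem x]
  rw [List.ofFn_eq_map]
  exact h.map l

theorem perm_of_words_ne {k : ℕ} {q : ℤ} {X : (LLie K).obj k q} {l : Fin k → ℕ} {w : List ℕ}
    (h : words X l w ≠ 0) : w.Perm (List.ofFn l) := by
  obtain ⟨u, rfl⟩ := words_of_ne h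
  exact u.perm_ofFn l

theorem length_of_words_ne {k : ℕ} {q : ℤ} {X : (LLie K).obj k q} {l : Fin k → ℕ} {w : List ℕ}
    (h : words X l w ≠ 0) : w.length = k := by
  simpa using (perm_of_words_ne h).length_eq

theorem degree_of_words_ne {k : ℕ} {q : ℤ} {X : (LLie K).obj k q} {l : Fin k → ℕ} {w : List ℕ}
    (h : words X l w ≠ 0) : q = 1 - k := by
  obtain ⟨u, -⟩ := words_of_ne h
  exact u.2.2.2

end labels

section duplication

variable {K : Type u} [Field K]

/-- The alternating sum of the words that arise from a word by doubling one of the letters `0`. -/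
def dup (K : Type u) [Field K] : List ℕ → (List ℕ →₀ K)
  | [] => 0
  | x :: v => (if x = 0 then Finsupp.single (0 :: 0 :: v) 1 else 0) -
      Finsupp.mapDomain (List.cons x) (dup K v)

/-- The alternating sum of the values of a function on the words that arise from a word by
dropping one of two neighbouring letters `0`. -/
def wordDiff {M : Type*} [AddCommGroup M] : (List ℕ → M) → List ℕ → M
  | _, [] => 0
  | c, x :: w => (if x = 0 ∧ w.head? = some 0 then c w else 0) -
      wordDiff (fun w => c (x :: w)) w

variable {M N : Type*} [AddCommGroup M] [AddCommGroup N]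

theorem map_wordDiff (F : M →+ N) (c : List ℕ → M) (w : List ℕ) :
    F (wordDiff c w) = wordDiff (fun w => F (c w)) w := by
  induction w generalizing c with
  | nil => exact map_zero F
  | cons x w ih =>
    rw [wordDiff, wordDiff, map_sub, ih]
    split_ifs <;> simp

theorem wordDiff_add (c c' : List ℕ → M) (w : List ℕ) :
    wordDiff (fun w => c w + c' w) w = wordDiff c w + wordDiff c' w := by
  induction w generalizing c c' with
  | nil => simp [wordDiff]
  | cons x w ih =>
    rw [wordDiff, wordDiff, wordDiff, ih]
    split_ifs <;> abel

theorem wordDiff_zero (w : List ℕ) : wordDiff (fun _ => (0 : M)) w = 0 := by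
  have := wordDiff_add (fun _ => (0 : M)) (fun _ => 0) w
  simpa using this

theorem wordDiff_smul [Module K M] (a : K) (c : List ℕ → M) (w : List ℕ) :
    wordDiff (fun w => a • c w) w = a • wordDiff c w :=
  (map_wordDiff (DistribSMul.toAddMonoidHom M a) c w).symm

/-- Doubling a letter `0` and dropping one of two neighbouring letters `0` are transposed to each
other. -/
theorem wordDiff_single (v w : List ℕ) :
    wordDiff (fun w => Finsupp.single v (1 : K) w) w = dup K v w := by
  induction w generalizing v with
  | nil =>
    cases v with
    | nil => rfl
    | cons x v =>
      rw [wordDiff, dup, Finsupp.sub_apply, Finsupp.mapDomain_of_notMem_range _ _ (by simp)]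
      split_ifs <;> simp
  | cons z w ih =>
    cases v with
    | nil =>
      rw [wordDiff, dup]
      have h : (fun w => Finsupp.single [] (1 : K) (z :: w)) = fun _ => 0 := by
        funext w; simp
      rw [h, wordDiff_zero]
      split_ifs with h1
      · rw [Finsupp.single_eq_of_ne (by rintro rfl; simp at h1)]; simp
      · simp
    -- Compare the terms of a doubled first letter, and then the terms of the remaining letters.
    | cons x v =>
      rw [wordDiff, dup, Finsupp.sub_apply]
      congr 1
      · by_cases hx : x = 0
        · subst hx
          rw [if_pos rfl]
          simp only [Finsupp.single_apply, List.cons.injEq]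
          by_cases h : z = 0 ∧ 0 :: v = w
          · obtain ⟨rfl, rfl⟩ := h
            simp
          · have : ¬ (0 = z ∧ 0 :: v = w) := fun h' => h ⟨h'.1.symm, h'.2⟩
            rw [if_neg this]
            split_ifs with h1 h2
            · exact absurd ⟨h1.1, h2⟩ h
            · rfl
            · rfl
        · rw [if_neg hx]
          split_ifs with h1
          · rw [Finsupp.single_eq_of_ne]
            · rfl
            · rintro rfl
              simp at h1
              exact hx h1.2
          · rfl
      · by_cases hx : x = z
        · subst hx
          rw [Finsupp.mapDomain_apply List.cons_injective, ← ih]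
          congr 1
          funext w
          simp only [Finsupp.single_apply, List.cons.injEq, true_and]
        · rw [Finsupp.mapDomain_of_notMem_range _ _ (by
            rintro ⟨y, hy⟩; rw [List.cons.injEq] at hy; exact hx hy.1)]
          have h : (fun w => Finsupp.single (x :: v) (1 : K) (z :: w)) = fun _ => 0 := by
            funext w; rw [Finsupp.single_eq_of_ne]; intro h
            rw [List.cons.injEq] at h; exact hx h.1.symm
          rw [h, wordDiff_zero]

/-- The word that arises from `u` by doubling the letter `x`, in letters `l`. -/
def dupAt {k : ℕ} (l : Fin k → ℕ) (y : Fin k) (u : List (Fin k)) : List ℕ :=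
  u.flatMap fun x => if x = y then [l x, l x] else [l x]

theorem dupAt_of_notMem {k : ℕ} (l : Fin k → ℕ) {y : Fin k} {u : List (Fin k)} (h : y ∉ u) :
    dupAt l y u = u.map l := by
  rw [dupAt, List.map_eq_flatMap]
  refine List.flatMap_congr fun x hx => ?_
  rw [if_neg]
  rintro rfl
  exact h hx

/-- The words that arise from a word without repetitions by doubling a letter `0`, indexed by the
letter that is doubled. -/
theorem dup_map {k : ℕ} (l : Fin k → ℕ) (u : List (Fin k)) (hu : u.Nodup) :
    dup K (u.map l) = (u.map fun y => if l y = 0 then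
      sgn K (u.idxOf y) • Finsupp.single (dupAt l y u) 1 else 0).sum := by
  induction u with
  | nil => rfl
  | cons x u ih =>
    rw [List.nodup_cons] at hu
    rw [List.map_cons, dup, List.map_cons, List.sum_cons, ih hu.2, sub_eq_add_neg]
    congr 1
    · by_cases h : l x = 0
      · rw [if_pos h, if_pos h, List.idxOf_cons_self, Nat.cast_zero, sgn_zero, one_smul, dupAt,
          List.flatMap_cons, if_pos rfl, ← dupAt, dupAt_of_notMem l hu.1, h]
        rfl
      · rw [if_neg h, if_neg h]
    · change -(Finsupp.mapDomain.addMonoidHom (List.cons (l x))) _ = _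
      have hneg : ∀ L : List (List ℕ →₀ K), -L.sum = (L.map Neg.neg).sum := fun L => by
        induction L with
        | nil => simp
        | cons a L ih => rw [List.sum_cons, List.map_cons, List.sum_cons, neg_add, ih]
      rw [map_list_sum, List.map_map, hneg, List.map_map]
      · congr 1
        refine List.map_congr_left fun y hy => ?_
        have hxy : x ≠ y := by rintro rfl; exact hu.1 hy
        simp only [Function.comp_apply]
        split_ifs with h
        · rw [List.idxOf_cons_ne _ hxy, Nat.cast_succ, sgn_add, sgn_one]
          change -Finsupp.mapDomain _ _ = _
          rw [Finsupp.mapDomain_smul, Finsupp.mapDomain_single, dupAt, dupAt, List.flatMap_cons,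
            if_neg hxy]
          simp
        · simp

end duplication

section doubling

variable {K : Type u} [Field K]

/-- Both words `01` and `10`, with equal letters, double the letter for which they are substituted.
-/
theorem map_substWord_pair {k : ℕ} (l : Fin k → ℕ) (y : Fin k) (u : List (Fin k)) (b : Bool) :
    (substWord (n := k) (k := 2) (m := k + 1) rfl y u (Word.pair b).1).map (l ∘ Fin.predAbove y) =
        dupAt l y u := by
  rw [substWord, List.map_flatMap, dupAt]
  refine List.flatMap_congr fun x _ => ?_
  have hin : ∀ t : Fin 2, Fin.predAbove y
      (innerPos (n := k) (k := 2) (m := k + 1) rfl y t) = y := by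
    intro t
    have ht := t.2
    rcases Nat.lt_or_ge (t : ℕ) 1 with h | h
    · rw [Fin.predAbove_of_le_castSucc _ _
          (by rw [Fin.le_def, val_innerPos, Fin.val_castSucc]; omega)]
      ext; rw [Fin.coe_castPred, val_innerPos]; omega
    · rw [Fin.predAbove_of_castSucc_lt _ _
          (by rw [Fin.lt_def, val_innerPos, Fin.val_castSucc]; omega)]
      ext; rw [Fin.val_pred, val_innerPos]; omega
  by_cases hx : x = y
  · subst hx
    rw [substLetter_self, if_pos rfl, List.map_map]
    cases b <;> simp [Word.pair, hin]
  · rw [substLetter_of_ne hx, if_neg hx, List.map_singleton, Function.comp_apply]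
    congr 2
    have h' : (x : ℕ) ≠ y := fun h => hx (Fin.ext h)
    rcases Nat.lt_or_ge (x : ℕ) y with h | h
    · rw [Fin.predAbove_of_le_castSucc _ _ (by
        rw [Fin.le_def, val_outerPos, Fin.val_castSucc]; split_ifs; omega)]
      ext; rw [Fin.coe_castPred, val_outerPos, if_pos h]
    · rw [Fin.predAbove_of_castSucc_lt _ _ (by
        rw [Fin.lt_def, val_outerPos, Fin.val_castSucc]; split_ifs <;> omega)]
      ext; rw [Fin.val_pred, val_outerPos, if_neg (by omega)]; omega

/-- The factor `2` appears because both words of the bracket contribute the same word with the same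
sign. -/
theorem relabel_assComp_bracket {k : ℕ} {q e : ℤ} (he : q + -1 = e) (l : Fin k → ℕ) (y : Fin k)
    (u : Word k q) :
    relabel (l ∘ Fin.predAbove y) (assComp K (m := k + 1) y rfl he (Finsupp.single u 1)
      (assBracket K)) = (2 * sgn K (u.1.idxOf y)) • Finsupp.single (dupAt l y u.1) 1 := by
  rw [assBracket, map_add, assComp_single, assComp_single, map_add, map_smul, map_smul,
    relabel_single, relabel_single]
  have h : ∀ b, (Word.subst (m := k + 1) (d := e) y rfl he u (Word.pair b)).1.map
      (l ∘ Fin.predAbove y) = dupAt l y u.1 := map_substWord_pair l y u.1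
  rw [h, h, ← add_smul, neg_one_mul, sgn_neg]
  congr 1
  ring

/-- Inserting the bracket of two letters `0` into the inputs labelled `0` doubles letters `0`. -/
theorem sum_words_comp_bracket {k : ℕ} {q e : ℤ} (he : q + -1 = e) (X : (LLie K).obj k q)
    (l : Fin k → ℕ) (w : List ℕ) :
    ∑ y : Fin k, (if l y = 0 then
      words ((LLie K).comp (m := k + 1) y rfl he X (bracket K)) (l ∘ Fin.predAbove y) w else 0) =
      2 * wordDiff (fun w => words X l w) w := by
  simp only [words, expand_comp, expand_bracket]
  generalize expand X = A
  induction A using finsupp_induction with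
  | zero => simp [wordDiff_zero]
  | add A B hA hB =>
    simp only [map_add, LinearMap.add_apply, Finsupp.add_apply, wordDiff_add, mul_add, ← hA, ← hB]
    rw [← Finset.sum_add_distrib]
    refine Finset.sum_congr rfl fun y _ => ?_
    split_ifs <;> simp
  | smul c A hA =>
    have : ∀ w, (relabel l (c • A)) w = c • relabel l A w := fun w => by simp
    simp only [this, wordDiff_smul]
    rw [mul_smul_comm, ← hA, Finset.smul_sum]
    refine Finset.sum_congr rfl fun y _ => ?_
    split_ifs <;> simp
  | single u =>
    simp only [relabel_single, wordDiff_single, relabel_assComp_bracket]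
    rw [dup_map l u.1 u.2.1, ← List.sum_toFinset _ u.2.1]
    have : u.1.toFinset = Finset.univ := by ext x; simp [u.mem x]
    rw [this, Finsupp.finsetSum_apply, Finset.mul_sum]
    refine Finset.sum_congr rfl fun y _ => ?_
    split_ifs
    · rw [mul_smul, Finsupp.smul_apply, smul_eq_mul]
    · simp

end doubling

/-! ### Right-normed brackets -/

section rightNormed

variable (K : Type u) [Field K]

/-- The right-normed bracket `{a₀, {a₁, … {a_{k-1}, a_k} … }}`. -/
def lieWord : ∀ k : ℕ, (LLie K).obj (k + 1) (-(k : ℤ))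
  | 0 => (LLie K).cast rfl (by simp) (LLie K).one
  | k + 1 => (LLie K).comp (1 : Fin 2) (by omega) (by push_cast; omega) (bracket K) (lieWord k)

variable {K}

/-- Inserting a right-normed bracket in the innermost input of another one gives a right-normed
bracket. -/
theorem lieWord_comp_last {a b c m : ℕ} {d : ℤ} (hm : a + 1 + (b + 1) = m + 1)
    (hd : -(a : ℤ) + -(b : ℤ) = d) (hc : a + b = c) :
    (LLie K).comp (Fin.last a) hm hd (lieWord K a) (lieWord K b) =
      (LLie K).cast (by omega) (by omega) (lieWord K c) := by
  induction a generalizing c m d with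
  | zero =>
    obtain rfl : b = c := by omega
    obtain rfl : m = b + 1 := by omega
    obtain rfl : d = -(b : ℤ) := by simpa using hd.symm
    rw [lieWord, OperadData.comp_cast_left]
    exact (LLie K).one_comp (lieWord K b)
  | succ a ih =>
    obtain ⟨c, rfl⟩ : ∃ c', c = c' + 1 := ⟨c - 1, by omega⟩
    obtain ⟨m, rfl⟩ : ∃ m', m = m' + 1 := ⟨m - 1, by omega⟩
    rw [lieWord, ← (LLie K).comp_assoc (1 : Fin 2) (Fin.last a) (Fin.last (a + 1)) (by omega) hm
      (by omega : a + 1 + (b + 1) = m + 1) (by omega) (by push_cast; omega) hd rfl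
      (by push_cast at hd ⊢; omega) (bracket K) (lieWord K a) (lieWord K b)
      (by simp [add_comm]), ih _ rfl (by omega : a + b = c), OperadData.comp_cast_right, lieWord,
      OperadData.cast_comp]

/-- The right-normed brackets with innermost input `y`. -/
def IsRightNormed {k : ℕ} {q : ℤ} (y : Fin k) (X : (LLie K).obj k q) : Prop :=
  ∃ (a : ℕ) (τ : Fin (a + 1) ≃ Fin k) (h : -(a : ℤ) = q), τ (Fin.last a) = y ∧
    X = (LLie K).act τ ((LLie K).cast rfl h (lieWord K a))

variable (K) in
/-- The span of the right-normed brackets with innermost input `y`. -/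
def rightNormed {k : ℕ} (q : ℤ) (y : Fin k) : Submodule K ((LLie K).obj k q) :=
  Submodule.span K {X | IsRightNormed y X}

theorem lieWord_mem (a : ℕ) : lieWord K a ∈ rightNormed K (-(a : ℤ)) (Fin.last a) :=
  Submodule.subset_span ⟨a, Equiv.refl _, rfl, rfl, ((LLie K).act_refl _).symm⟩

theorem mem_rightNormed_of_val {k : ℕ} {q : ℤ} {y y' : Fin k} {X : (LLie K).obj k q}
    (h : X ∈ rightNormed K q y) (hy : (y : ℕ) = y') : X ∈ rightNormed K q y' := by
  obtain rfl : y = y' := Fin.ext hy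
  exact h

theorem act_mem_rightNormed {k k' : ℕ} {q : ℤ} {y : Fin k} {X : (LLie K).obj k q}
    (h : X ∈ rightNormed K q y) (σ : Fin k ≃ Fin k') :
    (LLie K).act σ X ∈ rightNormed K q (σ y) := by
  induction h using Submodule.span_induction with
  | mem X hX =>
    obtain ⟨a, τ, h, rfl, rfl⟩ := hX
    exact Submodule.subset_span ⟨a, τ.trans σ, h, rfl, ((LLie K).act_trans _ _ _).symm⟩
  | zero => rw [map_zero]; exact zero_mem _
  | add X Y _ _ hX hY => rw [map_add]; exact add_mem hX hY
  | smul c X _ hX => rw [map_smul]; exact Submodule.smul_mem _ _ hX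

theorem comp_mem_rightNormed {n k m : ℕ} {p q d : ℤ} {i : Fin n} {y : Fin k} (hm : n + k = m + 1)
    (hd : p + q = d) {X : (LLie K).obj n p} {Y : (LLie K).obj k q}
    (hX : X ∈ rightNormed K p i) (hY : Y ∈ rightNormed K q y) :
    (LLie K).comp i hm hd X Y ∈ rightNormed K d (innerPos hm i y) := by
  induction hX using Submodule.span_induction with
  | zero => rw [map_zero]; exact zero_mem _
  | add X X' _ _ hX hX' => rw [map_add]; exact add_mem hX hX'
  | smul c X _ hX => rw [map_smul]; exact Submodule.smul_mem _ _ hX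
  | mem X hX =>
  induction hY using Submodule.span_induction with
  | zero => rw [map_zero]; exact zero_mem _
  | add Y Y' _ _ hY hY' => rw [map_add]; exact add_mem hY hY'
  | smul c Y _ hY => rw [map_smul]; exact Submodule.smul_mem _ _ hY
  | mem Y hY =>
  obtain ⟨a, τ, rfl, rfl, rfl⟩ := hX
  obtain ⟨b, σ, rfl, rfl, rfl⟩ := hY
  have h0 : a + 1 + (b + 1) = (a + b + 1) + 1 := by omega
  rw [Collection.cast_rfl, Collection.cast_rfl, (LLie K).comp_act_act (Fin.last a) h0,
    lieWord_comp_last h0 hd rfl]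
  refine Submodule.subset_span ⟨a + b, _, by push_cast; omega, ?_, rfl⟩
  rw [← insertionCongr_innerPos h0]
  congr 1

theorem bracket_mem : bracket K ∈ rightNormed K (-1) (1 : Fin 2) := by
  have h : lieWord K 1 = bracket K := by
    rw [lieWord, lieWord, OperadData.comp_cast_right]
    exact (LLie K).comp_one 1 (bracket K)
  rw [← h]
  exact lieWord_mem 1

/-- The Jacobi identity, in right-normed form. -/
theorem bracket_comp_zero : (LLie K).comp (m := 3) (d := -2) (0 : Fin 2) (by norm_num)
    (by norm_num) (bracket K) (bracket K) =
      -((LLie K).comp (m := 3) (d := -2) (1 : Fin 2) (by norm_num) (by norm_num)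
          (bracket K) (bracket K) +
        (LLie K).act (Equiv.swap 0 1) ((LLie K).comp (m := 3) (d := -2) (1 : Fin 2) (by norm_num)
          (by norm_num) (bracket K) (bracket K))) := by
  have h0 := LLie.jacobi (K := K)
  have h1 := bracket_comp_one (LLie K) (bracket K) (act_bracket K)
  have e2 : (finRotate 3).trans (Equiv.swap 0 1 : Fin 3 ≃ Fin 3) =
    ((Equiv.swap 0 1 : Fin 3 ≃ Fin 3).trans ((finRotate 3).trans (finRotate 3))) := by decide
  have e3 : (LLie K).act (Equiv.swap 0 1 : Fin 3 ≃ Fin 3) ((LLie K).comp (m := 3) (d := -2)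
      (0 : Fin 2) (by norm_num) (by norm_num) (bracket K) (bracket K)) = (LLie K).comp (m := 3)
      (d := -2) (0 : Fin 2) (by norm_num) (by norm_num) (bracket K) (bracket K) := by
    have h := (LLie K).comp_act (m := 3) (m' := 3) (d := -2) (0 : Fin 2) (by norm_num)
      (by norm_num) (by norm_num) (Equiv.refl _) (Equiv.swap 0 1) (Equiv.swap (0 : Fin 3) 1)
      (bracket K) (bracket K) (by decide) (by decide)
    rw [act_bracket, act_bracket] at h
    exact h.symm
  rw [h1, ← (LLie K).act_trans, e2, (LLie K).act_trans, e3]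
  exact eq_neg_of_add_eq_zero_left h0

/-- The bracket `{X, a}` of a right-normed bracket `X` and an input `a` is a combination of
right-normed brackets with innermost input `a`. -/
theorem bracket_comp_lieWord_mem (a : ℕ) {m : ℕ} {d : ℤ} (hm : 2 + (a + 1) = m + 1)
    (hd : -1 + -(a : ℤ) = d) (y : Fin m) (hy : (y : ℕ) = a + 1) :
    (LLie K).comp (0 : Fin 2) hm hd (bracket K) (lieWord K a) ∈ rightNormed K d y := by
  induction a generalizing m d with
  | zero =>
    obtain rfl : m = 2 := by omega
    obtain rfl : d = -1 := by simpa using hd.symm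
    obtain rfl : y = 1 := Fin.ext hy
    rw [lieWord, OperadData.comp_cast_right]
    have h : (LLie K).comp (m := 2) (d := -1) (0 : Fin 2) rfl (by norm_num) (bracket K)
      (LLie K).one = bracket K := (LLie K).comp_one 0 (bracket K)
    exact h.symm ▸ bracket_mem
  | succ a ih =>
    obtain rfl : m = a + 3 := by omega
    obtain rfl : d = -2 + -(a : ℤ) := by push_cast at hd; omega
    have h1 : (LLie K).comp (m := a + 2) (d := -1 + -(a : ℤ)) (0 : Fin 2) (by omega) rfl
        (bracket K) (lieWord K a) ∈ rightNormed K (-1 + -(a : ℤ)) (Fin.last (a + 1)) :=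
      ih _ rfl _ rfl
    -- `{{a₀, X}, a} = -{a₀, {X, a}} - {X, {a₀, a}}` up to sign, where `{X, -}` is known by
    -- induction in both terms.
    rw [lieWord, (LLie K).comp_assoc (0 : Fin 2) (1 : Fin 2) (1 : Fin 3) (by norm_num) (by omega)
      (by omega) hm (by norm_num : (-1 : ℤ) + -1 = -2) rfl (by push_cast; omega) hd (bracket K)
      (bracket K) (lieWord K a) rfl, bracket_comp_zero, map_neg, LinearMap.neg_apply]
    refine neg_mem ?_
    rw [map_add, LinearMap.add_apply]
    refine add_mem ?_ ?_
    · rw [← (LLie K).comp_assoc (m₂ := a + 2) (d₂ := -1 + -(a : ℤ)) (1 : Fin 2) (0 : Fin 2)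
        (1 : Fin 3) (by norm_num) (by omega) (by omega) (by omega)
        (by norm_num : (-1 : ℤ) + -1 = -2) rfl rfl (by omega) (bracket K) (bracket K)
        (lieWord K a) rfl]
      refine mem_rightNormed_of_val (comp_mem_rightNormed _ _ bracket_mem h1) ?_
      rw [val_innerPos, hy]
      simp [add_comm]
    · have h2 := (LLie K).comp_act_act (m := a + 3) (m' := a + 3) (0 : Fin 3) (by omega) (by omega)
        (rfl : -2 + -(a : ℤ) = _) (Equiv.swap 0 1) (Equiv.refl _)
        ((LLie K).comp (m := 3) (d := -2) (1 : Fin 2) (by norm_num) (by norm_num)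
          (bracket K) (bracket K)) (lieWord K a)
      rw [(LLie K).act_refl, Equiv.swap_apply_left] at h2
      rw [h2]
      have h3 := (LLie K).comp_comm (m := a + 3) (0 : Fin 2) (1 : Fin 2) (Fin.last (a + 1))
        (0 : Fin 3) (by omega : 2 + (a + 1) = a + 2 + 1) (by omega) (by norm_num) (by omega)
        (rfl : -1 + -(a : ℤ) = _) (by omega : -1 + -(a : ℤ) + -1 = -2 + -(a : ℤ))
        (by norm_num : (-1 : ℤ) + -1 = -2) rfl (bracket K) (lieWord K a) (bracket K) (by decide)
        (by simp; omega) rfl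
      have h4 := congrArg (sgn K (-(a : ℤ) * -1) • ·) h3
      simp only [smul_smul, sgn_mul_self, one_smul] at h4
      rw [← h4]
      have h5 : y = insertionCongr (n := 3) (k := a + 1) (m := a + 3) (n' := 3) (k' := a + 1)
          (m' := a + 3) (by omega) (by omega) 0 (Equiv.swap 0 1) (Equiv.refl _)
          (innerPos (n := a + 2) (k := 2) (by omega) (Fin.last (a + 1)) 1) := by
        have h6 : innerPos (n := a + 2) (k := 2) (m := a + 3) (by omega) (Fin.last (a + 1)) 1 =
            outerPos (n := 3) (k := a + 1) (by omega) 0 2 (by decide) := by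
          ext; rw [val_innerPos, val_outerPos]; simp; omega
        rw [h6, insertionCongr_outerPos]
        ext
        rw [val_outerPos, Equiv.swap_apply_of_ne_of_ne (by decide) (by decide),
          Equiv.swap_apply_left]
        simp; omega
      rw [h5]
      exact act_mem_rightNormed (Submodule.smul_mem _ _
        (comp_mem_rightNormed _ _ h1 bracket_mem)) _

/-- The same for an arbitrary combination of right-normed brackets. -/
theorem bracket_comp_mem {k m : ℕ} {q d : ℤ} (hm : 2 + k = m + 1) (hd : -1 + q = d) {y : Fin k}
    {Y : (LLie K).obj k q} (hY : Y ∈ rightNormed K q y) (z : Fin m) (hz : (z : ℕ) = k) :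
    (LLie K).comp (0 : Fin 2) hm hd (bracket K) Y ∈ rightNormed K d z := by
  induction hY using Submodule.span_induction with
  | zero => rw [map_zero]; exact zero_mem _
  | add Y Y' _ _ hY hY' => rw [map_add]; exact add_mem hY hY'
  | smul c Y _ hY => rw [map_smul]; exact Submodule.smul_mem _ _ hY
  | mem Y hY =>
  obtain ⟨a, σ, rfl, rfl, rfl⟩ := hY
  have h0 : 2 + (a + 1) = (a + 2) + 1 := by omega
  have hk : a + 1 = k := by simpa using Fintype.card_congr σ
  have h1 := (LLie K).comp_act_act (0 : Fin 2) h0 hm hd (Equiv.refl _) σ (bracket K)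
    (lieWord K a)
  rw [(LLie K).act_refl] at h1
  rw [Collection.cast_rfl]
  refine h1 ▸ mem_rightNormed_of_val (act_mem_rightNormed
    (bracket_comp_lieWord_mem a h0 hd (Fin.last (a + 1)) rfl) _) ?_
  have h2 : Fin.last (a + 1) = outerPos h0 0 1 (by decide) := by
    ext; rw [val_outerPos]; simp
  rw [h2, insertionCongr_outerPos, val_outerPos, hz]
  simp; try omega

/-- An insertion in an input of a right-normed bracket other than the innermost one is a
combination of right-normed brackets with the same innermost input. -/
theorem lieWord_comp_mem (a : ℕ) (j : Fin (a + 1)) (hj : j ≠ Fin.last a) {k m : ℕ} {q d : ℤ}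
    (hm : a + 1 + k = m + 1) (hd : -(a : ℤ) + q = d) {y : Fin k} {Y : (LLie K).obj k q}
    (hY : Y ∈ rightNormed K q y) (z : Fin m) (hz : (z : ℕ) + 1 = m) :
    (LLie K).comp j hm hd (lieWord K a) Y ∈ rightNormed K d z := by
  induction a generalizing m d with
  | zero => exact absurd (Fin.ext (by simp)) hj
  | succ a ih =>
    have hy := y.2
    rcases Fin.eq_zero_or_eq_succ j with rfl | ⟨j, rfl⟩
    -- If the input is the outermost one, the result is `{Y, X}` with `X` right-normed, and `{Y,
    -- -}` is a combination of right-normed brackets whose innermost input is the one of `X`.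
    · have h1 := (LLie K).comp_comm (0 : Fin 2) (1 : Fin 2) (⟨k, by omega⟩ : Fin (k + 1))
        (0 : Fin (a + 2)) (by omega : 2 + k = k + 1 + 1) (by omega : k + 1 + (a + 1) = m + 1)
        (by omega) hm rfl (by push_cast at hd; omega : -1 + q + -(a : ℤ) = d)
        (by push_cast; omega) hd (bracket K) Y (lieWord K a) (by decide) (by simp; omega) rfl
      have h4 := congrArg (sgn K (q * -(a : ℤ)) • ·) h1
      simp only [smul_smul, sgn_mul_self, one_smul] at h4
      rw [lieWord]
      refine h4 ▸ Submodule.smul_mem _ _ (mem_rightNormed_of_val (comp_mem_rightNormed _ _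
        (bracket_comp_mem _ _ hY _ rfl) (lieWord_mem a)) ?_)
      rw [val_innerPos]; simp; omega
    · have hj' : j ≠ Fin.last a := fun h => hj (by rw [h]; rfl)
      obtain ⟨m, rfl⟩ : ∃ m', m = m' + 1 := ⟨m - 1, by omega⟩
      have h2 := ih j hj' (by omega : a + 1 + k = m + 1) rfl ⟨m - 1, by omega⟩ (by simp; omega)
      rw [lieWord, ← (LLie K).comp_assoc (1 : Fin 2) j j.succ (by omega) hm
        (by omega : a + 1 + k = m + 1) (by omega) (by push_cast; omega) hd rfl
        (by push_cast at hd ⊢; omega) (bracket K) (lieWord K a) Y (by simp [add_comm])]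
      refine mem_rightNormed_of_val (comp_mem_rightNormed _ _ bracket_mem h2) ?_
      rw [val_innerPos]; simp; omega

theorem LLie.eq_zero_of_arity_zero {k : ℕ} {q : ℤ} (X : (LLie K).obj k q) (hk : k = 0) :
    X = 0 := by
  refine LLie.induction (C := fun {k _} X => k = 0 → X = 0) ?_ ?_ ?_ ?_ ?_ ?_ ?_ ?_ X hk
  · intro h; omega
  · intro h; omega
  · intros; rfl
  · intro n d X Y hX hY h; rw [hX h, hY h, add_zero]
  · intro n d c X hX h; rw [hX h, smul_zero]
  · intro m n d σ X hX h
    have := Fintype.card_congr σ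
    rw [Fintype.card_fin, Fintype.card_fin] at this
    rw [hX (by omega), map_zero]
  · intro n k m p q d i hm hd X Y hX hY h
    have := i.2
    rw [hY (by omega), map_zero]
  · intro n p q h X hX _; rw [LLie.diff_eq_zero]

/-- The operad `ΛLie` is spanned by right-normed brackets with a prescribed innermost input. -/
theorem LLie.mem_rightNormed {k : ℕ} {q : ℤ} (X : (LLie K).obj k q) (y : Fin k) :
    X ∈ rightNormed K q y := by
  refine LLie.induction (C := fun {k q} X => ∀ y : Fin k, X ∈ rightNormed K q y)
    ?_ ?_ ?_ ?_ ?_ ?_ ?_ ?_ X y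
  · intro y
    have := act_mem_rightNormed (bracket_mem (K := K)) (Equiv.swap 1 y)
    rwa [act_bracket, Equiv.swap_apply_left] at this
  · intro y
    obtain rfl : y = Fin.last 0 := Subsingleton.elim _ _
    exact lieWord_mem 0
  · intros; exact zero_mem _
  · intro n d X Y hX hY y; exact add_mem (hX y) (hY y)
  · intro n d c X hX y; exact Submodule.smul_mem _ _ (hX y)
  · intro m n d σ X hX y
    have := act_mem_rightNormed (hX (σ.symm y)) σ
    rwa [Equiv.apply_symm_apply] at this
  · intro n k m p q d i hm hd X Y hX hY z
    -- The innermost input of the composite is prescribed as an input of `X` or of `Y`, and the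
    -- factor it belongs to is written with this input innermost.
    rcases outerPos_or_innerPos hm i z with ⟨x, hx, rfl⟩ | ⟨y, rfl⟩
    · rcases Nat.eq_zero_or_pos k with hk | hk
      · rw [LLie.eq_zero_of_arity_zero Y hk, map_zero]; exact zero_mem _
      have hX' := hX x
      clear hX
      induction hX' using Submodule.span_induction with
      | zero => rw [map_zero]; exact zero_mem _
      | add X X' _ _ hX hX' => rw [map_add]; exact add_mem hX hX'
      | smul c X _ hX => rw [map_smul]; exact Submodule.smul_mem _ _ hX
      | mem X hX =>
      obtain ⟨a, τ, rfl, rfl, rfl⟩ := hX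
      obtain ⟨j, rfl⟩ := τ.surjective i
      have hj : j ≠ Fin.last a := fun h => hx (by rw [h])
      have h0 : a + 1 + k = (a + k) + 1 := by omega
      have h1 := (LLie K).comp_act_act j h0 hm hd τ (Equiv.refl _) (lieWord K a) Y
      rw [(LLie K).act_refl] at h1
      rw [Collection.cast_rfl, h1, ← insertionCongr_outerPos h0 hm j τ (Equiv.refl _)
        (Fin.last a) hj.symm]
      refine act_mem_rightNormed (lieWord_comp_mem a j hj h0 hd (hY ⟨0, hk⟩) _ ?_) _
      have := j.2
      have h3 : (j : ℕ) ≠ a := fun h => hj (Fin.ext h)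
      rw [val_outerPos, if_neg (by simp; omega)]
      simp; omega
    · exact comp_mem_rightNormed hm hd (hX i) (hY y)
  · intro n p q h X hX y; rw [LLie.diff_eq_zero]; exact zero_mem _

end rightNormed

section coefficients

variable {K : Type u} [Field K]

theorem words_lieWord_zero (l : Fin 1 → ℕ) : words (lieWord K 0) l = Finsupp.single [l 0] 1 := by
  have h : expand (lieWord K 0) = Finsupp.single Word.one 1 := (toAss K).app_one
  rw [words, h, relabel_single]
  rfl

/-- The expansion `{a₀, X} = ± a₀ X + X a₀` of a bracket. -/
theorem words_lieWord_succ (k : ℕ) (l : Fin (k + 2) → ℕ) :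
    words (lieWord K (k + 1)) l =
      sgn K k • Finsupp.mapDomain (List.cons (l 0)) (words (lieWord K k) (l ∘ Fin.succ)) +
        Finsupp.mapDomain (· ++ [l 0]) (words (lieWord K k) (l ∘ Fin.succ)) := by
  rw [words, lieWord, expand_comp, expand_bracket, words]
  generalize expand (lieWord K k) = A
  induction A using finsupp_induction with
  | zero => simp
  | add A B hA hB =>
    rw [map_add, map_add, hA, hB, map_add, Finsupp.mapDomain_add, Finsupp.mapDomain_add, smul_add]
    abel
  | smul c A hA =>
    rw [map_smul, map_smul, hA, map_smul, Finsupp.mapDomain_smul, Finsupp.mapDomain_smul, smul_add,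
      smul_comm]
  | single u =>
    have h1 : ∀ x : Fin (k + 1), innerPos (n := 2) (m := k + 2) (by omega) 1 x = x.succ :=
      fun x => by ext; rw [val_innerPos]; simp [add_comm]
    have h0 : ∀ h, outerPos (n := 2) (k := k + 1) (m := k + 2) (by omega) 1 0 h = 0 := fun h => by
      ext; rw [val_outerPos]; simp
    have h2 : substLetter (n := 2) (k := k + 1) (m := k + 2) (by omega) 1 u.1 1 =
        u.1.map Fin.succ := by
      rw [substLetter_self]; exact List.map_congr_left fun x _ => h1 x
    have h3 : substLetter (n := 2) (k := k + 1) (m := k + 2) (by omega) 1 u.1 0 = [0] := by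
      rw [substLetter_of_ne (by decide), h0]
    have e1 : (Word.pair true).1.idxOf 1 = 1 := rfl
    have e2 : (Word.pair false).1.idxOf 1 = 0 := rfl
    rw [assBracket, map_add, LinearMap.add_apply, assComp_single, assComp_single, map_add,
      map_smul, map_smul, relabel_single, relabel_single, relabel_single,
      Finsupp.mapDomain_single, Finsupp.mapDomain_single, e1, e2]
    congr 1
    · rw [Nat.cast_one, mul_one, sgn_neg]
      congr 2
      change (substWord _ 1 [0, 1] u.1).map l = _
      rw [substWord, List.flatMap_cons, List.flatMap_cons, List.flatMap_nil, h2, h3]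
      simp
    · rw [Nat.cast_zero, mul_zero, sgn_zero, one_smul]
      congr 1
      change (substWord _ 1 [1, 0] u.1).map l = _
      rw [substWord, List.flatMap_cons, List.flatMap_cons, List.flatMap_nil, h2, h3]
      simp

variable (K) in
/-- The coefficient of the word `a₀ a₁ … a_k` in the right-normed bracket of its letters. -/
def lieCoeff : ℕ → K
  | 0 => 1
  | k + 1 => sgn K k * lieCoeff k

theorem lieCoeff_ne_zero (k : ℕ) : lieCoeff K k ≠ 0 := by
  induction k with
  | zero => exact one_ne_zero
  | succ k ih => exact mul_ne_zero (sgn_ne_zero K _) ih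

/-- If the last letter of a right-normed bracket differs from the other letters, then the only
word with this last letter in its expansion is `a₀ a₁ … a_k`. -/
theorem words_lieWord (k : ℕ) (l : Fin (k + 1) → ℕ)
    (hl : ∀ x, x ≠ Fin.last k → l x ≠ l (Fin.last k))
    (w : List ℕ) (hw : w.getLast? = some (l (Fin.last k))) :
    words (lieWord K k) l w = if w = List.ofFn l then lieCoeff K k else 0 := by
  induction k generalizing w with
  | zero =>
    rw [words_lieWord_zero, Finsupp.single_apply, List.ofFn_succ, List.ofFn_zero]
    simp only [lieCoeff, eq_comm]
  | succ k ih =>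
    have h0 : l 0 ≠ l (Fin.last (k + 1)) := hl 0 (by simp [Fin.ext_iff])
    rw [words_lieWord_succ, Finsupp.add_apply, Finsupp.smul_apply]
    -- In `± a₀ X + X a₀` the words of the second summand end with the letter `a₀`.
    rw [Finsupp.mapDomain_of_notMem_range (f := (· ++ [l 0])) _ w, add_zero]
    · rcases w with _ | ⟨x, w⟩
      · simp at hw
      rw [List.ofFn_succ]
      by_cases hx : x = l 0
      · subst hx
        rw [Finsupp.mapDomain_apply List.cons_injective]
        have hw' : w ≠ [] := by
          rintro rfl
          simp at hw
          exact h0 hw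
        rw [List.getLast?_cons_of_ne_nil hw'] at hw
        rw [ih (l ∘ Fin.succ) (fun x hx => hl x.succ fun h => hx (Fin.succ_injective _ h)) w hw]
        simp only [List.cons.injEq, true_and, lieCoeff, smul_eq_mul, mul_ite, mul_zero]
        rfl
      · rw [Finsupp.mapDomain_of_notMem_range, smul_zero, if_neg]
        · intro h; rw [List.cons.injEq] at h; exact hx h.1
        · rintro ⟨y, hy⟩; rw [List.cons.injEq] at hy; exact hx hy.1.symm
    · rintro ⟨y, rfl⟩
      rw [List.getLast?_concat] at hw
      exact h0 (Option.some.inj hw)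

theorem words_lieWord_one_const (l : Fin 2 → ℕ) (hl : ∀ x, l x = 0) :
    words (lieWord K 1) l = Finsupp.single [0, 0] 2 := by
  rw [words_lieWord_succ, words_lieWord_zero, Finsupp.mapDomain_single, Finsupp.mapDomain_single]
  simp only [hl, Function.comp_apply, Nat.cast_zero, sgn_zero, one_smul]
  simp only [List.cons_append, List.nil_append]
  rw [← Finsupp.single_add]
  norm_num

/-- Brackets of at least three equal letters vanish. -/
theorem words_lieWord_const (k : ℕ) (l : Fin (k + 3) → ℕ) (hl : ∀ x, l x = 0) :
    words (lieWord K (k + 2)) l = 0 := by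
  induction k with
  -- The bracket of two letters `0` expands to `2 ⬝ 00`, an element of odd degree, so its two
  -- products with the letter `0` cancel.
  | zero =>
    rw [words_lieWord_succ, words_lieWord_one_const (l ∘ Fin.succ) fun x => hl _,
        Finsupp.mapDomain_single,
      Finsupp.mapDomain_single]
    simp [hl, sgn_one]
  | succ k ih =>
    rw [words_lieWord_succ, ih (l ∘ Fin.succ) fun x => hl _]
    simp

end coefficients

section symmetrization

variable {K : Type u} [Field K]

theorem sum_act_comp (k : ℕ) {q d : ℤ} (hd : -1 + q = d) (X : (LLie K).obj k q)
    (τ : Fin k ≃ Fin k) :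
    (LLie K).comp (m := k + 1) (1 : Fin 2) (by omega) hd (bracket K) ((LLie K).act τ X) =
      (LLie K).act (succEquiv τ) ((LLie K).comp (m := k + 1) (1 : Fin 2) (by omega) hd
        (bracket K) X) := by
  have h1 : ∀ y : Fin k, innerPos (n := 2) (m := k + 1) (by omega) 1 y = y.succ :=
    fun x => by ext; rw [val_innerPos]; simp [add_comm]
  refine (LLie K).comp_act_right (1 : Fin 2) _ _ hd τ (succEquiv τ) (bracket K) X ?_ ?_
  · intro x hx
    obtain rfl : x = 0 := by omega
    have h0 : outerPos (n := 2) (k := k) (m := k + 1) (by omega) 1 0 hx = 0 := by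
      ext; rw [val_outerPos]; simp
    rw [h0, succEquiv_zero]
  · intro y
    rw [h1, h1, succEquiv_succ]

/-- The total symmetrization of a bracket with at least three inputs vanishes. -/
theorem sum_act_lieWord [CharZero K] (k : ℕ) :
    ∑ τ : Fin (k + 3) ≃ Fin (k + 3), (LLie K).act τ (lieWord K (k + 2)) = 0 := by
  induction k with
  | zero =>
    have h : lieWord K 2 = (LLie K).comp (m := 3) (d := -2) (1 : Fin 2) (by norm_num)
        (by norm_num) (bracket K) (bracket K) := by
      have h : lieWord K 1 = bracket K := by
        rw [lieWord, lieWord, OperadData.comp_cast_right]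
        exact (LLie K).comp_one 1 (bracket K)
      rw [lieWord, h]
    have h1 := bracket_comp_one (LLie K) (bracket K) (act_bracket K)
    -- The three terms of the Jacobi identity have the same symmetrization, three times which is
    -- therefore zero.
    set F : (LLie K).obj 3 (-2) → (LLie K).obj 3 (-2) := fun X =>
      ∑ τ : Fin 3 ≃ Fin 3, (LLie K).act τ X with hF
    have hadd : ∀ X Y, F (X + Y) = F X + F Y := fun X Y => by
      simp only [hF, map_add, Finset.sum_add_distrib]
    have hact : ∀ σ X, F ((LLie K).act σ X) = F X := fun σ X => by
      simp only [hF, ← (LLie K).act_trans]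
      exact Fintype.sum_equiv (Equiv.mulRight σ) _ _ fun τ => rfl
    have h0 := congrArg F (LLie.jacobi (K := K))
    rw [hadd, hadd, hact, hact] at h0
    have hz : F 0 = 0 := by simp [hF]
    rw [hz] at h0
    change F (lieWord K 2) = 0
    rw [h, h1, hact]
    have h3 : (3 : K) • F ((LLie K).comp (m := 3) (d := -2) (0 : Fin 2) (by norm_num)
        (by norm_num) (bracket K) (bracket K)) = 0 := by
      rw [← h0]; module
    exact (smul_eq_zero.1 h3).resolve_left (by norm_num)
  | succ k ih =>
    -- By induction, the sum over the permutations that fix the outermost input vanishes.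
    -- Symmetrizing once more multiplies the total symmetrization by the number of these
    -- permutations.
    set X := lieWord K (k + 3) with hX
    have h1 : ∑ τ : Fin (k + 3) ≃ Fin (k + 3), (LLie K).act (succEquiv τ) X = 0 := by
      have h2 := congrArg ((LLie K).comp (m := k + 4) (d := -((k + 3 : ℕ) : ℤ)) (1 : Fin 2)
        (by omega) (by push_cast; omega) (bracket K)) ih
      rw [map_sum, map_zero] at h2
      rw [← h2]
      refine Finset.sum_congr rfl fun τ _ => ?_
      exact (sum_act_comp _ _ _ τ).symm
    have h2 := congrArg (fun Y => ∑ τ : Fin (k + 4) ≃ Fin (k + 4), (LLie K).act τ Y) h1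
    simp only [map_sum, map_zero, Finset.sum_const_zero] at h2
    rw [Finset.sum_comm] at h2
    have h3 : ∀ σ : Fin (k + 4) ≃ Fin (k + 4),
        ∑ τ : Fin (k + 4) ≃ Fin (k + 4), (LLie K).act τ ((LLie K).act σ X) =
          ∑ τ : Fin (k + 4) ≃ Fin (k + 4), (LLie K).act τ X := fun σ => by
      simp only [← (LLie K).act_trans]
      exact Fintype.sum_equiv (Equiv.mulRight σ) _ _ fun τ => rfl
    rw [Finset.sum_congr rfl fun τ _ => h3 _, Finset.sum_const, ← Nat.cast_smul_eq_nsmul K,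
      smul_eq_zero] at h2
    rcases h2 with h2 | h2
    · rw [Nat.cast_eq_zero, Finset.card_eq_zero] at h2
      exact absurd h2 Finset.univ_nonempty.ne_empty
    · exact h2

end symmetrization

/-! ### Koszul signs -/

section koszul

variable (K : Type u) [Field K]

/-- The Koszul sign of a bijection `ρ`, for the degrees `q`. -/
def koszul {m r : ℕ} (ρ : Fin m ≃ Fin r) (q : Fin r → ℤ) : K :=
  ∏ x : Fin m, ∏ y : Fin m, if x < y ∧ ρ y < ρ x then sgn K (q (ρ x) * q (ρ y)) else 1

variable {K}

/-- Collects the factors of a product over ordered pairs by unordered pairs. -/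
theorem prod_pairs {m : ℕ} (F : Fin m → Fin m → K) (hF : ∀ x, F x x = 1) :
    ∏ x, ∏ y, F x y = ∏ x, ∏ y, if x < y then F x y * F y x else 1 := by
  have h : ∀ x y, F x y = (if x < y then F x y else 1) * (if y < x then F x y else 1) := by
    intro x y
    rcases lt_trichotomy x y with h | rfl | h
    · rw [if_pos h, if_neg h.not_gt, mul_one]
    · simp [hF]
    · rw [if_neg h.not_gt, if_pos h, one_mul]
  calc ∏ x, ∏ y, F x y = ∏ x, ∏ y, (if x < y then F x y else 1) * (if y < x then F x y else 1) :=
        Finset.prod_congr rfl fun x _ => Finset.prod_congr rfl fun y _ => h x y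
    _ = (∏ x, ∏ y, if x < y then F x y else 1) * ∏ x, ∏ y, if y < x then F x y else 1 := by
        simp only [Finset.prod_mul_distrib]
    _ = (∏ x, ∏ y, if x < y then F x y else 1) * ∏ x, ∏ y, if x < y then F y x else 1 := by
        rw [Finset.prod_comm (f := fun x y => if y < x then F x y else 1)]
    _ = _ := by
        simp only [← Finset.prod_mul_distrib]
        refine Finset.prod_congr rfl fun x _ => Finset.prod_congr rfl fun y _ => ?_
        split_ifs <;> simp

/-- The Koszul signs form a cocycle. Both sides are compared pair by pair, see `prod_pairs`. -/
theorem koszul_trans {m r r' : ℕ} (ρ : Fin m ≃ Fin r) (τ : Fin r ≃ Fin r') (q : Fin r' → ℤ) :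
    koszul K (ρ.trans τ) q = koszul K τ q * koszul K ρ (q ∘ τ) := by
  have h : koszul K τ q = ∏ x, ∏ y, if ρ x < ρ y ∧ τ (ρ y) < τ (ρ x) then
      sgn K (q (τ (ρ x)) * q (τ (ρ y))) else 1 := by
    rw [koszul, ← ρ.prod_comp]
    refine Finset.prod_congr rfl fun x _ => ?_
    rw [← ρ.prod_comp]
  have e1 := prod_pairs (fun x y : Fin m => if x < y ∧ τ (ρ y) < τ (ρ x) then
      sgn K (q (τ (ρ x)) * q (τ (ρ y))) else 1) (by simp)
  have e2 := prod_pairs (fun x y : Fin m => if ρ x < ρ y ∧ τ (ρ y) < τ (ρ x) then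
      sgn K (q (τ (ρ x)) * q (τ (ρ y))) else 1) (by simp)
  have e3 := prod_pairs (fun x y : Fin m => if x < y ∧ ρ y < ρ x then
      sgn K (q (τ (ρ x)) * q (τ (ρ y))) else 1) (by simp)
  refine e1.trans ((?_ : _ = _).trans (congrArg₂ (· * ·) (h.trans e2) e3).symm)
  simp only [← Finset.prod_mul_distrib]
  refine Finset.prod_congr rfl fun x _ => Finset.prod_congr rfl fun y _ => ?_
  by_cases hxy : x < y
  · have h1 : ¬ y < x := hxy.not_gt
    simp only [hxy, h1, if_true, false_and, if_false, mul_one, true_and]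
    rw [mul_comm (q (τ (ρ y))) (q (τ (ρ x)))]
    have hS := sgn_mul_self K (q (τ (ρ x)) * q (τ (ρ y)))
    rcases lt_or_gt_of_ne (ρ.injective.ne hxy.ne) with h2 | h2
    · simp [h2, h2.not_gt]
    · rcases lt_or_gt_of_ne (τ.injective.ne h2.ne) with h3 | h3
      · simp [h2, h3, h2.not_gt, h3.not_gt]
      -- A pair that is inverted by both bijections contributes the square of a sign.
      · simp [h2, h3, h2.not_gt, h3.not_gt, hS]
  · simp [hxy]

/-- The change of the Koszul sign when the degree of the last element is lowered by one. -/
theorem koszul_lower_last {m r : ℕ} (ρ : Fin m ≃ Fin (r + 1)) (q q' : Fin (r + 1) → ℤ)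
    (h : ∀ l, l ≠ Fin.last r → q' l = q l) (hl : q' (Fin.last r) = q (Fin.last r) - 1) :
    koszul K ρ q' = koszul K ρ q *
      ∏ y, if ρ.symm (Fin.last r) < y then sgn K (q (ρ y)) else 1 := by
  have h1 : (∏ y, if ρ.symm (Fin.last r) < y then sgn K (q (ρ y)) else 1) =
      ∏ x, ∏ y, if x = ρ.symm (Fin.last r) then (if x < y then sgn K (q (ρ y)) else 1) else 1 := by
    refine Eq.symm ((Finset.prod_eq_single (ρ.symm (Fin.last r)) ?_ ?_).trans ?_)
    · intro x _ hx; simp only [if_neg hx, Finset.prod_const_one]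
    · simp
    · simp only [if_true]
  rw [h1, koszul, koszul, ← Finset.prod_mul_distrib]
  refine Finset.prod_congr rfl fun x _ => ?_
  rw [← Finset.prod_mul_distrib]
  refine Finset.prod_congr rfl fun y _ => ?_
  by_cases hxy : x < y
  swap
  · simp [hxy]
  by_cases hx : x = ρ.symm (Fin.last r)
  · have hx' : ρ x = Fin.last r := by rw [hx, Equiv.apply_symm_apply]
    have hy' : ρ y ≠ Fin.last r := by rw [← hx']; exact ρ.injective.ne hxy.ne'
    have hlt : ρ y < ρ x := by rw [hx']; exact lt_of_le_of_ne (Fin.le_last _) hy'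
    rw [if_pos ⟨hxy, hlt⟩, if_pos ⟨hxy, hlt⟩, if_pos hx, if_pos hxy, hx', hl, h _ hy', ← sgn_add]
    exact sgn_eq_of_even_sub K ⟨-q (ρ y), by ring⟩
  · rw [if_neg hx, mul_one]
    by_cases hlt : ρ y < ρ x
    · have hx' : ρ x ≠ Fin.last r := fun h => hx (by rw [← h, Equiv.symm_apply_apply])
      have hy' : ρ y ≠ Fin.last r := (hlt.trans_le (Fin.le_last _)).ne
      rw [h _ hx', h _ hy']
    · simp [hlt]

end koszul

/-! ### The coefficients of an operation -/

section coefficients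

variable {K : Type u} [Field K]

/-- Transport along an equality of degrees if there is one, and `0` otherwise. -/
def degCast (A : Collection.{u, v} K) {m : ℕ} (p e : ℤ) : A.obj m p →ₗ[K] A.obj m e :=
  if h : p = e then A.cast rfl h else 0

theorem degCast_self (A : Collection.{u, v} K) {m : ℕ} (p : ℤ) (a : A.obj m p) :
    degCast A p p a = a := by simp [degCast]

theorem act_degCast (A : Collection.{u, v} K) {m n : ℕ} {p e : ℤ} (σ : Fin m ≃ Fin n)
    (a : A.obj m p) : A.act σ (degCast A p e a) = degCast A p e (A.act σ a) := by
  unfold degCast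
  split_ifs with h
  · exact A.act_cast_deg h σ a
  · simp

/-- The sum over all bijections `ρ` of the relabellings of `a` by `ρ⁻¹`, with Koszul signs and
weights `F ρ`. -/
def permSum (A : Collection.{u, v} K) {m r : ℕ} {p : ℤ} (e : ℤ) (q : Fin r → ℤ)
    (F : (Fin m ≃ Fin r) → K) : A.obj r p →ₗ[K] A.obj m e :=
  ∑ ρ : Fin m ≃ Fin r, (koszul K ρ q * F ρ) • (degCast A p e).comp (A.act ρ.symm)

variable (A : Collection.{u, v} K)

theorem permSum_apply {m r : ℕ} {p : ℤ} (e : ℤ) (q : Fin r → ℤ) (F : (Fin m ≃ Fin r) → K)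
    (a : A.obj r p) : permSum A e q F a =
      ∑ ρ : Fin m ≃ Fin r, (koszul K ρ q * F ρ) • degCast A p e (A.act ρ.symm a) := by
  simp [permSum]

theorem permSum_add {m r : ℕ} {p : ℤ} (e : ℤ) (q : Fin r → ℤ) (F G : (Fin m ≃ Fin r) → K)
    (a : A.obj r p) :
    permSum A e q (fun ρ => F ρ + G ρ) a = permSum A e q F a + permSum A e q G a := by
  simp only [permSum_apply, ← Finset.sum_add_distrib, ← add_smul, mul_add]

theorem permSum_smul {m r : ℕ} {p : ℤ} (e : ℤ) (q : Fin r → ℤ) (c : K) (F : (Fin m ≃ Fin r) → K)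
    (a : A.obj r p) : permSum A e q (fun ρ => c * F ρ) a = c • permSum A e q F a := by
  simp only [permSum_apply, Finset.smul_sum, smul_smul, mul_left_comm]

theorem permSum_sum {ι : Type*} (s : Finset ι) {m r : ℕ} {p : ℤ} (e : ℤ) (q : Fin r → ℤ)
    (F : ι → (Fin m ≃ Fin r) → K) (a : A.obj r p) :
    permSum A e q (fun ρ => ∑ i ∈ s, F i ρ) a = ∑ i ∈ s, permSum A e q (F i) a := by
  simp only [permSum_apply, Finset.mul_sum, Finset.sum_smul]
  exact Finset.sum_comm

/-- A relabelling of the operation can be absorbed in the summation over bijections. -/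
theorem permSum_act {m r : ℕ} {p : ℤ} (e : ℤ) (q : Fin r → ℤ) (F : (Fin m ≃ Fin r) → K)
    (τ : Fin r ≃ Fin r) (a : A.obj r p) :
    permSum A e q F (A.act τ a) =
      koszul K τ q • permSum A e (fun l => q (τ l)) (fun ρ => F (ρ.trans τ)) a := by
  rw [permSum_apply, permSum_apply, Finset.smul_sum]
  refine (Fintype.sum_equiv (Equiv.equivCongr (Equiv.refl (Fin m)) τ) _ _ fun ρ => ?_).symm
  have h : Equiv.equivCongr (Equiv.refl (Fin m)) τ ρ = ρ.trans τ := rfl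
  rw [h, smul_smul, koszul_trans, ← A.act_trans, mul_assoc]
  have h1 : τ.trans (ρ.trans τ).symm = ρ.symm := by ext x; simp
  rw [h1]
  rfl

theorem permSum_congr {m r : ℕ} {p : ℤ} (e : ℤ) (q : Fin r → ℤ) {F G : (Fin m ≃ Fin r) → K}
    (h : ∀ ρ, F ρ = G ρ) (a : A.obj r p) : permSum A e q F a = permSum A e q G a := by
  rw [funext h]

variable {A}

variable {P : Collection.{u, v} K}

/-- The labels of the inputs of the `l`-th element of a symbol. -/
def PlSym.labels {N : ℕ} {d : ℤ} (s : PlSym P (LLie K).toCollection N d) (g : Fin N → ℕ)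
    (l : Fin s.r) : Fin (s.k l) → ℕ := fun x => g (s.f ⟨l, x⟩)

/-- The product of the coefficients of the words `π l` in the expansions of the elements `X_l` of
a symbol, with letters `g x` substituted for the inputs `x`. -/
def PlSym.weight {N : ℕ} {d : ℤ} (s : PlSym P (LLie K).toCollection N d) (g : Fin N → ℕ)
    (π : Fin s.r → List ℕ) : K :=
  ∏ l : Fin s.r, words (s.X l) (s.labels g l) (π l)

/-- The coefficient of a symbol at a tuple of words. -/
def symCoeff {N : ℕ} {d : ℤ} (g : Fin N → ℕ) {m : ℕ} (e : ℤ) (π : Fin m → List ℕ)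
    (s : PlSym P (LLie K).toCollection N d) : P.obj m e :=
  permSum P e s.q (fun ρ => s.weight g (π ∘ ρ.symm)) s.v

theorem prod_update {ι : Type*} [Fintype ι] [DecidableEq ι] {B : ι → Type*} (W : ∀ l, B l → K)
    (X : ∀ l, B l) (i : ι) (b : B i) :
    ∏ l, W l (Function.update X i b l) = W i b * ∏ l ∈ Finset.univ.erase i, W l (X l) := by
  rw [← Finset.mul_prod_erase _ _ (Finset.mem_univ i), Function.update_self]
  congr 1
  refine Finset.prod_congr rfl fun l hl => ?_
  rw [Function.update_of_ne (Finset.ne_of_mem_erase hl)]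

/-- The coefficients respect the relations that define the plethysm. -/
theorem linearCombination_symCoeff {N : ℕ} {d : ℤ} (g : Fin N → ℕ) {m : ℕ} (e : ℤ)
    (π : Fin m → List ℕ) (x : PlSym P (LLie K).toCollection N d →₀ K)
    (hx : PlRel P (LLie K).toCollection N d x) :
    Finsupp.linearCombination K (symCoeff g e π) x = 0 := by
  cases hx with
  | left_add a a' k q X f hd =>
    simp only [map_sub, Finsupp.linearCombination_single, one_smul]
    rw [symCoeff, map_add, sub_sub, sub_eq_zero]
    rfl
  | left_smul c a k q X f hd =>
    simp only [map_sub, Finsupp.linearCombination_single, one_smul]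
    rw [symCoeff, map_smul, sub_eq_zero]
    rfl
  | right_add a k q X i b b' f hd =>
    simp only [map_sub, Finsupp.linearCombination_single, one_smul]
    rw [sub_sub, sub_eq_zero]
    simp only [symCoeff]
    refine Eq.trans (permSum_congr P e q (fun ρ => ?_) a) (permSum_add P e q _ _ a)
    have hW := prod_update (B := fun l => (LLie K).obj (k l) (q l))
        (fun l x => words x (fun y => g (f ⟨l, y⟩)) (π (ρ.symm l))) X i
    refine (hW (b + b')).trans (Eq.trans ?_ (congrArg₂ (· + ·) (hW b) (hW b')).symm)
    rw [words_add, Finsupp.add_apply, add_mul]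
  | right_smul a k q X i c b f hd =>
    simp only [map_sub, Finsupp.linearCombination_single, one_smul]
    rw [sub_eq_zero]
    simp only [symCoeff]
    refine Eq.trans (permSum_congr P e q (fun ρ => ?_) a) (permSum_smul P e q _ _ a)
    have hW := prod_update (B := fun l => (LLie K).obj (k l) (q l))
        (fun l x => words x (fun y => g (f ⟨l, y⟩)) (π (ρ.symm l))) X i
    refine (hW (c • b)).trans (Eq.trans ?_ (congrArg (c * ·) (hW b)).symm)
    rw [words_smul, Finsupp.smul_apply, smul_eq_mul, mul_assoc]
  | act_right a k q X τ f hd =>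
    simp only [map_sub, Finsupp.linearCombination_single, one_smul]
    rw [sub_eq_zero]
    simp only [symCoeff]
    refine permSum_congr P e q (fun ρ => ?_) a
    simp only [PlSym.weight, words_act]
    rfl
  | act_left τ a k q X f hd hd' =>
    simp only [map_sub, Finsupp.linearCombination_single, one_smul]
    rw [sub_eq_zero, symCoeff, permSum_act, symCoeff]
    change koszul K τ q • _ = koszul K τ q • _
    congr 1
    refine permSum_congr P e (fun l => q (τ l)) (fun ρ => ?_) a
    simp only [PlSym.weight]
    rw [← τ.prod_comp]
    refine Finset.prod_congr rfl fun l _ => ?_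
    simp only [Function.comp_apply, Equiv.symm_trans_apply, Equiv.symm_apply_apply]
    rfl

/-- The coefficients of the elements of the plethysm. -/
def plCoeff {N : ℕ} {d : ℤ} (g : Fin N → ℕ) {m : ℕ} (e : ℤ) (π : Fin m → List ℕ) :
    Plethysm P (LLie K).toCollection N d →ₗ[K] P.obj m e :=
  Submodule.liftQ _ (Finsupp.linearCombination K (symCoeff g e π)) <|
    Submodule.span_le.2 fun x hx => linearCombination_symCoeff g e π x hx

theorem plCoeff_plMk {N : ℕ} {d : ℤ} (g : Fin N → ℕ) {m : ℕ} (e : ℤ) (π : Fin m → List ℕ)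
    (s : PlSym P (LLie K).toCollection N d) : plCoeff g e π (plMk s) = symCoeff g e π s := by
  change Finsupp.linearCombination K (symCoeff g e π) (Finsupp.single s 1) = _
  rw [Finsupp.linearCombination_single, one_smul]

end coefficients

section operations

variable {K : Type u} [Field K] {P : DGOperad.{u, v} K} {O : DGOperad.{u, w} K}
  {j : OperadHom P.toOperadData O.toOperadData}
  {i : OperadHom (LLie K).toOperadData O.toOperadData} (h : IsDistributive j i)

/-- The coefficient of an operation at a tuple `π` of words, with letters `g x` substituted for the
inputs `x`. -/
def coeff {N : ℕ} {d : ℤ} (g : Fin N → ℕ) {m : ℕ} (e : ℤ) (π : Fin m → List ℕ) :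
    O.obj N d →ₗ[K] P.obj m e :=
  (plCoeff g e π).comp (h.plethysm N d).choose.symm.toLinearMap

theorem coeff_value {N : ℕ} {d : ℤ} (g : Fin N → ℕ) {m : ℕ} (e : ℤ) (π : Fin m → List ℕ)
    (s : PlSym P.toCollection (LLie K).toCollection N d) :
    coeff h g e π (s.value (O := O.toOperadData) j.toHom i.toHom) = symCoeff g e π s := by
  rw [← (h.plethysm N d).choose_spec s, coeff, LinearMap.comp_apply, LinearEquiv.coe_coe,
    LinearEquiv.symm_apply_apply, plCoeff_plMk]

/-- The same symbol with other labels of the inputs. -/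
def PlSym.relabel {N N' : ℕ} {d : ℤ} (s : PlSym P.toCollection (LLie K).toCollection N d)
    (σ : Fin N ≃ Fin N') : PlSym P.toCollection (LLie K).toCollection N' d where
  r := s.r
  p := s.p
  v := s.v
  k := s.k
  q := s.q
  X := s.X
  f := s.f.trans σ
  hd := s.hd

theorem value_relabel {N N' : ℕ} {d : ℤ} (s : PlSym P.toCollection (LLie K).toCollection N d)
    (σ : Fin N ≃ Fin N') :
    (s.relabel σ).value (O := O.toOperadData) j.toHom i.toHom =
      O.act σ (s.value (O := O.toOperadData) j.toHom i.toHom) := by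
  rw [PlSym.value, PlSym.value, ← O.act_trans]
  rfl

theorem coeff_act {N N' : ℕ} {d : ℤ} (g : Fin N' → ℕ) {m : ℕ} (e : ℤ) (π : Fin m → List ℕ)
    (σ : Fin N ≃ Fin N') (f : O.obj N d) :
    coeff h g e π (O.act σ f) = coeff h (g ∘ σ) e π f := by
  refine h.induction (C := fun f => coeff h g e π (O.act σ f) = coeff h (g ∘ σ) e π f)
    ?_ ?_ ?_ ?_ f
  · intro s
    rw [← value_relabel, coeff_value, coeff_value]
    rfl
  · simp
  · intro f f' hf hf'; simp only [map_add, hf, hf']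
  · intro c f hf; simp only [map_smul, hf]

/-- A property of all coefficients of symbols carries over to the coefficients of operations. -/
theorem coeff_eq_zero {N : ℕ} {d : ℤ} (g : Fin N → ℕ) {m : ℕ} (e : ℤ) (π : Fin m → List ℕ)
    (h0 : ∀ s : PlSym P.toCollection (LLie K).toCollection N d, symCoeff g e π s = 0)
    (f : O.obj N d) : coeff h g e π f = 0 := by
  refine h.induction (C := fun f => coeff h g e π f = 0) ?_ ?_ ?_ ?_ f
  · intro s; rw [coeff_value, h0]
  · simp
  · intro f f' hf hf'; rw [map_add, hf, hf', add_zero]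
  · intro c f hf; rw [map_smul, hf, smul_zero]

theorem weight_ne {N : ℕ} {d : ℤ} {s : PlSym P.toCollection (LLie K).toCollection N d}
    {g : Fin N → ℕ} {π : Fin s.r → List ℕ} (hw : s.weight g π ≠ 0) (l : Fin s.r) :
    words (s.X l) (s.labels g l) (π l) ≠ 0 := fun h0 =>
  hw (Finset.prod_eq_zero (Finset.mem_univ l) h0)

/-- The letters of the words at which the coefficient of an operation does not vanish are the
labels of the inputs. -/
theorem content_of_coeff_ne {N : ℕ} {d : ℤ} {g : Fin N → ℕ} {m : ℕ} {e : ℤ} {π : Fin m → List ℕ}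
    {f : O.obj N d} (hf : coeff h g e π f ≠ 0) :
    ∑ x, (π x : Multiset ℕ) = ∑ x, {g x} := by
  by_contra hc
  refine hf (coeff_eq_zero h g e π (fun s => ?_) f)
  rw [symCoeff, permSum_apply]
  refine Finset.sum_eq_zero fun ρ _ => ?_
  by_contra hw
  have hw' : s.weight g (π ∘ ρ.symm) ≠ 0 := fun h0 => hw (by rw [h0, mul_zero, zero_smul])
  apply hc
  rw [← s.f.sum_comp, Fintype.sum_sigma, ← ρ.symm.sum_comp]
  refine Finset.sum_congr rfl fun l _ => ?_
  have h1 := perm_of_words_ne (weight_ne hw' l)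
  rw [Function.comp_apply] at h1
  rw [Multiset.coe_eq_coe.2 h1, ← List.sum_ofFn, List.ofFn_eq_map, List.ofFn_eq_map]
  induction List.finRange (s.k l) with
  | nil => rfl
  | cons x L ih => rw [List.map_cons, List.map_cons, List.sum_cons, ← ih]; rfl

/-- The behaviour of the coefficients under permutations of the words. -/
theorem coeff_perm {N : ℕ} {d : ℤ} (g : Fin N → ℕ) {m : ℕ} (e : ℤ) (π : Fin m → List ℕ)
    (θ : Fin m ≃ Fin m) (f : O.obj N d) :
    coeff h g e (π ∘ θ) f =
      koszul K θ (fun x => 1 - ((π x).length : ℤ)) • P.act θ.symm (coeff h g e π f) := by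
  refine h.induction (C := fun f => coeff h g e (π ∘ θ) f =
      koszul K θ (fun x => 1 - ((π x).length : ℤ)) • P.act θ.symm (coeff h g e π f))
    ?_ ?_ ?_ ?_ f
  · intro s
    rw [coeff_value, coeff_value, symCoeff, symCoeff, permSum_apply, permSum_apply, map_sum,
      Finset.smul_sum]
    refine Fintype.sum_equiv (Equiv.equivCongr θ (Equiv.refl (Fin s.r))) _ _ fun ρ => ?_
    have hρ : Equiv.equivCongr θ (Equiv.refl (Fin s.r)) ρ = θ.symm.trans ρ := rfl
    rw [hρ]
    have h1 : (π ∘ θ) ∘ ρ.symm = π ∘ (θ.symm.trans ρ).symm := rfl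
    rw [h1]
    by_cases hw : s.weight g (π ∘ (θ.symm.trans ρ).symm) = 0
    · rw [hw, mul_zero, mul_zero, zero_smul, zero_smul, map_zero, smul_zero]
    have h2 : ρ = θ.trans (θ.symm.trans ρ) := by ext; simp
    generalize θ.symm.trans ρ = ρ' at *
    subst h2
    rw [koszul_trans, map_smul, act_degCast, ← P.act_trans, smul_smul]
    have h3 : (s.q ∘ ρ') = fun x => 1 - ((π x).length : ℤ) := by
      funext x
      have h4 := weight_ne hw (ρ' x)
      rw [Function.comp_apply, degree_of_words_ne h4, ← length_of_words_ne h4]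
      simp
    rw [h3]
    congr 1
    ring
  · simp
  · intro f f' hf hf'; simp only [map_add, smul_add, hf, hf']
  · intro c f hf; simp only [map_smul, hf]; rw [smul_comm]

end operations

/-! ### Substituting a bracket for an input -/

section collapse

/-- The map of inputs that identifies the two inputs of an operation inserted in the input `x`. -/
def collapse {n m : ℕ} (hm : n + 2 = m + 1) (x : Fin n) (t : Fin m) : Fin n :=
  ⟨if (t : ℕ) ≤ x then t else t - 1, by have := x.2; have := t.2; split_ifs <;> omega⟩

theorem val_collapse {n m : ℕ} (hm : n + 2 = m + 1) (x : Fin n) (t : Fin m) :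
    (collapse hm x t : ℕ) = if (t : ℕ) ≤ x then (t : ℕ) else t - 1 := rfl

theorem collapse_outerPos {n m : ℕ} (hm : n + 2 = m + 1) (x y : Fin n) (hy : y ≠ x) :
    collapse hm x (outerPos hm x y hy) = y := by
  have : (y : ℕ) ≠ x := fun h => hy (Fin.ext h)
  ext
  rw [val_collapse, val_outerPos]
  grind

theorem collapse_innerPos {n m : ℕ} (hm : n + 2 = m + 1) (x : Fin n) (t : Fin 2) :
    collapse hm x (innerPos hm x t) = x := by
  have := t.2
  ext
  rw [val_collapse, val_innerPos]
  split_ifs <;> omega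

theorem predAbove_eq_collapse {n : ℕ} (x : Fin n) (t : Fin (n + 1)) :
    Fin.predAbove x t = collapse rfl x t := by
  ext
  rw [val_collapse]
  rcases Nat.lt_or_ge (x : ℕ) t with h | h
  · rw [Fin.predAbove_of_castSucc_lt _ _ (by rw [Fin.lt_def, Fin.val_castSucc]; exact h),
      if_neg (by omega), Fin.val_pred]
  · rw [Fin.predAbove_of_le_castSucc _ _ (by rw [Fin.le_def, Fin.val_castSucc]; exact h),
      if_pos h, Fin.coe_castPred]

theorem collapse_insertionCongr {n m n' m' : ℕ} (hm : n + 2 = m + 1) (hm' : n' + 2 = m' + 1)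
    (x : Fin n) (θ : Fin n ≃ Fin n') (t : Fin m) :
    collapse hm' (θ x) (insertionCongr hm hm' x θ (Equiv.refl _) t) = θ (collapse hm x t) := by
  rcases outerPos_or_innerPos hm x t with ⟨y, hy, rfl⟩ | ⟨y, rfl⟩
  · rw [insertionCongr_outerPos, collapse_outerPos, collapse_outerPos]
  · rw [insertionCongr_innerPos, collapse_innerPos, collapse_innerPos]

theorem val_finSigmaFinEquiv {r : ℕ} (k : Fin r → ℕ) (l : Fin r) (z : Fin (k l)) :
    (finSigmaFinEquiv ⟨l, z⟩ : ℕ) = psum k l + z := by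
  rw [finSigmaFinEquiv_apply]
  congr 1
  have h : ∀ j (hj : j ≤ r), ∑ i : Fin j, k (Fin.castLE hj i) = psum k j := by
    intro j
    induction j with
    | zero => intro _; rw [psum_zero]; rfl
    | succ j ih =>
      intro hj
      rw [Fin.sum_univ_castSucc, psum_succ k j hj, ← ih (by omega)]
      rfl
  exact h l _

theorem psum_le {r : ℕ} (k : Fin r → ℕ) {a b : ℕ} (h : a ≤ b) : psum k a ≤ psum k b := by
  refine Finset.sum_le_sum fun x _ => ?_
  split_ifs <;> omega

theorem psum_congr {M : Type} [AddCommMonoid M] {r : ℕ} {k k' : Fin r → M} {a : ℕ}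
    (h : ∀ l : Fin r, (l : ℕ) < a → k' l = k l) : psum k' a = psum k a := by
  refine Finset.sum_congr rfl fun x _ => ?_
  split_ifs with hx
  · exact h x hx
  · rfl

end collapse

section lastInsertion

variable {K : Type u} [Field K]

theorem comp_congr_index (O : OperadData.{u, v} K) {n k m : ℕ} {p q d : ℤ} {i i' : Fin n}
    (h : (i : ℕ) = i') (hm : n + k = m + 1) (hd : p + q = d) (a : O.obj n p) (b : O.obj k q) :
    O.comp i hm hd a b = O.comp i' hm hd a b := by
  obtain rfl : i = i' := Fin.ext h
  rfl

theorem insertFirst_congr (O : OperadData.{u, v} K) {r : ℕ} {p : ℤ} (a : O.obj r p)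
    {k k' : Fin r → ℕ} {q q' : Fin r → ℤ} (X : ∀ l, O.obj (k l) (q l))
        (X' : ∀ l, O.obj (k' l) (q' l))
    (t : ℕ) (ht : t ≤ r) (hk : ∀ l : Fin r, (l : ℕ) < t → k' l = k l)
    (hq : ∀ l : Fin r, (l : ℕ) < t → q' l = q l)
    (hX : ∀ (l : Fin r) (hl : (l : ℕ) < t), X' l = O.cast (hk l hl).symm (hq l hl).symm (X l)) :
    insertFirst O a X' t ht = O.cast (by rw [psum_congr hk]) (by rw [psum_congr hq])
      (insertFirst O a X t ht) := by
  induction t with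
  | zero => rw [insertFirst, insertFirst, Collection.cast_cast]
  | succ t ih =>
    have hk' : ∀ l : Fin r, (l : ℕ) < t → k' l = k l := fun l hl => hk l (by omega)
    have hq' : ∀ l : Fin r, (l : ℕ) < t → q' l = q l := fun l hl => hq l (by omega)
    rw [insertFirst, insertFirst, ih (by omega) hk' hq' (fun l hl => hX l (by omega)),
      hX ⟨t, ht⟩ (Nat.lt_succ_self t), OperadData.comp_cast_left, OperadData.comp_cast_right,
      OperadData.cast_comp]
    exact comp_congr_index O (psum_congr hk') _ _ _ _

theorem words_cast {k k' : ℕ} {q q' : ℤ} (h : k = k') (h' : q = q') (X : (LLie K).obj k q)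
    (l : Fin k' → ℕ) : words ((LLie K).cast h h' X) l = words X (l ∘ Fin.cast h) := by
  subst h; subst h'; rfl

variable {r : ℕ} {p : ℤ} {k : Fin (r + 1) → ℕ} {q : Fin (r + 1) → ℤ}

/-- The arities after the insertion of a binary operation in the last of several operations. -/
def lastArity (k : Fin (r + 1) → ℕ) (l : Fin (r + 1)) : ℕ :=
  if l = Fin.last r then k (Fin.last r) + 1 else k l

/-- The degrees after the insertion of an operation of degree `-1` in the last of several
operations. -/
def lastDegree (q : Fin (r + 1) → ℤ) (l : Fin (r + 1)) : ℤ :=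
  if l = Fin.last r then q (Fin.last r) + -1 else q l

theorem lastArity_last (k : Fin (r + 1) → ℕ) :
    lastArity k (Fin.last r) = k (Fin.last r) + 1 := if_pos rfl

theorem lastArity_of_ne (k : Fin (r + 1) → ℕ) {l : Fin (r + 1)} (hl : l ≠ Fin.last r) :
    lastArity k l = k l := if_neg hl

/-- The insertion of the bracket in the input `y` of the last of several elements of `ΛLie`. -/
def lastInsert (X : ∀ l, (LLie K).obj (k l) (q l)) (y : Fin (k (Fin.last r))) (l : Fin (r + 1)) :
    (LLie K).obj (lastArity k l) (lastDegree q l) :=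
  if h : l = Fin.last r then
    (LLie K).cast (by rw [lastArity, if_pos h]) (by rw [lastDegree, if_pos h])
      ((LLie K).comp (m := k (Fin.last r) + 1) y rfl rfl (X (Fin.last r)) (bracket K))
  else (LLie K).cast (by rw [lastArity, if_neg h]) (by rw [lastDegree, if_neg h]) (X l)

theorem sum_lastArity (k : Fin (r + 1) → ℕ) : ∑ l, lastArity k l = ∑ l, k l + 1 := by
  rw [Fin.sum_univ_castSucc, Fin.sum_univ_castSucc, lastArity, if_pos rfl, ← add_assoc]
  congr 2
  exact Finset.sum_congr rfl fun l _ => if_neg (Fin.castSucc_lt_last l).ne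

theorem sum_lastDegree (q : Fin (r + 1) → ℤ) : ∑ l, lastDegree q l = ∑ l, q l + -1 := by
  rw [Fin.sum_univ_castSucc, Fin.sum_univ_castSucc, lastDegree, if_pos rfl, ← add_assoc]
  congr 2
  exact Finset.sum_congr rfl fun l _ => if_neg (Fin.castSucc_lt_last l).ne

theorem words_lastInsert_last (X : ∀ l, (LLie K).obj (k l) (q l)) (y : Fin (k (Fin.last r)))
    (c : Fin (lastArity k (Fin.last r)) → ℕ) (h : k (Fin.last r) + 1 = lastArity k (Fin.last r)) :
    words (lastInsert X y (Fin.last r)) c = words ((LLie K).comp (m := k (Fin.last r) + 1)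
      (d := q (Fin.last r) + -1) y rfl rfl (X (Fin.last r)) (bracket K)) (c ∘ Fin.cast h) := by
  rw [lastInsert, dif_pos rfl, words_cast]

theorem words_lastInsert_of_ne (X : ∀ l, (LLie K).obj (k l) (q l)) (y : Fin (k (Fin.last r)))
    (l : Fin (r + 1)) (hl : l ≠ Fin.last r) (c : Fin (lastArity k l) → ℕ)
    (h : k l = lastArity k l) :
    words (lastInsert X y l) c = words (X l) (c ∘ Fin.cast h) := by
  rw [lastInsert, dif_neg hl, words_cast]

variable {O : DGOperad.{u, w} K} (i : OperadHom (LLie K).toOperadData O.toOperadData)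

/-- A bracket inserted in an input of the last of the operations `X_l` of a composite `a(X_1, …,
X_r)` can be inserted in this operation beforehand, without a sign. -/
theorem fullComp_lastInsert (a : O.obj (r + 1) p) (X : ∀ l, (LLie K).obj (k l) (q l))
    (y : Fin (k (Fin.last r))) (x : Fin (∑ l, k l)) (hx : (x : ℕ) = psum k r + y)
    (hm : ∑ l, k l + 2 = ∑ l, lastArity k l + 1)
    (hd : p + ∑ l, q l + -1 = p + ∑ l, lastDegree q l) :
    O.comp x hm hd (fullComp O.toOperadData a fun l => i.app _ _ (X l)) (br i) =
      fullComp O.toOperadData a fun l => i.app _ _ (lastInsert X y l) := by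
  have hk : ∀ l : Fin (r + 1), (l : ℕ) < r → lastArity k l = k l := fun l hl =>
    if_neg fun h => by rw [h] at hl; simp at hl
  have hq : ∀ l : Fin (r + 1), (l : ℕ) < r → lastDegree q l = q l := fun l hl =>
    if_neg fun h => by rw [h] at hl; simp at hl
  have hX : ∀ (l : Fin (r + 1)) (hl : (l : ℕ) < r), i.app _ _ (lastInsert X y l) =
      O.cast (hk l hl).symm (hq l hl).symm (i.app _ _ (X l)) := fun l hl => by
    rw [lastInsert, dif_neg (fun h => by rw [h] at hl; simp at hl), Collection.Hom.app_cast]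
  have h1 : i.app _ _ (lastInsert X y (Fin.last r)) =
      O.cast (by rw [lastArity, if_pos rfl]) (by rw [lastDegree, if_pos rfl])
        (O.comp (m := k (Fin.last r) + 1) (d := q (Fin.last r) + -1) y rfl rfl
          (i.app _ _ (X (Fin.last r))) (br i)) := by
    rw [lastInsert, dif_pos rfl, Collection.Hom.app_cast, i.app_comp]
    rfl
  have e1 : psum k (r + 1) = ∑ l, k l := psum_self k
  have e2 : psum k (r + 1) = psum k r + k (Fin.last r) := psum_succ k r (Nat.lt_succ_self r)
  have e3 : psum q (r + 1) = ∑ l, q l := psum_self q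
  have e4 : psum q (r + 1) = psum q r + q (Fin.last r) := psum_succ q r (Nat.lt_succ_self r)
  have hy := y.2
  rw [fullComp, fullComp, insertFirst, insertFirst]
  change _ = O.cast _ _ (O.comp _ _ _ (insertFirst O.toOperadData a
    (fun l => i.app _ _ (lastInsert X y l)) r (by omega))
    (i.app _ _ (lastInsert X y (Fin.last r))))
  rw [h1, insertFirst_congr O.toOperadData a (fun l => i.app _ _ (X l))
    (fun l => i.app _ _ (lastInsert X y l)) r (by omega) hk hq hX, OperadData.comp_cast_left,
    OperadData.comp_cast_left, OperadData.comp_cast_right, OperadData.cast_comp]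
  refine Eq.trans (O.comp_assoc (m₂ := k (Fin.last r) + 1) (d₂ := q (Fin.last r) + -1)
    ⟨psum k r, by omega⟩ y _ _ _ rfl (by omega) _ _ rfl (by omega) _ _ _ ?_).symm
    (comp_congr_index O.toOperadData (psum_congr hk).symm _ _ _ _)
  simpa using hx

end lastInsertion

/-! ### The coefficients after the substitution of a bracket -/

section tuples

variable (K : Type u) [Field K]

/-- The sign with which a modification of the word `π i` enters: the degrees of the words that
follow it are passed. -/
def siteSign {m : ℕ} (π : Fin m → List ℕ) (i : Fin m) : K :=
  ∏ y, if i < y then sgn K (1 - ((π y).length : ℤ)) else 1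

variable {M : Type*} [AddCommGroup M] [Module K M]

/-- The alternating sum of the values of a function of tuples of words at the tuples that arise
by dropping one of two neighbouring letters `0`. -/
def tupleDiff {m : ℕ} (c : (Fin m → List ℕ) → M) (π : Fin m → List ℕ) : M :=
  ∑ i, siteSign K π i • wordDiff (fun w => c (Function.update π i w)) (π i)

variable {K}

theorem tupleDiff_add {m : ℕ} (c c' : (Fin m → List ℕ) → M) (π : Fin m → List ℕ) :
    tupleDiff K (fun π => c π + c' π) π = tupleDiff K c π + tupleDiff K c' π := by
  simp only [tupleDiff, wordDiff_add, smul_add, Finset.sum_add_distrib]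

theorem tupleDiff_smul {m : ℕ} (a : K) (c : (Fin m → List ℕ) → M) (π : Fin m → List ℕ) :
    tupleDiff K (fun π => a • c π) π = a • tupleDiff K c π := by
  simp only [tupleDiff, wordDiff_smul, Finset.smul_sum, smul_comm a]

theorem tupleDiff_zero {m : ℕ} (π : Fin m → List ℕ) :
    tupleDiff K (fun _ => (0 : M)) π = 0 := by
  simp [tupleDiff, wordDiff_zero]

theorem wordDiff_pi {ι : Type*} (c : List ℕ → ι → M) (w : List ℕ) (x : ι) :
    wordDiff c w x = wordDiff (fun w => c w x) w :=
  map_wordDiff (Pi.evalAddMonoidHom (fun _ : ι => M) x) c w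

theorem wordDiff_mul_const (c : List ℕ → K) (a : K) (w : List ℕ) :
    wordDiff (fun w => c w * a) w = wordDiff c w * a :=
  (map_wordDiff (AddMonoidHom.mulRight a) c w).symm

theorem wordDiff_permSum (A : Collection.{u, v} K) {m r : ℕ} {p : ℤ} (e : ℤ) (q : Fin r → ℤ)
    (F : List ℕ → (Fin m ≃ Fin r) → K) (a : A.obj r p) (w : List ℕ) :
    wordDiff (fun w => permSum A e q (F w) a) w =
      permSum A e q (fun ρ => wordDiff (fun w => F w ρ) w) a := by
  have h := map_wordDiff ({
    toFun := fun F => permSum A e q F a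
    map_zero' := by rw [permSum_apply]; simp
    map_add' := fun F G => permSum_add A e q F G a } : ((Fin m ≃ Fin r) → K) →+ A.obj m e) F w
  refine h.symm.trans ?_
  exact permSum_congr A e q (fun ρ => wordDiff_pi F w ρ) a

end tuples

section blocks

variable {K : Type u} [Field K] {P : DGOperad.{u, v} K}

/-- The part of the differential of the coefficients of a symbol that modifies the words of the
`l`-th element. -/
def blockDiff {N : ℕ} {d : ℤ} (g : Fin N → ℕ) {m : ℕ} (e : ℤ) (π : Fin m → List ℕ)
    (s : PlSym P.toCollection (LLie K).toCollection N d) (l : Fin s.r) : P.obj m e :=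
  permSum P.toCollection e s.q (fun ρ => siteSign K π (ρ.symm l) *
    (wordDiff (fun w => words (s.X l) (s.labels g l) w) (π (ρ.symm l)) *
      ∏ l' ∈ Finset.univ.erase l, words (s.X l') (s.labels g l') (π (ρ.symm l')))) s.v

/-- The differential of the coefficients of a symbol is the sum of the contributions of the
elements of `ΛLie`. -/
theorem sum_blockDiff {N : ℕ} {d : ℤ} (g : Fin N → ℕ) {m : ℕ} (e : ℤ) (π : Fin m → List ℕ)
    (s : PlSym P.toCollection (LLie K).toCollection N d) :
    ∑ l, blockDiff g e π s l = tupleDiff K (fun π => symCoeff g e π s) π := by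
  simp only [blockDiff, tupleDiff, symCoeff]
  rw [← permSum_sum]
  simp only [wordDiff_permSum, ← permSum_smul]
  rw [← permSum_sum]
  refine permSum_congr _ _ _ (fun ρ => ?_) _
  rw [← ρ.sum_comp]
  refine Finset.sum_congr rfl fun x _ => ?_
  rw [Equiv.symm_apply_apply]
  congr 1
  rw [← wordDiff_mul_const]
  congr 1
  funext w
  rw [PlSym.weight, ← Finset.mul_prod_erase _ _ (Finset.mem_univ (ρ x))]
  simp only [Function.comp_apply, Equiv.symm_apply_apply, Function.update_self]
  congr 1
  refine Finset.prod_congr rfl fun l hl => ?_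
  rw [Function.update_of_ne]
  rintro rfl
  simp at hl

/-- The symbol obtained by permuting the elements of `ΛLie`. -/
def PlSym.permute {N : ℕ} {d : ℤ} (s : PlSym P.toCollection (LLie K).toCollection N d)
    (τ : Fin s.r ≃ Fin s.r) : PlSym P.toCollection (LLie K).toCollection N d where
  r := s.r
  p := s.p
  v := P.act τ.symm s.v
  k l := s.k (τ l)
  q l := s.q (τ l)
  X l := s.X (τ l)
  f := (Equiv.sigmaCongrLeft (β := fun l => Fin (s.k l)) τ).trans s.f
  hd := by rw [τ.sum_comp s.q]; exact s.hd

/-- The parts of the differential are compatible with permutations of the elements of `ΛLie`, with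
the same sign as the values of symbols (`value_permute`). -/
theorem blockDiff_permute {N : ℕ} {d : ℤ} (g : Fin N → ℕ) {m : ℕ} (e : ℤ) (π : Fin m → List ℕ)
    (s : PlSym P.toCollection (LLie K).toCollection N d) (τ : Fin s.r ≃ Fin s.r) (l : Fin s.r) :
    blockDiff g e π s (τ l) = koszul K τ s.q • blockDiff g e π (s.permute τ) l := by
  have hv : s.v = P.act τ (P.act τ.symm s.v) := (P.toCollection.act_act_symm τ s.v).symm
  rw [blockDiff, hv, permSum_act]
  refine congrArg (koszul K τ s.q • ·) ?_
  refine permSum_congr _ _ (fun l => s.q (τ l)) (fun ρ => ?_) _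
  rw [Equiv.symm_trans_apply, Equiv.symm_apply_apply]
  refine congrArg (siteSign K π (ρ.symm l) * ·) (congrArg₂ (· * ·) rfl ?_)
  refine (Finset.prod_equiv τ (fun x => ?_) fun x _ => ?_).symm
  · exact ⟨fun h => Finset.mem_erase.2 ⟨τ.injective.ne (Finset.ne_of_mem_erase h),
      Finset.mem_univ _⟩, fun h => Finset.mem_erase.2 ⟨fun h' =>
        Finset.ne_of_mem_erase h (congrArg τ h'), Finset.mem_univ _⟩⟩
  · rw [Equiv.symm_trans_apply, Equiv.symm_apply_apply]
    rfl

variable {O : DGOperad.{u, w} K}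
  {j : OperadHom P.toOperadData O.toOperadData}
  {i : OperadHom (LLie K).toOperadData O.toOperadData}

theorem value_permute (h : IsDistributive j i) {N : ℕ} {d : ℤ}
    (s : PlSym P.toCollection (LLie K).toCollection N d) (τ : Fin s.r ≃ Fin s.r) :
    s.value (O := O.toOperadData) j.toHom i.toHom =
      koszul K τ s.q • (s.permute τ).value (O := O.toOperadData) j.toHom i.toHom := by
  obtain ⟨Φ, hΦ⟩ := h.plethysm N d
  rw [← hΦ, ← hΦ, ← map_smul]
  congr 1
  have h1 := PlRel.act_left (B := (LLie K).toCollection) (n := N) (d := d) τ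
    (P.act τ.symm s.v) s.k s.q s.X s.f s.hd (s.permute τ).hd
  have h2 := (Submodule.Quotient.mk_eq_zero (Submodule.span K
    {x | PlRel P.toCollection (LLie K).toCollection N d x})).2 (Submodule.subset_span h1)
  rw [Submodule.Quotient.mk_sub, sub_eq_zero] at h2
  have hv : P.act τ (P.act τ.symm s.v) = s.v := P.toCollection.act_act_symm τ s.v
  rw [hv] at h2
  refine h2.trans ?_
  rw [plMk, ← Submodule.Quotient.mk_smul, Finsupp.smul_single, smul_eq_mul, mul_one]
  rfl

/-- The bracket inserted in an input of the last element of `ΛLie` of a symbol yields a symbol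
again. -/
theorem value_comp_last {N : ℕ} {d d' : ℤ} {r : ℕ} {p : ℤ} (v : P.obj (r + 1) p)
    (k : Fin (r + 1) → ℕ) (q : Fin (r + 1) → ℤ) (X : ∀ l, (LLie K).obj (k l) (q l))
    (f : (Σ l, Fin (k l)) ≃ Fin N) (hd : p + ∑ l, q l = d) (y : Fin (k (Fin.last r)))
    (x : Fin (∑ l, k l)) (hx : x = finSigmaFinEquiv ⟨Fin.last r, y⟩)
    (hm : N + 2 = N + 1 + 1) (hd' : d + -1 = d') (hm' : ∑ l, k l + 2 = ∑ l, lastArity k l + 1)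
    (hd'' : p + ∑ l, lastDegree q l = d') :
    O.comp (m := N + 1) ((finSigmaFinEquiv.symm.trans f) x) hm hd'
      ((⟨r + 1, p, v, k, q, X, f, hd⟩ : PlSym P.toCollection (LLie K).toCollection N d).value
        (O := O.toOperadData) j.toHom i.toHom) (br i) =
      (⟨r + 1, p, v, lastArity k, lastDegree q, lastInsert X y, finSigmaFinEquiv.trans
        (insertionCongr hm' hm x (finSigmaFinEquiv.symm.trans f) (Equiv.refl (Fin 2))), hd''⟩ :
        PlSym P.toCollection (LLie K).toCollection (N + 1) d').value
        (O := O.toOperadData) j.toHom i.toHom := by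
  have h1 := O.comp_act_act x hm' hm hd' (finSigmaFinEquiv.symm.trans f) (Equiv.refl (Fin 2))
    (O.cast rfl hd (fullComp O.toOperadData (j.app _ _ v) fun l => i.app _ _ (X l))) (br i)
  rw [O.act_refl] at h1
  refine h1.trans ?_
  rw [PlSym.value, ← Equiv.trans_assoc, Equiv.symm_trans_self, Equiv.refl_trans]
  refine congrArg (O.act _) ?_
  have h2 := fullComp_lastInsert i (j.app _ _ v) X y x (by rw [hx, val_finSigmaFinEquiv]; rfl) hm'
    (by rw [sum_lastDegree]; ring)
  change _ = O.cast rfl hd'' (fullComp O.toOperadData (j.app _ _ v) fun l =>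
    i.app _ _ (lastInsert X y l))
  rw [← h2, OperadData.cast_comp, OperadData.comp_cast_left]
  rfl

/-- The insertion of the bracket lowers the degree of the last element. The resulting change of the
Koszul sign is the sign of the site, because an element of `ΛLie` in whose expansion a word occurs
has degree one minus the length of the word. -/
theorem koszul_mul_prod {m r : ℕ} (ρ : Fin m ≃ Fin (r + 1)) (k : Fin (r + 1) → ℕ)
    (q : Fin (r + 1) → ℤ)
    (X : ∀ l, (LLie K).obj (k l) (q l)) (c : ∀ l, Fin (k l) → ℕ) (π : Fin m → List ℕ) (a : K) :
    koszul K ρ (lastDegree q) * (a * ∏ l ∈ Finset.univ.erase (Fin.last r),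
      words (X l) (c l) (π (ρ.symm l))) =
    koszul K ρ q * (siteSign K π (ρ.symm (Fin.last r)) * (a *
      ∏ l ∈ Finset.univ.erase (Fin.last r), words (X l) (c l) (π (ρ.symm l)))) := by
  rw [koszul_lower_last ρ q (lastDegree q) (fun l hl => if_neg hl)
    ((if_pos rfl).trans (sub_eq_add_neg _ _).symm), mul_assoc]
  -- If the product vanishes, the degrees of the elements need not match the lengths of the words.
  by_cases h0 : ∏ l ∈ Finset.univ.erase (Fin.last r), words (X l) (c l) (π (ρ.symm l)) = 0
  · rw [h0]; simp
  congr 2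
  refine Finset.prod_congr rfl fun y _ => ?_
  split_ifs with hy
  · have hy' : ρ y ≠ Fin.last r := by
      intro h'
      rw [← h', Equiv.symm_apply_apply] at hy
      exact lt_irrefl _ hy
    have h1 := Finset.prod_ne_zero_iff.1 h0 (ρ y) (Finset.mem_erase.2 ⟨hy', Finset.mem_univ _⟩)
    rw [Equiv.symm_apply_apply] at h1
    rw [degree_of_words_ne h1, length_of_words_ne h1]
  · rfl

/-- The coefficients after the insertion of the bracket in the last element: the words of this
element are replaced, and the sign of the site appears. -/
theorem symCoeff_lastInsert {N : ℕ} {d' : ℤ} {r : ℕ} {p : ℤ} (v : P.obj (r + 1) p)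
    (k : Fin (r + 1) → ℕ) (q : Fin (r + 1) → ℤ) (X : ∀ l, (LLie K).obj (k l) (q l))
    (f : (Σ l, Fin (k l)) ≃ Fin N) (y : Fin (k (Fin.last r)))
    (x : Fin (∑ l, k l)) (hx : x = finSigmaFinEquiv ⟨Fin.last r, y⟩)
    (hm : N + 2 = N + 1 + 1) (hm' : ∑ l, k l + 2 = ∑ l, lastArity k l + 1)
    (hd'' : p + ∑ l, lastDegree q l = d') (g : Fin N → ℕ) {m : ℕ} (e : ℤ) (π : Fin m → List ℕ) :
    symCoeff (g ∘ Fin.predAbove ((finSigmaFinEquiv.symm.trans f) x)) e π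
      (⟨r + 1, p, v, lastArity k, lastDegree q, lastInsert X y, finSigmaFinEquiv.trans
        (insertionCongr hm' hm x (finSigmaFinEquiv.symm.trans f) (Equiv.refl (Fin 2))), hd''⟩ :
        PlSym P.toCollection (LLie K).toCollection (N + 1) d') =
      permSum P.toCollection e q (fun ρ => siteSign K π (ρ.symm (Fin.last r)) *
        (words ((LLie K).comp (m := k (Fin.last r) + 1) (d := q (Fin.last r) + -1) y rfl rfl
          (X (Fin.last r)) (bracket K)) ((fun z => g (f ⟨Fin.last r, z⟩)) ∘ Fin.predAbove y)
            (π (ρ.symm (Fin.last r))) *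
          ∏ l ∈ Finset.univ.erase (Fin.last r),
            words (X l) (fun z => g (f ⟨l, z⟩)) (π (ρ.symm l)))) v := by
  set s : PlSym P.toCollection (LLie K).toCollection (N + 1) d' :=
    ⟨r + 1, p, v, lastArity k, lastDegree q, lastInsert X y, finSigmaFinEquiv.trans
        (insertionCongr hm' hm x (finSigmaFinEquiv.symm.trans f) (Equiv.refl (Fin 2))), hd''⟩
    with hs
  have hk : ∀ l : Fin (r + 1), (l : ℕ) ≤ r → psum (lastArity k) l = psum k l := fun l hl =>
    psum_congr fun l' hl' => if_neg fun h => by rw [h] at hl'; simp at hl'; omega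
  -- The labels of the new symbol are obtained by identifying the two inputs of the bracket.
  have hlab : ∀ (l : Fin (r + 1)) (z : Fin (lastArity k l)) (z' : Fin (k l)),
      collapse hm' x (finSigmaFinEquiv ⟨l, z⟩) = finSigmaFinEquiv ⟨l, z'⟩ →
      s.labels (g ∘ Fin.predAbove ((finSigmaFinEquiv.symm.trans f) x)) l z = g (f ⟨l, z'⟩) := by
    intro l z z' hz
    change g (Fin.predAbove ((finSigmaFinEquiv.symm.trans f) x)
      (insertionCongr hm' hm x (finSigmaFinEquiv.symm.trans f) (Equiv.refl (Fin 2))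
        (finSigmaFinEquiv ⟨l, z⟩))) = _
    rw [predAbove_eq_collapse, collapse_insertionCongr, hz, Equiv.trans_apply,
      Equiv.symm_apply_apply]
  have hlast : ∀ h : k (Fin.last r) + 1 = lastArity k (Fin.last r),
      s.labels (g ∘ Fin.predAbove ((finSigmaFinEquiv.symm.trans f) x)) (Fin.last r) ∘ Fin.cast h =
        (fun z => g (f ⟨Fin.last r, z⟩)) ∘ Fin.predAbove y := by
    intro h
    funext z
    refine hlab _ _ (Fin.predAbove y z) ?_
    ext
    rw [val_collapse, val_finSigmaFinEquiv, val_finSigmaFinEquiv, predAbove_eq_collapse,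
      val_collapse, hx, val_finSigmaFinEquiv, hk _ le_rfl]
    simp only [Fin.val_cast]
    split_ifs <;> omega
  have hne : ∀ (l : Fin (r + 1)) (hl : l ≠ Fin.last r) (h : k l = lastArity k l),
      s.labels (g ∘ Fin.predAbove ((finSigmaFinEquiv.symm.trans f) x)) l ∘ Fin.cast h =
        fun z => g (f ⟨l, z⟩) := by
    intro l hl h
    funext z
    refine hlab _ _ z ?_
    have hl' : (l : ℕ) < r := lt_of_le_of_ne (Fin.le_last l) fun h' => hl (Fin.ext h')
    have h1 : psum k (l + 1) = psum k l + k l := psum_succ k l l.2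
    have h2 : psum k (l + 1) ≤ psum k r := psum_le k hl'
    have h3 := z.2
    ext
    rw [val_collapse, val_finSigmaFinEquiv, val_finSigmaFinEquiv, hx, val_finSigmaFinEquiv,
      hk _ hl'.le]
    simp only [Fin.val_cast, Fin.val_last]
    rw [if_pos (by omega)]
  rw [symCoeff, permSum_apply, permSum_apply]
  refine Finset.sum_congr rfl fun ρ _ => ?_
  congr 1
  rw [PlSym.weight, ← Finset.mul_prod_erase _ _ (Finset.mem_univ (Fin.last r))]
  refine Eq.trans ?_ (koszul_mul_prod ρ k q X _ π _)
  refine congrArg (koszul K ρ (lastDegree q) * ·) (congrArg₂ (· * ·) ?_ ?_)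
  · change words (lastInsert X y (Fin.last r)) (s.labels _ (Fin.last r)) _ = _
    rw [words_lastInsert_last X y _ (lastArity_last k).symm, hlast]
    rfl
  · refine Finset.prod_congr rfl fun l hl => ?_
    have hl' := Finset.ne_of_mem_erase hl
    change words (lastInsert X y l) (s.labels _ l) _ = _
    rw [words_lastInsert_of_ne X y l hl' _ (lastArity_of_ne k hl').symm, hne l hl']
    rfl

/-- Inserting the bracket in the inputs with label `0` of the `l`-th element of a symbol modifies
the words of this element by the differential. -/
theorem sum_block (h : IsDistributive j i) {N : ℕ} {d d' : ℤ} (hd' : d + -1 = d')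
    (s : PlSym P.toCollection (LLie K).toCollection N d) (g : Fin N → ℕ) {m : ℕ} (e : ℤ)
    (π : Fin m → List ℕ) (l : Fin s.r) :
    ∑ y, (if g (s.f ⟨l, y⟩) = 0 then coeff h (g ∘ Fin.predAbove (s.f ⟨l, y⟩)) e π
      (O.comp (m := N + 1) (s.f ⟨l, y⟩) rfl hd'
        (s.value (O := O.toOperadData) j.toHom i.toHom) (br i)) else 0) =
      (2 : K) • blockDiff g e π s l := by
  -- The elements of `ΛLie` can be permuted so that the `l`-th one becomes the last one.
  have key : ∀ (s : PlSym P.toCollection (LLie K).toCollection N d) (l : Fin s.r),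
      (l : ℕ) + 1 = s.r →
      ∑ y, (if g (s.f ⟨l, y⟩) = 0 then coeff h (g ∘ Fin.predAbove (s.f ⟨l, y⟩)) e π
        (O.comp (m := N + 1) (s.f ⟨l, y⟩) rfl hd'
          (s.value (O := O.toOperadData) j.toHom i.toHom) (br i)) else 0) =
        (2 : K) • blockDiff g e π s l := by
    rintro ⟨r, p, v, k, q, X, f, hd⟩ l hl
    obtain ⟨r, rfl⟩ : ∃ r', r = r' + 1 := ⟨l, hl.symm⟩
    obtain rfl : l = Fin.last r := Fin.ext (Nat.succ_injective hl)
    have h1 : ∀ y : Fin (k (Fin.last r)), coeff h (g ∘ Fin.predAbove (f ⟨Fin.last r, y⟩)) e π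
        (O.comp (m := N + 1) (f ⟨Fin.last r, y⟩) rfl hd'
          ((⟨r + 1, p, v, k, q, X, f, hd⟩ : PlSym P.toCollection (LLie K).toCollection N d).value
            (O := O.toOperadData) j.toHom i.toHom) (br i)) =
        permSum P.toCollection e q (fun ρ => siteSign K π (ρ.symm (Fin.last r)) *
          (words ((LLie K).comp (m := k (Fin.last r) + 1) (d := q (Fin.last r) + -1) y rfl rfl
            (X (Fin.last r)) (bracket K)) ((fun z => g (f ⟨Fin.last r, z⟩)) ∘ Fin.predAbove y)
              (π (ρ.symm (Fin.last r))) *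
            ∏ l ∈ Finset.univ.erase (Fin.last r),
              words (X l) (fun z => g (f ⟨l, z⟩)) (π (ρ.symm l)))) v := fun y => by
      have h2 := value_comp_last (O := O) (j := j) (i := i) v k q X f hd y _ rfl rfl hd'
        (by rw [sum_lastArity]) (by rw [sum_lastDegree]; omega)
      have h3 : (finSigmaFinEquiv.symm.trans f) (finSigmaFinEquiv ⟨Fin.last r, y⟩) =
          f ⟨Fin.last r, y⟩ := by simp
      have h4 := symCoeff_lastInsert v k q X f y _ rfl rfl (by rw [sum_lastArity])
        (by rw [sum_lastDegree]; omega : p + ∑ l, lastDegree q l = d') g e π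
      rw [h3] at h2 h4
      exact (congrArg (coeff h _ e π) h2).trans ((coeff_value h _ e π _).trans h4)
    rw [blockDiff, ← permSum_smul]
    have h5 : ∀ (c : Prop) [Decidable c] (F : (Fin m ≃ Fin (r + 1)) → K),
        (if c then permSum P.toCollection e q F v else 0) =
          permSum P.toCollection e q (fun ρ => if c then F ρ else 0) v := by
      intro c _ F
      split_ifs
      · rfl
      · rw [permSum_apply]; simp
    refine Eq.trans (Finset.sum_congr rfl fun y _ => (congrArg (fun t =>
      if g (f ⟨Fin.last r, y⟩) = 0 then t else 0) (h1 y)).trans (h5 _ _)) ?_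
    rw [← permSum_sum]
    refine permSum_congr _ _ _ (fun ρ => ?_) _
    have h6 := sum_words_comp_bracket rfl (X (Fin.last r)) (fun z => g (f ⟨Fin.last r, z⟩))
      (π (ρ.symm (Fin.last r)))
    rw [mul_left_comm, ← mul_assoc (2 : K)]
    refine Eq.trans ?_ (congrArg (siteSign K π (ρ.symm (Fin.last r)) * ·)
      (congrArg (· * ∏ l' ∈ Finset.univ.erase (Fin.last r),
        words (X l') (fun z => g (f ⟨l', z⟩)) (π (ρ.symm l'))) h6))
    rw [Finset.sum_mul, Finset.mul_sum]
    refine Finset.sum_congr rfl fun y _ => ?_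
    split_ifs
    · rfl
    · rw [zero_mul, mul_zero]
  obtain ⟨l₀, hl₀⟩ : ∃ l₀ : Fin s.r, (l₀ : ℕ) + 1 = s.r :=
    ⟨⟨s.r - 1, by have := l.2; omega⟩, by have := l.2; simp; omega⟩
  obtain ⟨τ, rfl⟩ : ∃ τ : Fin s.r ≃ Fin s.r, τ l₀ = l :=
    ⟨Equiv.swap l₀ l, Equiv.swap_apply_left _ _⟩
  have h1 := key (s.permute τ) l₀ hl₀
  rw [blockDiff_permute, smul_comm, ← h1, Finset.smul_sum]
  refine Finset.sum_congr rfl fun y _ => ?_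
  rw [value_permute h s τ, map_smul, LinearMap.smul_apply, map_smul, smul_ite, smul_zero]
  rfl

/-- The substitution of brackets for the inputs with label `0` acts on the coefficients by
doubling letters `0`. -/
theorem sum_coeff_comp_bracket (h : IsDistributive j i) {N : ℕ} {d d' : ℤ} (hd' : d + -1 = d')
    (f : O.obj N d) (g : Fin N → ℕ) {m : ℕ} (e : ℤ) (π : Fin m → List ℕ) :
    ∑ x, (if g x = 0 then coeff h (g ∘ Fin.predAbove x) e π
      (O.comp (m := N + 1) x rfl hd' f (br i)) else 0) =
      (2 : K) • tupleDiff K (fun π => coeff h g e π f) π := by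
  refine h.induction (C := fun f => ∑ x, (if g x = 0 then coeff h (g ∘ Fin.predAbove x) e π
      (O.comp (m := N + 1) x rfl hd' f (br i)) else 0) =
      (2 : K) • tupleDiff K (fun π => coeff h g e π f) π) ?_ ?_ ?_ ?_ f
  · intro s
    simp only [coeff_value]
    rw [← sum_blockDiff, Finset.smul_sum, ← s.f.sum_comp, Fintype.sum_sigma]
    exact Finset.sum_congr rfl fun l _ => sum_block h hd' s g e π l
  · simp [tupleDiff_zero]
  · intro f f' hf hf'
    simp only [map_add, LinearMap.add_apply, tupleDiff_add, smul_add, ← hf, ← hf']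
    rw [← Finset.sum_add_distrib]
    refine Finset.sum_congr rfl fun y _ => ?_
    split_ifs <;> simp
  · intro c f hf
    simp only [map_smul, LinearMap.smul_apply, tupleDiff_smul]
    rw [smul_comm, ← hf, Finset.smul_sum]
    refine Finset.sum_congr rfl fun y _ => ?_
    split_ifs <;> simp

end blocks

/-! ### The contracting homotopy on words -/

section words

/-- `DropZero v w`: the word `v` arises from `w` by dropping one of two neighbouring letters `0`. -/
inductive DropZero : List ℕ → List ℕ → Prop
  | here (w : List ℕ) : DropZero (0 :: w) (0 :: 0 :: w)
  | cons (x : ℕ) {v w : List ℕ} : DropZero v w → DropZero (x :: v) (x :: w)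

/-- The number of maximal runs of letters `0`; a run at the beginning only counts if `b` holds. -/
def runs : Bool → List ℕ → ℕ
  | _, [] => 0
  | b, x :: w => (if b = true ∧ x = 0 then 1 else 0) + runs (x != 0) w

theorem DropZero.length_eq {v w : List ℕ} (h : DropZero v w) : w.length = v.length + 1 := by
  induction h with
  | here w => rfl
  | cons x _ ih => simp [ih]

theorem DropZero.runs_eq {v w : List ℕ} (h : DropZero v w) (b : Bool) : runs b v = runs b w := by
  induction h generalizing b with
  | here w => simp [runs]
  | cons x _ ih => simp [runs, ih]

theorem DropZero.zero_mem {v w : List ℕ} (h : DropZero v w) : 0 ∈ v := by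
  induction h with
  | here w => simp
  | cons x _ ih => exact List.mem_cons_of_mem _ ih

theorem notMem_of_runs_eq_zero {w : List ℕ} (h : runs true w = 0) : 0 ∉ w := by
  induction w with
  | nil => simp
  | cons x w ih =>
    rw [runs] at h
    by_cases hx : x = 0
    · simp [hx] at h
    · have hx' : (x != 0) = true := by simpa using hx
      rw [hx'] at h
      simp only [List.mem_cons, not_or]
      exact ⟨Ne.symm hx, ih (by omega)⟩

variable {M : Type*} [AddCommGroup M]

theorem wordDiff_congr {c c' : List ℕ → M} {w : List ℕ} (h : ∀ v, DropZero v w → c v = c' v) :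
    wordDiff c w = wordDiff c' w := by
  induction w generalizing c c' with
  | nil => rfl
  | cons x w ih =>
    rw [wordDiff, wordDiff, ih fun v hv => h _ (.cons x hv)]
    congr 1
    split_ifs with h0
    · obtain ⟨rfl, h1⟩ := h0
      cases w with
      | nil => simp at h1
      | cons y w =>
        obtain rfl : y = 0 := by simpa using h1
        exact h _ (.here w)
    · rfl

/-- The contracting homotopy: the alternating sum of the values of `c` at the words that arise
from a word by inserting a letter `0` before a letter that does not follow a letter `0`. The truth
value `b` says whether an insertion at the beginning is allowed. -/
def wordHtpy : Bool → (List ℕ → M) → List ℕ → M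
  | _, _, [] => 0
  | b, c, x :: w => (if b = true then c (0 :: x :: w) else 0) -
      wordHtpy (x != 0) (fun w => c (x :: w)) w

theorem wordHtpy_congr {b : Bool} {c c' : List ℕ → M} {w : List ℕ}
    (h : ∀ v : List ℕ, v.length = w.length + 1 → c v = c' v) :
    wordHtpy b c w = wordHtpy b c' w := by
  induction w generalizing c c' b with
  | nil => rfl
  | cons x w ih =>
    rw [wordHtpy, wordHtpy, ih fun v hv => h _ (by simp [hv]), h _ (by simp)]

theorem map_wordHtpy {N : Type*} [AddCommGroup N] (F : M →+ N) (b : Bool) (c : List ℕ → M)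
    (w : List ℕ) : F (wordHtpy b c w) = wordHtpy b (fun w => F (c w)) w := by
  induction w generalizing c b with
  | nil => exact map_zero F
  | cons x w ih =>
    rw [wordHtpy, wordHtpy, map_sub, ih]
    split_ifs <;> simp

theorem wordHtpy_add (b : Bool) (c c' : List ℕ → M) (w : List ℕ) :
    wordHtpy b (fun w => c w + c' w) w = wordHtpy b c w + wordHtpy b c' w := by
  induction w generalizing c c' b with
  | nil => simp [wordHtpy]
  | cons x w ih =>
    rw [wordHtpy, wordHtpy, wordHtpy, ih]
    split_ifs <;> abel

theorem wordHtpy_zero (b : Bool) (w : List ℕ) : wordHtpy b (fun _ => (0 : M)) w = 0 := by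
  have := wordHtpy_add b (fun _ => (0 : M)) (fun _ => 0) w
  simpa using this

theorem wordHtpy_smul {K : Type*} [Field K] [Module K M] (b : Bool) (a : K) (c : List ℕ → M)
    (w : List ℕ) : wordHtpy b (fun w => a • c w) w = a • wordHtpy b c w :=
  (map_wordHtpy (DistribSMul.toAddMonoidHom M a) b c w).symm

theorem wordDiff_sub (c c' : List ℕ → M) (w : List ℕ) :
    wordDiff (fun w => c w - c' w) w = wordDiff c w - wordDiff c' w := by
  have h := wordDiff_add (fun w => c w - c' w) c' w
  simp only [sub_add_cancel] at h
  rw [h, add_sub_cancel_right]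

theorem wordHtpy_sub (b : Bool) (c c' : List ℕ → M) (w : List ℕ) :
    wordHtpy b (fun w => c w - c' w) w = wordHtpy b c w - wordHtpy b c' w := by
  have h := wordHtpy_add b (fun w => c w - c' w) c' w
  simp only [sub_add_cancel] at h
  rw [h, add_sub_cancel_right]

theorem wordDiff_ite (p : Prop) [Decidable p] (c : List ℕ → M) (w : List ℕ) :
    wordDiff (fun w => if p then c w else 0) w = if p then wordDiff c w else 0 := by
  split_ifs
  · rfl
  · exact wordDiff_zero w

/-- On a single word, the homotopy contracts the differential, up to the number of runs. -/
theorem wordDiff_wordHtpy (b : Bool) (c : List ℕ → M) (w : List ℕ) :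
    wordDiff (wordHtpy b c) w + wordHtpy b (wordDiff c) w = runs b w • c w := by
  induction w generalizing b c with
  | nil => simp [wordDiff, wordHtpy, runs]
  | cons x w ih =>
    have e1 : wordDiff (wordHtpy b c) (x :: w) =
        (if x = 0 ∧ w.head? = some 0 then wordHtpy b c w else 0) -
          ((if b = true then wordDiff (fun w => c (0 :: x :: w)) w else 0) -
            wordDiff (wordHtpy (x != 0) fun w => c (x :: w)) w) := by
      rw [wordDiff]
      congr 1
      simp only [wordHtpy]
      rw [wordDiff_sub, wordDiff_ite]
    have e2 : wordHtpy b (wordDiff c) (x :: w) =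
        (if b = true then ((if x = 0 then c (x :: w) else 0) -
          ((if x = 0 ∧ w.head? = some 0 then c (0 :: w) else 0) -
            wordDiff (fun w => c (0 :: x :: w)) w)) else 0) -
        (wordHtpy (x != 0) (fun w => if x = 0 ∧ w.head? = some 0 then c w else 0) w -
          wordHtpy (x != 0) (wordDiff fun w => c (x :: w)) w) := by
      rw [wordHtpy]
      simp only [wordDiff]
      rw [wordHtpy_sub]
      simp
    have e3 := ih (x != 0) (fun w => c (x :: w))
    -- The terms in which two letters at the beginning are involved.
    have e4 : (if x = 0 ∧ w.head? = some 0 then wordHtpy b c w else 0) =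
        (if b = true then (if x = 0 ∧ w.head? = some 0 then c (0 :: w) else 0) else 0) +
        wordHtpy (x != 0) (fun w => if x = 0 ∧ w.head? = some 0 then c w else 0) w := by
      by_cases hx : x = 0
      · subst hx
        cases w with
        | nil => simp [wordHtpy]
        | cons y w =>
          by_cases hy : y = 0
          · subst hy
            simp [wordHtpy, sub_eq_add_neg]
          · simp [wordHtpy, hy, wordHtpy_zero]
      · simp [hx, wordHtpy_zero]
    rw [e1, e2, e4, runs, add_smul, ← e3]
    by_cases hb : b = true
    · by_cases hx : x = 0
      · simp only [hb, hx, if_true, and_self, one_smul, true_and]; abel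
      · simp only [hb, hx, if_true, if_false, zero_smul, false_and, and_false]; abel
    · obtain rfl : b = false := by simpa using hb
      simp only [Bool.false_eq_true, if_false, false_and, zero_smul]; abel

theorem wordDiff_wordHtpy_comm (b : Bool) (F : List ℕ → List ℕ → M) (v w : List ℕ) :
    wordDiff (fun v => wordHtpy b (fun w => F v w) w) v =
      wordHtpy b (fun w => wordDiff (fun v => F v w) v) w := by
  induction w generalizing F b with
  | nil => simp only [wordHtpy, wordDiff_zero]
  | cons x w ih =>
    simp only [wordHtpy]
    rw [wordDiff_sub, wordDiff_ite, ih]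

end words

/-! ### The contracting homotopy on tuples of words -/

section tuples

variable (K : Type u) [Field K] {M : Type*} [AddCommGroup M] [Module K M] {m : ℕ}

/-- The contracting homotopy on tuples of words. -/
def tupleHtpy (c : (Fin m → List ℕ) → M) (π : Fin m → List ℕ) : M :=
  ∑ i, siteSign K π i • wordHtpy true (fun w => c (Function.update π i w)) (π i)

theorem siteSign_mul_self (π : Fin m → List ℕ) (i : Fin m) :
    siteSign K π i * siteSign K π i = 1 := by
  rw [siteSign, ← Finset.prod_mul_distrib]
  refine Finset.prod_eq_one fun y _ => ?_
  split_ifs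
  · exact sgn_mul_self K _
  · exact one_mul 1

/-- Changing the length of one word by one changes the signs of the sites before it. -/
theorem siteSign_update (π : Fin m → List ℕ) (i x : Fin m) (w : List ℕ)
    (hw : Even ((w.length : ℤ) - (π i).length - 1)) :
    siteSign K (Function.update π i w) x = (if x < i then -1 else 1) * siteSign K π x := by
  have h1 : (if x < i then (-1 : K) else 1) =
      ∏ y, if y = i then (if x < y then -1 else 1) else 1 := by
    rw [Finset.prod_ite_eq' Finset.univ i]; simp
  rw [h1, siteSign, siteSign, ← Finset.prod_mul_distrib]
  refine Finset.prod_congr rfl fun y _ => ?_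
  by_cases hy : y = i
  · subst hy
    rw [Function.update_self]
    simp only [if_true]
    split_ifs with hxy
    · have : sgn K (1 - (w.length : ℤ)) = sgn K (1 + (1 - ((π y).length : ℤ))) := by
        refine sgn_eq_of_even_sub K ?_
        have h2 := hw.neg
        have h3 : (1 - (w.length : ℤ)) - (1 + (1 - ((π y).length : ℤ))) =
          -((w.length : ℤ) - (π y).length - 1) + 2 * (-1) := by ring
        rw [h3]
        exact h2.add (even_two_mul _)
      rw [this, sgn_add, sgn_one]
    · exact (one_mul 1).symm
  · rw [Function.update_of_ne hy, if_neg hy, one_mul]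

theorem siteSign_update_self (π : Fin m → List ℕ) (i : Fin m) (w : List ℕ) :
    siteSign K (Function.update π i w) i = siteSign K π i := by
  refine Finset.prod_congr rfl fun y _ => ?_
  by_cases hy : y = i
  · simp [hy]
  · rw [Function.update_of_ne hy]

variable {K}

theorem wordDiff_sum {ι : Type*} (s : Finset ι) (F : ι → List ℕ → M) (w : List ℕ) :
    wordDiff (fun w => ∑ x ∈ s, F x w) w = ∑ x ∈ s, wordDiff (F x) w := by
  classical
  induction s using Finset.induction_on with
  | empty => simp [wordDiff_zero]
  | insert a s ha ih => simp only [Finset.sum_insert ha]; rw [wordDiff_add, ih]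

theorem wordHtpy_sum {ι : Type*} (s : Finset ι) (b : Bool) (F : ι → List ℕ → M) (w : List ℕ) :
    wordHtpy b (fun w => ∑ x ∈ s, F x w) w = ∑ x ∈ s, wordHtpy b (F x) w := by
  classical
  induction s using Finset.induction_on with
  | empty => simp [wordHtpy_zero]
  | insert a s ha ih => simp only [Finset.sum_insert ha]; rw [wordHtpy_add, ih]

/-- The number of maximal runs of letters `0` in the words of a tuple. -/
def tupleRuns (π : Fin m → List ℕ) : ℕ := ∑ x, runs true (π x)

/-- The homotopy contracts the differential, up to the number of runs. -/
theorem tupleDiff_tupleHtpy (c : (Fin m → List ℕ) → M) (π : Fin m → List ℕ) :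
    tupleDiff K (tupleHtpy K c) π + tupleHtpy K (tupleDiff K c) π = tupleRuns π • c π := by
  have e1 : tupleDiff K (tupleHtpy K c) π = ∑ x, ∑ y, siteSign K π x •
      wordDiff (fun v => siteSign K (Function.update π x v) y •
        wordHtpy true (fun w => c (Function.update (Function.update π x v) y w))
          (Function.update π x v y)) (π x) := by
    refine Finset.sum_congr rfl fun x _ => ?_
    rw [← Finset.smul_sum, ← wordDiff_sum]
    rfl
  have e2 : tupleHtpy K (tupleDiff K c) π = ∑ x, ∑ y, siteSign K π y •
      wordHtpy true (fun w => siteSign K (Function.update π y w) x •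
        wordDiff (fun v => c (Function.update (Function.update π y w) x v))
          (Function.update π y w x)) (π y) := by
    rw [Finset.sum_comm]
    refine Finset.sum_congr rfl fun y _ => ?_
    rw [← Finset.smul_sum, ← wordHtpy_sum]
    rfl
  rw [e1, e2, ← Finset.sum_add_distrib, tupleRuns, Finset.sum_smul]
  refine Finset.sum_congr rfl fun x _ => ?_
  rw [← Finset.sum_add_distrib]
  refine (Finset.sum_eq_single x (fun y _ hy => ?_) (by simp)).trans ?_
  -- Modifications of different words anticommute: the sign of a site changes if the length of a
  -- later word changes by one.
  · have h1 : wordDiff (fun v => siteSign K (Function.update π x v) y •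
        wordHtpy true (fun w => c (Function.update (Function.update π x v) y w))
          (Function.update π x v y)) (π x) = ((if y < x then -1 else 1) * siteSign K π y) •
        wordHtpy true (fun w => wordDiff (fun v =>
          c (Function.update (Function.update π x v) y w)) (π x)) (π y) := by
      rw [← wordDiff_wordHtpy_comm, ← wordDiff_smul]
      refine wordDiff_congr fun v hv => ?_
      rw [siteSign_update K π x y v (by
        rw [hv.length_eq]; push_cast; exact ⟨-1, by ring⟩), Function.update_of_ne hy]
    have h2 : wordHtpy true (fun w => siteSign K (Function.update π y w) x •
        wordDiff (fun v => c (Function.update (Function.update π y w) x v))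
          (Function.update π y w x)) (π y) = ((if x < y then -1 else 1) * siteSign K π x) •
        wordHtpy true (fun w => wordDiff (fun v =>
          c (Function.update (Function.update π x v) y w)) (π x)) (π y) := by
      rw [← wordHtpy_smul]
      refine wordHtpy_congr fun w hw => ?_
      rw [siteSign_update K π y x w (by rw [hw]; push_cast; exact ⟨0, by ring⟩),
        Function.update_of_ne hy.symm]
      simp only [Function.update_comm hy.symm]
    rw [h1, h2, smul_smul, smul_smul, ← add_smul]
    rcases lt_or_gt_of_ne hy with h | h
    · rw [if_pos h, if_neg h.not_gt]; convert zero_smul K _ using 2; ring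
    · rw [if_pos h, if_neg h.not_gt]; convert zero_smul K _ using 2; ring
  -- Modifications of the same word contribute the number of runs of this word.
  · simp only [siteSign_update_self, Function.update_self, Function.update_idem, wordDiff_smul,
      wordHtpy_smul, smul_smul, siteSign_mul_self, one_smul]
    have h := wordDiff_wordHtpy true (fun w => c (Function.update π x w)) (π x)
    rwa [Function.update_eq_self] at h

theorem tupleRuns_update {π : Fin m → List ℕ} {x : Fin m} {v : List ℕ} (h : DropZero v (π x)) :
    tupleRuns (Function.update π x v) = tupleRuns π := by
  refine Finset.sum_congr rfl fun y _ => ?_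
  by_cases hy : y = x
  · subst hy; rw [Function.update_self, h.runs_eq]
  · rw [Function.update_of_ne hy]

theorem tupleRuns_ne_zero {π : Fin m → List ℕ} {x : Fin m} (h : 0 ∈ π x) : tupleRuns π ≠ 0 :=
  fun h0 => notMem_of_runs_eq_zero (Finset.sum_eq_zero_iff.1 h0 x (Finset.mem_univ x)) h

theorem tupleDiff_congr {c c' : (Fin m → List ℕ) → M} {π : Fin m → List ℕ}
    (h : ∀ x v, DropZero v (π x) → c (Function.update π x v) = c' (Function.update π x v)) :
    tupleDiff K c π = tupleDiff K c' π :=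
  Finset.sum_congr rfl fun x _ => congrArg _ (wordDiff_congr (h x))

/-- The homotopy divided by the number of runs. -/
def contract (c : (Fin m → List ℕ) → M) (π : Fin m → List ℕ) : M :=
  (tupleRuns π : K)⁻¹ • tupleHtpy K c π

theorem tupleDiff_contract [CharZero K] (c : (Fin m → List ℕ) → M) (π : Fin m → List ℕ)
    (hc : ∀ π, tupleDiff K c π = 0) (hπ : ∃ x, 0 ∈ π x) :
    tupleDiff K (contract (K := K) c) π = c π := by
  -- The differential does not change the number of runs, so the division by it can be carried out
  -- afterwards.
  have h1 : tupleDiff K (contract (K := K) c) π =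
      (tupleRuns π : K)⁻¹ • tupleDiff K (tupleHtpy K c) π := by
    rw [← tupleDiff_smul]
    refine tupleDiff_congr fun x v hv => ?_
    rw [contract, tupleRuns_update hv]
  have h2 := tupleDiff_tupleHtpy (K := K) c π
  have h3 : tupleHtpy K (tupleDiff K c) π = 0 := by
    simp only [tupleHtpy, hc, wordHtpy_zero, smul_zero, Finset.sum_const_zero]
  rw [h3, add_zero] at h2
  obtain ⟨x, hx⟩ := hπ
  rw [h1, h2, ← Nat.cast_smul_eq_nsmul K, smul_smul, inv_mul_cancel₀, one_smul]
  exact Nat.cast_ne_zero.2 (tupleRuns_ne_zero hx)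

end tuples

section equivariance

variable {K : Type u} [Field K]

/-- The change of the Koszul sign when one degree is lowered by one. -/
theorem koszul_lower {m : ℕ} (θ : Fin m ≃ Fin m) (q q' : Fin m → ℤ) (a : Fin m)
    (h : ∀ l, l ≠ θ a → q' l = q l) (hl : q' (θ a) = q (θ a) - 1) :
    (∏ y, if a < y then sgn K (q (θ y)) else 1) * koszul K θ q' =
      koszul K θ q * ∏ y, if θ a < y then sgn K (q y) else 1 := by
  have hab : ∀ s : K, s * s = 1 → ∀ t : Prop, [Decidable t] → (if t then s else 1) *
      (if t then s else 1) = 1 := by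
    intro s hs t _; split_ifs <;> simp [hs]
  -- The pairs that are inverted and contain `a` change by the degree of their other element.
  have e1 : koszul K θ q' = koszul K θ q *
      ∏ y, if (a < y ∧ θ y < θ a) ∨ (y < a ∧ θ a < θ y) then sgn K (q (θ y)) else 1 := by
    have h1 : (∏ y, if (a < y ∧ θ y < θ a) ∨ (y < a ∧ θ a < θ y) then sgn K (q (θ y)) else 1) =
        (∏ x, ∏ y, if x = a then (if a < y ∧ θ y < θ a then sgn K (q (θ y)) else 1) else 1) *
        ∏ x, ∏ y, if y = a then (if x < a ∧ θ a < θ x then sgn K (q (θ x)) else 1) else 1 := by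
      have h2 : (∏ x, ∏ y, if x = a then
          (if a < y ∧ θ y < θ a then sgn K (q (θ y)) else 1) else 1) =
          ∏ y, if a < y ∧ θ y < θ a then sgn K (q (θ y)) else 1 := by
        rw [Finset.prod_comm]
        refine Finset.prod_congr rfl fun y _ => ?_
        rw [Finset.prod_ite_eq' Finset.univ a]; simp
      have h3 : (∏ x, ∏ y, if y = a then
          (if x < a ∧ θ a < θ x then sgn K (q (θ x)) else 1) else 1) =
          ∏ x, if x < a ∧ θ a < θ x then sgn K (q (θ x)) else 1 := by
        refine Finset.prod_congr rfl fun y _ => ?_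
        rw [Finset.prod_ite_eq' Finset.univ a]; simp
      rw [h2, h3, ← Finset.prod_mul_distrib]
      refine Finset.prod_congr rfl fun y _ => ?_
      by_cases h4 : a < y
      · simp [h4, h4.not_gt]
      · simp [h4]
    rw [h1, koszul, koszul, ← Finset.prod_mul_distrib, ← Finset.prod_mul_distrib]
    refine Finset.prod_congr rfl fun x _ => ?_
    rw [← Finset.prod_mul_distrib, ← Finset.prod_mul_distrib]
    refine Finset.prod_congr rfl fun y _ => ?_
    have hs : ∀ s t : ℤ, sgn K ((s - 1) * t) = sgn K (s * t) * sgn K t := fun s t => by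
      rw [← sgn_add]; exact sgn_eq_of_even_sub K ⟨-t, by ring⟩
    have hs' : ∀ s t : ℤ, sgn K (s * (t - 1)) = sgn K (s * t) * sgn K s := fun s t => by
      rw [← sgn_add]; exact sgn_eq_of_even_sub K ⟨-s, by ring⟩
    by_cases hxy : x < y
    · by_cases hx : x = a
      · subst hx
        have hy : θ y ≠ θ x := θ.injective.ne hxy.ne'
        simp only [hxy, true_and, if_true, hxy.ne', if_false, mul_one, hl, h _ hy, hs]
        split_ifs <;> simp
      · have hx' : θ x ≠ θ a := θ.injective.ne hx
        by_cases hy : y = a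
        · subst hy
          simp only [hxy, true_and, if_true, hx, if_false, one_mul, hl, h _ hx', hs']
          split_ifs <;> simp
        · have hy' : θ y ≠ θ a := θ.injective.ne hy
          simp only [hx, hy, if_false, mul_one, h _ hx', h _ hy']
    · by_cases hx : x = a
      · subst hx
        by_cases hy : y = x
        · subst hy; simp
        · simp [hxy, hy]
      · by_cases hy : y = a
        · subst hy; simp [hxy, hx]
        · simp [hxy, hx, hy]
  have e2 : (∏ y, if θ a < y then sgn K (q y) else 1) =
      ∏ y, if θ a < θ y then sgn K (q (θ y)) else 1 :=
    (θ.prod_comp fun y => if θ a < y then sgn K (q y) else 1).symm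
  -- Either `y` follows `a` or the pair of `a` and `y` is inverted, but not both, exactly if `θ y`
  -- follows `θ a`.
  rw [e1, e2, mul_left_comm, ← Finset.prod_mul_distrib]
  congr 1
  refine Finset.prod_congr rfl fun y _ => ?_
  have hS := sgn_mul_self K (q (θ y))
  rcases lt_trichotomy a y with h1 | rfl | h1
  · rcases lt_or_gt_of_ne (θ.injective.ne h1.ne) with h2 | h2
    · simp [h1, h2, h1.not_gt, h2.not_gt]
    · simp [h1, h2, h1.not_gt, h2.not_gt, hS]
  · simp
  · rcases lt_or_gt_of_ne (θ.injective.ne h1.ne) with h2 | h2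
    · simp [h1, h2, h1.not_gt, h2.not_gt]
    · simp [h1, h2, h1.not_gt, h2.not_gt]

/-- The functions of tuples of words that transform under permutations of the words as the
coefficients of operations do. -/
def IsEquivariant (A : Collection.{u, v} K) {m : ℕ} {e : ℤ} (c : (Fin m → List ℕ) → A.obj m e) :
    Prop :=
  ∀ (π : Fin m → List ℕ) (θ : Fin m ≃ Fin m),
    c (π ∘ θ) = koszul K θ (fun x => 1 - ((π x).length : ℤ)) • A.act θ.symm (c π)

/-- The homotopy preserves equivariance: the site signs and the Koszul signs change compatibly when
one word is made longer by a letter (`koszul_lower`). -/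
theorem IsEquivariant.contract {A : Collection.{u, v} K} {m : ℕ} {e : ℤ}
    {c : (Fin m → List ℕ) → A.obj m e} (hc : IsEquivariant A c) :
    IsEquivariant A (contract (K := K) c) := by
  intro π θ
  have hN : tupleRuns (π ∘ θ) = tupleRuns π := θ.sum_comp fun x => runs true (π x)
  rw [TwOperad.contract, TwOperad.contract, hN, map_smul, smul_comm]
  congr 1
  rw [tupleHtpy, tupleHtpy, map_sum, Finset.smul_sum]
  refine Eq.trans (Finset.sum_congr rfl fun x _ => ?_) (θ.sum_comp _)
  set q : Fin m → ℤ := fun x => 1 - ((π x).length : ℤ) with hq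
  have h1 : wordHtpy true (fun w => c (Function.update (π ∘ θ) x w)) ((π ∘ θ) x) =
      koszul K θ (Function.update q (θ x) (q (θ x) - 1)) •
        A.act θ.symm (wordHtpy true (fun w => c (Function.update π (θ x) w)) (π (θ x))) := by
    have h2 := map_wordHtpy (A.act (d := e) θ.symm).toAddMonoidHom true
      (fun w => c (Function.update π (θ x) w)) (π (θ x))
    simp only [LinearMap.toAddMonoidHom_coe] at h2
    rw [h2, ← wordHtpy_smul]
    refine wordHtpy_congr fun w hw => ?_
    have h3 : Function.update (π ∘ θ) x w = Function.update π (θ x) w ∘ θ := by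
      rw [Function.update_comp_equiv, Equiv.symm_apply_apply]
    rw [h3, hc]
    congr 2
    funext y
    by_cases hy : y = θ x
    · subst hy
      simp only [Function.update_self, hq]
      rw [hw, Function.comp_apply]; push_cast; ring
    · simp only [Function.update_of_ne hy, hq]
  rw [h1, map_smul, smul_smul, smul_smul]
  congr 1
  exact koszul_lower θ q _ x (fun l hl => Function.update_of_ne hl _ _) (Function.update_self _ _ _)

end equivariance

/-! ### Normal words -/

section good

/-- The words that occur as normal forms: a single letter or a word whose last letter is larger
than all others, and the word `00`. The latter is needed because the bracket is symmetric, so that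
`{a₀, a₁}` survives if both letters are `0`. -/
def IsGood (w : List ℕ) : Prop := w = [0, 0] ∨ ∃ u y, w = u ++ [y] ∧ ∀ x ∈ u, x < y

/-- Dropping one of two neighbouring letters `0` preserves normal words: neighbouring letters `0`
precede a larger last letter, or the word is `00`. -/
theorem DropZero.isGood {v w : List ℕ} (h : DropZero v w) (hw : IsGood w) : IsGood v := by
  rcases hw with rfl | ⟨u, y, hw, hu⟩
  · cases h with
    | here => exact Or.inr ⟨[], 0, rfl, by simp⟩
    | cons _ h => cases h with | cons _ h => cases h
  · refine Or.inr ?_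
    suffices h' : ∃ u', v = u' ++ [y] ∧ ∀ x ∈ u', x < y from
      ⟨h'.choose, y, h'.choose_spec⟩
    induction h generalizing u with
    | here w =>
      match u, hw, hu with
      | [], hw, _ => simp at hw
      | [x], hw, hu =>
        obtain ⟨rfl, rfl, rfl⟩ : 0 = x ∧ 0 = y ∧ w = [] := by simpa using hw
        simp at hu
      | x :: x' :: u, hw, hu =>
        obtain ⟨rfl, rfl, rfl⟩ : 0 = x ∧ 0 = x' ∧ w = u ++ [y] := by simpa using hw
        exact ⟨0 :: u, rfl, fun z hz => hu z (List.mem_cons_of_mem _ hz)⟩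
    | @cons x v w hvw ih =>
      match u, hw, hu with
      | [], hw, _ =>
        obtain ⟨rfl, rfl⟩ : x = y ∧ w = [] := by simpa using hw
        cases hvw
      | x' :: u, hw, hu =>
        obtain ⟨rfl, rfl⟩ : x = x' ∧ w = u ++ [y] := by simpa using hw
        obtain ⟨u', rfl, h''⟩ := ih u rfl fun z hz => hu z (List.mem_cons_of_mem _ hz)
        refine ⟨x :: u', rfl, fun z hz => ?_⟩
        rcases List.mem_cons.1 hz with rfl | hz
        · exact hu z (by simp)
        · exact h'' z hz

theorem IsGood.length_pos {w : List ℕ} (hw : IsGood w) : 0 < w.length := by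
  rcases hw with rfl | ⟨u, y, rfl, _⟩ <;> simp

variable (K : Type u) [Field K]

/-- The coefficient of a normal word in the expansion of the right-normed bracket of its
letters. -/
def goodWeight (w : List ℕ) : K := if w = [0, 0] then 2 else lieCoeff K (w.length - 1)

theorem goodWeight_ne_zero [CharZero K] (w : List ℕ) : goodWeight K w ≠ 0 := by
  rw [goodWeight]
  split_ifs
  · exact two_ne_zero
  · exact lieCoeff_ne_zero _

variable {K}

/-- In the expansion of a right-normed bracket whose letters form a normal word, this is the only
normal word. -/
theorem words_lieWord_good {k : ℕ} {l : Fin (k + 1) → ℕ} (hl : IsGood (List.ofFn l)) {w : List ℕ}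
    (hw : IsGood w) : words (lieWord K k) l w =
      if w = List.ofFn l then goodWeight K (List.ofFn l) else 0 := by
  by_cases h0 : List.ofFn l = [0, 0]
  · obtain rfl : k = 1 := by simpa using congrArg List.length h0
    rw [h0, words_lieWord_one_const, Finsupp.single_apply, goodWeight, if_pos rfl]
    · simp only [eq_comm]
    · intro x
      have : l x ∈ List.ofFn l := List.mem_ofFn.2 ⟨x, rfl⟩
      rw [h0] at this
      simpa using this
  · rcases hl with hl | ⟨u, y, hl, hu⟩
    · exact absurd hl h0
    have h1 := hl
    rw [List.ofFn_succ', List.concat_eq_append] at h1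
    obtain ⟨rfl, h2⟩ := List.append_inj' h1 rfl
    obtain rfl : l (Fin.last k) = y := by simpa using h2
    have hlt : ∀ x, x ≠ Fin.last k → l x < l (Fin.last k) := by
      intro x hx
      obtain ⟨z, rfl⟩ := Fin.exists_castSucc_eq.2 hx
      exact hu _ (by simp)
    by_cases hp : w.Perm (List.ofFn l)
    · rw [words_lieWord k l (fun x hx => (hlt x hx).ne), goodWeight, if_neg h0, List.length_ofFn,
        Nat.add_sub_cancel]
      rcases hw with rfl | ⟨u', y', rfl, hu'⟩
      · exfalso
        apply h0
        have h3 : List.ofFn l = List.replicate 2 0 := by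
          refine List.eq_replicate_iff.2 ⟨by simpa using hp.length_eq.symm, fun b hb => ?_⟩
          simpa using hp.mem_iff.2 hb
        exact h3
      · have h3 : y' ∈ List.ofFn l := hp.mem_iff.1 (by simp)
        have h4 : l (Fin.last k) ∈ u' ++ [y'] :=
          hp.mem_iff.2 (List.mem_ofFn.2 ⟨_, rfl⟩)
        obtain ⟨x, hx⟩ := List.mem_ofFn.1 h3
        have h5 : y' ≤ l (Fin.last k) := by
          by_cases h6 : x = Fin.last k
          · rw [← hx, h6]
          · rw [← hx]; exact (hlt x h6).le
        have h6 : l (Fin.last k) ≤ y' := by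
          rcases List.mem_append.1 h4 with h7 | h7
          · exact (hu' _ h7).le
          · exact (List.mem_singleton.1 h7).le
        simpa using le_antisymm h5 h6
    · rw [if_neg fun h => hp (by rw [h])]
      by_contra h3
      exact hp (perm_of_words_ne h3)

/-- A block of labels whose last label is the largest one is a normal word, or it consists of at
least three labels `0`. -/
theorem isGood_or {k : ℕ} {l : Fin (k + 1) → ℕ} (h1 : ∀ z, l z ≤ l (Fin.last k))
    (h2 : l (Fin.last k) ≠ 0 → ∀ z, l z = l (Fin.last k) → z = Fin.last k) :
    IsGood (List.ofFn l) ∨ (2 ≤ k ∧ ∀ z, l z = 0) := by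
  by_cases h0 : l (Fin.last k) = 0
  · have h3 : ∀ z, l z = 0 := fun z => Nat.le_zero.1 (h0 ▸ h1 z)
    match k, l, h3 with
    | 0, l, h3 => exact Or.inl (Or.inr ⟨[], 0, by simp [h3], by simp⟩)
    | 1, l, h3 => exact Or.inl (Or.inl (by simp [h3]))
    | k + 2, l, h3 => exact Or.inr ⟨by omega, h3⟩
  · refine Or.inl (Or.inr ⟨List.ofFn fun z => l (Fin.castSucc z), l (Fin.last k), ?_, ?_⟩)
    · rw [List.ofFn_succ', List.concat_eq_append]
    · intro x hx
      obtain ⟨z, rfl⟩ := List.mem_ofFn.1 hx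
      refine lt_of_le_of_ne (h1 _) fun h => ?_
      exact (Fin.castSucc_lt_last z).ne (h2 h0 _ h)

end good

/-! ### Symbols with right-normed brackets -/

section symbols

variable {K : Type u} [Field K] {P : DGOperad.{u, v} K} {O : DGOperad.{u, w} K}
  {j : OperadHom P.toOperadData O.toOperadData}
  {i : OperadHom (LLie K).toOperadData O.toOperadData}

theorem linearCombination_value (h : IsDistributive j i) {N : ℕ} {d : ℤ}
    {x : PlSym P.toCollection (LLie K).toCollection N d →₀ K}
    (hx : PlRel P.toCollection (LLie K).toCollection N d x) :
    Finsupp.linearCombination K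
      (fun s => s.value (O := O.toOperadData) j.toHom i.toHom) x = 0 := by
  obtain ⟨Φ, hΦ⟩ := h.plethysm N d
  have h1 : Finsupp.linearCombination K
      (fun s => s.value (O := O.toOperadData) j.toHom i.toHom) =
      Φ.toLinearMap.comp (Submodule.mkQ (Submodule.span K
        {x | PlRel P.toCollection (LLie K).toCollection N d x})) := by
    refine Finsupp.lhom_ext' fun s => LinearMap.ext_ring ?_
    simp only [LinearMap.comp_apply, Finsupp.lsingle_apply, Finsupp.linearCombination_single,
      one_smul]
    exact (hΦ s).symm
  rw [h1, LinearMap.comp_apply, Submodule.mkQ_apply,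
    (Submodule.Quotient.mk_eq_zero _).2 (Submodule.subset_span hx), map_zero]

/-- The value of a symbol, as a function of the operation of `P`. -/
def headValue (h : IsDistributive j i) {N : ℕ} {d : ℤ} {r : ℕ} {p : ℤ} (k : Fin r → ℕ)
    (q : Fin r → ℤ) (X : ∀ l, (LLie K).obj (k l) (q l)) (f : (Σ l, Fin (k l)) ≃ Fin N)
    (hd : p + ∑ l, q l = d) : P.obj r p →ₗ[K] O.obj N d where
  toFun v := PlSym.value (O := O.toOperadData) j.toHom i.toHom ⟨r, p, v, k, q, X, f, hd⟩
  map_add' a b := by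
    have := linearCombination_value h (PlRel.left_add a b k q X f hd)
    simpa [sub_sub, sub_eq_zero] using this
  map_smul' c a := by
    have := linearCombination_value h (PlRel.left_smul c a k q X f hd)
    simpa [sub_eq_zero] using this

/-- The value of a symbol, as a function of one of the elements of `ΛLie`. -/
def slotValue (h : IsDistributive j i) {N : ℕ} {d : ℤ} {r : ℕ} {p : ℤ} (v : P.obj r p)
    (k : Fin r → ℕ) (q : Fin r → ℤ) (X : ∀ l, (LLie K).obj (k l) (q l))
    (f : (Σ l, Fin (k l)) ≃ Fin N) (hd : p + ∑ l, q l = d) (a : Fin r) :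
    (LLie K).obj (k a) (q a) →ₗ[K] O.obj N d where
  toFun b := PlSym.value (O := O.toOperadData) j.toHom i.toHom
    ⟨r, p, v, k, q, Function.update X a b, f, hd⟩
  map_add' b b' := by
    have := linearCombination_value h (PlRel.right_add v k q X a b b' f hd)
    simpa [sub_sub, sub_eq_zero] using this
  map_smul' c b := by
    have := linearCombination_value h (PlRel.right_smul v k q X a c b f hd)
    simpa [sub_eq_zero] using this

theorem value_act_right (h : IsDistributive j i) {N : ℕ} {d : ℤ} {r : ℕ} {p : ℤ} (v : P.obj r p)
    (k : Fin r → ℕ) (q : Fin r → ℤ) (X : ∀ l, (LLie K).obj (k l) (q l))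
    (τ : ∀ l, Fin (k l) ≃ Fin (k l))
    (f : (Σ l, Fin (k l)) ≃ Fin N) (hd : p + ∑ l, q l = d) :
    PlSym.value (O := O.toOperadData) j.toHom i.toHom
      ⟨r, p, v, k, q, fun l => (LLie K).act (τ l) (X l), f, hd⟩ =
    PlSym.value (O := O.toOperadData) j.toHom i.toHom
      ⟨r, p, v, k, q, X, (Equiv.sigmaCongrRight τ).trans f, hd⟩ := by
  have := linearCombination_value h (PlRel.act_right v k q X τ f hd)
  simpa [sub_eq_zero] using this

/-- The symbol whose elements of `ΛLie` are right-normed brackets, with `k l + 1` inputs. -/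
def lieSymbol {N : ℕ} {d : ℤ} {m : ℕ} {p : ℤ} (v : P.obj m p) (k : Fin m → ℕ)
    (f : (Σ x, Fin (k x + 1)) ≃ Fin N) (hd : p + ∑ x, -(k x : ℤ) = d) :
    PlSym P.toCollection (LLie K).toCollection N d :=
  ⟨m, p, v, fun x => k x + 1, fun x => -(k x : ℤ), fun x => lieWord K (k x), f, hd⟩

/-- Operations are combinations of values of symbols whose elements of `ΛLie` are right-normed
brackets with a maximal label at the innermost input. -/
theorem mem_of_lieSymbol (h : IsDistributive j i) {N : ℕ} {d : ℤ} (g : Fin N → ℕ)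
    (S : Submodule K (O.obj N d))
    (hS : ∀ (m : ℕ) (p : ℤ) (v : P.obj m p) (k : Fin m → ℕ) (f : (Σ x, Fin (k x + 1)) ≃ Fin N)
      (hd : p + ∑ x, -(k x : ℤ) = d), (∀ x z, g (f ⟨x, z⟩) ≤ g (f ⟨x, Fin.last (k x)⟩)) →
      (lieSymbol v k f hd).value (O := O.toOperadData) j.toHom i.toHom ∈ S) (F : O.obj N d) :
    F ∈ S := by
  -- symbols whose elements are all right-normed brackets, up to relabelling of inputs
  have h1 : ∀ (r : ℕ) (p : ℤ) (v : P.obj r p) (k : Fin r → ℕ) (q : Fin r → ℤ)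
      (X : ∀ l, (LLie K).obj (k l) (q l)) (f : (Σ l, Fin (k l)) ≃ Fin N)
      (hd : p + ∑ l, q l = d),
      (∀ l, ∃ y, (∀ z, g (f ⟨l, z⟩) ≤ g (f ⟨l, y⟩)) ∧ IsRightNormed y (X l)) →
      PlSym.value (O := O.toOperadData) j.toHom i.toHom ⟨r, p, v, k, q, X, f, hd⟩ ∈ S := by
    intro r p v k q X f hd hX
    choose y hy a τ ha hτ hX using hX
    obtain rfl : k = fun l => a l + 1 := funext fun l => by
      simpa using (Fintype.card_congr (τ l)).symm
    obtain rfl : q = fun l => -(a l : ℤ) := funext fun l => (ha l).symm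
    obtain rfl : X = fun l => (LLie K).act (τ l) (lieWord K (a l)) := funext hX
    rw [value_act_right h]
    refine hS r p v a _ hd fun x z => ?_
    have h2 := hy x (τ x z)
    rw [← hτ x] at h2
    exact h2
  refine h.induction (C := fun F => F ∈ S) ?_ (zero_mem S) (fun _ _ => add_mem)
    (fun c _ => S.smul_mem c) F
  rintro ⟨r, p, v, k, q, X, f, hd⟩
  -- The elements outside of `T` are right-normed brackets already; one element of `T` after the
  -- other is written as a combination of such.
  have h2 : ∀ (T : Finset (Fin r)) (X : ∀ l, (LLie K).obj (k l) (q l)),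
      (∀ l, l ∉ T → ∃ y, (∀ z, g (f ⟨l, z⟩) ≤ g (f ⟨l, y⟩)) ∧ IsRightNormed y (X l)) →
      PlSym.value (O := O.toOperadData) j.toHom i.toHom ⟨r, p, v, k, q, X, f, hd⟩ ∈ S := by
    intro T
    induction T using Finset.induction_on with
    | empty => intro X hX; exact h1 r p v k q X f hd fun l => hX l (by simp)
    | insert a T ha ih =>
      intro X hX
      have h3 : PlSym.value (O := O.toOperadData) j.toHom i.toHom ⟨r, p, v, k, q, X, f, hd⟩ =
          slotValue h v k q X f hd a (X a) := by
        change _ = PlSym.value _ _ _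
        rw [Function.update_eq_self]
      rw [h3]
      by_cases hk : k a = 0
      · rw [LLie.eq_zero_of_arity_zero (X a) hk, map_zero]
        exact zero_mem S
      · have : Nonempty (Fin (k a)) := ⟨⟨0, Nat.pos_of_ne_zero hk⟩⟩
        obtain ⟨y, hy⟩ := Finite.exists_max fun z => g (f ⟨a, z⟩)
        have h4 : rightNormed K (q a) y ≤ S.comap (slotValue h v k q X f hd a) := by
          refine Submodule.span_le.2 fun b hb => ?_
          refine ih (Function.update X a b) fun l hl => ?_
          by_cases hla : l = a
          · subst hla
            exact ⟨y, hy, by rwa [Function.update_self]⟩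
          · rw [Function.update_of_ne hla]
            exact hX l (by simp [hla, hl])
        exact h4 (LLie.mem_rightNormed (X a) y)
  exact h2 Finset.univ X (by simp)

end symbols

/-! ### The reconstruction of operations from coefficients -/

section fibers

/-- The permutations that preserve the letters `g`. -/
def letterPerms {N : ℕ} (g : Fin N → ℕ) : Finset (Fin N ≃ Fin N) :=
  Finset.univ.filter fun σ => g ∘ σ = g

theorem mem_letterPerms {N : ℕ} {g : Fin N → ℕ} {σ : Fin N ≃ Fin N} :
    σ ∈ letterPerms g ↔ g ∘ σ = g := by simp [letterPerms]

/-- The words spelled by the letters of the inputs of a symbol. -/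
def tupleOf {N m : ℕ} (g : Fin N → ℕ) (k : Fin m → ℕ) (f : (Σ x, Fin (k x + 1)) ≃ Fin N) :
    Fin m → List ℕ := fun x => List.ofFn fun z => g (f ⟨x, z⟩)

theorem lt_of_labelling {N m : ℕ} {k : Fin m → ℕ} (f : (Σ x, Fin (k x + 1)) ≃ Fin N) (x : Fin m) :
    k x < N + 1 := by
  have h1 : k x + 1 ≤ Fintype.card (Σ x, Fin (k x + 1)) := by
    rw [← Fintype.card_fin (k x + 1)]
    exact Fintype.card_le_of_injective (fun z => (⟨x, z⟩ : Σ x, Fin (k x + 1)))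
      fun a b hab => by simpa using hab
  rw [Fintype.card_congr f, Fintype.card_fin] at h1
  omega

theorem sum_labelling {N m : ℕ} {k : Fin m → ℕ} (f : (Σ x, Fin (k x + 1)) ≃ Fin N) :
    ∑ x, k x + m = N := by
  have h1 := Fintype.card_congr f
  simpa [Finset.sum_add_distrib] using h1

/-- A sum over the labellings that spell the same words as a given one. -/
theorem sum_tupleOf_eq {M : Type*} [AddCommMonoid M] {N m : ℕ} (g : Fin N → ℕ)
    (Ψ : ∀ k : Fin m → ℕ, ((Σ x, Fin (k x + 1)) ≃ Fin N) → M) (k₀ : Fin m → ℕ)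
    (f₀ : (Σ x, Fin (k₀ x + 1)) ≃ Fin N) :
    ∑ k : Fin m → Fin (N + 1), ∑ f : (Σ x, Fin ((k x : ℕ) + 1)) ≃ Fin N,
      (if tupleOf g (fun x => k x) f = tupleOf g k₀ f₀ then Ψ (fun x => k x) f else 0) =
    ∑ σ ∈ letterPerms g, Ψ k₀ (f₀.trans σ) := by
  obtain ⟨k₁, rfl⟩ : ∃ k₁ : Fin m → Fin (N + 1), k₀ = fun x => (k₁ x : ℕ) :=
    ⟨fun x => ⟨k₀ x, lt_of_labelling f₀ x⟩, rfl⟩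
  refine (Finset.sum_eq_single k₁ (fun k _ hk => Finset.sum_eq_zero fun f _ => if_neg fun h => ?_)
    (by simp)).trans ?_
  · refine hk (funext fun x => Fin.ext ?_)
    simpa [tupleOf] using congrArg List.length (congrFun h x)
  · rw [letterPerms, Finset.sum_filter]
    refine (Fintype.sum_equiv (Equiv.equivCongr f₀ (Equiv.refl _)) _ _ fun f => ?_)
    have h1 : f₀.trans (Equiv.equivCongr f₀ (Equiv.refl _) f) = f := by ext; simp
    rw [h1]
    have h2 : tupleOf g (fun x => k₁ x) f = tupleOf g (fun x => k₁ x) f₀ ↔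
        g ∘ (Equiv.equivCongr f₀ (Equiv.refl _) f) = g := by
      constructor
      · intro h
        funext y
        obtain ⟨⟨x, z⟩, rfl⟩ := f₀.surjective y
        have h3 := congrFun (List.ofFn_injective (congrFun h x)) z
        simpa using h3
      · intro h
        funext x
        refine congrArg List.ofFn (funext fun z => ?_)
        have h3 := congrFun h (f₀ ⟨x, z⟩)
        simpa using h3
    simp only [h2]

/-- Families with the same multiset of values agree up to a bijection of the indices. -/
theorem exists_equiv_of_sum_eq {α β : Type*} [Fintype α] [Fintype β] (s : α → ℕ) (t : β → ℕ)
    (h : ∑ x, ({s x} : Multiset ℕ) = ∑ y, {t y}) : ∃ f : α ≃ β, ∀ x, t (f x) = s x := by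
  have h1 : ∀ y, Nonempty ({x // s x = y} ≃ {x // t x = y}) := by
    intro y
    rw [← Fintype.card_eq, Fintype.card_subtype, Fintype.card_subtype]
    have h2 := congrArg (Multiset.count y) h
    simp only [Multiset.count_sum', Multiset.count_singleton] at h2
    simpa [eq_comm] using h2
  exact ⟨Equiv.ofFiberEquiv fun y => (h1 y).some, fun x => Equiv.ofFiberEquiv_map _ x⟩

/-- Every tuple of nonempty words with the correct letters is spelled by a labelling. -/
theorem exists_labelling {N m : ℕ} {g : Fin N → ℕ} {π : Fin m → List ℕ}
    (hπ : ∀ x, 0 < (π x).length) (hc : ∑ x, (π x : Multiset ℕ) = ∑ x, {g x}) :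
    ∃ (k : Fin m → ℕ) (f : (Σ x, Fin (k x + 1)) ≃ Fin N), tupleOf g k f = π := by
  obtain ⟨k, l, rfl⟩ : ∃ (k : Fin m → ℕ) (l : ∀ x, Fin (k x + 1) → ℕ),
      π = fun x => List.ofFn (l x) := by
    refine ⟨fun x => (π x).length - 1, fun x z => (π x)[(z : ℕ)]'(by
      have h1 := hπ x
      have h2 : (z : ℕ) < (π x).length - 1 + 1 := z.2
      omega), funext fun x => ?_⟩
    refine List.ext_getElem ?_ fun n h1 h2 => ?_
    · simp; have := hπ x; omega
    · rw [List.getElem_ofFn]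
  obtain ⟨f, hf⟩ := exists_equiv_of_sum_eq (fun p : Σ x, Fin (k x + 1) => l p.1 p.2) g (by
    rw [← hc, Fintype.sum_sigma]
    refine Finset.sum_congr rfl fun x _ => ?_
    change _ = ((List.ofFn (l x) : List ℕ) : Multiset ℕ)
    rw [← List.sum_ofFn, List.ofFn_eq_map, List.ofFn_eq_map]
    induction List.finRange (k x + 1) with
    | nil => rfl
    | cons x L ih => rw [List.map_cons, List.map_cons, List.sum_cons, ih]; rfl)
  exact ⟨k, f, funext fun x => congrArg List.ofFn (funext fun z => hf ⟨x, z⟩)⟩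

end fibers

section reconstruction

variable {K : Type u} [Field K] {P : DGOperad.{u, v} K} {O : DGOperad.{u, w} K}
  {j : OperadHom P.toOperadData O.toOperadData}
  {i : OperadHom (LLie K).toOperadData O.toOperadData}

/-- The sum of the relabellings of an operation by the permutations that preserve the letters. -/
def symmLetters (A : Collection.{u, v} K) {N : ℕ} (g : Fin N → ℕ) {d : ℤ} :
    A.obj N d →ₗ[K] A.obj N d := ∑ σ ∈ letterPerms g, A.act σ

theorem symmLetters_apply (A : Collection.{u, v} K) {N : ℕ} (g : Fin N → ℕ) {d : ℤ}
    (F : A.obj N d) : symmLetters A g F = ∑ σ ∈ letterPerms g, A.act σ F := by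
  simp [symmLetters]

theorem symmLetters_act (A : Collection.{u, v} K) {N : ℕ} {g : Fin N → ℕ} {d : ℤ}
    (F : A.obj N d) {τ : Fin N ≃ Fin N} (hτ : g ∘ τ = g) :
    symmLetters A g (A.act τ F) = symmLetters A g F := by
  rw [symmLetters_apply, symmLetters_apply]
  have hτ' : g ∘ τ.symm = g := by
    funext x
    have := congrFun hτ (τ.symm x)
    simpa using this.symm
  refine Finset.sum_bij' (fun σ _ => τ.trans σ) (fun σ _ => τ.symm.trans σ) ?_ ?_ ?_ ?_ ?_
  · intro σ hσ
    rw [mem_letterPerms] at *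
    change (g ∘ σ) ∘ τ = g
    rw [hσ, hτ]
  · intro σ hσ
    rw [mem_letterPerms] at *
    change (g ∘ σ) ∘ τ.symm = g
    rw [hσ, hτ']
  · intro σ _; ext; simp
  · intro σ _; ext; simp
  · intro σ _; rw [A.act_trans]

/-- The coefficients of a symbol with right-normed brackets at normal words. -/
theorem symCoeff_lieSymbol {N : ℕ} {d : ℤ} (g : Fin N → ℕ) {m m' : ℕ} {p : ℤ} (v : P.obj m' p)
    (k : Fin m' → ℕ) (f : (Σ x, Fin (k x + 1)) ≃ Fin N) (hd : p + ∑ x, -(k x : ℤ) = d)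
    (hk : ∀ x, IsGood (tupleOf g k f x)) (e : ℤ) (π : Fin m → List ℕ) (hπ : ∀ x, IsGood (π x)) :
    symCoeff g e π (lieSymbol v k f hd) = (∏ x, goodWeight K (tupleOf g k f x)) •
      ∑ ρ : Fin m ≃ Fin m', if π ∘ ρ.symm = tupleOf g k f then
        koszul K ρ (fun x => -(k x : ℤ)) • degCast P.toCollection p e (P.act ρ.symm v) else 0 := by
  rw [symCoeff, permSum_apply, Finset.smul_sum]
  refine Finset.sum_congr rfl fun ρ _ => ?_
  change Fin m ≃ Fin m' at ρ
  have h1 : (lieSymbol v k f hd).weight g (π ∘ ρ.symm) =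
      if π ∘ ρ.symm = tupleOf g k f then ∏ x, goodWeight K (tupleOf g k f x) else 0 := by
    have h2 : (lieSymbol v k f hd).weight g (π ∘ ρ.symm) =
        ∏ x, if (π ∘ ρ.symm) x = tupleOf g k f x then goodWeight K (tupleOf g k f x) else 0 :=
      Finset.prod_congr rfl fun x _ => words_lieWord_good (hk x) (hπ (ρ.symm x))
    rw [h2]
    split_ifs with h3
    · exact Finset.prod_congr rfl fun x _ => by rw [if_pos (congrFun h3 x)]
    · obtain ⟨x, hx⟩ := Function.ne_iff.1 h3
      exact Finset.prod_eq_zero (Finset.mem_univ x) (if_neg hx)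
  refine (congrArg (fun a => (koszul K ρ (fun x => -(k x : ℤ)) * a) •
    degCast P.toCollection p e (P.act ρ.symm v)) h1).trans ?_
  split_ifs with h3
  · rw [smul_smul, mul_comm]
  · rw [mul_zero, zero_smul, smul_zero]

theorem lieSymbol_degree {N m : ℕ} {d E : ℤ} (hE : E = d + N) {k : Fin m → ℕ}
    (f : (Σ x, Fin (k x + 1)) ≃ Fin N) : E - m + ∑ x, -(k x : ℤ) = d := by
  have h1 := sum_labelling f
  have h2 : (∑ x, (k x : ℤ)) + m = N := by exact_mod_cast h1
  rw [Finset.sum_neg_distrib]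
  omega

/-- The value of the symbol with head `v` and with right-normed brackets, as a function of `v`. -/
def lieValue (h : IsDistributive j i) {N : ℕ} {d E : ℤ} (hE : E = d + N) {m : ℕ} (k : Fin m → ℕ)
    (f : (Σ x, Fin (k x + 1)) ≃ Fin N) : P.obj m (E - m) →ₗ[K] O.obj N d :=
  headValue h (fun x => k x + 1) (fun x => -(k x : ℤ)) (fun x => lieWord K (k x)) f
    (lieSymbol_degree hE f)

theorem lieValue_apply (h : IsDistributive j i) {N : ℕ} {d E : ℤ} (hE : E = d + N) {m : ℕ}
    (k : Fin m → ℕ) (f : (Σ x, Fin (k x + 1)) ≃ Fin N) (v : P.obj m (E - m)) :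
    lieValue h hE k f v = (lieSymbol v k f (lieSymbol_degree hE f)).value (O := O.toOperadData)
      j.toHom i.toHom := rfl

theorem lieValue_trans (h : IsDistributive j i) {N : ℕ} {d E : ℤ} (hE : E = d + N) {m : ℕ}
    (k : Fin m → ℕ) (f : (Σ x, Fin (k x + 1)) ≃ Fin N) (σ : Fin N ≃ Fin N)
    (v : P.obj m (E - m)) : lieValue h hE k (f.trans σ) v = O.act σ (lieValue h hE k f v) := by
  rw [lieValue_apply, lieValue_apply, ← value_relabel]
  rfl

theorem lieValue_permute (h : IsDistributive j i) {N : ℕ} {d E : ℤ} (hE : E = d + N) {m : ℕ}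
    (k : Fin m → ℕ) (f : (Σ x, Fin (k x + 1)) ≃ Fin N) (ρ : Fin m ≃ Fin m)
    (v : P.obj m (E - m)) : koszul K ρ (fun x => -(k x : ℤ)) • lieValue h hE (k ∘ ρ)
      ((Equiv.sigmaCongrLeft (β := fun x => Fin (k x + 1)) ρ).trans f) (P.act ρ.symm v) =
      lieValue h hE k f v :=
  (value_permute h (lieSymbol v k f (lieSymbol_degree hE f)) ρ).symm

open Classical in
/-- The contribution of the words spelled by a labelling to the operation with coefficients `c`:
the head of the symbol is the prescribed coefficient, divided by the coefficients of the words in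
the right-normed brackets. Labellings that spell a word that is not normal do not contribute. -/
def reconstructTerm (h : IsDistributive j i) {N : ℕ} {d E : ℤ} (hE : E = d + N) (g : Fin N → ℕ)
    {m : ℕ} (c : (Fin m → List ℕ) → P.obj m (E - m)) (k : Fin m → ℕ)
    (f : (Σ x, Fin (k x + 1)) ≃ Fin N) : O.obj N d :=
  (if ∀ x, IsGood (tupleOf g k f x) then (∏ x, goodWeight K (tupleOf g k f x))⁻¹ else 0) •
    lieValue h hE k f (c (tupleOf g k f))

/-- The part of the reconstruction that involves the operations of `P` of arity `m`. The factor
`1 / m!` accounts for the orders of the elements of `ΛLie`. The arities `k x + 1` add up to `N`, so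
the bound on `k` is no restriction. -/
def reconstructPart (h : IsDistributive j i) {N : ℕ} {d E : ℤ} (hE : E = d + N) (g : Fin N → ℕ)
    {m : ℕ} (c : (Fin m → List ℕ) → P.obj m (E - m)) : O.obj N d :=
  ((Nat.factorial m : K))⁻¹ • ∑ k : Fin m → Fin (N + 1),
    ∑ f : (Σ x, Fin ((k x : ℕ) + 1)) ≃ Fin N, reconstructTerm h hE g c (fun x => k x) f

/-- The operation with prescribed coefficients `c` at the normal words. -/
def reconstruct (h : IsDistributive j i) {N : ℕ} {d E : ℤ} (hE : E = d + N) (g : Fin N → ℕ)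
    (c : ∀ m : ℕ, (Fin m → List ℕ) → P.obj m (E - m)) : O.obj N d :=
  ∑ m ∈ Finset.range (N + 1), reconstructPart h hE g (c m)

/-- Words that do not occur: the coefficients of a symbol one of whose elements is a bracket of
at least three inputs with letter `0`. -/
theorem symCoeff_lieSymbol_of_zero {N : ℕ} {d : ℤ} (g : Fin N → ℕ) {m m' : ℕ} {p : ℤ}
    (v : P.obj m' p) (k : Fin m' → ℕ) (f : (Σ x, Fin (k x + 1)) ≃ Fin N)
    (hd : p + ∑ x, -(k x : ℤ) = d) (x : Fin m') (hk : 2 ≤ k x) (hx : ∀ z, g (f ⟨x, z⟩) = 0)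
    (e : ℤ) (π : Fin m → List ℕ) : symCoeff g e π (lieSymbol v k f hd) = 0 := by
  rw [symCoeff, permSum_apply]
  refine Finset.sum_eq_zero fun ρ _ => ?_
  have h1 : (lieSymbol v k f hd).weight g (π ∘ ρ.symm) = 0 := by
    refine Finset.prod_eq_zero (Finset.mem_univ x) ?_
    have h2 : ∀ (n : ℕ) (_ : 2 ≤ n) (l : Fin (n + 1) → ℕ), (∀ z, l z = 0) →
        words (lieWord K n) l = 0 := by
      intro n hn l hl
      obtain ⟨n, rfl⟩ := Nat.exists_eq_add_of_le' hn
      exact words_lieWord_const n l hl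
    have h3 : words ((lieSymbol v k f hd).X x) ((lieSymbol v k f hd).labels g x) = 0 :=
      h2 (k x) hk _ hx
    rw [h3, Finsupp.zero_apply]
  rw [h1, mul_zero, zero_smul]

/-- The symmetrization of such a symbol vanishes. -/
theorem symmLetters_lieSymbol_of_zero [CharZero K] (h : IsDistributive j i) {N : ℕ} {d : ℤ}
    (g : Fin N → ℕ) {m : ℕ} {p : ℤ}
    (v : P.obj m p) (k : Fin m → ℕ) (f : (Σ x, Fin (k x + 1)) ≃ Fin N)
    (hd : p + ∑ x, -(k x : ℤ) = d) (x : Fin m) (hk : 2 ≤ k x) (hx : ∀ z, g (f ⟨x, z⟩) = 0) :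
    symmLetters O.toCollection g
      ((lieSymbol v k f hd).value (O := O.toOperadData) j.toHom i.toHom) = 0 := by
  set V := slotValue h v (fun x => k x + 1) (fun x => -(k x : ℤ)) (fun x => lieWord K (k x)) f hd x
  -- A permutation of the inputs of the bracket preserves the letters, so it does not change the
  -- symmetrization; by `sum_act_lieWord` the sum over these permutations is zero.
  have h1 : ∀ τ : Fin (k x + 1) ≃ Fin (k x + 1),
      symmLetters O.toCollection g (V ((LLie K).act τ (lieWord K (k x)))) =
      symmLetters O.toCollection g
        ((lieSymbol v k f hd).value (O := O.toOperadData) j.toHom i.toHom) := by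
    intro τ
    set T : ∀ y, Fin (k y + 1) ≃ Fin (k y + 1) :=
      Function.update (fun y => Equiv.refl _) x τ with hT
    have h2 : Function.update (fun x => lieWord K (k x)) x ((LLie K).act τ (lieWord K (k x))) =
        fun y => (LLie K).act (T y) (lieWord K (k y)) := by
      funext y
      by_cases hy : y = x
      · subst hy; rw [Function.update_self, hT, Function.update_self]
      · rw [Function.update_of_ne hy, hT, Function.update_of_ne hy, Collection.act_refl]
    have h3 : V ((LLie K).act τ (lieWord K (k x))) = O.act
        ((f.symm.trans (Equiv.sigmaCongrRight T)).trans f)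
        ((lieSymbol v k f hd).value (O := O.toOperadData) j.toHom i.toHom) := by
      change PlSym.value _ _ _ = _
      rw [h2, value_act_right h, ← value_relabel]
      congr 1
      rw [PlSym.relabel, lieSymbol]
      congr 1
      ext; simp
    rw [h3]
    refine symmLetters_act _ _ ?_
    funext y
    obtain ⟨⟨y, z⟩, rfl⟩ := f.surjective y
    by_cases hy : y = x
    · subst hy
      simp [hx]
    · simp [hT, hy]
  have h4 : ∀ (n : ℕ), 2 ≤ n →
      ∑ τ : Fin (n + 1) ≃ Fin (n + 1), (LLie K).act τ (lieWord K n) = 0 := by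
    intro n hn
    obtain ⟨n, rfl⟩ := Nat.exists_eq_add_of_le' hn
    exact sum_act_lieWord n
  have h5 := congrArg (fun X => symmLetters O.toCollection g (V X)) (h4 (k x) hk)
  simp only [map_sum, h1, map_zero, Finset.sum_const, Finset.card_univ] at h5
  rw [← Nat.cast_smul_eq_nsmul K] at h5
  exact (smul_eq_zero.1 h5).resolve_left (Nat.cast_ne_zero.2 Fintype.card_ne_zero)

end reconstruction

section reconstruction

variable {K : Type u} [Field K] {P : DGOperad.{u, v} K} {O : DGOperad.{u, w} K}
  {j : OperadHom P.toOperadData O.toOperadData}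
  {i : OperadHom (LLie K).toOperadData O.toOperadData}

/-- At normal words, the term of a labelling has coefficients only at the words that it spells, in
any order. -/
theorem coeff_reconstructTerm [CharZero K] (h : IsDistributive j i) {N : ℕ} {d E : ℤ}
    (hE : E = d + N)
    (g : Fin N → ℕ) {m m' : ℕ} (c : (Fin m' → List ℕ) → P.obj m' (E - m')) (k : Fin m' → ℕ)
    (f : (Σ x, Fin (k x + 1)) ≃ Fin N) (e : ℤ) (π : Fin m → List ℕ) (hπ : ∀ x, IsGood (π x)) :
    coeff h g e π (reconstructTerm h hE g c k f) =
      ∑ ρ : Fin m ≃ Fin m', if tupleOf g k f = π ∘ ρ.symm then koszul K ρ (fun x => -(k x : ℤ)) •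
        degCast P.toCollection (E - m') e (P.act ρ.symm (c (tupleOf g k f))) else 0 := by
  rw [reconstructTerm, map_smul, lieValue_apply, coeff_value]
  split_ifs with hk
  · rw [symCoeff_lieSymbol g _ k f _ hk e π hπ, smul_smul, inv_mul_cancel₀, one_smul]
    · simp only [eq_comm]
    · exact Finset.prod_ne_zero_iff.2 fun x _ => goodWeight_ne_zero K _
  · rw [zero_smul]
    refine (Finset.sum_eq_zero fun ρ _ => if_neg fun h0 => hk fun x => ?_).symm
    rw [h0]
    exact hπ _

theorem coeff_reconstructPart_of_ne [CharZero K] (h : IsDistributive j i) {N : ℕ} {d E : ℤ}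
    (hE : E = d + N) (g : Fin N → ℕ) {m m' : ℕ} (hm : m ≠ m')
    (c : (Fin m' → List ℕ) → P.obj m' (E - m'))
    (e : ℤ) (π : Fin m → List ℕ) (hπ : ∀ x, IsGood (π x)) :
    coeff h g e π (reconstructPart h hE g c) = 0 := by
  have : IsEmpty (Fin m ≃ Fin m') := ⟨fun ρ => hm (by simpa using Fintype.card_congr ρ)⟩
  simp only [reconstructPart, map_smul, map_sum, coeff_reconstructTerm h hE g c _ _ e π hπ,
    Finset.univ_eq_empty, Finset.sum_empty, Finset.sum_const_zero, smul_zero]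

/-- By equivariance, each of the `m!` orders of the words contributes the same, and each word tuple
is spelled by as many labellings as there are permutations that preserve the letters. -/
theorem coeff_reconstructPart [CharZero K] (h : IsDistributive j i) {N : ℕ} {d E : ℤ}
    (hE : E = d + N) (g : Fin N → ℕ) {m : ℕ} {c : (Fin m → List ℕ) → P.obj m (E - m)}
    (hc : IsEquivariant P.toCollection c) (π : Fin m → List ℕ) (hπ : ∀ x, IsGood (π x))
    (hcont : ∑ x, (π x : Multiset ℕ) = ∑ x, {g x}) :
    coeff h g (E - m) π (reconstructPart h hE g c) = ((letterPerms g).card : K) • c π := by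
  have h1 : ∀ (k : Fin m → ℕ) (f : (Σ x, Fin (k x + 1)) ≃ Fin N),
      coeff h g (E - m) π (reconstructTerm h hE g c k f) =
        ∑ ρ : Fin m ≃ Fin m, if tupleOf g k f = π ∘ ρ.symm then c π else 0 := by
    intro k f
    rw [coeff_reconstructTerm h hE g c k f _ π hπ]
    refine Finset.sum_congr rfl fun ρ _ => ?_
    split_ifs with h0
    · have h2 : π = tupleOf g k f ∘ ρ := by rw [h0]; funext x; simp
      rw [degCast_self]
      conv_rhs => rw [h2, hc]
      congr 2
      funext x
      simp [tupleOf]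
    · rfl
  have h2 : ∀ ρ : Fin m ≃ Fin m, ∑ k : Fin m → Fin (N + 1),
      ∑ f : (Σ x, Fin ((k x : ℕ) + 1)) ≃ Fin N,
        (if tupleOf g (fun x => k x) f = π ∘ ρ.symm then c π else 0) =
      ((letterPerms g).card : K) • c π := by
    intro ρ
    obtain ⟨k₀, f₀, h3⟩ := exists_labelling (g := g) (π := π ∘ ρ.symm)
      (fun x => (hπ _).length_pos)
          (by rw [← hcont]; exact ρ.symm.sum_comp fun x => (π x : Multiset ℕ))
    rw [← h3]
    refine (sum_tupleOf_eq g (fun _ _ => c π) k₀ f₀).trans ?_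
    rw [Finset.sum_const, Nat.cast_smul_eq_nsmul]
  simp only [reconstructPart, map_smul, map_sum, h1]
  rw [Finset.sum_congr rfl fun k _ => Finset.sum_comm, Finset.sum_comm,
    Finset.sum_congr rfl fun ρ _ => h2 ρ, Finset.sum_const, Finset.card_univ, Fintype.card_equiv
      (Equiv.refl _), Fintype.card_fin, ← Nat.cast_smul_eq_nsmul K, smul_smul, inv_mul_cancel₀,
    one_smul]
  exact Nat.cast_ne_zero.2 (Nat.factorial_ne_zero m)

/-- The reconstructed operation has the prescribed coefficients at the tuples of normal words, up
to the number of permutations that preserve the letters. -/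
theorem coeff_reconstruct [CharZero K] (h : IsDistributive j i) {N : ℕ} {d E : ℤ}
    (hE : E = d + N) (g : Fin N → ℕ) {c : ∀ m : ℕ, (Fin m → List ℕ) → P.obj m (E - m)}
    (hc : ∀ m, IsEquivariant P.toCollection (c m)) {m : ℕ} (π : Fin m → List ℕ)
    (hπ : ∀ x, IsGood (π x)) (hcont : ∑ x, (π x : Multiset ℕ) = ∑ x, {g x}) :
    coeff h g (E - m) π (reconstruct h hE g c) = ((letterPerms g).card : K) • c m π := by
  have hm : m < N + 1 := by
    obtain ⟨k, f, -⟩ := exists_labelling (fun x => (hπ x).length_pos) hcont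
    have := sum_labelling f
    omega
  rw [reconstruct, map_sum, Finset.sum_eq_single m, coeff_reconstructPart h hE g (hc m) π hπ hcont]
  · intro m' _ hm'
    exact coeff_reconstructPart_of_ne h hE g hm'.symm (c m') _ π hπ
  · intro h'
    exact absurd (Finset.mem_range.2 hm) h'

theorem reconstruct_add (h : IsDistributive j i) {N : ℕ} {d E : ℤ} (hE : E = d + N)
    (g : Fin N → ℕ) (c c' : ∀ m : ℕ, (Fin m → List ℕ) → P.obj m (E - m)) :
    reconstruct h hE g (fun m π => c m π + c' m π) =
      reconstruct h hE g c + reconstruct h hE g c' := by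
  simp only [reconstruct, reconstructPart, reconstructTerm, map_add, smul_add,
    Finset.sum_add_distrib]

theorem reconstruct_smul (h : IsDistributive j i) {N : ℕ} {d E : ℤ} (hE : E = d + N)
    (g : Fin N → ℕ) (a : K) (c : ∀ m : ℕ, (Fin m → List ℕ) → P.obj m (E - m)) :
    reconstruct h hE g (fun m π => a • c m π) = a • reconstruct h hE g c := by
  simp only [reconstruct, reconstructPart, reconstructTerm, map_smul, Finset.smul_sum,
    smul_comm _ a]

theorem reconstruct_zero (h : IsDistributive j i) {N : ℕ} {d E : ℤ} (hE : E = d + N)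
    (g : Fin N → ℕ) :
    reconstruct h hE g (fun _ _ => 0) = (0 : O.obj N d) := by
  simp only [reconstruct, reconstructPart, reconstructTerm, map_zero, smul_zero,
    Finset.sum_const_zero]

/-- The reconstruction of a symbol with normal words. -/
theorem reconstruct_lieSymbol [CharZero K] (h : IsDistributive j i) {N : ℕ} {d E : ℤ}
    (hE : E = d + N) (g : Fin N → ℕ) {m : ℕ} (v : P.obj m (E - m)) (k : Fin m → ℕ)
    (f : (Σ x, Fin (k x + 1)) ≃ Fin N) (hk : ∀ x, IsGood (tupleOf g k f x)) :
    reconstruct h hE g (fun m' π => coeff h g (E - m') π (lieValue h hE k f v)) =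
      symmLetters O.toCollection g (lieValue h hE k f v) := by
  -- the term of a labelling, as a sum over the bijections that match the words
  have h1 : ∀ (m' : ℕ) (k' : Fin m' → ℕ) (f' : (Σ x, Fin (k' x + 1)) ≃ Fin N),
      reconstructTerm h hE g (fun π => coeff h g (E - m') π (lieValue h hE k f v)) k' f' =
        ∑ ρ : Fin m' ≃ Fin m, if tupleOf g k' f' = tupleOf g k f ∘ ρ then
          lieValue h hE k' f' (koszul K ρ (fun x => -(k x : ℤ)) •
            degCast P.toCollection (E - m) (E - m') (P.act ρ.symm v)) else 0 := by
    intro m' k' f'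
    rw [reconstructTerm]
    split_ifs with hk'
    · rw [lieValue_apply h hE k f, coeff_value, symCoeff_lieSymbol g v k f _ hk _ _ hk', map_smul,
        smul_smul, map_sum, Finset.smul_sum]
      refine Finset.sum_congr rfl fun ρ _ => ?_
      have h2 : tupleOf g k' f' ∘ ρ.symm = tupleOf g k f ↔ tupleOf g k' f' = tupleOf g k f ∘ ρ :=
        Equiv.comp_symm_eq ρ _ _
      by_cases h3 : tupleOf g k' f' = tupleOf g k f ∘ ρ
      · have h4 : ∏ x, goodWeight K (tupleOf g k' f' x) = ∏ x, goodWeight K (tupleOf g k f x) := by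
          rw [h3]; exact ρ.prod_comp fun x => goodWeight K (tupleOf g k f x)
        rw [if_pos h3, if_pos (h2.2 h3), h4, inv_mul_cancel₀, one_smul]
        exact Finset.prod_ne_zero_iff.2 fun x _ => goodWeight_ne_zero K _
      · rw [if_neg h3, if_neg fun h4 => h3 (h2.1 h4), map_zero, smul_zero]
    · rw [zero_smul]
      refine (Finset.sum_eq_zero fun ρ _ => if_neg fun h0 => hk' fun x => ?_).symm
      rw [h0]
      exact hk _
  have hm : m < N + 1 := by have := sum_labelling f; omega
  rw [reconstruct, Finset.sum_eq_single m]
  · have h2 : ∀ ρ : Fin m ≃ Fin m, ∑ k' : Fin m → Fin (N + 1),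
        ∑ f' : (Σ x, Fin ((k' x : ℕ) + 1)) ≃ Fin N,
          (if tupleOf g (fun x => k' x) f' = tupleOf g k f ∘ ρ then
          lieValue h hE (fun x => k' x) f' (koszul K ρ (fun x => -(k x : ℤ)) •
            degCast P.toCollection (E - m) (E - m) (P.act ρ.symm v)) else 0) =
        symmLetters O.toCollection g (lieValue h hE k f v) := by
      intro ρ
      have h3 : tupleOf g k f ∘ ρ = tupleOf g (k ∘ ρ)
          ((Equiv.sigmaCongrLeft (β := fun x => Fin (k x + 1)) ρ).trans f) := rfl
      rw [h3]
      refine (sum_tupleOf_eq g (fun k' f' => lieValue h hE k' f' _) (k ∘ ρ) _).trans ?_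
      rw [symmLetters_apply]
      refine Finset.sum_congr rfl fun σ _ => ?_
      rw [lieValue_trans, degCast_self, map_smul, lieValue_permute]
    simp only [reconstructPart, h1]
    rw [Finset.sum_congr rfl fun k _ => Finset.sum_comm, Finset.sum_comm,
      Finset.sum_congr rfl fun ρ _ => h2 ρ, Finset.sum_const, Finset.card_univ, Fintype.card_equiv
        (Equiv.refl _), Fintype.card_fin, ← Nat.cast_smul_eq_nsmul K, smul_smul, inv_mul_cancel₀,
      one_smul]
    exact Nat.cast_ne_zero.2 (Nat.factorial_ne_zero m)
  · intro m' _ hm'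
    have : IsEmpty (Fin m' ≃ Fin m) := ⟨fun ρ => hm' (by simpa using Fintype.card_congr ρ)⟩
    simp only [reconstructPart, h1, Finset.univ_eq_empty, Finset.sum_empty, Finset.sum_const_zero,
      smul_zero]
  · intro h'
    exact absurd (Finset.mem_range.2 hm) h'

/-- The symmetrization of an operation can be reconstructed from its coefficients. -/
theorem reconstruct_coeff [CharZero K] (h : IsDistributive j i) {N : ℕ} {d E : ℤ}
    (hE : E = d + N) (g : Fin N → ℕ) (hg : ∀ x y, g x = g y → g x ≠ 0 → x = y) (F : O.obj N d) :
    reconstruct h hE g (fun m π => coeff h g (E - m) π F) = symmLetters O.toCollection g F := by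
  let S : Submodule K (O.obj N d) :=
    { carrier := {F | reconstruct h hE g (fun m π => coeff h g (E - m) π F) =
        symmLetters O.toCollection g F}
      zero_mem' := by
        simp only [Set.mem_ofPred_eq, map_zero]
        exact reconstruct_zero h hE g
      add_mem' := by
        intro F F' hF hF'
        simp only [Set.mem_ofPred_eq, map_add] at *
        rw [reconstruct_add, hF, hF']
      smul_mem' := by
        intro a F hF
        simp only [Set.mem_ofPred_eq, map_smul] at *
        rw [reconstruct_smul, hF] }
  refine mem_of_lieSymbol h g S (fun m p v k f hd hmax => ?_) F
  obtain rfl : p = E - m := by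
    have := lieSymbol_degree hE f
    omega
  -- A right-normed bracket whose innermost letter is maximal spells a normal word, unless it has
  -- at least three inputs, all with letter `0`; such symbols contribute zero to both sides.
  by_cases hk : ∀ x, IsGood (tupleOf g k f x)
  · exact reconstruct_lieSymbol h hE g v k f hk
  · push Not at hk
    obtain ⟨x, hx⟩ := hk
    obtain ⟨h1, h2⟩ := (isGood_or (hmax x) fun h0 z hz => by
      have := hg _ _ hz.symm h0
      simpa using this.symm).resolve_left hx
    change reconstruct h hE g _ = _
    rw [symmLetters_lieSymbol_of_zero h g v k f hd x h1 h2]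
    simp only [coeff_value, symCoeff_lieSymbol_of_zero g v k f hd x h1 h2]
    exact reconstruct_zero h hE g

/-- The coefficients at the tuples of normal words determine the symmetrization. -/
theorem symmLetters_eq_zero [CharZero K] (h : IsDistributive j i) {N : ℕ} {d : ℤ} (g : Fin N → ℕ)
    (hg : ∀ x y, g x = g y → g x ≠ 0 → x = y) (F : O.obj N d)
    (hF : ∀ (m : ℕ) (π : Fin m → List ℕ), (∀ x, IsGood (π x)) →
      coeff h g (d + N - m) π F = 0) : symmLetters O.toCollection g F = 0 := by
  rw [← reconstruct_coeff h rfl g hg]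
  refine Finset.sum_eq_zero fun m _ => ?_
  rw [reconstructPart]
  refine (congrArg _ (Finset.sum_eq_zero fun k _ => Finset.sum_eq_zero fun f _ => ?_)).trans
    (smul_zero _)
  rw [reconstructTerm]
  split_ifs with hk
  · refine (congrArg (fun a => _ • lieValue h _ _ f a) (hF m _ hk)).trans ?_
    rw [map_zero, smul_zero]
  · exact zero_smul _ _

theorem isEquivariant_coeff (h : IsDistributive j i) {N : ℕ} {d : ℤ} (g : Fin N → ℕ) (m : ℕ)
    (e : ℤ) (F : O.obj N d) :
    IsEquivariant P.toCollection fun π : Fin m → List ℕ => coeff h g e π F :=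
  fun π θ => coeff_perm h g e π θ F

end reconstruction

/-! ### Exactness of the rows -/

section letters

/-- The letters for which the permutations of the first `r` inputs are the permutations that
preserve the letters: the first `r` inputs have the letter `0`, the others have distinct positive
letters. -/
def letters (r N : ℕ) : Fin N → ℕ := fun z => if (z : ℕ) < r then 0 else z - r + 1

theorem letters_eq_zero {r N : ℕ} {z : Fin N} : letters r N z = 0 ↔ (z : ℕ) < r := by
  rw [letters]; split_ifs with h <;> simp [h]

theorem letters_inj {r N : ℕ} (x y : Fin N) (h : letters r N x = letters r N y)
    (h0 : letters r N x ≠ 0) : x = y := by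
  have h1 : ¬ (x : ℕ) < r := fun h' => h0 (letters_eq_zero.2 h')
  have h2 : ¬ (y : ℕ) < r := fun h' => h0 (h.trans (letters_eq_zero.2 h'))
  rw [letters, letters, if_neg h1, if_neg h2] at h
  exact Fin.ext (by omega)

theorem letterPerms_letters (r N : ℕ) : letterPerms (letters r N) = fixing r N := by
  ext σ
  rw [mem_letterPerms, mem_fixing]
  constructor
  · intro h x hx
    refine letters_inj _ _ (congrFun h x) ?_
    refine fun h0 => absurd (letters_eq_zero.1 ((congrFun h x).symm.trans h0)) (by omega)
  · intro h
    funext x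
    rw [Function.comp_apply]
    by_cases hx : r ≤ (x : ℕ)
    · rw [h x hx]
    · have h1 : ¬ r ≤ (σ x : ℕ) := fun h' => hx (by
        have := h _ h'
        rwa [σ.injective this] at h')
      rw [letters_eq_zero.2 (by omega), letters_eq_zero.2 (by omega)]

theorem letters_comp_predAbove {r N : ℕ} (x : Fin N) (hx : (x : ℕ) < r) :
    letters r N ∘ Fin.predAbove x = letters (r + 1) (N + 1) := by
  funext y
  simp only [Function.comp_apply, letters, predAbove_eq_collapse, collapse]
  grind

theorem sum_letters_succ (r N : ℕ) :
    ∑ x, ({letters (r + 1) (N + 1) x} : Multiset ℕ) = {0} + ∑ x, {letters r N x} := by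
  rw [Fin.sum_univ_succ]
  congr 1
  refine Finset.sum_congr rfl fun x _ => ?_
  simp only [letters, Fin.val_succ, Nat.add_lt_add_iff_right, Nat.add_sub_add_right]

theorem count_letters {r N : ℕ} (hr : r ≤ N) :
    Multiset.count 0 (∑ x, ({letters r N x} : Multiset ℕ)) = r := by
  rw [Multiset.count_sum']
  simp only [Multiset.count_singleton, @eq_comm ℕ 0, letters_eq_zero]
  rw [← Finset.card_filter, Fin.card_filter_val_lt, min_eq_right hr]

theorem symmLetters_letters {K : Type u} [Field K] (A : Collection.{u, v} K)
    (r : ℕ) {N : ℕ} {d : ℤ} :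
    symmLetters A (letters r N) = (symm A r : A.obj N d →ₗ[K] A.obj N d) := by
  rw [symmLetters, symm, letterPerms_letters]

end letters

section rows

variable {K : Type u} [Field K] [CharZero K] {P : DGOperad.{u, v} K} {O : DGOperad.{u, w} K}
  {j : OperadHom P.toOperadData O.toOperadData}
  {i : OperadHom (LLie K).toOperadData O.toOperadData}

theorem card_fixing_ne_zero (r N : ℕ) : ((fixing r N).card : K) ≠ 0 :=
  Nat.cast_ne_zero.2 (Finset.card_ne_zero.2 (fixing_nonempty r N))

omit [CharZero K] in
theorem coeff_symm (h : IsDistributive j i) {N : ℕ} {d : ℤ} (r : ℕ) {m : ℕ} (e : ℤ)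
    (π : Fin m → List ℕ) (F : O.obj N d) :
    coeff h (letters r N) e π (symm O.toCollection r F) =
      ((fixing r N).card : K) • coeff h (letters r N) e π F := by
  rw [symm_apply, map_sum, Finset.sum_congr rfl (g := fun _ => coeff h (letters r N) e π F),
    Finset.sum_const, Nat.cast_smul_eq_nsmul]
  intro σ hσ
  rw [coeff_act, mem_letterPerms.1 (by rwa [letterPerms_letters])]

omit [CharZero K] in
/-- Up to scalars, the coefficients of the symmetrized substitution of the bracket in an invariant
operation are obtained from the coefficients of the operation by the differential. -/
theorem coeff_symm_comp_bracket (h : IsDistributive j i) {N r : ℕ} {d d' : ℤ} (hd' : d + -1 = d')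
    (hr : r ≤ N)
    {f : O.obj N d} (hf : IsInv O.toCollection r f) (x : Fin N) (hx : (x : ℕ) < r) {m : ℕ} (e : ℤ)
    (π : Fin m → List ℕ) :
    (r : K) • coeff h (letters (r + 1) (N + 1)) e π
      (symm O.toCollection (r + 1) (O.comp (m := N + 1) x rfl hd' f (br i))) =
    (((fixing (r + 1) (N + 1)).card : K) * 2) •
      tupleDiff K (fun π => coeff h (letters r N) e π f) π := by
  rw [mul_smul, ← sum_coeff_comp_bracket h hd' f (letters r N) e π, Finset.smul_sum]
  have h1 : ∀ y : Fin N, ((fixing (r + 1) (N + 1)).card : K) •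
      (if letters r N y = 0 then coeff h (letters r N ∘ Fin.predAbove y) e π
        (O.comp (m := N + 1) y rfl hd' f (br i)) else 0) =
      if (y : ℕ) < r then coeff h (letters (r + 1) (N + 1)) e π
        (symm O.toCollection (r + 1) (O.comp (m := N + 1) x rfl hd' f (br i))) else 0 := by
    -- All inputs with letter `0` yield the same symmetrized composite.
    intro y
    simp only [letters_eq_zero]
    split_ifs with hy
    · rw [letters_comp_predAbove y hy, ← coeff_symm, symm_comp_eq hf (br i) rfl hd' y x hy hx]
    · exact smul_zero _
  rw [Finset.sum_congr rfl fun y _ => h1 y, ← Finset.sum_filter, Finset.sum_const,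
    Fin.card_filter_val_lt, min_eq_right hr, Nat.cast_smul_eq_nsmul]

/-- An invariant operation vanishes if its coefficients at the tuples of normal words do. -/
theorem eq_zero_of_coeff (h : IsDistributive j i) {N r : ℕ} {d E : ℤ}
    (hE : E = d + N) {f : O.obj N d}
    (hf : IsInv O.toCollection r f) (h0 : ∀ (m : ℕ) (π : Fin m → List ℕ), (∀ x, IsGood (π x)) →
      ∑ x, (π x : Multiset ℕ) = ∑ x, {letters r N x} →
      coeff h (letters r N) (E - m) π f = 0) : f = 0 := by
  subst hE
  have h1 := symmLetters_eq_zero h (letters r N) letters_inj f fun m π hπ => by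
    by_contra hc
    exact hc (h0 m π hπ (content_of_coeff_ne h hc))
  rw [symmLetters_letters, hf.symm_eq] at h1
  exact (smul_eq_zero.1 h1).resolve_left (card_fixing_ne_zero r N)

theorem tupleDiff_coeff_eq_zero (h : IsDistributive j i) {N r : ℕ} {d d' : ℤ} (hd' : d + -1 = d')
    (hr : r ≤ N)
    {f : O.obj N d} (hf : IsInv O.toCollection r f) (x : Fin N) (hx : (x : ℕ) < r)
    (h0 : symm O.toCollection (r + 1) (O.comp (m := N + 1) x rfl hd' f (br i)) = 0) {m : ℕ} (e : ℤ)
    (π : Fin m → List ℕ) : tupleDiff K (fun π => coeff h (letters r N) e π f) π = 0 := by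
  have h1 := coeff_symm_comp_bracket h hd' hr hf x hx e π
  rw [h0, map_zero, smul_zero] at h1
  exact (smul_eq_zero.1 h1.symm).resolve_left
    (mul_ne_zero (card_fixing_ne_zero _ _) two_ne_zero)

theorem content_update {m : ℕ} {π : Fin m → List ℕ} {x : Fin m} {v : List ℕ}
    (hv : DropZero v (π x)) : ∑ y, (π y : Multiset ℕ) =
      {0} + ∑ y, (Function.update π x v y : Multiset ℕ) := by
  have h1 : ((π x : List ℕ) : Multiset ℕ) = {0} + (v : Multiset ℕ) := by
    have : ∀ {v w : List ℕ}, DropZero v w → (w : Multiset ℕ) = {0} + (v : Multiset ℕ) := by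
      intro v w h
      induction h with
      | here w => rfl
      | cons y _ ih =>
        rw [← Multiset.cons_coe, ih, ← Multiset.cons_coe, Multiset.add_cons]
    exact this hv
  rw [← Finset.add_sum_erase _ _ (Finset.mem_univ x), ← Finset.add_sum_erase (a := x) _ (fun y =>
    (Function.update π x v y : Multiset ℕ)) (Finset.mem_univ x), h1, Function.update_self,
        add_assoc]
  congr 2
  refine Finset.sum_congr rfl fun y hy => ?_
  rw [Function.update_of_ne (Finset.ne_of_mem_erase hy)]

theorem exists_zero_mem {m r N : ℕ} {π : Fin m → List ℕ}
    (hc : ∑ x, (π x : Multiset ℕ) = ∑ x, {letters (r + 1) (N + 1) x}) : ∃ x, 0 ∈ π x := by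
  have h1 : (0 : ℕ) ∈ ∑ x, (π x : Multiset ℕ) := by
    rw [hc, sum_letters_succ]; simp
  obtain ⟨x, -, hx⟩ := Multiset.mem_sum.1 h1
  exact ⟨x, hx⟩

/-- The rows are exact at the first place. -/
theorem eq_zero_of_symm_comp_bracket (h : IsDistributive j i) {M L : ℕ} {d d' : ℤ}
    (hL : M + 2 = L + 1) (hd' : d + -1 = d')
    {f : O.obj M d} (hf : IsInv O.toCollection 1 f) (x : Fin M) (hx : (x : ℕ) = 0)
    (h0 : symm O.toCollection 2 (O.comp x hL hd' f (br i)) = 0) : f = 0 := by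
  obtain ⟨N, rfl⟩ : ∃ N, M = N + 1 := ⟨M - 1, by have := x.2; omega⟩
  obtain rfl : L = N + 1 + 1 := by omega
  refine eq_zero_of_coeff h rfl hf fun m π hπ hcont => ?_
  have h1 := tupleDiff_contract (K := K)
      (fun π => coeff h (letters 1 (N + 1)) (d + (N + 1 : ℕ) - m) π f) π
    (fun π => tupleDiff_coeff_eq_zero h hd' (by omega) hf x (by omega) h0 _ π)
    (exists_zero_mem hcont)
  rw [← h1, tupleDiff_congr (c' := fun _ => 0), tupleDiff_zero]
  intro y v hv
  -- a word with two letters `0` does not occur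
  exfalso
  have h2 := congrArg (Multiset.count 0) hcont
  rw [count_letters (by omega), content_update hv, Multiset.count_add,
    Multiset.count_singleton_self] at h2
  have h3 : 0 < Multiset.count 0 (∑ z, (Function.update π y v z : Multiset ℕ)) :=
    Multiset.count_pos.2 (Multiset.mem_sum.2 ⟨y, Finset.mem_univ y, by
      rw [Function.update_self]; exact hv.zero_mem⟩)
  omega

/-- The rows are exact at the other places. -/
theorem exists_symm_comp_bracket (h : IsDistributive j i) {N M L t : ℕ} {d₀ d d' : ℤ}
    (hM : N + 2 = M + 1)
    (hL : M + 2 = L + 1) (hd : d₀ + -1 = d) (hd' : d + -1 = d') (ht : 1 ≤ t) (htN : t ≤ N)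
    {f : O.obj M d} (hf : IsInv O.toCollection (t + 1) f) (x : Fin M) (hx : (x : ℕ) = 0)
    (h0 : symm O.toCollection (t + 2) (O.comp x hL hd' f (br i)) = 0) (y : Fin N)
    (hy : (y : ℕ) = 0) : ∃ g : O.obj N d₀, IsInv O.toCollection t g ∧
      symm O.toCollection (t + 1) (O.comp y hM hd g (br i)) = f := by
  obtain rfl : M = N + 1 := by omega
  obtain rfl : L = N + 1 + 1 := by omega
  set E : ℤ := d₀ + N with hE
  set C : ∀ m : ℕ, (Fin m → List ℕ) → P.obj m (E - m) := fun m π =>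
    coeff h (letters (t + 1) (N + 1)) (E - m) π f with hC
  set c : ∀ m : ℕ, (Fin m → List ℕ) → P.obj m (E - m) := fun m => contract (K := K) (C m) with hc
  have hcE : ∀ m, IsEquivariant P.toCollection (c m) := fun m =>
    (isEquivariant_coeff h (letters (t + 1) (N + 1)) m (E - m) f).contract
  -- The preimage is reconstructed from the contracted coefficients, and corrected by a scalar
  -- below.
  set g : O.obj N d₀ := symm O.toCollection t (reconstruct h hE (letters t N) c) with hg
  set a : K := ((fixing t N).card : K) with ha
  set b : K := ((fixing (t + 1) (N + 1)).card : K) with hb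
  have ha0 : a ≠ 0 := card_fixing_ne_zero _ _
  have hb0 : b ≠ 0 := card_fixing_ne_zero _ _
  have hg1 : IsInv O.toCollection t g := isInv_symm _ _ _
  have key : ((t : K) / (b * 2 * (a * a))) •
      symm O.toCollection (t + 1) (O.comp y hM hd g (br i)) - f = 0 := by
    refine eq_zero_of_coeff h (r := t + 1) (E := E) (by rw [hE]; push_cast; omega)
      (fun τ hτ => by rw [map_sub, map_smul, isInv_symm _ _ _ τ hτ, hf τ hτ]) fun m π hπ hcont => ?_
    have h1 : tupleDiff K (c m) π = C m π := tupleDiff_contract (C m) π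
      (fun π => tupleDiff_coeff_eq_zero h hd' (by omega) hf x (by omega) h0 _ π)
      (exists_zero_mem hcont)
    -- Both the symmetrization and the reconstruction multiply coefficients by the number of
    -- permutations of the first `t` inputs.
    have h2 : tupleDiff K (fun π => coeff h (letters t N) (E - m) π g) π =
        (a * a) • tupleDiff K (c m) π := by
      rw [← tupleDiff_smul]
      refine tupleDiff_congr fun z v hv => ?_
      rw [hg, coeff_symm, coeff_reconstruct h hE (letters t N) hcE, smul_smul, letterPerms_letters]
      · intro z'
        by_cases hz : z' = z
        · subst hz; rw [Function.update_self]; exact hv.isGood (hπ _)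
        · rw [Function.update_of_ne hz]; exact hπ _
      · rw [content_update hv, sum_letters_succ] at hcont
        exact add_left_cancel hcont
    have h3 := coeff_symm_comp_bracket h hd htN hg1 y (by omega) (E - m) π
    rw [h2, h1] at h3
    rw [map_sub, map_smul, div_eq_inv_mul, mul_smul]
    refine sub_eq_zero.2 ((congrArg ((b * 2 * (a * a))⁻¹ • ·) h3).trans ?_)
    have h4 : (b * 2 * (a * a))⁻¹ * (b * 2) * (a * a) = 1 := by field_simp
    rw [smul_smul, smul_smul, ← hb, h4, one_smul]
  refine ⟨((t : K) / (b * 2 * (a * a))) • g, fun τ hτ => by rw [map_smul, hg1 τ hτ], ?_⟩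
  rw [map_smul, LinearMap.smul_apply, map_smul]
  exact sub_eq_zero.1 key

end rows

/-! ### The counit is a quasi-isomorphism -/

section final

variable {K : Type u} [Field K] [CharZero K] {P : DGOperad.{u, v} K} {O : DGOperad.{u, w} K}
  {j : OperadHom P.toOperadData O.toOperadData}
  {i : OperadHom (LLie K).toOperadData O.toOperadData}

omit [CharZero K] in
/-- If the degrees of `P` are bounded below, then operations of small arity and degree vanish. -/
theorem eq_zero_of_bound (h : IsDistributive j i) {B : ℤ}
    (hB : ∀ (n : ℕ) (d : ℤ), d < B → ∀ a : P.obj n d, a = 0) {N : ℕ} {d : ℤ} (hN : d + N < B)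
    (f : O.obj N d) : f = 0 := by
  refine mem_of_lieSymbol h (fun _ => 0) ⊥ (fun m p v k f hd _ => ?_) f
  have h1 := lieSymbol_degree (d := d) rfl f
  rw [hB m p (by omega) v]
  exact (Submodule.mem_bot K).2 (map_zero (headValue h (fun x => k x + 1) (fun x => -(k x : ℤ))
    (fun x => lieWord K (k x)) f hd))

/-- The element of `Tw A` with a single component. -/
def twSingle (A : Collection.{u, v} K) {n : ℕ} {d : ℤ} (r : ℕ) (g : A.obj (r + n) (d - 2 * r))
    (hg : IsInv A r g) : (Tw A).obj n d :=
  twMk (fun s => if hs : r = s then A.cast (by omega) (by rw [hs]) g else 0) fun s τ hτ => by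
    by_cases hs : r = s
    · subst hs
      simpa using hg τ hτ
    · simp [hs]

omit [CharZero K] in
theorem twAt_twSingle_self (A : Collection.{u, v} K) {n : ℕ} {d : ℤ} (r : ℕ)
    (g : A.obj (r + n) (d - 2 * r)) (hg : IsInv A r g) : twAt r (twSingle A r g hg) = g := by
  rw [twSingle, twAt_twMk, dif_pos rfl]; rfl

omit [CharZero K] in
theorem twAt_twSingle_of_ne (A : Collection.{u, v} K) {n : ℕ} {d : ℤ} {r s : ℕ}
    (g : A.obj (r + n) (d - 2 * r)) (hg : IsInv A r g) (hs : r ≠ s) :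
    twAt s (twSingle A r g hg) = 0 := by
  rw [twSingle, twAt_twMk, dif_neg hs]

omit [CharZero K] in
theorem isInv_twAt {A : Collection.{u, v} K} {n : ℕ} {d : ℤ} (f : (Tw A).obj n d) (r : ℕ) :
    IsInv A r (twAt r f) := fun τ hτ => act_twAt f r τ hτ

omit [CharZero K] in
theorem diff_symm {r N : ℕ} {d e : ℤ} (he : d + 1 = e) (f : O.obj N d) :
    O.diff he (symm O.toCollection r f) = symm O.toCollection r (O.diff he f) := by
  simp only [symm_apply, map_sum, O.diff_act]

omit [CharZero K] in
theorem diff_comp_br {N M : ℕ} {d e d' e' : ℤ} (hM : N + 2 = M + 1) (hd : d + -1 = d')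
    (he : d + 1 = e) (he' : d' + 1 = e') (x : Fin N) (f : O.obj N d) :
    O.diff he' (O.comp x hM hd f (br i)) = O.comp x hM (by omega) (O.diff he f) (br i) := by
  rw [O.diff_comp x hM hd he rfl he' (by omega) (by omega), diff_br, map_zero, smul_zero, add_zero]

/-- A cocycle of `Tw O` with finitely many components and vanishing component of index `0` is a
coboundary: the components can be removed successively, beginning with that of largest index. -/
theorem exists_twDiff_eq (h : IsDistributive j i) {n : ℕ} {p q s : ℤ} (hpq : p + 1 = q)
    (hqs : q + 1 = s) (t : ℕ) (f : (Tw O.toCollection).obj n q)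
    (hf : twDiff ((toLie K).trans i) hqs f = 0) (hf0 : twAt 0 f = 0)
    (hft : ∀ r, t < r → twAt r f = 0) :
    ∃ a : (Tw O.toCollection).obj n p, twDiff ((toLie K).trans i) hpq a = f := by
  have hder : ∀ {n : ℕ} {p : ℤ} (f : O.obj n p), IsDerivationOn O (br i) f :=
    fun f => h.isDerivationOn f
  induction t generalizing f with
  | zero =>
    refine ⟨0, ?_⟩
    rw [map_zero]
    refine tw_ext fun r => ?_
    rcases Nat.eq_zero_or_pos r with rfl | hr
    · rw [hf0, map_zero]
    · rw [hft r hr, map_zero]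
  | succ t ih =>
    have hsgn : ∀ (d : ℤ) (m : ℕ), sgn K d * ((2 * m.factorial : ℕ) : K)⁻¹ ≠ 0 := fun d m =>
      mul_ne_zero (sgn_ne_zero K d) (inv_ne_zero (Nat.cast_ne_zero.2
        (mul_ne_zero two_ne_zero (Nat.factorial_ne_zero m))))
    -- The component of index `t + 2` of the cocycle condition, where only the bracket with the
    -- component of index `t + 1` is left.
    have htop := twAt_twDiff i hder hqs f t
    rw [hf, map_zero, hft (t + 2) (by omega), map_zero, zero_add] at htop
    replace htop := (smul_eq_zero.1 htop.symm).resolve_left (hsgn q t)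
    match t, ih, hft, htop with
    | 0, ih, hft, htop =>
      refine ih f hf hf0 fun r hr => ?_
      rcases Nat.lt_or_ge 1 r with h1 | h1
      · exact hft r h1
      obtain rfl : r = 1 := by omega
      -- A component of index `1` that is the largest one vanishes.
      exact eq_zero_of_symm_comp_bracket h _ _ (isInv_twAt f 1) _ rfl htop
    | t + 1, ih, hft, htop =>
      -- An element with a single component of index `t + 1`, whose coboundary agrees with `f` in
      -- index `t + 2` and vanishes in larger index.
      obtain ⟨g₀, hg₀, hg₁⟩ := exists_symm_comp_bracket h (N := t + 1 + n)
        (d₀ := p - 2 * ((t + 1 : ℕ) : ℤ)) (by omega) (by omega) (by push_cast; omega) _ (by omega)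
        (by omega) (isInv_twAt f (t + 2)) _ rfl htop ⟨0, by omega⟩ rfl
      set c : K := sgn K p * ((2 * t.factorial : ℕ) : K)⁻¹ with hc
      have hc0 : c ≠ 0 := hsgn p t
      have hg : IsInv O.toCollection (t + 1) (c⁻¹ • g₀) := fun τ hτ => by
        rw [map_smul, hg₀ τ hτ]
      set a := twSingle O.toCollection (n := n) (d := p) (t + 1) (c⁻¹ • g₀) hg with ha
      have ha1 : twAt (t + 1) a = c⁻¹ • g₀ := twAt_twSingle_self _ _ _ _
      have ha2 : ∀ r, t + 1 ≠ r → twAt r a = 0 := fun r hr => twAt_twSingle_of_ne _ _ _ hr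
      set A := twDiff ((toLie K).trans i) hpq a with hA
      have hA1 : twAt (t + 2) A = twAt (t + 2) f := by
        rw [hA, twAt_twDiff i hder hpq a t, ha2 (t + 2) (by omega), map_zero, zero_add, ha1,
          map_smul, LinearMap.smul_apply, map_smul, smul_smul, mul_inv_cancel₀ hc0, one_smul]
        exact hg₁
      have hA2 : ∀ r, r ≠ t + 2 → twAt r A = O.diff (by omega) (twAt r a) := by
        intro r hr
        match r, hr with
        | 0, _ => exact twAt_twDiff_zero i hpq a
        | 1, _ => exact twAt_twDiff_one i hder hpq a
        | r + 2, hr =>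
          rw [hA, twAt_twDiff i hder hpq a r, ha2 (r + 1) (by omega), map_zero,
            LinearMap.zero_apply, map_zero, smul_zero, add_zero]
      -- `∂^Tw ∂^Tw a = 0`, verified on components.
      have hA3 : twDiff ((toLie K).trans i) hqs A = 0 := by
        refine tw_ext fun r => ?_
        rw [map_zero]
        match r with
        | 0 => rw [twAt_twDiff_zero i hqs, hA2 0 (by omega), O.diff_diff]
        | 1 => rw [twAt_twDiff_one i hder hqs, hA2 1 (by omega), O.diff_diff]
        | r + 2 =>
          rw [twAt_twDiff i hder hqs]
          by_cases hr : r = t + 1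
          · subst hr
            rw [hA2 (t + 1 + 2) (by omega), O.diff_diff, zero_add, hA1]
            exact (congrArg _ htop).trans (smul_zero _)
          · rw [hA2 (r + 1) (by omega), hA, twAt_twDiff i hder hpq, map_add, O.diff_diff, zero_add,
              map_smul, diff_symm, diff_comp_br (e := q - 2 * ((r + 1 : ℕ) : ℤ)) (he := by omega),
              ← add_smul]
            obtain rfl : q = p + 1 := hpq.symm
            rw [sgn_add, sgn_one]
            convert zero_smul K _ using 2
            ring
      obtain ⟨a', ha'⟩ := ih (f - A) (by rw [map_sub, hf, hA3, sub_zero])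
        (by rw [map_sub, hf0, hA2 0 (by omega), ha2 0 (by omega), map_zero, sub_zero])
        (fun r hr => by
          rcases Nat.lt_or_ge (t + 2) r with h1 | h1
          · rw [map_sub, hft r h1, hA2 r (by omega), ha2 r (by omega), map_zero, sub_zero]
          · obtain rfl : r = t + 2 := by omega
            rw [map_sub, hA1, sub_self])
      exact ⟨a' + a, by rw [map_add, ha', ← hA, sub_add_cancel]⟩

theorem isHomotopyFixedPoint (h : IsDistributive j i) (hP : BoundedBelow P.toCollection) :
    IsHomotopyFixedPoint ((toLie K).trans i) := by
  have hder : ∀ {n : ℕ} {p : ℤ} (f : O.obj n p), IsDerivationOn O (br i) f :=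
    fun f => h.isDerivationOn f
  have hcomm : ∀ {n : ℕ} {p q : ℤ} (h : p + 1 = q) (a : (Tw O.toCollection).obj n p),
      twCounit O.toCollection n q (twDiff ((toLie K).trans i) h a) =
        O.diff h (twCounit O.toCollection n p a) := by
    intro n p q h a
    change O.cast _ _ (twAt 0 (twDiff ((toLie K).trans i) h a)) = O.diff h (O.cast _ _ (twAt 0 a))
    rw [twAt_twDiff_zero i h, O.diff_cast]
  refine ⟨hcomm, ?_, ?_⟩
  · rintro n p q s hpq hqs (a : (Tw O.toCollection).obj n q) ha ⟨b, hb⟩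
    change O.diff hpq b = twCounit O.toCollection n q a at hb
    change twDiff ((toLie K).trans i) hqs a = 0 at ha
    -- If `η a` is the coboundary of `b`, then `a - ∂ (emb b)` is a cocycle with vanishing
    -- component of index `0`.
    obtain ⟨B, hB⟩ := hP
    set f := a - embApp O.toCollection n q (O.diff hpq b) with hf
    obtain ⟨a', ha'⟩ := exists_twDiff_eq h hpq hqs (q + n - B).toNat f
      (by rw [hf, map_sub, ha, ← embApp_diff i hder, O.diff_diff, map_zero, sub_zero])
      (by
        have h1 : twCounit O.toCollection n q f = 0 := by
          rw [hf, map_sub, twCounit_embApp, hb, sub_self]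
        have h2 := congrArg (O.cast (Nat.zero_add n).symm
          (show q = q - 2 * ((0 : ℕ) : ℤ) by simp)) h1
        rw [map_zero] at h2
        change O.cast _ _ (O.cast _ _ (twAt 0 f)) = 0 at h2
        rwa [O.cast_cast, O.cast_rfl] at h2)
      (fun r hr => eq_zero_of_bound h hB (by push_cast; omega) _)
    refine ⟨a' + embApp O.toCollection n p b, ?_⟩
    change twDiff ((toLie K).trans i) hpq _ = a
    rw [map_add, ha', ← embApp_diff i hder, hf, sub_add_cancel]
  · intro n p q s hpq hqs b hb
    refine ⟨embApp O.toCollection n q b, 0, ?_, ?_⟩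
    · change twDiff ((toLie K).trans i) hqs _ = 0
      rw [← embApp_diff i hder]
      exact (congrArg _ hb).trans (map_zero _)
    · rw [map_zero, add_zero]
      exact twCounit_embApp _ _

end final

end TwOperad

end

theorem theorem5p3 {K : Type u} [Field K] [CharZero K]
    (P : TwOperad.DGOperad.{u, v} K) (O : TwOperad.DGOperad.{u, w} K)
    (j : TwOperad.OperadHom P.toOperadData O.toOperadData)
    (i : TwOperad.OperadHom (TwOperad.LLie K).toOperadData O.toOperadData)
    (h : TwOperad.IsDistributive j i) :
    (∃ c : TwOperad.OperadHom O.toOperadData (TwOperad.TwOp ((TwOperad.toLie K).trans i)),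
      TwOperad.IsCanonicalEmbedding ((TwOperad.toLie K).trans i) c ∧
        TwOperad.IsTwCoalgebra ((TwOperad.toLie K).trans i) c) ∧
    (TwOperad.BoundedBelow P.toCollection →
      TwOperad.IsHomotopyFixedPoint ((TwOperad.toLie K).trans i)) := by
  have hder : ∀ {n : ℕ} {p : ℤ} (f : O.obj n p),
      TwOperad.IsDerivationOn O (TwOperad.br i) f := fun f => h.isDerivationOn f
  exact ⟨⟨TwOperad.emb i hder, TwOperad.isCanonicalEmbedding_emb hder,
    TwOperad.isTwCoalgebra_emb hder⟩, TwOperad.isHomotopyFixedPoint h⟩
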